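/- **Setting.** Let $d\in\mathbb N$ and let $\rho_0,\rho_1$ be probability densities on $\mathbb R^d$. Let $I:[0,1]\times\mathbb R^d\times\mathbb R^d\to\mathbb R^d$ be $C^2$ in $t$ for every $(x_0,x_1)$ and $C^2$ in $(x_0,x_1)$ for every $t$, with $I(0,x_0,x_1)=x_0$, $I(1,x_0,x_1)=x_1$ and $|\partial_t I(t,x_0,x_1)|\le C_1|x_0-x_1|$ for some constant $C_1$. Let $\gamma:[0,1]\to\mathbb R$ satisfy $\gamma(0)=\gamma(1)=0$, $\gamma>0$ on $(0,1)$ and $\gamma^2\in C^2([0,1])$. Let $(x_0,x_1)$ be a pair of random variables with $x_0\sim\rho_0$, $x_1\sim\rho_1$ (any coupling), let $z\sim\mathsf N(0,\mathrm{Id})$ be independent of $(x_0,x_1)$, and put $x_t=I(t,x_0,x_1)+\gamma(t)z$. Assume that $\rho_0,\rho_1$ are strictly positive, $C^2$, with $\int|\nabla\log\rho_i|^2\rho_i\,dx<\infty$ for $i=0,1$, and that $\mathbb E|\partial_tI(t,x_0,x_1)|^4$ and $\mathbb E|\partial_t^2I(t,x_0,x_1)|^2$ are bounded uniformly in $t\in[0,1]$.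 Then, for each $t\in[0,1]$, the law of $x_t$ has a continuous density $\rho(t,\cdot)$ and, for each $t\in(0,1)$, there is a continuous version $b(t,\cdot)$ of $x\mapsto\mathbb E[\partial_tI(t,x_0,x_1)+\dot\gamma(t)z\mid x_t=x]$. Let $s=\nabla\log\rho$ be the score. For every $\epsilon\in C^0([0,1])$ with $\epsilon\ge0$, set $b_{\mathsf F}=b+\epsilon s$ and $b_{\mathsf B}=b-\epsilon s$. **Notion of solution and of well-posedness.** For functions $p>0$ and $u$ on $\mathbb R^d$ let $\mathcal E(u\,|\,p)=\int_{\mathbb R^d}u^2/p\,dx\in[0,\infty]$. For a drift $c$, a coefficient $\kappa$ and a time $t_0\in\{0,1\}$, an *energy solution from $t_0$* of $$\partial_tu+\nabla\cdot(cu)=\kappa(t)\Delta u$$ is a family $(u(t))_{t\in[0,1]}$ of measurable functions on $\mathbb R^d$ such that, for every $\varphi\in C_c^\infty(\mathbb R^d)$, the map $t\mapsto\int\varphi\,u(t)\,dx$ is continuous on $[0,1]$ and differentiable on $(0,1)$ with $$\frac{d}{dt}\int\varphi\, u(t)\,dx=\int\big(c(t,\cdot)\cdot\nabla\varphi+\kappa(t)\Delta\varphi\big)u(t)\,dx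 ,$$ and such that $\mathcal E(u(t)\,|\,\rho(t))\le\mathcal E(u(t_0)\,|\,\rho(t_0))<\infty$ for all $t\in[0,1]$. The equation is *well-posed from $t_0$* if * (existence) for every measurable $f$ with $\mathcal E(f\,|\,\rho(t_0))<\infty$ there is an energy solution $u$ from $t_0$ with $u(t_0)=f$ a.e.; * (uniqueness) two energy solutions from $t_0$ that agree a.e. at $t_0$ agree a.e. at every $t\in[0,1]$; * (continuous dependence) $\mathcal E(u(t)-v(t)\,|\,\rho(t))\le\mathcal E(u(t_0)-v(t_0)\,|\,\rho(t_0))$ for all energy solutions $u,v$ from $t_0$ and all $t\in[0,1]$. **Statement.** 1. *Forward Fokker–Planck equation.* $\rho$ is a classical solution on $(0,1)\times\mathbb R^d$, and an energy solution from $t_0=0$, of $$\partial_t\rho+\nabla\cdot(b_{\mathsf F}\rho)=\epsilon(t)\Delta\rho,\qquad\rho(0)=\rho_0 .$$ This equation is well-posed forward in time (from $t_0=0$), and every energy solution $u$ from $t_0=0$ with $u(0)=\rho_0$ a.e. satisfies $u(1)=\rho_1$ a.e. 2. *Backward Fokker–Planck equation.* $\rho$ is a classical solution on $(0,1)\times\mathbb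 R^d$, and an energy solution from $t_0=1$, of $$\partial_t\rho+\nabla\cdot(b_{\mathsf B}\rho)=-\epsilon(t)\Delta\rho,\qquad\rho(1)=\rho_1 .$$ This equation is well-posed backward in time (from $t_0=1$), and every energy solution $u$ from $t_0=1$ with $u(1)=\rho_1$ a.e. satisfies $u(0)=\rho_0$ a.e. -/

import Mathlib

open MeasureTheory ProbabilityTheory Set
open scoped ENNReal NNReal Laplacian Gradient RealInnerProductSpace

noncomputable section

/-- The Euclidean space `ℝ^d`. -/
abbrev Eu (d : ℕ) : Type := EuclideanSpace ℝ (Fin d)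

/-- `∂ₜ I(t, x₀, x₁)` for `t ∈ [0,1]` (one-sided at the end points). -/
def dtI {d : ℕ} (I : ℝ → Eu d → Eu d → Eu d) (t : ℝ) (x₀ x₁ : Eu d) : Eu d :=
  derivWithin (fun τ => I τ x₀ x₁) (Icc 0 1) t

/-- `∂ₜ² I(t, x₀, x₁)` for `t ∈ [0,1]` (one-sided at the end points). -/
def dttI {d : ℕ} (I : ℝ → Eu d → Eu d → Eu d) (t : ℝ) (x₀ x₁ : Eu d) : Eu d :=
  iteratedDerivWithin 2 (fun τ => I τ x₀ x₁) (Icc 0 1) t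

/-- The interpolant process `x_t = I(t, x₀, x₁) + γ(t) z`. -/
def interpolant {d : ℕ} {Ω : Type*} (I : ℝ → Eu d → Eu d → Eu d) (γ : ℝ → ℝ)
    (x₀ x₁ z : Ω → Eu d) (t : ℝ) (ω : Ω) : Eu d :=
  I t (x₀ ω) (x₁ ω) + γ t • z ω

/-- The time derivative `∂ₜ I(t, x₀, x₁) + γ'(t) z` of the interpolant, for `t ∈ (0,1)`. -/
def interpolantDot {d : ℕ} {Ω : Type*} (I : ℝ → Eu d → Eu d → Eu d) (γ : ℝ → ℝ)
    (x₀ x₁ z : Ω → Eu d) (t : ℝ) (ω : Ω) : Eu d :=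
  dtI I t (x₀ ω) (x₁ ω) + deriv γ t • z ω

/-- `(I, γ, x₀, x₁, z)` defines a stochastic interpolant between the densities `ρ₀` and `ρ₁`. The
coupling of `(x₀, x₁)` is arbitrary. -/
structure IsStochasticInterpolant {d : ℕ} {Ω : Type*} [MeasurableSpace Ω] (P : Measure Ω)
    (ρ₀ ρ₁ : Eu d → ℝ) (I : ℝ → Eu d → Eu d → Eu d) (γ : ℝ → ℝ)
    (x₀ x₁ z : Ω → Eu d) : Prop where
  contDiff_time : ∀ a b : Eu d, ContDiffOn ℝ 2 (fun t => I t a b) (Icc 0 1)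
  contDiff_space : ∀ t ∈ Icc (0 : ℝ) 1, ContDiff ℝ 2 (fun p : Eu d × Eu d => I t p.1 p.2)
  I_zero : ∀ a b : Eu d, I 0 a b = a
  I_one : ∀ a b : Eu d, I 1 a b = b
  dtI_bound : ∃ C₁ : ℝ, ∀ t ∈ Icc (0 : ℝ) 1, ∀ a b : Eu d, ‖dtI I t a b‖ ≤ C₁ * ‖a - b‖
  γ_zero : γ 0 = 0
  γ_one : γ 1 = 0
  γ_pos : ∀ t ∈ Ioo (0 : ℝ) 1, 0 < γ t
  γ_sq : ContDiffOn ℝ 2 (fun t => γ t ^ 2) (Icc 0 1)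
  meas_x₀ : Measurable x₀
  meas_x₁ : Measurable x₁
  meas_z : Measurable z
  law_x₀ : P.map x₀ = volume.withDensity (fun x => ENNReal.ofReal (ρ₀ x))
  law_x₁ : P.map x₁ = volume.withDensity (fun x => ENNReal.ofReal (ρ₁ x))
  law_z : P.map z = stdGaussian (Eu d)
  indep : IndepFun (fun ω => (x₀ ω, x₁ ω)) z P

/-- The density `p` is `C²`, strictly positive, and has finite Fisher information. -/
structure IsRegularDensity {d : ℕ} (p : Eu d → ℝ) : Prop where
  contDiff : ContDiff ℝ 2 p
  pos : ∀ x, 0 < p x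
  fisher : Integrable (fun x => ‖∇ (fun y => Real.log (p y)) x‖ ^ 2 * p x) volume

/-- The standing assumption on the densities, the interpolant function and the coupling. -/
structure InterpolantAssumption {d : ℕ} {Ω : Type*} [MeasurableSpace Ω] (P : Measure Ω)
    (ρ₀ ρ₁ : Eu d → ℝ) (I : ℝ → Eu d → Eu d → Eu d) (x₀ x₁ : Ω → Eu d) : Prop where
  reg₀ : IsRegularDensity ρ₀
  reg₁ : IsRegularDensity ρ₁
  moment_dt : ∃ M₁ : ℝ≥0, ∀ t ∈ Icc (0 : ℝ) 1, ∫⁻ ω, ‖dtI I t (x₀ ω) (x₁ ω)‖ₑ ^ 4 ∂P ≤ M₁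
  moment_dtt : ∃ M₂ : ℝ≥0, ∀ t ∈ Icc (0 : ℝ) 1, ∫⁻ ω, ‖dttI I t (x₀ ω) (x₁ ω)‖ₑ ^ 2 ∂P ≤ M₂

/-- `ρ(t, ·)` is the (continuous version of the) Lebesgue density of the law of `X_t`,
for every `t ∈ [0,1]`. -/
structure IsDensityOf {d : ℕ} {Ω : Type*} [MeasurableSpace Ω] (P : Measure Ω)
    (X : ℝ → Ω → Eu d) (ρ : ℝ → Eu d → ℝ) : Prop where
  nonneg : ∀ t ∈ Icc (0 : ℝ) 1, ∀ x, 0 ≤ ρ t x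
  cont : ∀ t ∈ Icc (0 : ℝ) 1, Continuous (ρ t)
  law : ∀ t ∈ Icc (0 : ℝ) 1,
    P.map (X t) = volume.withDensity (fun x => ENNReal.ofReal (ρ t x))

/-- `b(t, ·)` is the (continuous version of the) conditional expectation
`x ↦ 𝔼[X'_t | X_t = x]`, for every `t ∈ (0,1)`. -/
structure IsVelocityOf {d : ℕ} {Ω : Type*} [MeasurableSpace Ω] (P : Measure Ω)
    (X X' : ℝ → Ω → Eu d) (b : ℝ → Eu d → Eu d) : Prop where
  cont : ∀ t ∈ Ioo (0 : ℝ) 1, Continuous (b t)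
  condExp : ∀ t ∈ Ioo (0 : ℝ) 1,
    (fun ω => b t (X t ω)) =ᵐ[P] P[X' t | MeasurableSpace.comap (X t) inferInstance]

/-- The score `s(t, x) = ∇ log ρ(t, x)`. -/
def score {d : ℕ} (ρ : ℝ → Eu d → ℝ) (t : ℝ) (x : Eu d) : Eu d :=
  ∇ (fun y => Real.log (ρ t y)) x

/-- The divergence of a vector field. -/
def divergence {d : ℕ} (v : Eu d → Eu d) (x : Eu d) : ℝ :=
  ∑ i : Fin d, (fderiv ℝ v x (EuclideanSpace.single i 1)) i

/-- `u` is a classical solution of `∂ₜ u + ∇ · (c u) = κ(t) Δ u` on `(0,1) × ℝ^d`. -/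
structure IsClassicalFPE {d : ℕ} (c : ℝ → Eu d → Eu d) (κ : ℝ → ℝ) (u : ℝ → Eu d → ℝ) :
    Prop where
  time : ∀ x, ContDiffOn ℝ 1 (fun t => u t x) (Ioo 0 1)
  space : ∀ t ∈ Ioo (0 : ℝ) 1, ContDiff ℝ 2 (u t)
  drift : ∀ t ∈ Ioo (0 : ℝ) 1, ContDiff ℝ 1 (c t)
  eqn : ∀ t ∈ Ioo (0 : ℝ) 1, ∀ x,
    deriv (fun τ => u τ x) t + divergence (fun y => u t y • c t y) x = κ t * Δ (u t) x

/-- The weighted energy `∫ u² / p`, with values in `[0, ∞]`. -/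
def energy {d : ℕ} (p u : Eu d → ℝ) : ℝ≥0∞ :=
  ∫⁻ x, ENNReal.ofReal (u x ^ 2 / p x)

/-- `u` is an energy solution on `[0,1]` of `∂ₜ u + ∇ · (c u) = κ(t) Δ u`, solved from the
time `t₀` (which will be `0` or `1`): a weak solution, continuous in time up to `t = 0` and
`t = 1` when tested against smooth compactly supported functions, whose energy
relative to `ρ` is finite and never larger than it is at time `t₀`. -/
structure IsEnergySolution {d : ℕ} (t₀ : ℝ) (ρ : ℝ → Eu d → ℝ) (c : ℝ → Eu d → Eu d)
    (κ : ℝ → ℝ) (u : ℝ → Eu d → ℝ) : Prop where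
  meas : ∀ t ∈ Icc (0 : ℝ) 1, AEStronglyMeasurable (u t) volume
  finite : energy (ρ t₀) (u t₀) < ⊤
  energy_le : ∀ t ∈ Icc (0 : ℝ) 1, energy (ρ t) (u t) ≤ energy (ρ t₀) (u t₀)
  cont : ∀ φ : Eu d → ℝ, ContDiff ℝ (⊤ : ℕ∞) φ → HasCompactSupport φ →
    ContinuousOn (fun t => ∫ x, φ x * u t x) (Icc 0 1)
  weak : ∀ φ : Eu d → ℝ, ContDiff ℝ (⊤ : ℕ∞) φ → HasCompactSupport φ → ∀ t ∈ Ioo (0 : ℝ) 1,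
    HasDerivAt (fun τ => ∫ x, φ x * u τ x)
      (∫ x, (⟪c t x, ∇ φ x⟫ + κ t * Δ φ x) * u t x) t

/-- Well-posedness (existence, uniqueness, continuous dependence on the data) of
`∂ₜ u + ∇ · (c u) = κ(t) Δ u` on `[0,1]` when the data are prescribed at time `t₀`
(forward in time for `t₀ = 0`, backward in time for `t₀ = 1`). -/
structure IsWellPosedFrom {d : ℕ} (t₀ : ℝ) (ρ : ℝ → Eu d → ℝ) (c : ℝ → Eu d → Eu d)
    (κ : ℝ → ℝ) : Prop where
  exist : ∀ f : Eu d → ℝ, AEStronglyMeasurable f volume → energy (ρ t₀) f < ⊤ →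
    ∃ u, IsEnergySolution t₀ ρ c κ u ∧ u t₀ =ᵐ[volume] f
  unique : ∀ u v, IsEnergySolution t₀ ρ c κ u → IsEnergySolution t₀ ρ c κ v →
    u t₀ =ᵐ[volume] v t₀ → ∀ t ∈ Icc (0 : ℝ) 1, u t =ᵐ[volume] v t
  stable : ∀ u v, IsEnergySolution t₀ ρ c κ u → IsEnergySolution t₀ ρ c κ v →
    ∀ t ∈ Icc (0 : ℝ) 1, energy (ρ t) (u t - v t) ≤ energy (ρ t₀) (u t₀ - v t₀)

/-- The forward drift `b + ε s`. -/
def driftF {d : ℕ} (ρ : ℝ → Eu d → ℝ) (b : ℝ → Eu d → Eu d) (ε : ℝ → ℝ)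
    (t : ℝ) (x : Eu d) : Eu d :=
  b t x + ε t • score ρ t x

/-- The backward drift `b - ε s`. -/
def driftB {d : ℕ} (ρ : ℝ → Eu d → ℝ) (b : ℝ → Eu d → Eu d) (ε : ℝ → ℝ)
    (t : ℝ) (x : Eu d) : Eu d :=
  b t x - ε t • score ρ t x

end

section

open Filter Topology

/-! ### Gradient, divergence and Laplacian on Euclidean space, and integration by parts. -/

section Calculus

variable {d : ℕ}

/-! Everything rests on the ratio `h = u / ρ`. Since `s = ∇ρ / ρ`, the flux of the forward equation
is `b_F u - ε ∇u = h ρ b - ε ρ ∇h`: the score drift is exactly what turns the diffusion of `u` into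
a diffusion of `h` that is symmetric with respect to `ρ`. As `ρ` solves the continuity equation with
velocity `b`, the energy `∫ u² / ρ = ∫ h² ρ` formally has derivative `-2 ε ∫ ρ |∇h|²`. The analytic
properties of `(ρ, b)` that make this rigorous are collected in `FlowPair`, and the Fokker-Planck
theory is proved for an arbitrary flow pair.

Existence (`FlowPair.exists_energySolution`). The equation for `h` is solved by Galerkin
approximation in finite-dimensional spaces of test functions, on `[δ, 1 - δ]`, where `ρ` and `b` are
regular. The approximations satisfy the energy law exactly. Their pairings with a fixed test
function are equicontinuous up to the end points: the transport term is controlled by `(∫ |b|²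
ρ)^(1/2)`, which is integrable in time because `∫ |b|² ρ ≤ C/t + C/(1-t)`, and the diffusion term is
absorbed by the dissipated energy (`FlowPair.galerkin_modulus`). A limit along an ultrafilter gives
linear forms bounded in `L²(ρ)`, which are represented by densities through the Riesz theorem.

Uniqueness and stability (`FlowPair.integral_sq_sub_le`). A weak solution `w` is not known to be
regular, so the energy law is proved by renormalization in the manner of DiPerna and Lions. One
mollifies `w`, divides by `ρ`, applies a convex function of linear growth (`huber`) and localizes
with a cutoff. The commutator of mollification with the `C¹` drift vanishes in `L¹` on balls
(`tendsto_integral_commutator`), the diffusion has a sign by convexity (`integral_renormalize_le`),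
and the cutoff error vanishes because the velocity and the score have finite second moments
(`FlowPair.integral_cutoffFlux_le`). Hence the energy of `w` is nonincreasing on the open interval
(`FlowPair.integral_sq_antitone`). It remains to reach the initial time, where only weak continuity
is available and energy could appear suddenly. Here the energy inequality built into the notion of
solution enters: the parallelogram identity expresses the energy of `u - v` through those of `u`,
`v` and `u + v`; the first two are bounded by their initial values and the third is lower
semicontinuous. This excludes a jump.

The backward equation is the forward equation for the time-reversed pair `(ρ(1-t), -b(1-t))`. The
density `ρ` is itself an energy solution, with constant energy `1`, so uniqueness forces every
solution starting from `ρ₀` to end at `ρ₁`, and conversely.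

Finally the interpolant provides a flow pair (`IsStochasticInterpolant.flowPair`). At interior times
its law is a mixture of Gaussians of variance `γ²` centred at `I(t, x₀, x₁)`, which gives
regularity, positivity and the continuity equation by differentiation under the integral. The
velocity and the score are conditional expectations of `∂ₜI + γ' z` and `-z / γ`, so their second
moments are bounded by Jensen's inequality. The admissible blow-up of `γ'` comes from `(γ²)'² ≤ γ²
(A/t + A/(1-t))`, valid because `γ²` is nonnegative and `C²`. -/

theorem inner_gradient_eq (f : Eu d → ℝ) (x v : Eu d) : ⟪v, ∇ f x⟫ = fderiv ℝ f x v := by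
  simp [inner_gradient_right]

theorem gradient_eq_comp (f : Eu d → ℝ) :
    ∇ f = (InnerProductSpace.toDual ℝ (Eu d)).symm ∘ fderiv ℝ f := rfl

theorem ContDiff.gradient' {f : Eu d → ℝ} {m n : ℕ∞} (hf : ContDiff ℝ n f) (h : m + 1 ≤ n) :
    ContDiff ℝ m (∇ f) := by
  rw [gradient_eq_comp]
  have : ContDiff ℝ m (fderiv ℝ f) := hf.fderiv_right (by exact_mod_cast h)
  exact (InnerProductSpace.toDual ℝ (Eu d)).symm.contDiff.comp this

theorem ContDiff.continuous_gradient {f : Eu d → ℝ} (hf : ContDiff ℝ 1 f) :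
    Continuous (∇ f) := by
  have := ContDiff.gradient' (m := 0) (n := 1) hf (by norm_num)
  exact this.continuous

theorem HasCompactSupport.gradient {f : Eu d → ℝ} (hf : HasCompactSupport f) :
    HasCompactSupport (∇ f) := by
  rw [gradient_eq_comp]
  exact (hf.fderiv ℝ).comp_left (map_zero _)

theorem gradient_mul {f g : Eu d → ℝ} {x : Eu d} (hf : DifferentiableAt ℝ f x)
    (hg : DifferentiableAt ℝ g x) :
    ∇ (fun y => f y * g y) x = f x • ∇ g x + g x • ∇ f x := by
  refine ext_inner_left ℝ fun v => ?_
  rw [inner_gradient_eq, fderiv_fun_mul hf hg, inner_add_right, inner_smul_right,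
    inner_smul_right, inner_gradient_eq, inner_gradient_eq]
  simp

theorem gradient_comp_real {f : Eu d → ℝ} {x : Eu d} {β : ℝ → ℝ} {β' : ℝ}
    (hβ : HasDerivAt β β' (f x)) (hf : DifferentiableAt ℝ f x) :
    ∇ (fun y => β (f y)) x = β' • ∇ f x := by
  refine ext_inner_left ℝ fun v => ?_
  rw [inner_gradient_eq, inner_smul_right, inner_gradient_eq]
  have := (hβ.comp_hasFDerivAt x hf.hasFDerivAt).fderiv
  simp only [Function.comp_def] at this
  rw [this]; simp

theorem gradient_add' {f g : Eu d → ℝ} {x : Eu d} (hf : DifferentiableAt ℝ f x)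
    (hg : DifferentiableAt ℝ g x) :
    ∇ (fun y => f y + g y) x = ∇ f x + ∇ g x := by
  refine ext_inner_left ℝ fun v => ?_
  rw [inner_gradient_eq, fderiv_fun_add hf hg, inner_add_right, inner_gradient_eq,
    inner_gradient_eq]
  simp

theorem gradient_const_mul {f : Eu d → ℝ} {x : Eu d} (c : ℝ) (hf : DifferentiableAt ℝ f x) :
    ∇ (fun y => c * f y) x = c • ∇ f x := by
  refine ext_inner_left ℝ fun v => ?_
  rw [inner_gradient_eq, inner_smul_right, inner_gradient_eq, fderiv_const_mul hf]
  simp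

theorem divergence_smul {f : Eu d → ℝ} {v : Eu d → Eu d} {x : Eu d}
    (hf : DifferentiableAt ℝ f x) (hv : DifferentiableAt ℝ v x) :
    divergence (fun y => f y • v y) x = f x * divergence v x + ⟪v x, ∇ f x⟫ := by
  unfold divergence
  rw [inner_gradient_eq, fderiv_fun_smul hf hv]
  have h1 : fderiv ℝ f x (v x) = ∑ i, v x i * fderiv ℝ f x (EuclideanSpace.single i 1) := by
    have : v x = ∑ i, v x i • (EuclideanSpace.single i (1 : ℝ) : Eu d) := by
      ext j; simp [Finset.sum_apply, Pi.single_apply]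
    conv_lhs => rw [this]
    simp
  rw [h1, Finset.mul_sum, ← Finset.sum_add_distrib]
  refine Finset.sum_congr rfl fun i _ => ?_
  simp [mul_comm]

theorem divergence_add {v w : Eu d → Eu d} {x : Eu d} (hv : DifferentiableAt ℝ v x)
    (hw : DifferentiableAt ℝ w x) :
    divergence (fun y => v y + w y) x = divergence v x + divergence w x := by
  unfold divergence
  rw [fderiv_fun_add hv hw, ← Finset.sum_add_distrib]
  simp

theorem divergence_const_smul {v : Eu d → Eu d} {x : Eu d} (c : ℝ)
    (hv : DifferentiableAt ℝ v x) :
    divergence (fun y => c • v y) x = c * divergence v x := by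
  unfold divergence
  rw [fderiv_fun_const_smul hv, Finset.mul_sum]
  simp

/-- Writing the Laplacian in divergence form makes `integral_mul_divergence` the only integration by
parts that is ever needed. -/
theorem laplacian_eq_divergence {f : Eu d → ℝ} (hf : ContDiff ℝ 2 f) (x : Eu d) :
    Δ f x = divergence (∇ f) x := by
  rw [InnerProductSpace.laplacian_eq_iteratedFDeriv_orthonormalBasis f
    (EuclideanSpace.basisFun (Fin d) ℝ)]
  unfold divergence
  refine Finset.sum_congr rfl fun i _ => ?_
  rw [iteratedFDeriv_two_apply]
  have h1 : DifferentiableAt ℝ (fderiv ℝ f) x :=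
    ((hf.fderiv_right (m := 1) (by norm_num)).differentiable (by norm_num)) x
  have hg : DifferentiableAt ℝ (∇ f) x :=
    (ContDiff.gradient' (m := 1) (n := 2) hf (by norm_num)).differentiable (by norm_num) x
  have h2 : ∀ y, (∇ f y) i = fderiv ℝ f y (EuclideanSpace.single i 1) := fun y => by
    rw [← inner_gradient_eq, EuclideanSpace.inner_single_left]; simp
  have h3 := ((EuclideanSpace.proj i : Eu d →L[ℝ] ℝ).hasFDerivAt.comp x hg.hasFDerivAt).fderiv
  have h4 : (⇑(EuclideanSpace.proj i : Eu d →L[ℝ] ℝ) ∘ ∇ f) =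
      fun y => fderiv ℝ f y (EuclideanSpace.single i 1) := funext h2
  have h5 : fderiv ℝ (fun y => fderiv ℝ f y (EuclideanSpace.single i 1)) x =
      (fderiv ℝ (fderiv ℝ f) x).flip (EuclideanSpace.single i 1) := by
    have := (h1.hasFDerivAt.clm_apply (hasFDerivAt_const (EuclideanSpace.single i (1 : ℝ)) x)).fderiv
    rw [this]; simp
  rw [h4, h5] at h3
  have h6 := congrArg (fun L => L (EuclideanSpace.single i (1 : ℝ))) h3
  simpa using h6

theorem continuous_divergence {v : Eu d → Eu d} (hv : ContDiff ℝ 1 v) :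
    Continuous (divergence v) := by
  unfold divergence
  have := hv.continuous_fderiv (by norm_num)
  fun_prop

theorem HasCompactSupport.divergence {v : Eu d → Eu d} (hv : HasCompactSupport v) :
    HasCompactSupport (divergence v) := by
  have : _root_.divergence v = (fun L : Eu d →L[ℝ] Eu d =>
      ∑ i : Fin d, (L (EuclideanSpace.single i 1)) i) ∘ (fderiv ℝ v) := rfl
  rw [this]
  exact (hv.fderiv ℝ).comp_left (by simp)

/-- Integration by parts for a scalar function against the divergence of a vector field. -/
theorem integral_mul_divergence {f : Eu d → ℝ} {v : Eu d → Eu d} (hf : ContDiff ℝ 1 f)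
    (hv : ContDiff ℝ 1 v) (hs : HasCompactSupport f ∨ HasCompactSupport v) :
    ∫ x, f x * divergence v x = - ∫ x, ⟪v x, ∇ f x⟫ := by
  have hf' := hf.continuous_fderiv (by norm_num)
  have hv' := hv.continuous_fderiv (by norm_num)
  have hfc := hf.continuous
  have hvc := hv.continuous
  have hvi : ∀ i : Fin d, ∀ x, HasFDerivAt (fun y => v y i)
      ((EuclideanSpace.proj i : Eu d →L[ℝ] ℝ) ∘L fderiv ℝ v x) x := fun i x =>
    (EuclideanSpace.proj i : Eu d →L[ℝ] ℝ).hasFDerivAt.comp x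
      ((hv.differentiable (by norm_num)) x).hasFDerivAt
  have key : ∀ i : Fin d, Integrable (fun x => f x * (fderiv ℝ v x (EuclideanSpace.single i 1)) i) ∧
      Integrable (fun x => fderiv ℝ f x (EuclideanSpace.single i 1) * v x i) ∧
      Integrable (fun x => f x * v x i) := by
    intro i
    refine ⟨Continuous.integrable_of_hasCompactSupport (by fun_prop) ?_,
      Continuous.integrable_of_hasCompactSupport (by fun_prop) ?_,
      Continuous.integrable_of_hasCompactSupport (by fun_prop) ?_⟩
    · rcases hs with hs | hs
      · exact hs.mul_right
      · exact HasCompactSupport.mul_left (((hs.fderiv ℝ).comp_left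
          (g := fun L : Eu d →L[ℝ] Eu d => (L (EuclideanSpace.single i 1)) i) (by simp)))
    · rcases hs with hs | hs
      · exact HasCompactSupport.mul_right (((hs.fderiv ℝ).comp_left
          (g := fun L : Eu d →L[ℝ] ℝ => (L (EuclideanSpace.single i 1))) (by simp)))
      · exact HasCompactSupport.mul_left (hs.comp_left (g := fun L : Eu d => L i) (by simp))
    · rcases hs with hs | hs
      · exact hs.mul_right
      · exact HasCompactSupport.mul_left (hs.comp_left (g := fun L : Eu d => L i) (by simp))
  have h1 : ∀ x, ⟪v x, ∇ f x⟫ = ∑ i, fderiv ℝ f x (EuclideanSpace.single i 1) * v x i := by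
    intro x
    rw [inner_gradient_eq]
    have : v x = ∑ i, v x i • (EuclideanSpace.single i (1 : ℝ) : Eu d) := by
      ext j; simp [Finset.sum_apply, Pi.single_apply]
    conv_lhs => rw [this]
    simp [mul_comm]
  simp only [h1, divergence, Finset.mul_sum]
  rw [integral_finsetSum _ fun i _ => (key i).1, integral_finsetSum _ fun i _ => (key i).2.1,
    ← Finset.sum_neg_distrib]
  refine Finset.sum_congr rfl fun i _ => ?_
  have := integral_bilinear_hasFDerivAt_right_eq_neg_left_of_integrable (μ := volume)
    (f := f) (f' := fderiv ℝ f) (g := fun y => v y i)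
    (g' := fun x => (EuclideanSpace.proj i : Eu d →L[ℝ] ℝ) ∘L fderiv ℝ v x)
    (v := (EuclideanSpace.single i 1 : Eu d)) (B := ContinuousLinearMap.mul ℝ ℝ)
    (by simpa using (key i).2.1) (by simpa using (key i).1) (by simpa using (key i).2.2)
    (fun x _ => ((hf.differentiable (by norm_num)) x).hasFDerivAt) (fun x _ => hvi i x)
  simpa using this

/-- Differentiation under the integral sign when everything vanishes outside a compact set and the
derivative is bounded. -/
theorem hasDerivAt_integral_of_compact {F F' : ℝ → Eu d → ℝ} {t₀ r C : ℝ} {K : Set (Eu d)}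
    (hr : 0 < r) (hK : IsCompact K)
    (hF : ∀ t ∈ Metric.ball t₀ r, AEStronglyMeasurable (F t) volume)
    (hF0 : Integrable (F t₀)) (hF' : AEStronglyMeasurable (F' t₀) volume)
    (hb : ∀ t ∈ Metric.ball t₀ r, ∀ x ∈ K, |F' t x| ≤ C)
    (hz : ∀ t ∈ Metric.ball t₀ r, ∀ x, x ∉ K → F' t x = 0)
    (hd : ∀ t ∈ Metric.ball t₀ r, ∀ x, HasDerivAt (fun τ => F τ x) (F' t x) t) :
    HasDerivAt (fun t => ∫ x, F t x) (∫ x, F' t₀ x) t₀ := by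
  refine (hasDerivAt_integral_of_dominated_loc_of_deriv_le (F := F) (F' := F')
    (bound := K.indicator fun _ => C) (Metric.ball_mem_nhds t₀ hr) ?_ hF0 hF' ?_ ?_ ?_).2
  · filter_upwards [Metric.ball_mem_nhds t₀ hr] with t ht using hF t ht
  · refine Eventually.of_forall fun x t ht => ?_
    by_cases hx : x ∈ K
    · simpa [hx] using hb t ht x hx
    · simp [hx, hz t ht x hx]
  · rw [integrable_indicator_iff hK.measurableSet]
    exact integrableOn_const hK.measure_lt_top.ne
  · exact Eventually.of_forall fun x t ht => hd t ht x

end Calculus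

/-! ### Linear systems of ordinary differential equations on a compact interval. -/

section LinearODE

/-- Truncation of a real number to `[-R, R]`. -/
def truncAt (R r : ℝ) : ℝ := max (-R) (min R r)

theorem abs_truncAt_le {R : ℝ} (hR : 0 ≤ R) (r : ℝ) : |truncAt R r| ≤ |r| := by
  unfold truncAt
  rcases max_cases (-R) (min R r) with ⟨h, h'⟩ | ⟨h, h'⟩ <;>
    rcases min_cases R r with ⟨g, g'⟩ | ⟨g, g'⟩ <;>
      rw [h] <;> grind

theorem abs_truncAt_le' {R : ℝ} (hR : 0 ≤ R) (r : ℝ) : |truncAt R r| ≤ R := by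
  unfold truncAt
  grind

theorem truncAt_of_abs_le {R r : ℝ} (h : |r| ≤ R) : truncAt R r = r := by
  unfold truncAt
  grind

theorem abs_truncAt_sub_le (R r s : ℝ) : |truncAt R r - truncAt R s| ≤ |r - s| := by
  unfold truncAt
  grind

/-- Global solvability of linear systems of ordinary differential equations. -/
theorem exists_linear_ode {n : ℕ} {a b : ℝ} (hab : a < b)
    (A : ℝ → Matrix (Fin n) (Fin n) ℝ) (hA : ContinuousOn A (Icc a b)) (x₀ : Fin n → ℝ) :
    ∃ x : ℝ → Fin n → ℝ, x a = x₀ ∧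
      ∀ t ∈ Icc a b, HasDerivWithinAt x ((A t).mulVec (x t)) (Icc a b) t := by
  obtain ⟨K, hK0, hK⟩ : ∃ K : ℝ, 0 ≤ K ∧ ∀ t ∈ Icc a b, ∀ v : Fin n → ℝ,
      ‖(A t).mulVec v‖ ≤ K * ‖v‖ := by
    have hc : ∀ i j, ∃ C, ∀ t ∈ Icc a b, ‖A t i j‖ ≤ C := fun i j =>
      isCompact_Icc.exists_bound_of_continuousOn (f := fun t => A t i j)
        ((continuous_apply_apply i j).comp_continuousOn hA)
    choose C hC using hc
    have hCn : ∀ i j, 0 ≤ C i j := fun i j => (norm_nonneg _).trans (hC i j a ⟨le_rfl, hab.le⟩)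
    refine ⟨∑ i, ∑ j, C i j, Finset.sum_nonneg fun i _ => Finset.sum_nonneg fun j _ => hCn i j,
      fun t ht v => ?_⟩
    refine (pi_norm_le_iff_of_nonneg (mul_nonneg (Finset.sum_nonneg fun i _ =>
      Finset.sum_nonneg fun j _ => hCn i j) (norm_nonneg _))).2 fun i => ?_
    calc ‖(A t).mulVec v i‖ = ‖∑ j, A t i j * v j‖ := rfl
      _ ≤ ∑ j, C i j * ‖v‖ := norm_sum_le_of_le _ fun j _ => by
          rw [norm_mul]
          exact mul_le_mul (hC i j t ht) (norm_le_pi_norm v j) (norm_nonneg _) (hCn i j)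
      _ = (∑ j, C i j) * ‖v‖ := by rw [Finset.sum_mul]
      _ ≤ _ := mul_le_mul_of_nonneg_right (Finset.single_le_sum (f := fun i => ∑ j, C i j)
          (fun i _ => Finset.sum_nonneg fun j _ => hCn i j) (Finset.mem_univ i)) (norm_nonneg _)
  -- `R` is the a priori Grönwall bound for solutions of the linear system. The system truncated at
  -- level `R` has a bounded, globally Lipschitz right-hand side, so Picard-Lindelöf applies on the
  -- whole interval at once.
  set R : ℝ := gronwallBound ‖x₀‖ K 0 (b - a) with hR
  have hR0 : 0 ≤ R := by
    rw [hR, gronwallBound_ε0]; positivity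
  set T : (Fin n → ℝ) → (Fin n → ℝ) := fun v i => truncAt R (v i)
  have hT1 : ∀ v, ‖T v‖ ≤ ‖v‖ := fun v => (pi_norm_le_iff_of_nonneg (norm_nonneg _)).2 fun i =>
    (abs_truncAt_le hR0 _).trans (norm_le_pi_norm v i)
  have hT2 : ∀ v, ‖T v‖ ≤ R := fun v => (pi_norm_le_iff_of_nonneg hR0).2 fun i =>
    abs_truncAt_le' hR0 _
  have hT3 : ∀ v, ‖v‖ ≤ R → T v = v := fun v hv => funext fun i =>
    truncAt_of_abs_le ((norm_le_pi_norm v i).trans hv)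
  have hT4 : ∀ v w, ‖T v - T w‖ ≤ ‖v - w‖ := fun v w =>
    (pi_norm_le_iff_of_nonneg (norm_nonneg _)).2 fun i =>
      (abs_truncAt_sub_le R _ _).trans (norm_le_pi_norm (v - w) i)
  have hPL : IsPicardLindelof (fun t v => (A t).mulVec (T v)) (tmin := a) (tmax := b)
      ⟨a, le_rfl, hab.le⟩ x₀ (⟨K * R, by positivity⟩ * ⟨b - a, by linarith⟩) 0
      ⟨K * R, by positivity⟩ ⟨K, hK0⟩ := by
    refine ⟨fun t ht => ?_, fun x _ => ?_, fun t ht x _ => ?_, ?_⟩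
    · refine LipschitzOnWith.of_dist_le_mul fun v _ w _ => ?_
      rw [dist_eq_norm, dist_eq_norm, ← Matrix.mulVec_sub]
      exact (hK t ht _).trans (mul_le_mul_of_nonneg_left (hT4 v w) hK0)
    · refine continuousOn_pi.2 fun i => ?_
      simp only [Matrix.mulVec, dotProduct]
      refine continuousOn_finsetSum _ fun j _ => ?_
      exact ((continuous_apply_apply i j).comp_continuousOn hA).mul continuousOn_const
    · exact (hK t ht _).trans (mul_le_mul_of_nonneg_left (hT2 x) hK0)
    · simp only [NNReal.coe_zero, sub_self, sub_zero]
      rw [max_eq_left (by linarith)]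
      exact le_rfl
  obtain ⟨x, hx0, hx⟩ := hPL.exists_eq_forall_mem_Icc_hasDerivWithinAt₀
  refine ⟨x, hx0, fun t ht => ?_⟩
  -- Truncation does not increase the norm, so the truncated solution obeys the same Grönwall bound;
  -- the truncation is therefore never active.
  have hbound : ‖x t‖ ≤ R := by
    have h1 : ∀ t ∈ Icc a b, ‖x t‖ ≤ gronwallBound ‖x₀‖ K 0 (t - a) := by
      refine norm_le_gronwallBound_of_norm_deriv_right_le
        (f' := fun t => (A t).mulVec (T (x t)))
        (fun t ht => (hx t ht).continuousWithinAt) (fun t ht => ?_) (by rw [hx0]) fun t ht => ?_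
      · exact (hx t ⟨ht.1, ht.2.le⟩).mono_of_mem_nhdsWithin
          (mem_of_superset (Icc_mem_nhdsGE ht.2) (Icc_subset_Icc_left ht.1))
      · rw [add_zero]
        exact (hK t ⟨ht.1, ht.2.le⟩ _).trans (mul_le_mul_of_nonneg_left (hT1 _) hK0)
    refine (h1 t ht).trans ?_
    rw [hR, gronwallBound_ε0, gronwallBound_ε0]
    have : t - a ≤ b - a := by linarith [ht.2]
    gcongr
  have := hx t ht
  simp only [hT3 _ hbound] at this
  exact this

end LinearODE

/-! ### Abstract Galerkin systems for a time-dependent scalar product. -/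

section Galerkin

variable {V : Type*} [AddCommGroup V] [Module ℝ V] [FiniteDimensional ℝ V]

open LinearMap in
/-- A continuous family of positive definite forms can be inverted continuously: for every linear
form `y` there is a family of vectors representing it, along which `y` is continuous. -/
theorem exists_gram_solution {s : Set ℝ} (G : ℝ → V →ₗ[ℝ] V →ₗ[ℝ] ℝ)
    (hpos : ∀ t ∈ s, ∀ φ, φ ≠ 0 → 0 < G t φ φ)
    (hcont : ∀ φ ψ, ContinuousOn (fun t => G t φ ψ) s) :
    ∃ S : ℝ → (V →ₗ[ℝ] ℝ) → V, (∀ t ∈ s, ∀ y φ, G t φ (S t y) = y φ) ∧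
      ∀ y z : V →ₗ[ℝ] ℝ, ContinuousOn (fun t => z (S t y)) s := by
  classical
  set e := Module.finBasis ℝ V
  set n := Module.finrank ℝ V
  set M : ℝ → Matrix (Fin n) (Fin n) ℝ := fun t => Matrix.of fun i j => G t (e i) (e j)
  have hMG : ∀ t (v : Fin n → ℝ) i, (M t).mulVec v i = G t (e i) (∑ j, v j • e j) := by
    intro t v i
    simp [M, Matrix.mulVec, dotProduct, mul_comm]
  have hdet : ∀ t ∈ s, IsUnit (M t).det := by
    intro t ht
    rw [isUnit_iff_ne_zero]
    intro h0
    obtain ⟨v, hv, hMv⟩ := Matrix.exists_mulVec_eq_zero_iff.2 h0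
    set φ := ∑ j, v j • e j
    have hφ : φ ≠ 0 := by
      intro h
      apply hv
      exact funext (Fintype.linearIndependent_iff.1 e.linearIndependent v h)
    have : G t φ φ = 0 := by
      have h1 : ∀ i, G t (e i) φ = 0 := fun i => by rw [← hMG, hMv]; rfl
      have h2 : ∀ w, G t (∑ j, v j • e j) w = ∑ j, v j * G t (e j) w := fun w => by
        simp [LinearMap.sum_apply]
      rw [h2]
      exact Finset.sum_eq_zero fun i _ => by rw [h1, mul_zero]
    exact (hpos t ht φ hφ).ne' this
  have hMc : ContinuousOn M s := continuousOn_pi.2 fun i => continuousOn_pi.2 fun j =>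
    hcont (e i) (e j)
  have hinv : ContinuousOn (fun t => (M t)⁻¹) s := by
    have : ∀ t, (M t)⁻¹ = (M t).det⁻¹ • (M t).adjugate := fun t => by
      rw [Matrix.inv_def, Ring.inverse_eq_inv']
    simp only [this]
    have h1 : ContinuousOn (fun t => (M t).det) s := (Continuous.matrix_det continuous_id).comp_continuousOn hMc
    have h2 : ContinuousOn (fun t => (M t).adjugate) s :=
      (Continuous.matrix_adjugate continuous_id).comp_continuousOn hMc
    exact (h1.inv₀ fun t ht => (hdet t ht).ne_zero).smul h2
  refine ⟨fun t y => ∑ j, ((M t)⁻¹.mulVec fun i => y (e i)) j • e j, fun t ht y φ => ?_, ?_⟩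
  · have h1 : ∀ i, G t (e i) (∑ j, ((M t)⁻¹.mulVec fun i => y (e i)) j • e j) = y (e i) := by
      intro i
      rw [← hMG, Matrix.mulVec_mulVec, Matrix.mul_nonsing_inv _ (hdet t ht), Matrix.one_mulVec]
    have : (G t).flip (∑ j, ((M t)⁻¹.mulVec fun i => y (e i)) j • e j) = y :=
      e.ext fun i => by rw [LinearMap.flip_apply, h1]
    rw [← LinearMap.flip_apply, this]
  · intro y z
    simp only [map_sum, map_smul, smul_eq_mul, Matrix.mulVec, dotProduct]
    refine continuousOn_finsetSum _ fun j _ => ContinuousOn.mul ?_ continuousOn_const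
    refine continuousOn_finsetSum _ fun i _ => ContinuousOn.mul ?_ continuousOn_const
    exact (continuous_apply_apply j i).comp_continuousOn hinv

/-- Finite-dimensional evolution equations `⟨φ, h'⟩_t = N_t(φ, h)` for a differentiable family of
scalar products. -/
theorem exists_galerkin {a b : ℝ} (hab : a < b) (G G' N : ℝ → V →ₗ[ℝ] V →ₗ[ℝ] ℝ)
    (hsymm : ∀ t φ ψ, G t φ ψ = G t ψ φ)
    (hpos : ∀ t ∈ Icc a b, ∀ φ, φ ≠ 0 → 0 < G t φ φ)
    (hG : ∀ φ ψ, ∀ t ∈ Icc a b, HasDerivWithinAt (fun t => G t φ ψ) (G' t φ ψ) (Icc a b) t)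
    (hN : ∀ φ ψ, ContinuousOn (fun t => N t φ ψ) (Icc a b)) (h₀ : V) :
    ∃ h : ℝ → V, h a = h₀ ∧
      (∀ φ, ∀ t ∈ Icc a b, HasDerivWithinAt (fun t => G t φ (h t))
        (N t φ (h t) + G' t φ (h t)) (Icc a b) t) ∧
      ∀ t ∈ Icc a b, HasDerivWithinAt (fun t => G t (h t) (h t))
        (2 * N t (h t) (h t) + G' t (h t) (h t)) (Icc a b) t := by
  classical
  obtain ⟨S, hS, hSc⟩ := exists_gram_solution (s := Icc a b) G hpos
    fun φ ψ t ht => (hG φ ψ t ht).continuousWithinAt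
  set e := Module.finBasis ℝ V
  set n := Module.finrank ℝ V
  -- The map `S` comes without linearity in `y`. Uniqueness of the representing vector recovers it,
  -- and then the continuity of `A` reduces to that of finitely many Gram solutions with fixed
  -- right-hand sides.
  have hSadd : ∀ t ∈ Icc a b, ∀ v : V, ∀ y, (∀ φ, G t φ v = y φ) → v = S t y := by
    intro t ht v y hv
    by_contra hne
    have h1 := hpos t ht (v - S t y) (sub_ne_zero.2 hne)
    rw [map_sub, hv, hS t ht, sub_self] at h1
    exact lt_irrefl _ h1
  -- The matrix, in the basis `e`, of the operator sending `h` to the vector that represents `N_t(·,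
  -- h)`: the equation becomes `x' = A x`.
  set A : ℝ → Matrix (Fin n) (Fin n) ℝ := fun t => Matrix.of fun i j =>
    e.coord i (S t ((N t).flip (e j)))
  have hA : ContinuousOn A (Icc a b) := by
    refine continuousOn_pi.2 fun i => continuousOn_pi.2 fun j => ?_
    have hdec : ∀ t ∈ Icc a b, A t i j =
        ∑ k, N t (e k) (e j) * e.coord i (S t (e.coord k)) := by
      intro t ht
      have : S t ((N t).flip (e j)) = ∑ k, N t (e k) (e j) • S t (e.coord k) := by
        symm
        refine hSadd t ht _ _ fun φ => ?_
        rw [map_sum]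
        simp only [map_smul, smul_eq_mul, hS t ht]
        rw [LinearMap.flip_apply]
        conv_rhs => rw [← e.sum_repr φ, map_sum, LinearMap.sum_apply]
        refine Finset.sum_congr rfl fun k _ => ?_
        simp [mul_comm]
      simp only [A, Matrix.of_apply, this, map_sum, map_smul, smul_eq_mul]
    refine ContinuousOn.congr ?_ hdec
    exact continuousOn_finsetSum _ fun k _ => (hN _ _).mul (hSc _ _)
  obtain ⟨x, hx0, hx⟩ := exists_linear_ode hab A hA (fun i => e.coord i h₀)
  set h : ℝ → V := fun t => ∑ j, x t j • e j
  set h' : ℝ → V := fun t => ∑ j, (A t).mulVec (x t) j • e j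
  have hxi : ∀ j, ∀ t ∈ Icc a b, HasDerivWithinAt (fun t => x t j) ((A t).mulVec (x t) j)
      (Icc a b) t := fun j t ht => (hasDerivWithinAt_pi.1 (hx t ht)) j
  have hh' : ∀ t ∈ Icc a b, ∀ φ, G t φ (h' t) = N t φ (h t) := by
    intro t ht φ
    have : h' t = ∑ k, x t k • S t ((N t).flip (e k)) := by
      have h1 : ∀ k, S t ((N t).flip (e k)) = ∑ j, A t j k • e j := fun k => by
        conv_lhs => rw [← e.sum_repr (S t ((N t).flip (e k)))]
        rfl
      simp only [h', Matrix.mulVec, dotProduct, h1, Finset.smul_sum, Finset.sum_smul]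
      rw [Finset.sum_comm]
      refine Finset.sum_congr rfl fun k _ => Finset.sum_congr rfl fun j _ => ?_
      rw [smul_smul, mul_comm]
    rw [this, map_sum]
    simp only [map_smul, smul_eq_mul, hS t ht, LinearMap.flip_apply, h, map_sum]
  have hder : ∀ φ, ∀ t ∈ Icc a b, HasDerivWithinAt (fun t => G t φ (h t))
      (N t φ (h t) + G' t φ (h t)) (Icc a b) t := by
    intro φ t ht
    have h1 : HasDerivWithinAt (fun t => ∑ j, x t j * G t φ (e j))
        (∑ j, ((A t).mulVec (x t) j * G t φ (e j) + x t j * G' t φ (e j))) (Icc a b) t :=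
      HasDerivWithinAt.fun_sum fun j _ => (hxi j t ht).mul (hG φ (e j) t ht)
    have h2 : (fun t => G t φ (h t)) = fun t => ∑ j, x t j * G t φ (e j) := by
      funext t; simp [h]
    rw [h2]
    convert! h1 using 1
    rw [← hh' t ht, Finset.sum_add_distrib]
    simp [h, h']
  refine ⟨h, ?_, hder, fun t ht => ?_⟩
  · simp only [h, hx0]
    exact e.sum_repr h₀
  -- Product rule with one slot expanded in the basis. The symmetry of `G` identifies `G(h', h)`
  -- with `N(h, h)`, which yields the factor `2`.
  · have h1 : HasDerivWithinAt (fun t => ∑ j, x t j * G t (e j) (h t))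
        (∑ j, ((A t).mulVec (x t) j * G t (e j) (h t) +
          x t j * (N t (e j) (h t) + G' t (e j) (h t)))) (Icc a b) t :=
      HasDerivWithinAt.fun_sum fun j _ => (hxi j t ht).mul (hder (e j) t ht)
    have hexp : ∀ (L : V →ₗ[ℝ] V →ₗ[ℝ] ℝ) (y : Fin n → ℝ) (w : V),
        L (∑ j, y j • e j) w = ∑ j, y j * L (e j) w := by
      intro L y w; simp [LinearMap.sum_apply]
    have h2 : (fun t => G t (h t) (h t)) = fun t => ∑ j, x t j * G t (e j) (h t) := by
      funext t; exact hexp _ _ _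
    rw [h2]
    convert! h1 using 1
    have e1 : ∑ j, (A t).mulVec (x t) j * G t (e j) (h t) = N t (h t) (h t) := by
      rw [← hexp, ← hh' t ht, hsymm]
    rw [Finset.sum_add_distrib, e1]
    simp only [mul_add, Finset.sum_add_distrib]
    rw [← hexp, ← hexp]
    change 2 * N t (h t) (h t) + G' t (h t) (h t) = N t (h t) (h t) + (N t (h t) (h t) + G' t (h t) (h t))
    ring

end Galerkin

/-! ### Weighted energies, duality and Cauchy-Schwarz inequalities. -/

section L2

/-- The quadratic polynomial `t ↦ ∫ (t f + g)²` is nonnegative, so its discriminant is nonpositive.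
-/
theorem sq_integral_mul_le {α : Type*} [MeasurableSpace α] {μ : Measure α} {f g : α → ℝ}
    (hf : Integrable (fun x => f x ^ 2) μ) (hg : Integrable (fun x => g x ^ 2) μ)
    (hfg : Integrable (fun x => f x * g x) μ) :
    (∫ x, f x * g x ∂μ) ^ 2 ≤ (∫ x, f x ^ 2 ∂μ) * ∫ x, g x ^ 2 ∂μ := by
  have key : ∀ t : ℝ, 0 ≤ (∫ x, f x ^ 2 ∂μ) * (t * t) + (2 * ∫ x, f x * g x ∂μ) * t +
      ∫ x, g x ^ 2 ∂μ := by
    intro t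
    have h1 : 0 ≤ ∫ x, (t * f x + g x) ^ 2 ∂μ := integral_nonneg fun x => sq_nonneg _
    have h2 : ∀ x, (t * f x + g x) ^ 2 = t * t * f x ^ 2 + 2 * t * (f x * g x) + g x ^ 2 :=
      fun x => by ring
    simp only [h2] at h1
    have h3 : Integrable (fun x => t * t * f x ^ 2 + 2 * t * (f x * g x)) μ :=
      (hf.const_mul _).add (hfg.const_mul _)
    rw [integral_add h3 hg,
      integral_add (hf.const_mul _) (hfg.const_mul _), integral_const_mul,
      integral_const_mul] at h1
    linarith
  have := discrim_le_zero key
  unfold discrim at this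
  linarith

variable {d : ℕ}

/-- A linear form on a space of test functions which is bounded for the norm of `L²(p)` is given by
a density `u` with `∫ u² / p` bounded by the same constant. -/
theorem exists_density_of_sq_le {p : Eu d → ℝ} (hpc : Continuous p) (hp : ∀ x, 0 < p x)
    {V : Submodule ℝ (Eu d → ℝ)} (hV : ∀ φ ∈ V, Continuous φ ∧ HasCompactSupport φ)
    (l : V →ₗ[ℝ] ℝ) {C : ℝ} (hC : 0 ≤ C)
    (hl : ∀ φ : V, l φ ^ 2 ≤ C * ∫ x, φ.1 x ^ 2 * p x) :
    ∃ u : Eu d → ℝ, AEStronglyMeasurable u volume ∧ Integrable (fun x => u x ^ 2 / p x) ∧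
      ∫ x, u x ^ 2 / p x ≤ C ∧ ∀ φ : V, l φ = ∫ x, φ.1 x * u x := by
  have hs : Continuous fun x => √(p x) := hpc.sqrt
  have hmem : ∀ φ : V, MemLp (fun x => φ.1 x * √(p x)) 2 (volume : Measure (Eu d)) := fun φ =>
    ((hV _ φ.2).1.mul hs).memLp_of_hasCompactSupport (hV _ φ.2).2.mul_right
  let T : V →ₗ[ℝ] Lp ℝ 2 (volume : Measure (Eu d)) :=
    { toFun := fun φ => MemLp.toLp _ (hmem φ)
      map_add' := fun φ ψ => by
        rw [← MemLp.toLp_add]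
        congr 1; ext x; simp [add_mul]
      map_smul' := fun c φ => by
        rw [RingHom.id_apply, ← MemLp.toLp_const_smul]
        congr 1; ext x; simp [mul_assoc] }
  have hTn : ∀ φ, ‖T φ‖ ^ 2 = ∫ x, φ.1 x ^ 2 * p x := by
    intro φ
    rw [← real_inner_self_eq_norm_sq, L2.inner_def]
    refine integral_congr_ae ?_
    filter_upwards [(hmem φ).coeFn_toLp] with x hx
    change inner ℝ (MemLp.toLp _ (hmem φ) x) (MemLp.toLp _ (hmem φ) x) = _
    rw [hx]
    simp only [RCLike.inner_apply, conj_trivial]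
    have := Real.mul_self_sqrt (hp x).le
    linear_combination (φ.1 x) ^ 2 * this
  have : Module.Free ℝ (LinearMap.range T) := Module.Free.of_divisionRing ℝ _
  have : Module.Projective ℝ (LinearMap.range T) := Module.Projective.of_free
  -- The form is transported to the range of `φ ↦ φ √p` in `L²` through a linear section, extended
  -- by Hahn-Banach without increasing its norm, and represented by some `G`. The density is `u = G
  -- √p`.
  obtain ⟨σ, hσ⟩ := LinearMap.exists_rightInverse_of_surjective T.rangeRestrict
    (LinearMap.range_rangeRestrict T)
  have hσ' : ∀ w : LinearMap.range T, T (σ w) = w := fun w => by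
    have := LinearMap.congr_fun hσ w
    exact congrArg Subtype.val this
  have hls : ∀ φ, |l φ| ≤ √C * ‖T φ‖ := by
    intro φ
    refine abs_le_of_sq_le_sq ?_ (by positivity)
    rw [mul_pow, Real.sq_sqrt hC, hTn]
    exact hl φ
  let l' : LinearMap.range T →L[ℝ] ℝ := LinearMap.mkContinuous (l ∘ₗ σ) (√C) fun w => by
    have := hls (σ w)
    rw [hσ'] at this
    simpa using this
  obtain ⟨g, hg1, hg2⟩ := exists_extension_norm_eq (LinearMap.range T) l'
  have hl'n : ‖l'‖ ≤ √C := LinearMap.mkContinuous_norm_le _ (Real.sqrt_nonneg _) _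
  set G := (InnerProductSpace.toDual ℝ (Lp ℝ 2 (volume : Measure (Eu d)))).symm g
  have hGn : ‖G‖ ^ 2 ≤ C := by
    have : ‖G‖ ≤ √C := by
      rw [LinearIsometryEquiv.norm_map, hg2]; exact hl'n
    calc ‖G‖ ^ 2 ≤ √C ^ 2 := by gcongr
      _ = C := Real.sq_sqrt hC
  have hu : ∀ x, (G x * √(p x)) ^ 2 / p x = G x ^ 2 := fun x => by
    rw [mul_pow, Real.sq_sqrt (hp x).le]
    field_simp [(hp x).ne']
  refine ⟨fun x => G x * √(p x), (Lp.aestronglyMeasurable G).mul hs.aestronglyMeasurable, ?_, ?_,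
    fun φ => ?_⟩
  · simp only [hu]
    exact (Lp.memLp G).integrable_sq
  · simp only [hu]
    refine le_trans (le_of_eq ?_) hGn
    rw [← real_inner_self_eq_norm_sq, L2.inner_def]
    simp [sq]
  -- Injectivity of `T` is not needed: the bound on `l` makes it vanish on the kernel of `T`, so the
  -- choice of section does not matter.
  · have h1 : l φ = g (T φ) := by
      have hw := hg1 ⟨T φ, LinearMap.mem_range_self T φ⟩
      rw [hw]
      change l φ = l (σ _)
      have h2 := hls (φ - σ ⟨T φ, LinearMap.mem_range_self T φ⟩)
      rw [map_sub, map_sub, hσ', sub_self, norm_zero, mul_zero] at h2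
      exact sub_eq_zero.1 (abs_eq_zero.1 (le_antisymm h2 (abs_nonneg _)))
    rw [h1, ← InnerProductSpace.toDual_symm_apply (x := T φ) (y := g), L2.inner_def]
    refine integral_congr_ae ?_
    filter_upwards [(hmem φ).coeFn_toLp] with x hx
    change inner ℝ (G x) (MemLp.toLp _ (hmem φ) x) = _
    rw [hx]
    simp only [RCLike.inner_apply, conj_trivial]
    ring

theorem energy_eq_ofReal {p u : Eu d → ℝ} (hp : ∀ x, 0 < p x)
    (h : Integrable (fun x => u x ^ 2 / p x)) :
    energy p u = ENNReal.ofReal (∫ x, u x ^ 2 / p x) := by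
  rw [energy, ofReal_integral_eq_lintegral_ofReal h]
  exact Eventually.of_forall fun x => div_nonneg (sq_nonneg _) (hp x).le

theorem integrable_of_energy_lt_top {p u : Eu d → ℝ} (hpc : Continuous p) (hp : ∀ x, 0 < p x)
    (hu : AEStronglyMeasurable u volume) (h : energy p u < ⊤) :
    Integrable (fun x => u x ^ 2 / p x) := by
  refine ⟨?_, ?_⟩
  · have := (hu.mul hu).mul (hpc.inv₀ fun x => (hp x).ne').aestronglyMeasurable
    refine this.congr (Eventually.of_forall fun x => ?_)
    simp only [Pi.mul_apply, Pi.inv_apply, div_eq_mul_inv, sq]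
  · rw [hasFiniteIntegral_iff_ofReal]
    · exact h
    · exact Eventually.of_forall fun x => div_nonneg (sq_nonneg _) (hp x).le

/-- Pointwise `|u| ≤ u²/p + p`, by completing the square. -/
theorem integrable_of_energy {p u : Eu d → ℝ} (hp : ∀ x, 0 < p x)
    (hu : AEStronglyMeasurable u volume) (hpi : Integrable p)
    (h : Integrable (fun x => u x ^ 2 / p x)) : Integrable u := by
  refine (h.add hpi).mono' hu (Eventually.of_forall fun x => ?_)
  have h1 := hp x
  simp only [Pi.add_apply, Real.norm_eq_abs]
  have h2 : u x ^ 2 / p x + p x - |u x| = ((|u x| - p x / 2) ^ 2 + 3 / 4 * p x ^ 2) / p x := by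
    rw [← sq_abs (u x)]; field_simp; ring
  have : 0 ≤ u x ^ 2 / p x + p x - |u x| := by rw [h2]; positivity
  linarith

theorem integrable_mul_of_energy {p u φ : Eu d → ℝ} (hp : ∀ x, 0 < p x)
    (hu : AEStronglyMeasurable u volume) (h : Integrable (fun x => u x ^ 2 / p x))
    (hφ : AEStronglyMeasurable φ volume) (hφp : Integrable (fun x => φ x ^ 2 * p x)) :
    Integrable (fun x => φ x * u x) := by
  refine (h.add hφp).mono' (hφ.mul hu) (Eventually.of_forall fun x => ?_)
  have h1 := hp x
  simp only [Pi.add_apply, Real.norm_eq_abs, abs_mul]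
  have h2 : u x ^ 2 / p x + φ x ^ 2 * p x - |φ x| * |u x| =
      ((|u x| - |φ x| * p x / 2) ^ 2 + 3 / 4 * (|φ x| * p x) ^ 2) / p x := by
    rw [← sq_abs (u x), ← sq_abs (φ x)]; field_simp; ring
  have : 0 ≤ u x ^ 2 / p x + φ x ^ 2 * p x - |φ x| * |u x| := by rw [h2]; positivity
  linarith

/-- Cauchy-Schwarz for the factorization `φ u = (φ √p) (u / √p)`. -/
theorem sq_integral_mul_le_energy {p u φ : Eu d → ℝ} (hp : ∀ x, 0 < p x)
    (hu : AEStronglyMeasurable u volume) (h : Integrable (fun x => u x ^ 2 / p x))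
    (hφ : AEStronglyMeasurable φ volume) (hφp : Integrable (fun x => φ x ^ 2 * p x)) :
    (∫ x, φ x * u x) ^ 2 ≤ (∫ x, u x ^ 2 / p x) * ∫ x, φ x ^ 2 * p x := by
  have e1 : ∀ x, (φ x * √(p x)) ^ 2 = φ x ^ 2 * p x := fun x => by
    rw [mul_pow, Real.sq_sqrt (hp x).le]
  have e2 : ∀ x, (u x / √(p x)) ^ 2 = u x ^ 2 / p x := fun x => by
    rw [div_pow, Real.sq_sqrt (hp x).le]
  have e3 : ∀ x, (φ x * √(p x)) * (u x / √(p x)) = φ x * u x := fun x => by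
    have := (Real.sqrt_pos.2 (hp x)).ne'
    field_simp
  have := sq_integral_mul_le (μ := volume) (f := fun x => φ x * √(p x))
    (g := fun x => u x / √(p x)) (by simpa only [e1] using hφp) (by simpa only [e2] using h)
    (by simpa only [e3] using integrable_mul_of_energy hp hu h hφ hφp)
  simp only [e1, e2, e3] at this
  linarith

/-- The space of smooth compactly supported functions. -/
def smoothTest (d : ℕ) : Submodule ℝ (Eu d → ℝ) where
  carrier := {φ | ContDiff ℝ (⊤ : ℕ∞) φ ∧ HasCompactSupport φ}
  add_mem' := fun h g => ⟨h.1.add g.1, h.2.add g.2⟩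
  zero_mem' := ⟨contDiff_const, HasCompactSupport.zero⟩
  smul_mem' := fun c _ h => ⟨contDiff_const.smul h.1, HasCompactSupport.smul_left (f := fun _ => c) h.2⟩

/-- The space of continuously differentiable compactly supported functions. -/
def testSpace (d : ℕ) : Submodule ℝ (Eu d → ℝ) where
  carrier := {φ | ContDiff ℝ 1 φ ∧ HasCompactSupport φ}
  add_mem' := fun h g => ⟨h.1.add g.1, h.2.add g.2⟩
  zero_mem' := ⟨contDiff_const, HasCompactSupport.zero⟩
  smul_mem' := fun c _ h => ⟨contDiff_const.smul h.1, HasCompactSupport.smul_left (f := fun _ => c) h.2⟩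

/-- The energy is determined by duality against smooth test functions. -/
theorem integral_energy_le_of_test {p u : Eu d → ℝ} (hpc : Continuous p) (hp : ∀ x, 0 < p x)
    (hpi : Integrable p) (hu : LocallyIntegrable u volume) {C : ℝ} (hC : 0 ≤ C)
    (h : ∀ φ ∈ smoothTest d, (∫ x, φ x * u x) ^ 2 ≤ C * ∫ x, φ x ^ 2 * p x) :
    Integrable (fun x => u x ^ 2 / p x) ∧ ∫ x, u x ^ 2 / p x ≤ C := by
  have hint : ∀ φ ∈ smoothTest d, Integrable (fun x => φ x * u x) := fun φ hφ => by
    have := hu.integrable_smul_left_of_hasCompactSupport hφ.1.continuous hφ.2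
    simpa using this
  let l : smoothTest d →ₗ[ℝ] ℝ :=
    { toFun := fun φ => ∫ x, φ.1 x * u x
      map_add' := fun φ ψ => by
        rw [← integral_add (hint _ φ.2) (hint _ ψ.2)]
        simp [add_mul]
      map_smul' := fun c φ => by
        rw [RingHom.id_apply, smul_eq_mul, ← integral_const_mul]
        simp [mul_assoc] }
  obtain ⟨v, hv1, hv2, hv3, hv4⟩ := exists_density_of_sq_le hpc hp
    (V := smoothTest d) (fun φ hφ => ⟨hφ.1.continuous, hφ.2⟩) l hC (fun φ => h φ.1 φ.2)
  have hvi : Integrable v := integrable_of_energy hp hv1 hpi hv2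
  -- The density `v` obtained by duality has the same pairings with smooth test functions as `u`, so
  -- the fundamental lemma of the calculus of variations identifies the two.
  have hae : ∀ᵐ x, u x - v x = 0 := by
    refine ae_eq_zero_of_integral_contDiff_smul_eq_zero
      (hu.sub hvi.locallyIntegrable) fun g hg hgc => ?_
    have h1 := hv4 ⟨g, hg, hgc⟩
    change ∫ x, g x * u x = ∫ x, g x * v x at h1
    have h2 : Integrable fun x => g x * v x := by
      have := hvi.locallyIntegrable.integrable_smul_left_of_hasCompactSupport hg.continuous hgc
      simpa using this
    simp only [smul_eq_mul, mul_sub]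
    rw [integral_sub (hint g ⟨hg, hgc⟩) h2, h1, sub_self]
  have hae' : (fun x => v x ^ 2 / p x) =ᵐ[volume] fun x => u x ^ 2 / p x := by
    filter_upwards [hae] with x hx
    rw [sub_eq_zero.1 hx]
  exact ⟨hv2.congr hae', by rwa [← integral_congr_ae hae']⟩

end L2

/-- A positive density `ρ` transported by a velocity field `b`, regular in the open time interval,
with the integrability that the Fokker-Planck equations with drift `b ± ε ∇ log ρ` require. -/
structure FlowPair {d : ℕ} (ρ : ℝ → Eu d → ℝ) (b : ℝ → Eu d → Eu d) : Prop where
  pos : ∀ t ∈ Icc (0 : ℝ) 1, ∀ x, 0 < ρ t x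
  cont : ∀ t ∈ Icc (0 : ℝ) 1, Continuous (ρ t)
  integrable : ∀ t ∈ Icc (0 : ℝ) 1, Integrable (ρ t)
  integral_eq : ∀ t ∈ Icc (0 : ℝ) 1, ∫ x, ρ t x = 1
  weakCont : ∀ φ : Eu d → ℝ, Continuous φ → HasCompactSupport φ →
    ContinuousOn (fun t => ∫ x, φ x * ρ t x) (Icc 0 1)
  contDiff : ∀ t ∈ Ioo (0 : ℝ) 1, ContDiff ℝ 2 (ρ t)
  contDiff_b : ∀ t ∈ Ioo (0 : ℝ) 1, ContDiff ℝ 1 (b t)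
  cont_rho : ContinuousOn (fun q : ℝ × Eu d => ρ q.1 q.2) (Ioo 0 1 ×ˢ univ)
  cont_grad : ContinuousOn (fun q : ℝ × Eu d => ∇ (ρ q.1) q.2) (Ioo 0 1 ×ˢ univ)
  cont_hess : ContinuousOn (fun q : ℝ × Eu d => fderiv ℝ (∇ (ρ q.1)) q.2) (Ioo 0 1 ×ˢ univ)
  cont_b : ContinuousOn (fun q : ℝ × Eu d => b q.1 q.2) (Ioo 0 1 ×ˢ univ)
  cont_fderiv_b : ContinuousOn (fun q : ℝ × Eu d => fderiv ℝ (b q.1) q.2) (Ioo 0 1 ×ˢ univ)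
  deriv : ∀ t ∈ Ioo (0 : ℝ) 1, ∀ x,
    HasDerivAt (fun τ => ρ τ x) (-divergence (fun y => ρ t y • b t y) x) t
  b_sq : ∃ C : ℝ, ∀ t ∈ Ioo (0 : ℝ) 1, Integrable (fun x => ‖b t x‖ ^ 2 * ρ t x) ∧
    ∫ x, ‖b t x‖ ^ 2 * ρ t x ≤ C / t + C / (1 - t)
  score_sq : ∃ K : ℝ → ℝ, ContinuousOn K (Ioo 0 1) ∧ ∀ t ∈ Ioo (0 : ℝ) 1,
    Integrable (fun x => ‖∇ (ρ t) x‖ ^ 2 / ρ t x) ∧ ∫ x, ‖∇ (ρ t) x‖ ^ 2 / ρ t x ≤ K t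

/-! ### Time reversal and the weak continuity equation for a flow pair. -/

namespace FlowPair

variable {d : ℕ} {ρ : ℝ → Eu d → ℝ} {b : ℝ → Eu d → Eu d}

theorem Ioo_sub {t : ℝ} (ht : t ∈ Ioo (0 : ℝ) 1) : t ∈ Icc (0 : ℝ) 1 := ⟨ht.1.le, ht.2.le⟩

/-- The time-reversed pair. -/
theorem reverse (h : FlowPair ρ b) : FlowPair (fun t => ρ (1 - t)) (fun t x => -b (1 - t) x) := by
  have hc : ∀ t ∈ Icc (0 : ℝ) 1, 1 - t ∈ Icc (0 : ℝ) 1 := fun t ht =>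
    ⟨by linarith [ht.2], by linarith [ht.1]⟩
  have ho : ∀ t ∈ Ioo (0 : ℝ) 1, 1 - t ∈ Ioo (0 : ℝ) 1 := fun t ht =>
    ⟨by linarith [ht.2], by linarith [ht.1]⟩
  have hm : Continuous fun q : ℝ × Eu d => (1 - q.1, q.2) := by fun_prop
  have hmt : MapsTo (fun q : ℝ × Eu d => (1 - q.1, q.2)) (Ioo 0 1 ×ˢ univ) (Ioo 0 1 ×ˢ univ) :=
    fun q hq => ⟨ho _ hq.1, mem_univ _⟩
  refine ⟨fun t ht => h.pos _ (hc t ht), fun t ht => h.cont _ (hc t ht),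
    fun t ht => h.integrable _ (hc t ht), fun t ht => h.integral_eq _ (hc t ht), fun φ h1 h2 =>
      (h.weakCont φ h1 h2).comp (by fun_prop) hc, fun t ht => h.contDiff _ (ho t ht),
      fun t ht => (h.contDiff_b _ (ho t ht)).neg, h.cont_rho.comp hm.continuousOn hmt,
      h.cont_grad.comp hm.continuousOn hmt, h.cont_hess.comp hm.continuousOn hmt,
      (h.cont_b.comp hm.continuousOn hmt).neg, ?_, fun t ht x => ?_, ?_, ?_⟩
  · have := (h.cont_fderiv_b.comp hm.continuousOn hmt).neg
    refine this.congr fun q _ => ?_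
    simp only [Pi.neg_apply, Function.comp_apply]
    rw [fderiv_fun_neg]
  · have h1 := (h.deriv _ (ho t ht) x).scomp t ((hasDerivAt_id t).const_sub 1)
    simp only [Function.comp_def] at h1
    convert! h1 using 1
    have : (fun y => ρ (1 - t) y • -b (1 - t) y) =
        fun y => (-1 : ℝ) • (ρ (1 - t) y • b (1 - t) y) := by funext y; simp
    rw [this, divergence_const_smul]
    · simp
    · exact (((h.contDiff _ (ho t ht)).differentiable (by norm_num)) x).smul
        (((h.contDiff_b _ (ho t ht)).differentiable (by norm_num)) x)
  -- The bound `C / t + C / (1 - t)` is symmetric under `t ↦ 1 - t`, so the same constant works.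
  · obtain ⟨C, hC⟩ := h.b_sq
    refine ⟨C, fun t ht => ?_⟩
    have := hC _ (ho t ht)
    simp only [norm_neg]
    refine ⟨this.1, this.2.trans (le_of_eq ?_)⟩
    rw [sub_sub_cancel, add_comm]
  · obtain ⟨K, hK, hK'⟩ := h.score_sq
    exact ⟨fun t => K (1 - t), hK.comp (by fun_prop) ho, fun t ht => hK' _ (ho t ht)⟩

theorem contDiff_flux (h : FlowPair ρ b) {t : ℝ} (ht : t ∈ Ioo (0 : ℝ) 1) :
    ContDiff ℝ 1 (fun y => ρ t y • b t y) :=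
  ((h.contDiff t ht).of_le (by norm_num)).smul (h.contDiff_b t ht)

theorem cont_divergence_b (h : FlowPair ρ b) :
    ContinuousOn (fun q : ℝ × Eu d => divergence (b q.1) q.2) (Ioo 0 1 ×ˢ univ) := by
  unfold divergence
  refine continuousOn_finsetSum _ fun i _ => ?_
  have h1 : Continuous fun L : Eu d →L[ℝ] Eu d => (L (EuclideanSpace.single i 1)) i := by fun_prop
  exact h1.comp_continuousOn h.cont_fderiv_b

theorem cont_divergence (h : FlowPair ρ b) :
    ContinuousOn (fun q : ℝ × Eu d => divergence (fun y => ρ q.1 y • b q.1 y) q.2)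
      (Ioo 0 1 ×ˢ univ) := by
  refine ((h.cont_rho.mul h.cont_divergence_b).add (h.cont_b.inner h.cont_grad)).congr fun q hq => ?_
  exact divergence_smul (((h.contDiff _ hq.1).differentiable (by norm_num)) _)
    (((h.contDiff_b _ hq.1).differentiable (by norm_num)) _)

/-- Continuity on a compact set `[t - r, t + r] × K`. This supplies the dominating constants when
integrals of functions supported in `K` are differentiated in time. -/
theorem exists_Icc_bound {F : ℝ × Eu d → ℝ} (hF : ContinuousOn F (Ioo 0 1 ×ˢ univ)) {t : ℝ}
    (ht : t ∈ Ioo (0 : ℝ) 1) {K : Set (Eu d)} (hK : IsCompact K) :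
    ∃ r > 0, Metric.ball t r ⊆ Ioo 0 1 ∧ ∃ C, ∀ s ∈ Metric.ball t r, ∀ x ∈ K, |F (s, x)| ≤ C := by
  obtain ⟨r, hr, hrs⟩ := Metric.nhds_basis_closedBall.mem_iff.1 (isOpen_Ioo.mem_nhds ht)
  obtain ⟨C, hC⟩ := ((isCompact_closedBall t r).prod hK).exists_bound_of_continuousOn
    (hF.mono (prod_mono hrs (subset_univ _)))
  exact ⟨r, hr, Metric.ball_subset_closedBall.trans hrs, C, fun s hs x hx =>
    hC (s, x) ⟨Metric.ball_subset_closedBall hs, hx⟩⟩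

/-- The continuity equation tested against compactly supported functions. -/
theorem hasDerivAt_integral (h : FlowPair ρ b) {φ : Eu d → ℝ} (hφ : φ ∈ testSpace d) {t : ℝ}
    (ht : t ∈ Ioo (0 : ℝ) 1) :
    HasDerivAt (fun τ => ∫ x, φ x * ρ τ x) (∫ x, ⟪b t x, ∇ φ x⟫ * ρ t x) t := by
  obtain ⟨r, hr, hrs, C, hC⟩ := exists_Icc_bound (F := fun q => φ q.2 *
    -divergence (fun y => ρ q.1 y • b q.1 y) q.2)
    (((hφ.1.continuous.comp continuous_snd).continuousOn).mul h.cont_divergence.neg) ht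
    hφ.2.isCompact
  have key := hasDerivAt_integral_of_compact (F := fun τ x => φ x * ρ τ x)
    (F' := fun τ x => φ x * -divergence (fun y => ρ τ y • b τ y) x) (C := C) hr hφ.2.isCompact
    (fun s hs => (hφ.1.continuous.mul (h.cont s (Ioo_sub (hrs hs)))).aestronglyMeasurable)
    ((hφ.1.continuous.mul (h.cont t (Ioo_sub ht))).integrable_of_hasCompactSupport hφ.2.mul_right)
    (hφ.1.continuous.mul (continuous_divergence (h.contDiff_flux ht)).neg).aestronglyMeasurable
    hC (fun s _ x hx => by simp [image_eq_zero_of_notMem_tsupport hx])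
    (fun s hs x => (h.deriv s (hrs hs) x).const_mul (φ x))
  convert! key using 1
  have := integral_mul_divergence hφ.1 (h.contDiff_flux ht) (Or.inl hφ.2)
  simp only [mul_neg, integral_neg, this, neg_neg]
  refine integral_congr_ae (Eventually.of_forall fun x => ?_)
  simp [mul_comm]

end FlowPair

/-! ### Weighted bilinear forms on the space of test functions. -/

section Forms

variable {d : ℕ}

theorem testSpace.continuous (φ : testSpace d) : Continuous φ.1 := φ.2.1.continuous

theorem testSpace.continuous_gradient (φ : testSpace d) : Continuous (∇ φ.1) :=
  φ.2.1.continuous_gradient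

theorem testSpace.differentiable (φ : testSpace d) (x : Eu d) : DifferentiableAt ℝ φ.1 x :=
  φ.2.1.differentiable (by norm_num) x

theorem testSpace.gradient_add (φ ψ : testSpace d) (x : Eu d) :
    ∇ (φ + ψ).1 x = ∇ φ.1 x + ∇ ψ.1 x := gradient_add' ((testSpace.differentiable φ) x) ((testSpace.differentiable ψ) x)

theorem testSpace.gradient_smul (c : ℝ) (φ : testSpace d) (x : Eu d) :
    ∇ (c • φ).1 x = c • ∇ φ.1 x := gradient_const_mul c ((testSpace.differentiable φ) x)

theorem testSpace.integrable_mul (φ : testSpace d) {g : Eu d → ℝ} (hg : Continuous g) :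
    Integrable (fun x => φ.1 x * g x) :=
  ((testSpace.continuous φ).mul hg).integrable_of_hasCompactSupport φ.2.2.mul_right

theorem testSpace.integrable_inner (φ : testSpace d) {v : Eu d → Eu d} (hv : Continuous v) :
    Integrable (fun x => ⟪v x, ∇ φ.1 x⟫) :=
  (hv.inner (testSpace.continuous_gradient φ)).integrable_of_hasCompactSupport
    (φ.2.2.gradient.mono fun x hx => by
      contrapose! hx
      simp only [Function.mem_support, not_not] at hx ⊢
      rw [hx, inner_zero_right])

theorem testSpace.mul_mem (φ ψ : testSpace d) : (fun x => φ.1 x * ψ.1 x) ∈ testSpace d :=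
  ⟨φ.2.1.mul ψ.2.1, φ.2.2.mul_right⟩

/-- The scalar product with weight `p`. -/
noncomputable def gramForm (p : Eu d → ℝ) (hp : Continuous p) : testSpace d →ₗ[ℝ] testSpace d →ₗ[ℝ] ℝ :=
  LinearMap.mk₂ ℝ (fun φ ψ => ∫ x, φ.1 x * (ψ.1 x * p x))
    (fun φ φ' ψ => by
      rw [← integral_add (testSpace.integrable_mul φ (g := fun x => ψ.1 x * p x)
          ((testSpace.continuous ψ).mul hp)) (testSpace.integrable_mul φ'
          (g := fun x => ψ.1 x * p x) ((testSpace.continuous ψ).mul hp))]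
      exact integral_congr_ae (Eventually.of_forall fun x => add_mul _ _ _))
    (fun c φ ψ => by
      rw [smul_eq_mul, ← integral_const_mul]
      exact integral_congr_ae (Eventually.of_forall fun x => mul_assoc _ _ _))
    (fun φ ψ ψ' => by
      rw [← integral_add (testSpace.integrable_mul φ (g := fun x => ψ.1 x * p x)
          ((testSpace.continuous ψ).mul hp)) (testSpace.integrable_mul φ
          (g := fun x => ψ'.1 x * p x) ((testSpace.continuous ψ').mul hp))]
      refine integral_congr_ae (Eventually.of_forall fun x => ?_)
      change φ.1 x * ((ψ.1 x + ψ'.1 x) * p x) = _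
      ring)
    (fun c φ ψ => by
      rw [smul_eq_mul, ← integral_const_mul]
      refine integral_congr_ae (Eventually.of_forall fun x => ?_)
      change φ.1 x * ((c * ψ.1 x) * p x) = _
      ring)

/-- The advection form `∫ φ ⟪v, ∇ ψ⟫`. -/
noncomputable def advForm (v : Eu d → Eu d) (hv : Continuous v) : testSpace d →ₗ[ℝ] testSpace d →ₗ[ℝ] ℝ :=
  LinearMap.mk₂ ℝ (fun φ ψ => ∫ x, φ.1 x * ⟪v x, ∇ ψ.1 x⟫)
    (fun φ φ' ψ => by
      rw [← integral_add ((testSpace.integrable_mul φ) (hv.inner (testSpace.continuous_gradient ψ)))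
        ((testSpace.integrable_mul φ') (hv.inner (testSpace.continuous_gradient ψ)))]
      exact integral_congr_ae (Eventually.of_forall fun x => add_mul _ _ _))
    (fun c φ ψ => by
      rw [smul_eq_mul, ← integral_const_mul]
      exact integral_congr_ae (Eventually.of_forall fun x => mul_assoc _ _ _))
    (fun φ ψ ψ' => by
      rw [← integral_add ((testSpace.integrable_mul φ) (hv.inner (testSpace.continuous_gradient ψ)))
        ((testSpace.integrable_mul φ) (hv.inner (testSpace.continuous_gradient ψ')))]
      refine integral_congr_ae (Eventually.of_forall fun x => ?_)
      simp only [testSpace.gradient_add, inner_add_right]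
      ring)
    (fun c φ ψ => by
      rw [smul_eq_mul, ← integral_const_mul]
      refine integral_congr_ae (Eventually.of_forall fun x => ?_)
      simp only [testSpace.gradient_smul, inner_smul_right]
      ring)

theorem advForm_apply (v : Eu d → Eu d) (hv : Continuous v) (φ ψ : testSpace d) :
    advForm v hv φ ψ = ∫ x, φ.1 x * ⟪v x, ∇ ψ.1 x⟫ := rfl

/-- The Dirichlet form with weight `p`. -/
noncomputable def dirichletForm (p : Eu d → ℝ) (hp : Continuous p) :
    testSpace d →ₗ[ℝ] testSpace d →ₗ[ℝ] ℝ :=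
  LinearMap.mk₂ ℝ (fun φ ψ => ∫ x, ⟪p x • ∇ φ.1 x, ∇ ψ.1 x⟫)
    (fun φ φ' ψ => by
      rw [← integral_add (testSpace.integrable_inner ψ (v := fun x => p x • ∇ φ.1 x) (hp.smul (testSpace.continuous_gradient φ)))
        (testSpace.integrable_inner ψ (v := fun x => p x • ∇ φ'.1 x) (hp.smul (testSpace.continuous_gradient φ')))]
      refine integral_congr_ae (Eventually.of_forall fun x => ?_)
      simp only [testSpace.gradient_add, smul_add, inner_add_left])
    (fun c φ ψ => by
      rw [smul_eq_mul, ← integral_const_mul]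
      refine integral_congr_ae (Eventually.of_forall fun x => ?_)
      simp only [testSpace.gradient_smul, inner_smul_left, conj_trivial]
      ring)
    (fun φ ψ ψ' => by
      rw [← integral_add (testSpace.integrable_inner ψ (v := fun x => p x • ∇ φ.1 x) (hp.smul (testSpace.continuous_gradient φ)))
        (testSpace.integrable_inner ψ' (v := fun x => p x • ∇ φ.1 x) (hp.smul (testSpace.continuous_gradient φ)))]
      refine integral_congr_ae (Eventually.of_forall fun x => ?_)
      simp only [testSpace.gradient_add, inner_add_right])
    (fun c φ ψ => by
      rw [smul_eq_mul, ← integral_const_mul]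
      refine integral_congr_ae (Eventually.of_forall fun x => ?_)
      simp only [testSpace.gradient_smul, inner_smul_right])

theorem dirichletForm_apply (p : Eu d → ℝ) (hp : Continuous p) (φ ψ : testSpace d) :
    dirichletForm p hp φ ψ = ∫ x, ⟪p x • ∇ φ.1 x, ∇ ψ.1 x⟫ := rfl

theorem gramForm_apply (p : Eu d → ℝ) (hp : Continuous p) (φ ψ : testSpace d) :
    gramForm p hp φ ψ = ∫ x, φ.1 x * (ψ.1 x * p x) := rfl

theorem gramForm_symm (p : Eu d → ℝ) (hp : Continuous p) (φ ψ : testSpace d) :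
    gramForm p hp φ ψ = gramForm p hp ψ φ := by
  rw [gramForm_apply, gramForm_apply]
  exact integral_congr_ae (Eventually.of_forall fun x => by ring)

/-- A nonzero continuous function is nonzero on a set of positive measure, and the weight is
positive there. This makes the Gram matrices of the Galerkin systems invertible. -/
theorem gramForm_pos {p : Eu d → ℝ} (hp : Continuous p) (hpos : ∀ x, 0 < p x) {φ : testSpace d}
    (hφ : φ ≠ 0) : 0 < gramForm p hp φ φ := by
  rw [gramForm_apply]
  obtain ⟨x, hx⟩ : ∃ x, φ.1 x ≠ 0 := by
    by_contra! h
    exact hφ (Subtype.ext (funext h))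
  refine Continuous.integral_pos_of_hasCompactSupport_nonneg_nonzero (x := x)
    ((testSpace.continuous φ).mul ((testSpace.continuous φ).mul hp)) φ.2.2.mul_right (fun y => ?_) ?_
  · change 0 ≤ φ.1 y * (φ.1 y * p y)
    have := hpos y
    have h2 : φ.1 y * (φ.1 y * p y) = φ.1 y ^ 2 * p y := by ring
    rw [h2]; positivity
  · exact mul_ne_zero hx (mul_ne_zero hx (hpos x).ne')

/-- The projection of the real line onto `[a, b]`. -/
def clampTo (a b t : ℝ) : ℝ := max a (min b t)

theorem clampTo_mem {a b : ℝ} (hab : a ≤ b) (t : ℝ) : clampTo a b t ∈ Icc a b :=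
  ⟨le_max_left _ _, max_le hab (min_le_left _ _)⟩

theorem clampTo_of_mem {a b t : ℝ} (ht : t ∈ Icc a b) : clampTo a b t = t := by
  rw [clampTo, min_eq_right ht.2, max_eq_right ht.1]

/-- Integrals of continuous families supported in a fixed compact set are continuous. -/
theorem continuousOn_integral_of_test {F : ℝ × Eu d → ℝ} {s : Set ℝ} {K : Set (Eu d)}
    (hK : IsCompact K) (hF : ContinuousOn F (s ×ˢ univ)) (hz : ∀ t ∈ s, ∀ x ∉ K, F (t, x) = 0) :
    ContinuousOn (fun t => ∫ x, F (t, x)) s :=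
  continuousOn_integral_of_compact_support (f := fun t x => F (t, x)) hK hF
    (fun t x ht hx => hz t ht x hx)

end Forms

/-! ### Galerkin approximation of the equation for `u / ρ`. -/

namespace FlowPair

variable {d : ℕ} {ρ : ℝ → Eu d → ℝ} {b : ℝ → Eu d → Eu d}

/-- Galerkin approximation of the Fokker-Planck equation, written for the ratio `h = u / ρ`, in a
finite-dimensional space of test functions and on a time interval inside `(0,1)`. -/
theorem exists_approximation (h : FlowPair ρ b) {ε : ℝ → ℝ} (hε : ContinuousOn ε (Icc 0 1))
    {f : Eu d → ℝ} (hf : AEStronglyMeasurable f volume)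
    (hfe : Integrable (fun x => f x ^ 2 / ρ 0 x))
    (V : Submodule ℝ (testSpace d)) [FiniteDimensional ℝ V] (n : ℕ) :
    ∃ δ : ℝ, 0 < δ ∧ δ ≤ 1 / (n + 3) ∧ ∃ w : ℝ → testSpace d, (∀ t, w t ∈ V) ∧
      (∀ φ ∈ V, ∫ x, φ.1 x * ((w δ).1 x * ρ δ x) = ∫ x, φ.1 x * f x) ∧
      ∫ x, (w δ).1 x * ((w δ).1 x * ρ δ x) ≤ (∫ x, f x ^ 2 / ρ 0 x) + 1 / (n + 1) ∧
      (∀ φ ∈ V, ∀ t ∈ Icc δ (1 - δ), HasDerivWithinAt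
        (fun t => ∫ x, φ.1 x * ((w t).1 x * ρ t x))
        ((∫ x, (w t).1 x * ⟪ρ t x • b t x, ∇ φ.1 x⟫) -
          ε t * ∫ x, ⟪ρ t x • ∇ φ.1 x, ∇ (w t).1 x⟫) (Icc δ (1 - δ)) t) ∧
      ∀ t ∈ Icc δ (1 - δ), HasDerivWithinAt (fun t => ∫ x, (w t).1 x * ((w t).1 x * ρ t x))
        (-2 * ε t * ∫ x, ⟪ρ t x • ∇ (w t).1 x, ∇ (w t).1 x⟫) (Icc δ (1 - δ)) t := by
  have h01 : (0 : ℝ) ≤ 1 := zero_le_one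
  have hfi : ∀ φ : testSpace d, Integrable (fun x => φ.1 x * f x) := fun φ => by
    have h0 : (0 : ℝ) ∈ Icc (0 : ℝ) 1 := ⟨le_rfl, h01⟩
    have := (integrable_of_energy (h.pos 0 h0) hf (h.integrable 0 h0)
      hfe).locallyIntegrable.integrable_smul_left_of_hasCompactSupport (testSpace.continuous φ) φ.2.2
    simpa using this
  let y : V →ₗ[ℝ] ℝ :=
    { toFun := fun φ => ∫ x, φ.1.1 x * f x
      map_add' := fun φ ψ => by
        rw [← integral_add (hfi _) (hfi _)]
        exact integral_congr_ae (Eventually.of_forall fun x => add_mul _ _ _)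
      map_smul' := fun c φ => by
        rw [RingHom.id_apply, smul_eq_mul, ← integral_const_mul]
        exact integral_congr_ae (Eventually.of_forall fun x => mul_assoc _ _ _) }
  -- the starting time
  obtain ⟨S, hS1, hS2⟩ := exists_gram_solution (s := Icc 0 1) (V := V)
    (fun t => (gramForm (ρ (clampTo 0 1 t)) (h.cont _ (clampTo_mem h01 t))).domRestrict₁₂ V V)
    (fun t _ φ hφ => gramForm_pos (h.cont _ (clampTo_mem h01 t)) (h.pos _ (clampTo_mem h01 t))
      (by simpa using hφ)) (fun φ ψ => by
        refine (h.weakCont _ ((testSpace.continuous φ.1).mul (testSpace.continuous ψ.1)) φ.1.2.2.mul_right).congr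
          fun t ht => ?_
        simp only [LinearMap.domRestrict₁₂_apply, gramForm_apply, clampTo_of_mem ht]
        exact integral_congr_ae (Eventually.of_forall fun x => (mul_assoc _ _ _).symm))
  have h0 : (0 : ℝ) ∈ Icc (0 : ℝ) 1 := ⟨le_rfl, h01⟩
  -- The vector `q = S 0 y` is the projection of `f / ρ 0` onto `V` in `L²(ρ 0)`, and `y q = ∫ q² ρ
  -- 0`. Cauchy-Schwarz gives `(y q)² ≤ E · y q`, hence the projection does not increase the energy.
  have hE : y (S 0 y) ≤ ∫ x, f x ^ 2 / ρ 0 x := by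
    have h1 := hS1 0 h0 y (S 0 y)
    simp only [LinearMap.domRestrict₁₂_apply, gramForm_apply, clampTo_of_mem h0] at h1
    set q := S 0 y
    have h2 : ∫ x, q.1.1 x ^ 2 * ρ 0 x = y q := by
      rw [← h1]
      exact integral_congr_ae (Eventually.of_forall fun x => by ring)
    have h4 : Integrable (fun x => q.1.1 x ^ 2 * ρ 0 x) := by
      have := testSpace.integrable_mul q.1 (g := fun x => q.1.1 x * ρ 0 x)
        ((testSpace.continuous q.1).mul (h.cont 0 h0))
      refine this.congr (Eventually.of_forall fun x => by ring)
    have h3 := sq_integral_mul_le_energy (h.pos 0 h0) hf hfe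
      (testSpace.continuous q.1).aestronglyMeasurable h4
    rw [h2] at h3
    change (y q) ^ 2 ≤ _ at h3
    have h5 : 0 ≤ ∫ x, f x ^ 2 / ρ 0 x := integral_nonneg fun x =>
      div_nonneg (sq_nonneg _) (h.pos 0 h0 x).le
    by_contra hlt
    push Not at hlt
    nlinarith
  -- The flow pair is regular only at interior times, so the system starts at some `δ > 0` from the
  -- vector representing `f` there. By continuity at `0` this costs at most `1 / (n + 1)` in energy.
  -- The bound `1 / (n + 3)` keeps `δ ≤ 1 / 3`, so that `[δ, 1 - δ]` is nondegenerate.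
  obtain ⟨δ, hδ0, hδ1, hδ2⟩ : ∃ δ : ℝ, 0 < δ ∧ δ ≤ 1 / (n + 3) ∧
      y (S δ y) ≤ (∫ x, f x ^ 2 / ρ 0 x) + 1 / (n + 1) := by
    have hc : Tendsto (fun t => y (S t y)) (𝓝[>] 0) (𝓝 (y (S 0 y))) :=
      (hS2 y y 0 h0).mono_left (nhdsWithin_le_of_mem
        (mem_of_superset (Icc_mem_nhdsGT zero_lt_one) subset_rfl))
    have h1 : ∀ᶠ t in 𝓝[>] (0 : ℝ), y (S t y) < (∫ x, f x ^ 2 / ρ 0 x) + 1 / (n + 1) := by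
      refine hc.eventually (gt_mem_nhds (lt_of_le_of_lt hE ?_))
      have : (0 : ℝ) < 1 / (n + 1) := by positivity
      linarith
    have h2 : ∀ᶠ t in 𝓝[>] (0 : ℝ), t ∈ Ioc (0 : ℝ) (1 / (n + 3)) :=
      Ioc_mem_nhdsGT (by positivity)
    obtain ⟨t, ht1, ht2⟩ := (h1.and h2).exists
    exact ⟨t, ht2.1, ht2.2, ht1.le⟩
  have hδ3 : δ ≤ 1 / 3 := hδ1.trans (by
    apply one_div_le_one_div_of_le <;> [norm_num; (have : (0 : ℝ) ≤ n := n.cast_nonneg; linarith)])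
  have hδm : δ ∈ Icc (0 : ℝ) 1 := ⟨hδ0.le, by linarith⟩
  have hδlt : δ < 1 - δ := by linarith
  have hsub : Icc δ (1 - δ) ⊆ Ioo 0 1 := fun t ht => ⟨by linarith [ht.1], by linarith [ht.2]⟩
  -- The forms carry a proof that the weight is continuous, which is known only for times in the
  -- interval; clamping the time makes them total functions of `t`.
  set c : ℝ → ℝ := clampTo δ (1 - δ) with hc
  have hcm : ∀ t, c t ∈ Ioo (0 : ℝ) 1 := fun t => hsub (clampTo_mem hδlt.le t)
  have hρc : ∀ t, Continuous (ρ (c t)) := fun t => h.cont _ (Ioo_sub (hcm t))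
  have hjc : ∀ t, Continuous (fun x => ρ (c t) x • b (c t) x) := fun t =>
    (h.contDiff_flux (hcm t)).continuous
  set G : ℝ → V →ₗ[ℝ] V →ₗ[ℝ] ℝ := fun t => (gramForm _ (hρc t)).domRestrict₁₂ V V with hG
  set T : ℝ → V →ₗ[ℝ] V →ₗ[ℝ] ℝ := fun t => (advForm _ (hjc t)).domRestrict₁₂ V V with hT
  set D : ℝ → V →ₗ[ℝ] V →ₗ[ℝ] ℝ := fun t => (dirichletForm _ (hρc t)).domRestrict₁₂ V V with hD
  have hGa : ∀ t ∈ Icc δ (1 - δ), ∀ φ ψ : V, G t φ ψ = ∫ x, φ.1.1 x * (ψ.1.1 x * ρ t x) := by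
    intro t ht φ ψ
    simp only [hG, LinearMap.domRestrict₁₂_apply, gramForm_apply, hc, clampTo_of_mem ht]
  have hTa : ∀ t ∈ Icc δ (1 - δ), ∀ φ ψ : V,
      T t φ ψ = ∫ x, φ.1.1 x * ⟪ρ t x • b t x, ∇ ψ.1.1 x⟫ := by
    intro t ht φ ψ
    simp only [hT, LinearMap.domRestrict₁₂_apply, advForm_apply, hc, clampTo_of_mem ht]
  have hDa : ∀ t ∈ Icc δ (1 - δ), ∀ φ ψ : V,
      D t φ ψ = ∫ x, ⟪ρ t x • ∇ φ.1.1 x, ∇ ψ.1.1 x⟫ := by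
    intro t ht φ ψ
    simp only [hD, LinearMap.domRestrict₁₂_apply, dirichletForm_apply, hc, clampTo_of_mem ht]
  have hcρ : ContinuousOn (fun q : ℝ × Eu d => ρ q.1 q.2) (Icc δ (1 - δ) ×ˢ univ) :=
    h.cont_rho.mono (prod_mono hsub subset_rfl)
  have hcb : ContinuousOn (fun q : ℝ × Eu d => b q.1 q.2) (Icc δ (1 - δ) ×ˢ univ) :=
    h.cont_b.mono (prod_mono hsub subset_rfl)
  have hsnd : ∀ {E : Type} [TopologicalSpace E] {g : Eu d → E}, Continuous g →
      ContinuousOn (fun q : ℝ × Eu d => g q.2) (Icc δ (1 - δ) ×ˢ univ) := fun hg =>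
    (hg.comp continuous_snd).continuousOn
  have hTc : ∀ φ ψ, ContinuousOn (fun t => T t φ ψ) (Icc δ (1 - δ)) := fun φ ψ => by
    refine ContinuousOn.congr ?_ fun t ht => hTa t ht φ ψ
    refine continuousOn_integral_of_test (F := fun q => φ.1.1 q.2 *
      ⟪ρ q.1 q.2 • b q.1 q.2, ∇ ψ.1.1 q.2⟫) φ.1.2.2.isCompact
      ((hsnd (testSpace.continuous φ.1)).mul ((hcρ.smul hcb).inner (hsnd (testSpace.continuous_gradient ψ.1))))
      fun t _ x hx => ?_
    simp [image_eq_zero_of_notMem_tsupport hx]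
  have hDc : ∀ φ ψ, ContinuousOn (fun t => D t φ ψ) (Icc δ (1 - δ)) := fun φ ψ => by
    refine ContinuousOn.congr ?_ fun t ht => hDa t ht φ ψ
    refine continuousOn_integral_of_test (F := fun q =>
      ⟪ρ q.1 q.2 • ∇ φ.1.1 q.2, ∇ ψ.1.1 q.2⟫) φ.1.2.2.gradient.isCompact
      ((hcρ.smul (hsnd (testSpace.continuous_gradient φ.1))).inner (hsnd (testSpace.continuous_gradient ψ.1)))
      fun t _ x hx => ?_
    simp [image_eq_zero_of_notMem_tsupport hx]
  -- By the continuity equation `d/dt ∫ φ ψ ρ = ∫ ρ b · ∇(φ ψ)`, so `G' = T + Tᵗ`. With `N = -T - ε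
  -- D` one gets `N + G' = Tᵗ - ε D`, the weak form of the equation, and `2 N(h, h) + G'(h, h) = -2
  -- ε D(h, h)`: transport drops out of the energy law.
  obtain ⟨w, hw0, hw1, hw2⟩ := exists_galerkin hδlt G (fun t => T t + (T t).flip)
    (fun t => -T t - ε t • D t) (fun t φ ψ => gramForm_symm _ (hρc t) _ _)
    (fun t ht φ hφ => gramForm_pos (hρc t) (h.pos _ (Ioo_sub (hcm t))) (by simpa using hφ))
    (fun φ ψ t ht => by
      have h1 := (h.hasDerivAt_integral ((testSpace.mul_mem φ.1) ψ.1) (hsub ht)).hasDerivWithinAt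
        (s := Icc δ (1 - δ))
      have h2 := h1.congr (f₁ := fun t => G t φ ψ) (fun s hs => by
        rw [hGa s hs]
        exact integral_congr_ae (Eventually.of_forall fun x => (mul_assoc _ _ _).symm)) (by
        rw [hGa t ht]
        exact integral_congr_ae (Eventually.of_forall fun x => (mul_assoc _ _ _).symm))
      convert! h2 using 1
      simp only [LinearMap.add_apply, LinearMap.flip_apply, hTa t ht]
      have hj := (h.contDiff_flux (hsub ht)).continuous
      rw [← integral_add ((testSpace.integrable_mul φ.1) (hj.inner (testSpace.continuous_gradient ψ.1)))
        ((testSpace.integrable_mul ψ.1) (hj.inner (testSpace.continuous_gradient φ.1)))]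
      refine integral_congr_ae (Eventually.of_forall fun x => ?_)
      simp only [gradient_mul ((testSpace.differentiable φ.1) x) ((testSpace.differentiable ψ.1) x), inner_add_right,
        inner_smul_right, inner_smul_left, conj_trivial]
      ring)
    (fun φ ψ => by
      simp only [LinearMap.sub_apply, LinearMap.neg_apply, LinearMap.smul_apply, smul_eq_mul]
      exact (hTc φ ψ).neg.sub ((hε.mono fun t ht => Ioo_sub (hsub ht)).mul (hDc φ ψ)))
    (S δ y)
  have hδI : δ ∈ Icc δ (1 - δ) := ⟨le_rfl, hδlt.le⟩
  have hSδ : ∀ φ : V, ∫ x, φ.1.1 x * ((S δ y).1.1 x * ρ δ x) = y φ := fun φ => by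
    rw [← hS1 δ hδm y φ]
    simp only [LinearMap.domRestrict₁₂_apply, gramForm_apply, clampTo_of_mem hδm]
  refine ⟨δ, hδ0, hδ1, fun t => (w t).1, fun t => (w t).2, fun φ hφ => ?_, ?_,
    fun φ hφ t ht => ?_, fun t ht => ?_⟩
  · simp only [hw0]; exact hSδ ⟨φ, hφ⟩
  · simp only [hw0, hSδ]; exact hδ2
  · refine ((hw1 ⟨φ, hφ⟩ t ht).congr (f₁ := fun t => ∫ x, φ.1 x * ((w t).1.1 x * ρ t x))
      (fun s hs => (hGa s hs ⟨φ, hφ⟩ (w s)).symm) (hGa t ht ⟨φ, hφ⟩ (w t)).symm).congr_deriv ?_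
    simp only [LinearMap.sub_apply, LinearMap.neg_apply, LinearMap.smul_apply, smul_eq_mul,
      LinearMap.add_apply, LinearMap.flip_apply, hDa t ht, hTa t ht]
    ring
  · refine ((hw2 t ht).congr (f₁ := fun t => ∫ x, (w t).1.1 x * ((w t).1.1 x * ρ t x))
      (fun s hs => (hGa s hs _ _).symm) (hGa t ht _ _).symm).congr_deriv ?_
    simp only [LinearMap.sub_apply, LinearMap.neg_apply, LinearMap.smul_apply, smul_eq_mul,
      LinearMap.add_apply, LinearMap.flip_apply, hDa t ht, hTa t ht]
    ring

end FlowPair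

/-! ### The drift `b + ε s` and the adjoint Fokker-Planck operator. -/

namespace FlowPair

variable {d : ℕ} {ρ : ℝ → Eu d → ℝ} {b : ℝ → Eu d → Eu d}

theorem score_eq (h : FlowPair ρ b) {t : ℝ} (ht : t ∈ Ioo (0 : ℝ) 1) (x : Eu d) :
    score ρ t x = (ρ t x)⁻¹ • ∇ (ρ t) x :=
  gradient_comp_real (Real.hasDerivAt_log (h.pos t (Ioo_sub ht) x).ne')
    ((h.contDiff t ht).differentiable (by norm_num) x)

theorem contDiff_driftF (h : FlowPair ρ b) (ε : ℝ → ℝ) {t : ℝ} (ht : t ∈ Ioo (0 : ℝ) 1) :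
    ContDiff ℝ 1 (driftF ρ b ε t) := by
  have h1 : driftF ρ b ε t = fun x => b t x + ε t • (ρ t x)⁻¹ • ∇ (ρ t) x := by
    funext x; rw [driftF, h.score_eq ht]
  rw [h1]
  have h2 : ContDiff ℝ 1 (∇ (ρ t)) := ContDiff.gradient' (m := 1) (n := 2) (h.contDiff t ht)
    (by norm_num)
  have h3 : ContDiff ℝ 1 fun x => (ρ t x)⁻¹ :=
    ((h.contDiff t ht).of_le (by norm_num)).inv fun x => (h.pos t (Ioo_sub ht) x).ne'
  have h4 : ContDiff ℝ 1 fun x => ε t • (ρ t x)⁻¹ • ∇ (ρ t) x :=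
    (h3.smul h2).const_smul (ε t)
  exact (h.contDiff_b t ht).add h4

theorem cont_driftF (h : FlowPair ρ b) {ε : ℝ → ℝ} (hε : ContinuousOn ε (Icc 0 1)) :
    ContinuousOn (fun q : ℝ × Eu d => driftF ρ b ε q.1 q.2) (Ioo 0 1 ×ˢ univ) := by
  have h1 : ContinuousOn (fun q : ℝ × Eu d => ε q.1) (Ioo 0 1 ×ˢ univ) :=
    hε.comp continuousOn_fst fun q hq => Ioo_sub hq.1
  refine (h.cont_b.add (h1.smul ((h.cont_rho.inv₀ fun q hq =>
    (h.pos _ (Ioo_sub hq.1) _).ne').smul h.cont_grad))).congr fun q hq => ?_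
  rw [driftF, h.score_eq hq.1]
  rfl

/-- The adjoint of the Fokker-Planck operator applied to a test function. -/
noncomputable def adjoint (ρ : ℝ → Eu d → ℝ) (b : ℝ → Eu d → Eu d) (ε : ℝ → ℝ) (φ : Eu d → ℝ)
    (t : ℝ) (x : Eu d) : ℝ := ⟪driftF ρ b ε t x, ∇ φ x⟫ + ε t * Δ φ x

/-- The score of a `C²` density is only `C¹`, and so is the adjoint operator applied to a smooth
function. To be able to test the approximations against it, the Galerkin spaces consist of `C¹`
functions. -/
theorem adjoint_mem (h : FlowPair ρ b) (ε : ℝ → ℝ) {φ : Eu d → ℝ} (hφ : φ ∈ smoothTest d) {t : ℝ}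
    (ht : t ∈ Ioo (0 : ℝ) 1) : adjoint ρ b ε φ t ∈ testSpace d := by
  have h1 : ContDiff ℝ 1 (∇ φ) := ContDiff.gradient' (m := 1) (n := ⊤) hφ.1 (by simp)
  have h3 : ContDiff ℝ 2 φ := hφ.1.of_le ENat.LEInfty.out
  have h2 : Δ φ = divergence (∇ φ) := funext (laplacian_eq_divergence h3)
  have h4 : ContDiff ℝ 1 (divergence (∇ φ)) := by
    have h5 : ContDiff ℝ 2 (∇ φ) := ContDiff.gradient' (m := 2) (n := ⊤) hφ.1 (by simp)
    have h6 : ContDiff ℝ 1 (fderiv ℝ (∇ φ)) := h5.fderiv_right (by norm_num)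
    unfold divergence
    refine ContDiff.sum fun i _ => ?_
    have h7 : ContDiff ℝ 1 fun x => (fderiv ℝ (∇ φ) x) (EuclideanSpace.single i 1) :=
      h6.clm_apply contDiff_const
    exact (EuclideanSpace.proj i : Eu d →L[ℝ] ℝ).contDiff.comp h7
  refine ⟨?_, ?_⟩
  · unfold adjoint
    rw [h2]
    exact ((h.contDiff_driftF ε ht).inner ℝ h1).add (contDiff_const.mul h4)
  · have h5 : HasCompactSupport (∇ φ) := hφ.2.gradient
    refine HasCompactSupport.add ?_ ?_
    · exact h5.mono fun x hx => by
        contrapose! hx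
        simp only [Function.mem_support, not_not] at hx ⊢
        rw [hx, inner_zero_right]
    · rw [h2]
      exact h5.divergence.mul_left

/-- Joint continuity and compactness of the support make the adjoint continuous in time for the
uniform norm; off the support both terms vanish. This allows the time in the adjoint to be frozen
when the limit solution is differentiated. -/
theorem adjoint_eventually_close (h : FlowPair ρ b) {ε : ℝ → ℝ} (hε : ContinuousOn ε (Icc 0 1))
    {φ : Eu d → ℝ} (hφ : φ ∈ smoothTest d) {t : ℝ} (ht : t ∈ Ioo (0 : ℝ) 1) {η : ℝ} (hη : 0 < η) :
    ∀ᶠ τ in 𝓝 t, ∀ x, |adjoint ρ b ε φ τ x - adjoint ρ b ε φ t x| ≤ η := by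
  have h3 : ContDiff ℝ 2 φ := hφ.1.of_le ENat.LEInfty.out
  have h2 : Δ φ = divergence (∇ φ) := funext (laplacian_eq_divergence h3)
  have h1 : ContDiff ℝ 1 (∇ φ) := ContDiff.gradient' (m := 1) (n := ⊤) hφ.1 (by simp)
  have hcont : ContinuousOn (fun q : ℝ × Eu d => adjoint ρ b ε φ q.1 q.2) (Ioo 0 1 ×ˢ univ) := by
    unfold adjoint
    rw [h2]
    have h4 : ContinuousOn (fun q : ℝ × Eu d => ε q.1) (Ioo 0 1 ×ˢ univ) :=
      hε.comp continuousOn_fst fun q hq => Ioo_sub hq.1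
    exact ((h.cont_driftF hε).inner (h1.continuous.comp continuous_snd).continuousOn).add
      (h4.mul ((continuous_divergence h1).comp continuous_snd).continuousOn)
  have hz : ∀ τ, ∀ x ∉ tsupport φ, adjoint ρ b ε φ τ x = 0 := by
    intro τ x hx
    have e1 : ∇ φ x = 0 := by
      have : x ∉ tsupport (∇ φ) := fun hx' => hx (by
        rw [gradient_eq_comp] at hx'
        exact tsupport_fderiv_subset ℝ (tsupport_comp_subset (map_zero _) _ hx'))
      exact image_eq_zero_of_notMem_tsupport this
    have e2 : Δ φ x = 0 := by
      have : Δ φ x = Δ (fun _ : Eu d => (0 : ℝ)) x :=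
        InnerProductSpace.laplacian_congr_nhds (notMem_tsupport_iff_eventuallyEq.1 hx) |>.eq_of_nhds
      rw [this]; simp
    rw [adjoint, e1, e2]; simp
  have key : ∀ᶠ τ in 𝓝 t, ∀ x ∈ tsupport φ, |adjoint ρ b ε φ τ x - adjoint ρ b ε φ t x| < η := by
    refine hφ.2.isCompact.eventually_forall_of_forall_eventually
      (P := fun τ x => |adjoint ρ b ε φ τ x - adjoint ρ b ε φ t x| < η) fun x _ => ?_
    have hop : IsOpen (Ioo (0 : ℝ) 1 ×ˢ (univ : Set (Eu d))) := isOpen_Ioo.prod isOpen_univ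
    have c1 := hcont.continuousAt (hop.mem_nhds (x := (t, x)) ⟨ht, mem_univ _⟩)
    have c2 : ContinuousAt (fun q : ℝ × Eu d => adjoint ρ b ε φ t q.2) (t, x) :=
      ((h.adjoint_mem ε hφ ht).1.continuous.comp continuous_snd).continuousAt
    have c3 := (c1.sub c2).abs
    refine c3.eventually (gt_mem_nhds ?_)
    simpa using hη
  filter_upwards [key] with τ hτ x
  by_cases hx : x ∈ tsupport φ
  · exact (hτ x hx).le
  · rw [hz τ x hx, hz t x hx]; simpa using hη.le

end FlowPair

/-- An antiderivative of `1 / √t + 1 / √(1 - t)`. -/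
noncomputable def sqrtPrimitive (t : ℝ) : ℝ := 2 * √t - 2 * √(1 - t)

theorem continuous_sqrtPrimitive : Continuous sqrtPrimitive := by
  unfold sqrtPrimitive; fun_prop

theorem monotone_sqrtPrimitive : Monotone sqrtPrimitive := fun s t hst => by
  unfold sqrtPrimitive
  have h1 : √s ≤ √t := Real.sqrt_le_sqrt hst
  have h2 : √(1 - t) ≤ √(1 - s) := Real.sqrt_le_sqrt (by linarith)
  linarith

theorem hasDerivAt_sqrtPrimitive {t : ℝ} (ht : t ∈ Ioo (0 : ℝ) 1) :
    HasDerivAt sqrtPrimitive (1 / √t + 1 / √(1 - t)) t := by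
  have h1 := ((hasDerivAt_id t).sqrt ht.1.ne').const_mul 2
  have h2 := (((hasDerivAt_id t).const_sub 1).sqrt (sub_pos.2 ht.2).ne').const_mul 2
  refine (h1.sub h2).congr_deriv ?_
  simp only [id]
  field_simp
  ring

/-- Subadditivity of the square root. The right-hand side is integrable up to both end points, with
primitive `√C` times `sqrtPrimitive`; this is why a blow-up of `∫ |b|² ρ` like `1/t` is harmless. -/
theorem sqrt_div_add_div_le {C t : ℝ} (hC : 0 ≤ C) (ht : t ∈ Ioo (0 : ℝ) 1) :
    √(C / t + C / (1 - t)) ≤ √C * (1 / √t + 1 / √(1 - t)) := by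
  have h0 := ht.1
  have h1 : 0 < 1 - t := sub_pos.2 ht.2
  rw [Real.sqrt_le_left (by positivity), mul_pow, Real.sq_sqrt hC]
  have e1 : (1 / √t + 1 / √(1 - t)) ^ 2 = 1 / t + 1 / (1 - t) + 2 * (1 / √t * (1 / √(1 - t))) := by
    have a1 : (1 / √t) ^ 2 = 1 / t := by rw [div_pow, Real.sq_sqrt h0.le, one_pow]
    have a2 : (1 / √(1 - t)) ^ 2 = 1 / (1 - t) := by rw [div_pow, Real.sq_sqrt h1.le, one_pow]
    rw [add_sq, a1, a2]; ring
  rw [e1]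
  have : 0 ≤ C * (2 * (1 / √t * (1 / √(1 - t)))) := by positivity
  have e2 : C / t + C / (1 - t) = C * (1 / t + 1 / (1 - t)) := by ring
  rw [e2, mul_add]
  linarith

/-! ### Equicontinuity in time of the Galerkin approximations. -/

namespace FlowPair

variable {d : ℕ} {ρ : ℝ → Eu d → ℝ} {b : ℝ → Eu d → Eu d}

theorem integrable_sq_mul (h : FlowPair ρ b) {t : ℝ} (ht : t ∈ Icc (0 : ℝ) 1) (φ : testSpace d) :
    Integrable (fun x => φ.1 x ^ 2 * ρ t x) :=
  (testSpace.integrable_mul φ (g := fun x => φ.1 x * ρ t x)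
    ((testSpace.continuous φ).mul (h.cont t ht))).congr
      (Eventually.of_forall fun x => by simp only; ring)

theorem sq_integral_test_le (h : FlowPair ρ b) {t : ℝ} (ht : t ∈ Icc (0 : ℝ) 1)
    (φ w : testSpace d) {E : ℝ} (hE : ∫ x, w.1 x * (w.1 x * ρ t x) ≤ E) :
    (∫ x, φ.1 x * (w.1 x * ρ t x)) ^ 2 ≤ E * ∫ x, φ.1 x ^ 2 * ρ t x := by
  have hp := h.pos t ht
  have e : ∀ x, (w.1 x * ρ t x) ^ 2 / ρ t x = w.1 x * (w.1 x * ρ t x) := fun x => by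
    have := (hp x).ne'
    field_simp
  have h1 := sq_integral_mul_le_energy hp (u := fun x => w.1 x * ρ t x)
    ((testSpace.continuous w).mul (h.cont t ht)).aestronglyMeasurable
    (by
      simp only [e]
      exact testSpace.integrable_mul w (g := fun x => w.1 x * ρ t x)
        ((testSpace.continuous w).mul (h.cont t ht)))
    (testSpace.continuous φ).aestronglyMeasurable (h.integrable_sq_mul ht φ)
  simp only [e] at h1
  exact h1.trans (mul_le_mul_of_nonneg_right hE
    (integral_nonneg fun x => mul_nonneg (sq_nonneg _) (hp x).le))

theorem integral_sq_le (h : FlowPair ρ b) {t : ℝ} (ht : t ∈ Icc (0 : ℝ) 1)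
    (φ : testSpace d) {M : ℝ} (hM : ∀ x, |φ.1 x| ≤ M) :
    ∫ x, φ.1 x ^ 2 * ρ t x ≤ M ^ 2 := by
  calc ∫ x, φ.1 x ^ 2 * ρ t x ≤ ∫ x, M ^ 2 * ρ t x := by
        refine integral_mono (h.integrable_sq_mul ht φ) ((h.integrable t ht).const_mul _) fun x => ?_
        exact mul_le_mul_of_nonneg_right (sq_le_sq' (abs_le.1 (hM x)).1 (abs_le.1 (hM x)).2)
          (h.pos t ht x).le
    _ = M ^ 2 := by rw [integral_const_mul, h.integral_eq t ht, mul_one]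

/-- The modulus of continuity in time of the Galerkin approximations. -/
theorem galerkin_modulus (h : FlowPair ρ b) {ε : ℝ → ℝ} {εM C E L l δ : ℝ}
    (hε0 : ∀ t ∈ Icc (0 : ℝ) 1, 0 ≤ ε t) (hεM : ∀ t ∈ Icc (0 : ℝ) 1, ε t ≤ εM) (hC : 0 ≤ C)
    (hb : ∀ t ∈ Ioo (0 : ℝ) 1, Integrable (fun x => ‖b t x‖ ^ 2 * ρ t x) ∧
      ∫ x, ‖b t x‖ ^ 2 * ρ t x ≤ C / t + C / (1 - t)) (hl : 0 < l) (hδ : 0 < δ)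
    (hδ' : δ ≤ 1 / 3) {w : ℝ → testSpace d} {φ : testSpace d} (hL : ∀ x, ‖∇ φ.1 x‖ ≤ L)
    (hen : ∀ t ∈ Icc δ (1 - δ), ∫ x, (w t).1 x * ((w t).1 x * ρ t x) ≤ E)
    (h1 : ∀ t ∈ Icc δ (1 - δ), HasDerivWithinAt
        (fun t => ∫ x, φ.1 x * ((w t).1 x * ρ t x))
        ((∫ x, (w t).1 x * ⟪ρ t x • b t x, ∇ φ.1 x⟫) -
          ε t * ∫ x, ⟪ρ t x • ∇ φ.1 x, ∇ (w t).1 x⟫) (Icc δ (1 - δ)) t)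
    (h2 : ∀ t ∈ Icc δ (1 - δ), HasDerivWithinAt (fun t => ∫ x, (w t).1 x * ((w t).1 x * ρ t x))
        (-2 * ε t * ∫ x, ⟪ρ t x • ∇ (w t).1 x, ∇ (w t).1 x⟫) (Icc δ (1 - δ)) t)
    {s t : ℝ} (hs : s ∈ Icc δ (1 - δ)) (ht : t ∈ Icc δ (1 - δ)) (hst : s ≤ t) :
    (∫ x, φ.1 x * ((w t).1 x * ρ t x)) - ∫ x, φ.1 x * ((w s).1 x * ρ s x) ≤
      L * (l * E / 2 + √(E * C) * (sqrtPrimitive t - sqrtPrimitive s) + εM / (4 * l) * (t - s)) := by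
  have hsub : Icc δ (1 - δ) ⊆ Ioo 0 1 := fun t ht => ⟨by linarith [ht.1], by linarith [ht.2]⟩
  have hL0 : 0 ≤ L := (norm_nonneg _).trans (hL 0)
  set F := fun t => ∫ x, φ.1 x * ((w t).1 x * ρ t x) with hF
  set en := fun t => ∫ x, (w t).1 x * ((w t).1 x * ρ t x) with hendef
  have hen0 : ∀ t ∈ Icc δ (1 - δ), 0 ≤ en t := fun t ht => integral_nonneg fun x => by
    have := h.pos t (Ioo_sub (hsub ht)) x
    have e : (w t).1 x * ((w t).1 x * ρ t x) = (w t).1 x ^ 2 * ρ t x := by ring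
    simp only [Pi.zero_apply]
    rw [e]; positivity
  have hE0 : 0 ≤ E := (hen0 s hs).trans (hen s hs)
  -- The transport term is bounded by Cauchy-Schwarz against `∫ |b|² ρ`. In the diffusion term,
  -- `|∇w| ≤ 1/(4l) + l |∇w|²` leaves a multiple of the dissipation, which has no pointwise bound in
  -- time and is kept on the right.
  have key : ∀ t ∈ Icc δ (1 - δ), ((∫ x, (w t).1 x * ⟪ρ t x • b t x, ∇ φ.1 x⟫) -
      ε t * ∫ x, ⟪ρ t x • ∇ φ.1 x, ∇ (w t).1 x⟫) ≤
      L * (√(E * C) * (1 / √t + 1 / √(1 - t)) + εM / (4 * l)) +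
        (L * l / 2) * (2 * ε t * ∫ x, ⟪ρ t x • ∇ (w t).1 x, ∇ (w t).1 x⟫) := by
    intro t ht
    have ht1 := hsub ht
    have ht0 := Ioo_sub ht1
    have hp := h.pos t ht0
    have hpc := h.cont t ht0
    have hbc := (h.contDiff_b t ht1).continuous
    have hwc := testSpace.continuous (w t)
    have hgw := testSpace.continuous_gradient (w t)
    have hgφ := testSpace.continuous_gradient φ
    have a1 : ∫ x, (w t).1 x * ⟪ρ t x • b t x, ∇ φ.1 x⟫ ≤
        L * (√(E * C) * (1 / √t + 1 / √(1 - t))) := by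
      have b1 : ∀ x, (w t).1 x * ⟪ρ t x • b t x, ∇ φ.1 x⟫ ≤
          L * (‖b t x‖ * |(w t).1 x * ρ t x|) := fun x => by
        rw [inner_smul_left]
        simp only [conj_trivial]
        have c1 : |⟪b t x, ∇ φ.1 x⟫| ≤ ‖b t x‖ * L :=
          (abs_real_inner_le_norm _ _).trans (mul_le_mul_of_nonneg_left (hL x) (norm_nonneg _))
        calc (w t).1 x * (ρ t x * ⟪b t x, ∇ φ.1 x⟫) = ((w t).1 x * ρ t x) * ⟪b t x, ∇ φ.1 x⟫ := by
              ring
          _ ≤ |(w t).1 x * ρ t x| * |⟪b t x, ∇ φ.1 x⟫| := by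
              rw [← abs_mul]; exact le_abs_self _
          _ ≤ |(w t).1 x * ρ t x| * (‖b t x‖ * L) :=
              mul_le_mul_of_nonneg_left c1 (abs_nonneg _)
          _ = _ := by ring
      have e : ∀ x, |(w t).1 x * ρ t x| ^ 2 / ρ t x = (w t).1 x * ((w t).1 x * ρ t x) := fun x => by
        have := (hp x).ne'
        rw [sq_abs]
        field_simp
      have hint : Integrable (fun x => ‖b t x‖ * |(w t).1 x * ρ t x|) := by
        refine Continuous.integrable_of_hasCompactSupport
          (hbc.norm.mul (hwc.mul hpc).abs) (HasCompactSupport.mul_left ?_)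
        have : HasCompactSupport fun x => (w t).1 x * ρ t x := (w t).2.2.mul_right
        exact this.comp_left (g := fun r : ℝ => |r|) (by simp)
      have b2 := sq_integral_mul_le_energy hp (u := fun x => |(w t).1 x * ρ t x|)
        (φ := fun x => ‖b t x‖) (hwc.mul hpc).abs.aestronglyMeasurable
        (by
          simp only [e]
          exact testSpace.integrable_mul (w t) (g := fun x => (w t).1 x * ρ t x)
            (hwc.mul hpc)) hbc.norm.aestronglyMeasurable (hb t ht1).1
      simp only [e] at b2
      have b3 : (∫ x, ‖b t x‖ * |(w t).1 x * ρ t x|) ≤ √(E * C) * (1 / √t + 1 / √(1 - t)) := by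
        have t0 := ht1.1
        have t1 : 0 < 1 - t := sub_pos.2 ht1.2
        have c1 : (∫ x, ‖b t x‖ * |(w t).1 x * ρ t x|) ^ 2 ≤ E * (C / t + C / (1 - t)) :=
          b2.trans (mul_le_mul (hen t ht) (hb t ht1).2 (integral_nonneg fun x =>
            mul_nonneg (sq_nonneg _) (hp x).le) hE0)
        calc (∫ x, ‖b t x‖ * |(w t).1 x * ρ t x|) ≤ √(E * (C / t + C / (1 - t))) :=
              Real.le_sqrt_of_sq_le c1
          _ = √E * √(C / t + C / (1 - t)) := Real.sqrt_mul hE0 _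
          _ ≤ √E * (√C * (1 / √t + 1 / √(1 - t))) :=
              mul_le_mul_of_nonneg_left (sqrt_div_add_div_le hC ht1) (Real.sqrt_nonneg _)
          _ = _ := by rw [Real.sqrt_mul hE0]; ring
      calc ∫ x, (w t).1 x * ⟪ρ t x • b t x, ∇ φ.1 x⟫
          ≤ ∫ x, L * (‖b t x‖ * |(w t).1 x * ρ t x|) :=
            integral_mono (testSpace.integrable_mul (w t) ((hpc.smul hbc).inner hgφ))
              (hint.const_mul L) b1
        _ = L * ∫ x, ‖b t x‖ * |(w t).1 x * ρ t x| := integral_const_mul _ _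
        _ ≤ _ := mul_le_mul_of_nonneg_left b3 hL0
    have a2 : -(∫ x, ⟪ρ t x • ∇ φ.1 x, ∇ (w t).1 x⟫) ≤
        L / (4 * l) + L * l * ∫ x, ⟪ρ t x • ∇ (w t).1 x, ∇ (w t).1 x⟫ := by
      have i1 : Integrable fun x => ⟪ρ t x • ∇ φ.1 x, ∇ (w t).1 x⟫ :=
        testSpace.integrable_inner (w t) (v := fun x => ρ t x • ∇ φ.1 x) (hpc.smul hgφ)
      have i2 : Integrable fun x => ⟪ρ t x • ∇ (w t).1 x, ∇ (w t).1 x⟫ :=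
        testSpace.integrable_inner (w t) (v := fun x => ρ t x • ∇ (w t).1 x) (hpc.smul hgw)
      have e1 : L / (4 * l) + L * l * (∫ x, ⟪ρ t x • ∇ (w t).1 x, ∇ (w t).1 x⟫) =
          ∫ x, (L / (4 * l) * ρ t x + L * l * ⟪ρ t x • ∇ (w t).1 x, ∇ (w t).1 x⟫) := by
        rw [integral_add ((h.integrable t ht0).const_mul _) (i2.const_mul _), integral_const_mul,
          integral_const_mul, h.integral_eq t ht0, mul_one]
      rw [e1, ← integral_neg]
      refine integral_mono i1.neg (((h.integrable t ht0).const_mul _).add (i2.const_mul _))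
        fun x => ?_
      simp only [inner_smul_left, conj_trivial, real_inner_self_eq_norm_sq]
      have c1 : |⟪∇ φ.1 x, ∇ (w t).1 x⟫| ≤ L * ‖∇ (w t).1 x‖ :=
        (abs_real_inner_le_norm _ _).trans (mul_le_mul_of_nonneg_right (hL x) (norm_nonneg _))
      have c2 : ‖∇ (w t).1 x‖ ≤ 1 / (4 * l) + l * ‖∇ (w t).1 x‖ ^ 2 := by
        have : 1 / (4 * l) + l * ‖∇ (w t).1 x‖ ^ 2 - ‖∇ (w t).1 x‖ =
            (2 * l * ‖∇ (w t).1 x‖ - 1) ^ 2 / (4 * l) := by field_simp; ring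
        have h0 : 0 ≤ (2 * l * ‖∇ (w t).1 x‖ - 1) ^ 2 / (4 * l) := by positivity
        linarith
      have c3 : -⟪∇ φ.1 x, ∇ (w t).1 x⟫ ≤ L * (1 / (4 * l) + l * ‖∇ (w t).1 x‖ ^ 2) :=
        (neg_le_abs _).trans (c1.trans (mul_le_mul_of_nonneg_left c2 hL0))
      have c4 := mul_le_mul_of_nonneg_left c3 (hp x).le
      calc -(ρ t x * ⟪∇ φ.1 x, ∇ (w t).1 x⟫) = ρ t x * -⟪∇ φ.1 x, ∇ (w t).1 x⟫ := by ring
        _ ≤ _ := c4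
        _ = _ := by ring
    have a3 : ε t * -(∫ x, ⟪ρ t x • ∇ φ.1 x, ∇ (w t).1 x⟫) ≤
        ε t * (L / (4 * l) + L * l * ∫ x, ⟪ρ t x • ∇ (w t).1 x, ∇ (w t).1 x⟫) :=
      mul_le_mul_of_nonneg_left a2 (hε0 t ht0)
    have a4 : ε t * (L / (4 * l)) ≤ εM * (L / (4 * l)) :=
      mul_le_mul_of_nonneg_right (hεM t ht0) (by positivity)
    have e5 : εM * (L / (4 * l)) = L * (εM / (4 * l)) := by ring
    rw [mul_add] at a3
    rw [mul_add L]
    linarith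
  -- Subtracting `(L l / 2) en` adds exactly the dissipation left over in `key`, so `Φ` is
  -- nondecreasing. Since the energy drops by at most `E` in total, this costs only `L l E / 2`.
  set Φ : ℝ → ℝ := fun t => L * (√(E * C) * sqrtPrimitive t + εM / (4 * l) * t) - F t -
    (L * l / 2) * en t with hΦ
  have hmono : MonotoneOn Φ (Icc δ (1 - δ)) := by
    have hd : ∀ t ∈ Icc δ (1 - δ), HasDerivWithinAt Φ
        (L * (√(E * C) * (1 / √t + 1 / √(1 - t)) + εM / (4 * l) * 1) -
          ((∫ x, (w t).1 x * ⟪ρ t x • b t x, ∇ φ.1 x⟫) -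
            ε t * ∫ x, ⟪ρ t x • ∇ φ.1 x, ∇ (w t).1 x⟫) -
          (L * l / 2) * (-2 * ε t * ∫ x, ⟪ρ t x • ∇ (w t).1 x, ∇ (w t).1 x⟫))
        (Icc δ (1 - δ)) t := fun t ht =>
      ((((((hasDerivAt_sqrtPrimitive (hsub ht)).const_mul _).add
        ((hasDerivAt_id t).const_mul _)).const_mul L).hasDerivWithinAt).sub (h1 t ht)).sub
          ((h2 t ht).const_mul _)
    refine monotoneOn_of_hasDerivWithinAt_nonneg (convex_Icc _ _)
      (fun t ht => (hd t ht).continuousWithinAt)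
      (fun t ht => (hd t (interior_subset ht)).mono interior_subset) fun t ht => ?_
    have := key t (interior_subset ht)
    linarith
  have h3 := hmono hs ht hst
  simp only [hΦ] at h3
  have h4 : (L * l / 2) * (en s - en t) ≤ (L * l / 2) * E :=
    mul_le_mul_of_nonneg_left (by linarith [hen s hs, hen0 t ht]) (by positivity)
  have e : L * (l * E / 2 + √(E * C) * (sqrtPrimitive t - sqrtPrimitive s) +
      εM / (4 * l) * (t - s)) = L * (√(E * C) * sqrtPrimitive t + εM / (4 * l) * t) -
      L * (√(E * C) * sqrtPrimitive s + εM / (4 * l) * s) + (L * l / 2) * E := by ring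
  change F t - F s ≤ _
  rw [e]
  linarith

end FlowPair

/-- Clamping shortens the interval `[s, t]`. It carries the modulus of continuity from `[δ, 1 - δ]`
over to arbitrary times, uniformly in `δ`. -/
theorem Monotone.clampTo_sub_le {f : ℝ → ℝ} (hf : Monotone f) {a b : ℝ} (hab : a ≤ b) {s t : ℝ}
    (hst : s ≤ t) : f (clampTo a b t) - f (clampTo a b s) ≤ f t - f s := by
  unfold clampTo
  rcases le_total t a with h1 | h1
  · rw [max_eq_left ((min_le_right _ _).trans h1),
      max_eq_left ((min_le_right _ _).trans (hst.trans h1))]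
    have := hf hst; linarith
  · rcases le_total b s with h2 | h2
    · rw [min_eq_left h2, min_eq_left (h2.trans hst)]
      have := hf hst; linarith
    · have e1 : f (max a (min b t)) ≤ f t := hf (max_le h1 (min_le_right _ _))
      have e2 : f s ≤ f (max a (min b s)) := hf (by rw [min_eq_right h2]; exact le_max_right _ _)
      linarith

theorem clampTo_mono (a b : ℝ) : Monotone (clampTo a b) := fun _ _ hst =>
  max_le_max le_rfl (min_le_min le_rfl hst)

theorem abs_clampTo_sub_le {δ t : ℝ} (hδ : 0 ≤ δ) (ht : t ∈ Icc (0 : ℝ) 1) :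
    |clampTo δ (1 - δ) t - t| ≤ δ := by
  obtain ⟨h1, h2⟩ := ht
  unfold clampTo
  grind

theorem testSpace.exists_bound {d : ℕ} (φ : testSpace d) : ∃ M, 0 ≤ M ∧ ∀ x, |φ.1 x| ≤ M := by
  obtain ⟨M, hM⟩ := (testSpace.continuous φ).bounded_above_of_compact_support φ.2.2
  exact ⟨M, (norm_nonneg _).trans (hM 0), hM⟩

theorem testSpace.exists_gradient_bound {d : ℕ} (φ : testSpace d) :
    ∃ L, 0 ≤ L ∧ ∀ x, ‖∇ φ.1 x‖ ≤ L := by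
  obtain ⟨M, hM⟩ := (testSpace.continuous_gradient φ).bounded_above_of_compact_support
    φ.2.2.gradient
  exact ⟨M, (norm_nonneg _).trans (hM 0), hM⟩

theorem smoothTest_le_testSpace (d : ℕ) : smoothTest d ≤ testSpace d := fun _ hφ =>
  ⟨hφ.1.of_le ENat.LEInfty.out, hφ.2⟩

/-- A modulus of continuity of the form arising in the Galerkin approximation becomes small. -/
theorem eventually_modulus_lt {L E C M s η : ℝ} (hL : 0 ≤ L) (hE : 0 ≤ E) (hη : 0 < η) :
    ∃ l > 0, ∀ᶠ t in 𝓝 s, L * (l * E / 2 + √(E * C) * |sqrtPrimitive t - sqrtPrimitive s| +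
      M / (4 * l) * |t - s|) < η := by
  -- The term `L l E / 2` does not vanish as `t → s`; this choice of `l` makes it smaller than `η`,
  -- after which the other two terms are made small by taking `t` close to `s`.
  refine ⟨η / (L * E + 1), by positivity, ?_⟩
  set l := η / (L * E + 1)
  have hc : Continuous fun t => L * (l * E / 2 + √(E * C) * |sqrtPrimitive t - sqrtPrimitive s| +
      M / (4 * l) * |t - s|) := by
    have := continuous_sqrtPrimitive
    fun_prop
  refine (hc.tendsto s).eventually (gt_mem_nhds ?_)
  simp only [sub_self, abs_zero, mul_zero, add_zero]
  have h1 : L * (l * E / 2) = η * ((L * E) / (2 * (L * E + 1))) := by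
    have : L * E + 1 ≠ 0 := by positivity
    simp only [l]; field_simp
  rw [h1]
  have h2 : (L * E) / (2 * (L * E + 1)) < 1 := by
    rw [div_lt_one (by positivity)]
    nlinarith [mul_nonneg hL hE]
  nlinarith

/-! ### Existence of energy solutions by compactness. -/

namespace FlowPair

variable {d : ℕ} {ρ : ℝ → Eu d → ℝ} {b : ℝ → Eu d → Eu d}

/-- In the interior, the weak form of the Galerkin equation is the weak form of the Fokker-Planck
equation. -/
theorem galerkin_rhs_eq (h : FlowPair ρ b) (ε : ℝ → ℝ) {φ : Eu d → ℝ} (hφ : φ ∈ smoothTest d)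
    (w : testSpace d) {t : ℝ} (ht : t ∈ Ioo (0 : ℝ) 1) :
    (∫ x, w.1 x * ⟪ρ t x • b t x, ∇ φ x⟫) - ε t * ∫ x, ⟪ρ t x • ∇ φ x, ∇ w.1 x⟫ =
      ∫ x, adjoint ρ b ε φ t x * (w.1 x * ρ t x) := by
  have h3 : ContDiff ℝ 2 φ := hφ.1.of_le ENat.LEInfty.out
  have h1 : ContDiff ℝ 1 (∇ φ) := ContDiff.gradient' (m := 1) (n := ⊤) hφ.1 (by simp)
  have hρ : ContDiff ℝ 1 (ρ t) := (h.contDiff t ht).of_le (by norm_num)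
  have hv : ContDiff ℝ 1 (fun x => ρ t x • ∇ φ x) := hρ.smul h1
  have e1 := integral_mul_divergence w.2.1 hv (Or.inl w.2.2)
  have i1 : Integrable fun x => w.1 x * ⟪ρ t x • b t x, ∇ φ x⟫ :=
    testSpace.integrable_mul w ((h.contDiff_flux ht).continuous.inner h1.continuous)
  have i2 : Integrable fun x => w.1 x * divergence (fun x => ρ t x • ∇ φ x) x :=
    testSpace.integrable_mul w (continuous_divergence hv)
  rw [sub_eq_add_neg, ← mul_neg, ← e1, ← integral_const_mul,
    ← integral_add i1 (i2.const_mul _)]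
  refine integral_congr_ae (Eventually.of_forall fun x => ?_)
  have hp := (h.pos t (Ioo_sub ht) x).ne'
  simp only [adjoint, driftF]
  rw [divergence_smul (hρ.differentiable (by norm_num) x) (h1.differentiable (by norm_num) x),
    ← laplacian_eq_divergence h3, h.score_eq ht, real_inner_comm (∇ (ρ t) x)]
  simp only [inner_smul_left, inner_add_left, conj_trivial]
  field_simp
  ring

/-- The approximations are viewed as linear forms `F i t` on test functions. They are bounded for
the norm of `L²(ρ)` and equicontinuous in time, and both properties survive a limit; the limit forms
are then represented by densities, and the weak equation is recovered from the approximate ones by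
the mean value inequality. -/
theorem exists_energySolution (h : FlowPair ρ b) {ε : ℝ → ℝ} (hε : ContinuousOn ε (Icc 0 1))
    (hε0 : ∀ t ∈ Icc (0 : ℝ) 1, 0 ≤ ε t) {f : Eu d → ℝ} (hf : AEStronglyMeasurable f volume)
    (hfe : energy (ρ 0) f < ⊤) :
    ∃ u, IsEnergySolution 0 ρ (driftF ρ b ε) ε u ∧ u 0 =ᵐ[volume] f := by
  classical
  have h0I : (0 : ℝ) ∈ Icc (0 : ℝ) 1 := ⟨le_rfl, zero_le_one⟩
  have hfi := integrable_of_energy_lt_top (h.cont 0 h0I) (h.pos 0 h0I) hf hfe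
  obtain ⟨C₀, hC₀⟩ := h.b_sq
  obtain ⟨C, hC, hb⟩ : ∃ C, 0 ≤ C ∧ ∀ t ∈ Ioo (0 : ℝ) 1,
      Integrable (fun x => ‖b t x‖ ^ 2 * ρ t x) ∧
        ∫ x, ‖b t x‖ ^ 2 * ρ t x ≤ C / t + C / (1 - t) := by
    refine ⟨|C₀|, abs_nonneg _, fun t ht => ⟨(hC₀ t ht).1, (hC₀ t ht).2.trans ?_⟩⟩
    have h1 := ht.1
    have h2 : 0 < 1 - t := sub_pos.2 ht.2
    have := le_abs_self C₀
    gcongr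
  obtain ⟨εM, hεM'⟩ := isCompact_Icc.exists_bound_of_continuousOn hε
  have hεM : ∀ t ∈ Icc (0 : ℝ) 1, ε t ≤ εM := fun t ht => (le_abs_self _).trans (hεM' t ht)
  have hεM0 : 0 ≤ εM := (hε0 0 h0I).trans (hεM 0 h0I)
  -- The approximations are indexed by a finite set of test functions together with an accuracy `n`.
  -- Each given test function belongs to all sufficiently large index sets, so no countable dense
  -- family has to be chosen.
  choose δ hδ0 hδ1 w hwV hinit hinit2 hder hder2 using
    fun i : Finset (testSpace d) × ℕ =>
      h.exists_approximation hε hf hfi (Submodule.span ℝ (i.1 : Set (testSpace d))) i.2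
  set E : ℝ := ∫ x, f x ^ 2 / ρ 0 x with hE
  have hE0 : 0 ≤ E := integral_nonneg fun x => div_nonneg (sq_nonneg _) (h.pos 0 h0I x).le
  have hδ3 : ∀ i, δ i ≤ 1 / 3 := fun i => (hδ1 i).trans (by
    apply one_div_le_one_div_of_le
    · norm_num
    · have : (0 : ℝ) ≤ i.2 := i.2.cast_nonneg
      linarith)
  have hδlt : ∀ i, δ i ≤ 1 - δ i := fun i => by have := hδ3 i; linarith
  have hsub : ∀ i, Icc (δ i) (1 - δ i) ⊆ Ioo 0 1 := fun i t ht =>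
    ⟨(hδ0 i).trans_le ht.1, by linarith [ht.2, hδ0 i]⟩
  set c : Finset (testSpace d) × ℕ → ℝ → ℝ := fun i => clampTo (δ i) (1 - δ i) with hc
  have hcm : ∀ i t, c i t ∈ Icc (δ i) (1 - δ i) := fun i t => clampTo_mem (hδlt i) t
  have hcI : ∀ i t, c i t ∈ Icc (0 : ℝ) 1 := fun i t => Ioo_sub (hsub i (hcm i t))
  set F : Finset (testSpace d) × ℕ → ℝ → testSpace d → ℝ := fun i t φ =>
    ∫ x, φ.1 x * ((w i (c i t)).1 x * ρ (c i t) x) with hF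
  have hFlin : ∀ i t, ∀ φ ψ : testSpace d, ∀ a : ℝ,
      F i t (φ + ψ) = F i t φ + F i t ψ ∧ F i t (a • φ) = a * F i t φ := fun i t φ ψ a => by
    have hρc := h.cont _ (hcI i t)
    have e : ∀ φ, F i t φ = gramForm _ hρc φ (w i (c i t)) := fun φ => rfl
    rw [e, e, e, e, map_add, map_smul]
    exact ⟨rfl, rfl⟩
  -- energy bounds
  have hen : ∀ i, ∀ t ∈ Icc (δ i) (1 - δ i),
      ∫ x, (w i t).1 x * ((w i t).1 x * ρ t x) ≤ E + 1 / (i.2 + 1) := by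
    intro i t ht
    have hanti : AntitoneOn (fun t => ∫ x, (w i t).1 x * ((w i t).1 x * ρ t x))
        (Icc (δ i) (1 - δ i)) := by
      refine antitoneOn_of_hasDerivWithinAt_nonpos (convex_Icc _ _)
        (fun t ht => (hder2 i t ht).continuousWithinAt)
        (fun t ht => (hder2 i t (interior_subset ht)).mono interior_subset) fun t ht => ?_
      have ht' := Ioo_sub (hsub i (interior_subset ht))
      have h1 : 0 ≤ ∫ x, ⟪ρ t x • ∇ (w i t).1 x, ∇ (w i t).1 x⟫ := integral_nonneg fun x => by
        simp only [inner_smul_left, conj_trivial, Pi.zero_apply]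
        exact mul_nonneg (h.pos t ht' x).le real_inner_self_nonneg
      have := mul_nonneg (hε0 t ht') h1
      linarith
    exact (hanti ⟨le_rfl, hδlt i⟩ ht ht.1).trans (hinit2 i)
  have hen1 : ∀ i, ∀ t ∈ Icc (δ i) (1 - δ i),
      ∫ x, (w i t).1 x * ((w i t).1 x * ρ t x) ≤ E + 1 := fun i t ht => (hen i t ht).trans (by
    have : (1 : ℝ) / (i.2 + 1) ≤ 1 := by
      rw [div_le_one (by positivity)]
      have : (0 : ℝ) ≤ i.2 := i.2.cast_nonneg
      linarith
    linarith)
  -- The sharp factor is kept here because the limit must satisfy the energy inequality with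
  -- constant exactly `E`; elsewhere the crude bound `E + 1` suffices.
  have hFsq : ∀ i t φ, F i t φ ^ 2 ≤ (E + 1 / (i.2 + 1)) * ∫ x, φ.1 x ^ 2 * ρ (c i t) x :=
    fun i t φ => h.sq_integral_test_le (hcI i t) φ _ (hen i _ (hcm i t))
  have hFbd : ∀ i t φ M, (∀ x, |φ.1 x| ≤ M) → |F i t φ| ≤ √(E + 1) * M := by
    intro i t φ M hM
    have hM0 : 0 ≤ M := (abs_nonneg _).trans (hM 0)
    refine abs_le_of_sq_le_sq ?_ (by positivity)
    rw [mul_pow, Real.sq_sqrt (by positivity)]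
    exact (h.sq_integral_test_le (hcI i t) φ _ (hen1 i _ (hcm i t))).trans
      (mul_le_mul_of_nonneg_left (h.integral_sq_le (hcI i t) φ hM) (by positivity))
  -- equicontinuity
  have hmod1 : ∀ i, ∀ φ ∈ i.1, ∀ L, (∀ x, ‖∇ φ.1 x‖ ≤ L) → ∀ l > 0, ∀ s t, s ≤ t →
      |F i t φ - F i s φ| ≤ L * (l * (E + 1) / 2 +
        √((E + 1) * C) * (sqrtPrimitive t - sqrtPrimitive s) + εM / (4 * l) * (t - s)) := by
    intro i φ hφ L hL l hl s t hst
    have hφV : φ ∈ Submodule.span ℝ (i.1 : Set (testSpace d)) := Submodule.subset_span hφ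
    have hL0 : 0 ≤ L := (norm_nonneg _).trans (hL 0)
    have hB := monotone_sqrtPrimitive.clampTo_sub_le (hδlt i) hst
    have hI := monotone_id.clampTo_sub_le (hδlt i) hst
    have hle : L * (l * (E + 1) / 2 + √((E + 1) * C) *
        (sqrtPrimitive (c i t) - sqrtPrimitive (c i s)) + εM / (4 * l) * (c i t - c i s)) ≤
        L * (l * (E + 1) / 2 + √((E + 1) * C) * (sqrtPrimitive t - sqrtPrimitive s) +
          εM / (4 * l) * (t - s)) := by
      simp only [id] at hI
      gcongr
    have hone : ∀ ψ ∈ Submodule.span ℝ (i.1 : Set (testSpace d)), (∀ x, ‖∇ ψ.1 x‖ ≤ L) →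
        F i t ψ - F i s ψ ≤ L * (l * (E + 1) / 2 +
        √((E + 1) * C) * (sqrtPrimitive t - sqrtPrimitive s) + εM / (4 * l) * (t - s)) :=
      fun ψ hψ hψL => (h.galerkin_modulus hε0 hεM hC hb hl (hδ0 i) (hδ3 i) hψL (hen1 i)
        (hder i ψ hψ) (hder2 i) (hcm i s) (hcm i t) (clampTo_mono _ _ hst)).trans hle
    -- The modulus is one-sided, and the lower bound is the upper bound for `-φ`, which lies in the
    -- same span.
    refine abs_le.2 ⟨?_, hone φ hφV hL⟩
    have h2 := hone ((-1 : ℝ) • φ) (Submodule.smul_mem _ _ hφV) fun x => by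
      rw [testSpace.gradient_smul, norm_smul]; simpa using hL x
    rw [(hFlin i t φ φ (-1)).2, (hFlin i s φ φ (-1)).2] at h2
    linarith
  have hmod : ∀ i, ∀ φ ∈ i.1, ∀ L, (∀ x, ‖∇ φ.1 x‖ ≤ L) → ∀ l > 0, ∀ s t,
      |F i t φ - F i s φ| ≤ L * (l * (E + 1) / 2 +
        √((E + 1) * C) * |sqrtPrimitive t - sqrtPrimitive s| + εM / (4 * l) * |t - s|) := by
    intro i φ hφ L hL l hl s t
    rcases le_total s t with hst | hst
    · rw [abs_of_nonneg (sub_nonneg.2 (monotone_sqrtPrimitive hst)),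
        abs_of_nonneg (sub_nonneg.2 hst)]
      exact hmod1 i φ hφ L hL l hl s t hst
    · rw [abs_sub_comm (F i t φ), abs_sub_comm t, abs_sub_comm (sqrtPrimitive t),
        abs_of_nonneg (sub_nonneg.2 (monotone_sqrtPrimitive hst)),
        abs_of_nonneg (sub_nonneg.2 hst)]
      exact hmod1 i φ hφ L hL l hl t s hst
  -- the limit
  set U : Ultrafilter (Finset (testSpace d) × ℕ) := Ultrafilter.of atTop with hU
  have hUle : (U : Filter (Finset (testSpace d) × ℕ)) ≤ atTop := Ultrafilter.of_le _
  have hUmem : ∀ φ : testSpace d, ∀ᶠ i in (U : Filter (Finset (testSpace d) × ℕ)), φ ∈ i.1 := fun φ =>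
    hUle ((eventually_ge_atTop (({φ} : Finset (testSpace d)), 0)).mono fun i hi =>
      hi.1 (Finset.mem_singleton_self φ))
  have hUn : Tendsto (fun i : Finset (testSpace d) × ℕ => i.2) U atTop :=
    tendsto_atTop.2 fun n => hUle ((eventually_ge_atTop ((∅ : Finset (testSpace d)), n)).mono
      fun i hi => hi.2)
  have hUinv : Tendsto (fun i : Finset (testSpace d) × ℕ => (1 : ℝ) / (i.2 + 1)) U (𝓝 0) :=
    tendsto_one_div_add_atTop_nhds_zero_nat.comp hUn
  have hUδ : Tendsto δ U (𝓝 0) := by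
    refine squeeze_zero (fun i => (hδ0 i).le) (fun i => (hδ1 i).trans ?_) hUinv
    apply one_div_le_one_div_of_le <;> [positivity; linarith]
  -- Bounded real families converge along an ultrafilter, so one and the same limit procedure works
  -- for all `t` and `φ` simultaneously and is automatically linear.
  have hlim : ∀ t (φ : testSpace d), ∃ y, Tendsto (fun i => F i t φ) U (𝓝 y) := by
    intro t φ
    obtain ⟨M, -, hM⟩ := testSpace.exists_bound φ
    have hK : IsCompact (Icc (-(√(E + 1) * M)) (√(E + 1) * M)) := isCompact_Icc
    obtain ⟨y, -, hy⟩ := hK.ultrafilter_le_nhds (U.map fun i => F i t φ) (by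
      rw [le_principal_iff, Ultrafilter.mem_coe, Ultrafilter.mem_map]
      exact Filter.univ_mem' fun i => abs_le.1 (hFbd i t φ M hM))
    exact ⟨y, hy⟩
  choose l hl using hlim
  have hladd : ∀ t φ ψ, l t (φ + ψ) = l t φ + l t ψ := fun t φ ψ =>
    tendsto_nhds_unique (hl t _) (((hl t φ).add (hl t ψ)).congr fun i =>
      ((hFlin i t φ ψ 0).1).symm)
  have hlsmul : ∀ t (a : ℝ) φ, l t (a • φ) = a * l t φ := fun t a φ =>
    tendsto_nhds_unique (hl t _) (((hl t φ).const_mul a).congr fun i =>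
      ((hFlin i t φ φ a).2).symm)
  have hlsq : ∀ t ∈ Icc (0 : ℝ) 1, ∀ φ : testSpace d,
      l t φ ^ 2 ≤ E * ∫ x, φ.1 x ^ 2 * ρ t x := by
    intro t ht φ
    have h1 : Tendsto (fun i => c i t) U (𝓝[Icc 0 1] t) := by
      refine tendsto_nhdsWithin_iff.2 ⟨?_, Eventually.of_forall fun i => hcI i t⟩
      rw [tendsto_iff_dist_tendsto_zero]
      exact squeeze_zero (fun i => dist_nonneg)
        (fun i => abs_clampTo_sub_le (hδ0 i).le ht) hUδ
    have h2 : Tendsto (fun i => ∫ x, φ.1 x ^ 2 * ρ (c i t) x) U (𝓝 (∫ x, φ.1 x ^ 2 * ρ t x)) :=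
      Tendsto.comp (g := fun τ => ∫ x, φ.1 x ^ 2 * ρ τ x)
        (h.weakCont (fun x => φ.1 x ^ 2) ((testSpace.continuous φ).pow 2)
          (φ.2.2.comp_left (g := fun r : ℝ => r ^ 2) (by simp)) t ht) h1
    have h3 : Tendsto (fun i : Finset (testSpace d) × ℕ =>
        (E + 1 / ((i.2 : ℝ) + 1)) * ∫ x, φ.1 x ^ 2 * ρ (c i t) x) U
        (𝓝 ((E + 0) * ∫ x, φ.1 x ^ 2 * ρ t x)) := (tendsto_const_nhds.add hUinv).mul h2
    rw [add_zero] at h3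
    exact le_of_tendsto_of_tendsto' ((hl t φ).pow 2) h3 fun i => hFsq i t φ
  have hlmod : ∀ (φ : testSpace d), ∀ L, (∀ x, ‖∇ φ.1 x‖ ≤ L) → ∀ k > 0, ∀ s t,
      |l t φ - l s φ| ≤ L * (k * (E + 1) / 2 +
        √((E + 1) * C) * |sqrtPrimitive t - sqrtPrimitive s| + εM / (4 * k) * |t - s|) :=
    fun φ L hL k hk s t => le_of_tendsto (((hl t φ).sub (hl s φ)).abs)
      ((hUmem φ).mono fun i hi => hmod i φ hi L hL k hk s t)
  have hl0 : ∀ φ : testSpace d, l 0 φ = ∫ x, φ.1 x * f x := by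
    intro φ
    refine tendsto_nhds_unique (hl 0 φ) (tendsto_const_nhds.congr' ?_)
    filter_upwards [hUmem φ] with i hi
    have hc0 : c i 0 = δ i := by
      simp only [hc, clampTo]
      rw [min_eq_right (by linarith [hδlt i, hδ0 i]), max_eq_left (hδ0 i).le]
    simp only [hF, hc0]
    exact (hinit i φ (Submodule.subset_span hi)).symm
  -- the densities
  have hdens : ∀ t ∈ Icc (0 : ℝ) 1, ∃ u : Eu d → ℝ, AEStronglyMeasurable u volume ∧
      Integrable (fun x => u x ^ 2 / ρ t x) ∧ ∫ x, u x ^ 2 / ρ t x ≤ E ∧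
        (∀ φ : testSpace d, l t φ = ∫ x, φ.1 x * u x) ∧ (t = 0 → u = f) := by
    intro t ht
    -- At time `0` the limit form is already represented by `f`, and `f` itself is taken as the
    -- density.
    by_cases ht0 : t = 0
    · subst ht0
      exact ⟨f, hf, hfi, le_rfl, hl0, fun _ => rfl⟩
    · obtain ⟨u, h1, h2, h3, h4⟩ := exists_density_of_sq_le (h.cont t ht) (h.pos t ht)
        (V := testSpace d) (fun φ hφ => ⟨hφ.1.continuous, hφ.2⟩)
        { toFun := l t, map_add' := hladd t, map_smul' := fun a φ => hlsmul t a φ } hE0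
        (hlsq t ht)
      exact ⟨u, h1, h2, h3, h4, fun h => absurd h ht0⟩
  choose! u hu1 hu2 hu3 hu4 hu5 using hdens
  have hfE : energy (ρ 0) f = ENNReal.ofReal E := energy_eq_ofReal (h.pos 0 h0I) hfi
  refine ⟨u, ⟨hu1, ?_, fun t ht => ?_, fun φ hφ1 hφ2 => ?_, fun φ hφ1 hφ2 t ht => ?_⟩, ?_⟩
  · rw [hu5 0 h0I rfl]; exact hfe
  · rw [hu5 0 h0I rfl, hfE, energy_eq_ofReal (h.pos t ht) (hu2 t ht)]
    exact ENNReal.ofReal_le_ofReal (hu3 t ht)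
  · set φ' : testSpace d := ⟨φ, smoothTest_le_testSpace d ⟨hφ1, hφ2⟩⟩
    have hco : ContinuousOn (fun t => l t φ') (Icc 0 1) := by
      obtain ⟨L, hL0, hL⟩ := testSpace.exists_gradient_bound φ'
      refine Continuous.continuousOn (continuous_iff_continuousAt.2 fun s => ?_)
      rw [Metric.continuousAt_iff']
      intro η hη
      obtain ⟨k, hk, hk'⟩ := eventually_modulus_lt (L := L) (E := E + 1) (C := C) (M := εM)
        (s := s) hL0 (by positivity) hη
      filter_upwards [hk'] with t ht
      exact (hlmod φ' L hL k hk s t).trans_lt ht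
    exact hco.congr fun t ht => (hu4 t ht φ').symm
  · have hφs : φ ∈ smoothTest d := ⟨hφ1, hφ2⟩
    set φ' : testSpace d := ⟨φ, smoothTest_le_testSpace d hφs⟩
    set ψ : testSpace d := ⟨adjoint ρ b ε φ t, h.adjoint_mem ε hφs ht⟩
    -- The estimate `|F(s) φ - F(t) φ - (s - t) F(t) ψ| ≤ η |s - t|` is shown for the
    -- approximations, with a neighbourhood of `t` that does not depend on the index, and then
    -- passed to the limit. Here `ψ` is the adjoint at the frozen time `t`.
    have hder' : HasDerivAt (fun τ => l τ φ') (l t ψ) t := by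
      rw [hasDerivAt_iff_isLittleO, Asymptotics.isLittleO_iff]
      intro η hη
      obtain ⟨L, hL0, hL⟩ := testSpace.exists_gradient_bound ψ
      obtain ⟨k, hk, hk'⟩ := eventually_modulus_lt (L := L) (E := E + 1) (C := C) (M := εM)
        (s := t) hL0 (by positivity) (half_pos hη)
      -- One half of `η` pays for replacing the adjoint at `τ` by the one at `t`, through the
      -- sup-norm bound with constant `√(E + 1)`; the other half pays for the variation of `F · ψ`
      -- in time.
      have hadj := h.adjoint_eventually_close hε hφs ht
        (η := η / (2 * (√(E + 1) + 1))) (by positivity)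
      obtain ⟨r, hr, hball⟩ := Metric.eventually_nhds_iff_ball.1
        ((hk'.and hadj).and (isOpen_Ioo.eventually_mem ht))
      -- As soon as `δ i < r'`, the whole ball lies in the interval where the approximate equation
      -- holds and clamping has no effect.
      obtain ⟨r', hr', hr1⟩ : ∃ r' > 0, r' ≤ r ∧ Metric.ball t r' ⊆ Ioo (r') (1 - r') := by
        have h1 := ht.1
        have h2 := ht.2
        refine ⟨min r (min (t / 2) ((1 - t) / 2)), by
          refine lt_min hr (lt_min (by linarith) (by linarith)), min_le_left _ _,
          fun s hs => ?_⟩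
        rw [Metric.mem_ball, Real.dist_eq, abs_lt] at hs
        have h3 : min r (min (t / 2) ((1 - t) / 2)) ≤ t / 2 :=
          (min_le_right _ _).trans (min_le_left _ _)
        have h4 : min r (min (t / 2) ((1 - t) / 2)) ≤ (1 - t) / 2 :=
          (min_le_right _ _).trans (min_le_right _ _)
        constructor <;> linarith [hs.1, hs.2]
      have hδr : ∀ᶠ i in (U : Filter (Finset (testSpace d) × ℕ)), δ i < r' := hUδ.eventually (gt_mem_nhds hr')
      filter_upwards [Metric.ball_mem_nhds t hr'] with s hs
      have hb2 : ∀ τ ∈ Metric.ball t r', τ ∈ Metric.ball t r := fun τ hτ =>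
        Metric.ball_subset_ball hr1.1 hτ
      have hi : ∀ᶠ i in (U : Filter (Finset (testSpace d) × ℕ)),
          ‖F i s φ' - F i t φ' - (s - t) * F i t ψ‖ ≤ η * ‖s - t‖ := by
        filter_upwards [hδr, hUmem φ', hUmem ψ] with i hi1 hi2 hi3
        have hin : ∀ τ ∈ Metric.ball t r', τ ∈ Ioo (δ i) (1 - δ i) := fun τ hτ =>
          ⟨hi1.trans (hr1.2 hτ).1, by have := (hr1.2 hτ).2; linarith⟩
        have hcτ : ∀ τ ∈ Metric.ball t r', c i τ = τ := fun τ hτ =>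
          clampTo_of_mem (Ioo_subset_Icc_self (hin τ hτ))
        have hd : ∀ τ ∈ Metric.ball t r', HasDerivWithinAt
            (fun τ => F i τ φ' - τ * F i t ψ)
            ((∫ x, adjoint ρ b ε φ τ x * ((w i τ).1 x * ρ τ x)) - 1 * F i t ψ)
            (Metric.ball t r') τ := by
          intro τ hτ
          have h1 := hder i φ' (Submodule.subset_span hi2) τ (Ioo_subset_Icc_self (hin τ hτ))
          rw [h.galerkin_rhs_eq ε hφs _ (hsub i (Ioo_subset_Icc_self (hin τ hτ)))] at h1
          have h2 := h1.mono (fun τ hτ => Ioo_subset_Icc_self (hin τ hτ) :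
            Metric.ball t r' ⊆ Icc (δ i) (1 - δ i))
          have h3 : HasDerivWithinAt (fun τ => F i τ φ')
              (∫ x, adjoint ρ b ε φ τ x * ((w i τ).1 x * ρ τ x)) (Metric.ball t r') τ :=
            h2.congr (fun σ hσ => by simp only [hF, hcτ σ hσ]) (by simp only [hF, hcτ τ hτ])
          exact h3.sub ((hasDerivWithinAt_id τ _).mul_const _)
        have hbound : ∀ τ ∈ Metric.ball t r',
            ‖(∫ x, adjoint ρ b ε φ τ x * ((w i τ).1 x * ρ τ x)) - 1 * F i t ψ‖ ≤ η := by
          intro τ hτ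
          obtain ⟨⟨g1, g2⟩, g3⟩ := hball τ (hb2 τ hτ)
          set ψτ : testSpace d := ⟨adjoint ρ b ε φ τ, h.adjoint_mem ε hφs g3⟩
          have e1 : (∫ x, adjoint ρ b ε φ τ x * ((w i τ).1 x * ρ τ x)) = F i τ ψτ := by
            simp only [hF, hcτ τ hτ, ψτ]
          have e2 : F i τ (ψτ + (-1 : ℝ) • ψ) = F i τ ψτ - F i τ ψ := by
            rw [(hFlin i τ _ _ 0).1, (hFlin i τ ψ ψ (-1)).2]; ring
          have e3 : |F i τ (ψτ + (-1 : ℝ) • ψ)| ≤ √(E + 1) * (η / (2 * (√(E + 1) + 1))) := by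
            refine hFbd i τ _ _ fun x => ?_
            have := g2 x
            have e : (ψτ + (-1 : ℝ) • ψ).1 x = adjoint ρ b ε φ τ x - adjoint ρ b ε φ t x := by
              change adjoint ρ b ε φ τ x + (-1 : ℝ) * adjoint ρ b ε φ t x = _
              ring
            rwa [e]
          have e4 : √(E + 1) * (η / (2 * (√(E + 1) + 1))) ≤ η / 2 := by
            have hs0 := Real.sqrt_nonneg (E + 1)
            have : √(E + 1) * (η / (2 * (√(E + 1) + 1))) =
                (η / 2) * (√(E + 1) / (√(E + 1) + 1)) := by
              field_simp
            rw [this]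
            have h5 : √(E + 1) / (√(E + 1) + 1) ≤ 1 := by
              rw [div_le_one (by positivity)]; linarith
            nlinarith
          have e5 := (hmod i ψ hi3 L hL k hk t τ).trans g1.le
          rw [e1, one_mul, Real.norm_eq_abs]
          calc |F i τ ψτ - F i t ψ| = |(F i τ ψτ - F i τ ψ) + (F i τ ψ - F i t ψ)| := by
                congr 1; ring
            _ ≤ |F i τ ψτ - F i τ ψ| + |F i τ ψ - F i t ψ| := abs_add_le _ _
            _ ≤ η / 2 + η / 2 := add_le_add (by rw [← e2]; exact e3.trans e4) e5
            _ = η := by ring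
        have := (convex_ball t r').norm_image_sub_le_of_norm_hasDerivWithin_le hd hbound
          (Metric.mem_ball_self hr') hs
        calc ‖F i s φ' - F i t φ' - (s - t) * F i t ψ‖ =
            ‖F i s φ' - s * F i t ψ - (F i t φ' - t * F i t ψ)‖ := by congr 1; ring
          _ ≤ η * ‖s - t‖ := this
      have hlim' : Tendsto (fun i => ‖F i s φ' - F i t φ' - (s - t) * F i t ψ‖) U
          (𝓝 ‖l s φ' - l t φ' - (s - t) * l t ψ‖) :=
        (((hl s φ').sub (hl t φ')).sub ((hl t ψ).const_mul _)).norm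
      exact le_of_tendsto hlim' hi
    have e6 : l t ψ = ∫ x, (⟪driftF ρ b ε t x, ∇ φ x⟫ + ε t * Δ φ x) * u t x :=
      hu4 t (Ioo_sub ht) ψ
    rw [← e6]
    refine hder'.congr_of_eventuallyEq ?_
    filter_upwards [isOpen_Ioo.mem_nhds ht] with τ hτ
    exact (hu4 τ (Ioo_sub hτ) φ').symm
  · rw [hu5 0 h0I rfl]

end FlowPair

/-! ### Convolution and mollifiers. -/

section Mollify

variable {d : ℕ} {F : Type*} [NormedAddCommGroup F] [NormedSpace ℝ F]

/-- The convolution of a scalar function with a vector-valued kernel. -/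
noncomputable def conv (w : Eu d → ℝ) (g : Eu d → F) (x : Eu d) : F := ∫ y, w y • g (x - y)

theorem conv_eq_convolution (w : Eu d → ℝ) (g : Eu d → F) :
    conv w g = convolution w g (ContinuousLinearMap.lsmul ℝ ℝ) volume := rfl

theorem integrable_conv_integrand [FiniteDimensional ℝ F] {w : Eu d → ℝ} {g : Eu d → F}
    (hw : LocallyIntegrable w volume)
    (hg : Continuous g) (hgc : HasCompactSupport g) (x : Eu d) :
    Integrable fun y => w y • g (x - y) :=
  (hgc.convolutionExists_right (ContinuousLinearMap.lsmul ℝ ℝ) hw hg x)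

theorem hasFDerivAt_conv {w : Eu d → ℝ} {g : Eu d → F} (hw : LocallyIntegrable w volume)
    (hg : ContDiff ℝ 1 g) (hgc : HasCompactSupport g) (x : Eu d) :
    HasFDerivAt (conv w g) (conv w (fderiv ℝ g) x) x := by
  have h := hgc.hasFDerivAt_convolution_right (ContinuousLinearMap.lsmul ℝ ℝ) hw hg x
  rw [conv_eq_convolution]
  convert! h using 1

theorem contDiff_conv [CompleteSpace F] {w : Eu d → ℝ} {g : Eu d → F} {n : ℕ∞} (hw : LocallyIntegrable w volume)
    (hg : ContDiff ℝ n g) (hgc : HasCompactSupport g) : ContDiff ℝ n (conv w g) :=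
  hgc.contDiff_convolution_right (ContinuousLinearMap.lsmul ℝ ℝ) hw hg

/-- Derivatives of `conv` fall on the second argument. For merely integrable `w` the mollifier
stands there; for a smooth function the roles are exchanged. -/
theorem conv_comm (w g : Eu d → ℝ) : conv w g = conv g w := by
  funext x
  unfold conv
  rw [← integral_sub_left_eq_self (fun y => w y • g (x - y)) volume x]
  refine integral_congr_ae (Eventually.of_forall fun y => ?_)
  simp [mul_comm]

theorem fderiv_conv_apply [FiniteDimensional ℝ F] {w : Eu d → ℝ} {g : Eu d → F}
    (hw : LocallyIntegrable w volume)
    (hg : ContDiff ℝ 1 g) (hgc : HasCompactSupport g) (x v : Eu d) :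
    fderiv ℝ (conv w g) x v = ∫ y, w y • fderiv ℝ g (x - y) v := by
  rw [(hasFDerivAt_conv hw hg hgc x).fderiv]
  unfold conv
  rw [ContinuousLinearMap.integral_apply
    (integrable_conv_integrand hw (hg.continuous_fderiv (by norm_num)) (hgc.fderiv ℝ) x)]
  rfl

theorem gradient_conv {w g : Eu d → ℝ} (hw : LocallyIntegrable w volume)
    (hg : ContDiff ℝ 1 g) (hgc : HasCompactSupport g) (x : Eu d) :
    ∇ (conv w g) x = conv w (∇ g) x := by
  refine ext_inner_left ℝ fun v => ?_
  rw [inner_gradient_eq, fderiv_conv_apply hw hg hgc]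
  have h1 := integrable_conv_integrand hw (ContDiff.continuous_gradient hg) hgc.gradient x
  unfold conv
  rw [← integral_inner h1]
  refine integral_congr_ae (Eventually.of_forall fun y => ?_)
  simp only [inner_smul_right, inner_gradient_eq, smul_eq_mul]

theorem divergence_conv {w : Eu d → ℝ} {v : Eu d → Eu d} (hw : LocallyIntegrable w volume)
    (hv : ContDiff ℝ 1 v) (hvc : HasCompactSupport v) (x : Eu d) :
    divergence (conv w v) x = conv w (divergence v) x := by
  have h1 := integrable_conv_integrand hw (hv.continuous_fderiv (by norm_num)) (hvc.fderiv ℝ) x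
  have h2 : ∀ i : Fin d, Integrable fun y =>
      w y • ((fderiv ℝ v (x - y)) (EuclideanSpace.single i 1)) i := fun i => by
    have := ((EuclideanSpace.proj i : Eu d →L[ℝ] ℝ).comp
      (ContinuousLinearMap.apply ℝ (Eu d) (EuclideanSpace.single i (1 : ℝ)))).integrable_comp h1
    simpa using this
  unfold divergence
  simp only [fderiv_conv_apply hw hv hvc]
  unfold conv
  simp only [Finset.smul_sum]
  rw [integral_finsetSum _ fun i _ => h2 i]
  refine Finset.sum_congr rfl fun i _ => ?_
  have h3 := ((ContinuousLinearMap.apply ℝ (Eu d) (EuclideanSpace.single i (1 : ℝ)))).integrable_comp h1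
  have h4 := (EuclideanSpace.proj i : Eu d →L[ℝ] ℝ).integral_comp_comm h3
  simpa using h4.symm

theorem laplacian_conv {w g : Eu d → ℝ} (hw : LocallyIntegrable w volume)
    (hg : ContDiff ℝ 2 g) (hgc : HasCompactSupport g) (x : Eu d) :
    Δ (conv w g) x = conv w (Δ g) x := by
  have h1 : ∇ (conv w g) = conv w (∇ g) :=
    funext (gradient_conv hw (hg.of_le (by norm_num)) hgc)
  rw [laplacian_eq_divergence (contDiff_conv (n := 2) hw hg hgc), h1,
    divergence_conv hw (ContDiff.gradient' (m := 1) (n := 2) hg (by norm_num)) hgc.gradient,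
    (funext (laplacian_eq_divergence hg) : Δ g = _)]

theorem integrable_conv {w : Eu d → ℝ} {g : Eu d → F} (hw : Integrable w)
    (hg : Integrable g) : Integrable (conv w g) :=
  hw.integrable_convolution (ContinuousLinearMap.lsmul ℝ ℝ) hg

theorem norm_conv_le (w : Eu d → ℝ) (g : Eu d → F) (x : Eu d) :
    ‖conv w g x‖ ≤ conv (fun y => |w y|) (fun y => ‖g y‖) x := by
  unfold conv
  refine (norm_integral_le_integral_norm _).trans (le_of_eq ?_)
  simp [norm_smul]

theorem integral_conv {w g : Eu d → ℝ} (hw : Integrable w) (hg : Integrable g) :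
    ∫ x, conv w g x = (∫ x, w x) * ∫ x, g x :=
  integral_convolution (ContinuousLinearMap.lsmul ℝ ℝ) hw hg

theorem conv_sub_left [FiniteDimensional ℝ F] {w w' : Eu d → ℝ} {g : Eu d → F}
    (hw : LocallyIntegrable w volume)
    (hw' : LocallyIntegrable w' volume) (hg : Continuous g) (hgc : HasCompactSupport g)
    (x : Eu d) : conv (fun y => w y - w' y) g x = conv w g x - conv w' g x := by
  unfold conv
  rw [← integral_sub (integrable_conv_integrand hw hg hgc x)
    (integrable_conv_integrand hw' hg hgc x)]
  simp only [sub_smul]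

/-- A smooth bump function with integral one supported in the unit ball. -/
noncomputable def unitBump (d : ℕ) : Eu d → ℝ :=
  (⟨1 / 2, 1, by norm_num, by norm_num⟩ : ContDiffBump (0 : Eu d)).normed volume

/-- The rescaled bump function. -/
noncomputable def mollifier (d : ℕ) (δ : ℝ) (x : Eu d) : ℝ := (δ ^ d)⁻¹ * unitBump d (δ⁻¹ • x)

theorem contDiff_unitBump : ContDiff ℝ (⊤ : ℕ∞) (unitBump d) := ContDiffBump.contDiff_normed _

theorem contDiff_mollifier (δ : ℝ) : ContDiff ℝ (⊤ : ℕ∞) (mollifier d δ) :=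
  contDiff_const.mul (contDiff_unitBump.comp (contDiff_const_smul δ⁻¹))

theorem mollifier_nonneg {δ : ℝ} (hδ : 0 < δ) (x : Eu d) : 0 ≤ mollifier d δ x :=
  mul_nonneg (by positivity) (ContDiffBump.nonneg_normed _ _)

theorem support_mollifier {δ : ℝ} (hδ : 0 < δ) :
    Function.support (mollifier d δ) ⊆ Metric.ball 0 δ := by
  intro x hx
  have h1 : unitBump d (δ⁻¹ • x) ≠ 0 := fun h => hx (by simp [mollifier, h])
  have h2 : δ⁻¹ • x ∈ Function.support (unitBump d) := h1
  rw [unitBump, ContDiffBump.support_normed_eq] at h2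
  simp only [Metric.mem_ball, dist_zero_right, norm_smul, norm_inv, Real.norm_eq_abs,
    abs_of_pos hδ] at h2 ⊢
  rwa [inv_mul_lt_iff₀ hδ, mul_one] at h2

theorem hasCompactSupport_mollifier {δ : ℝ} (hδ : 0 < δ) : HasCompactSupport (mollifier d δ) :=
  HasCompactSupport.of_support_subset_isCompact (isCompact_closedBall 0 δ)
    ((support_mollifier hδ).trans Metric.ball_subset_closedBall)

theorem integral_mollifier {δ : ℝ} (hδ : 0 < δ) : ∫ x, mollifier d δ x = 1 := by
  unfold mollifier
  rw [integral_const_mul, Measure.integral_comp_inv_smul_of_nonneg _ _ hδ.le]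
  have : ∫ x, unitBump d x = 1 := ContDiffBump.integral_normed _
  rw [this]
  simp only [finrank_euclideanSpace, Fintype.card_fin, smul_eq_mul, mul_one]
  exact inv_mul_cancel₀ (by positivity)

theorem gradient_mollifier (δ : ℝ) (x : Eu d) :
    ∇ (mollifier d δ) x = (δ⁻¹ * (δ ^ d)⁻¹) • ∇ (unitBump d) (δ⁻¹ • x) := by
  refine ext_inner_left ℝ fun v => ?_
  rw [inner_gradient_eq, inner_smul_right, inner_gradient_eq]
  have h0 : DifferentiableAt ℝ (unitBump d) (δ⁻¹ • x) :=
    (contDiff_unitBump.differentiable (by simp)) _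
  have h1 : HasFDerivAt (fun y : Eu d => δ⁻¹ • y) (δ⁻¹ • ContinuousLinearMap.id ℝ (Eu d)) x :=
    (δ⁻¹ • ContinuousLinearMap.id ℝ (Eu d)).hasFDerivAt
  have h2 := (h0.hasFDerivAt.comp x h1).const_mul ((δ ^ d)⁻¹)
  have h3 : mollifier d δ = fun y => (δ ^ d)⁻¹ * (unitBump d ∘ fun y => δ⁻¹ • y) y := rfl
  rw [h3, h2.fderiv]
  simp only [smul_apply, ContinuousLinearMap.comp_apply,
    ContinuousLinearMap.id_apply, map_smul, smul_eq_mul]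
  ring

/-- The blow-up `δ⁻¹` is exactly compensated in the commutator by the oscillation of a Lipschitz
field over a distance `δ`. -/
theorem integral_norm_gradient_mollifier {δ : ℝ} (hδ : 0 < δ) :
    ∫ x, ‖∇ (mollifier d δ) x‖ = δ⁻¹ * ∫ x, ‖∇ (unitBump d) x‖ := by
  simp only [gradient_mollifier, norm_smul]
  rw [integral_const_mul, Measure.integral_comp_inv_smul_of_nonneg volume
    (fun y => ‖∇ (unitBump d) y‖) hδ.le]
  simp only [finrank_euclideanSpace, Fintype.card_fin, smul_eq_mul, norm_mul, norm_inv,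
    Real.norm_eq_abs, abs_of_pos hδ, norm_pow]
  field_simp

theorem tendsto_support_mollifier :
    Tendsto (fun δ => Function.support (mollifier d δ)) (𝓝[>] 0) (𝓝 0).smallSets := by
  rw [tendsto_smallSets_iff]
  intro s hs
  obtain ⟨r, hr, hrs⟩ := Metric.mem_nhds_iff.1 hs
  filter_upwards [Ioo_mem_nhdsGT hr] with δ hδ
  exact (support_mollifier hδ.1).trans ((Metric.ball_subset_ball hδ.2.le).trans hrs)

theorem tendsto_conv_mollifier [CompleteSpace F] {f : Eu d → F} (hf : Continuous f) (x : Eu d) :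
    Tendsto (fun δ => conv (mollifier d δ) f x) (𝓝[>] 0) (𝓝 (f x)) := by
  refine convolution_tendsto_right (g := fun _ => f) (k := fun _ => x) ?_ ?_
    tendsto_support_mollifier (Eventually.of_forall fun _ => hf.aestronglyMeasurable)
    ((hf.tendsto x).comp tendsto_snd) tendsto_const_nhds
  · filter_upwards [self_mem_nhdsWithin] with δ hδ using mollifier_nonneg hδ
  · filter_upwards [self_mem_nhdsWithin] with δ hδ using integral_mollifier hδ

theorem norm_conv_mollifier_le {f : Eu d → F} {M : ℝ} (hM : ∀ x, ‖f x‖ ≤ M)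
    {δ : ℝ} (hδ : 0 < δ) (x : Eu d) : ‖conv (mollifier d δ) f x‖ ≤ M := by
  have hi : Integrable (mollifier d δ) :=
    (contDiff_mollifier δ).continuous.integrable_of_hasCompactSupport
      (hasCompactSupport_mollifier hδ)
  have h1 : ∀ y, ‖mollifier d δ y • f (x - y)‖ ≤ M * mollifier d δ y := fun y => by
    rw [norm_smul, Real.norm_eq_abs, abs_of_nonneg (mollifier_nonneg hδ y), mul_comm]
    exact mul_le_mul_of_nonneg_right (hM _) (mollifier_nonneg hδ y)
  calc ‖conv (mollifier d δ) f x‖ ≤ ∫ y, M * mollifier d δ y :=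
        norm_integral_le_of_norm_le (hi.const_mul M) (Eventually.of_forall h1)
    _ = M := by rw [integral_const_mul, integral_mollifier hδ, mul_one]

end Mollify

/-! ### The commutator of mollification and transport. -/

section Commutator

variable {d : ℕ}

theorem exists_smooth_integral_sub_le {w : Eu d → ℝ} (hw : Integrable w) {η : ℝ} (hη : 0 < η) :
    ∃ g ∈ smoothTest d, ∫ x, |w x - g x| ≤ η := by
  obtain ⟨g, hgc, hg, hle⟩ := MemLp.exist_eLpNorm_sub_le ENNReal.one_ne_top le_rfl
    (memLp_one_iff_integrable.2 hw) hη
  have hgi : Integrable g := hg.continuous.integrable_of_hasCompactSupport hgc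
  refine ⟨g, ⟨hg, hgc⟩, ?_⟩
  rw [eLpNorm_one_eq_lintegral_enorm, ← ofReal_integral_norm_eq_lintegral_enorm (hw.sub hgi),
    ENNReal.ofReal_le_ofReal_iff hη.le] at hle
  simpa using hle

/-- A family of seminorms that is bounded on `L¹` and tends to zero on smooth functions tends to
zero on `L¹`. -/
theorem tendsto_zero_of_smooth {N : ℝ → (Eu d → ℝ) → ℝ} {l : Filter ℝ} {C : ℝ} (hC : 0 ≤ C)
    (hN0 : ∀ δ w, 0 ≤ N δ w)
    (hsub : ∀ᶠ δ in l, ∀ w g : Eu d → ℝ, Integrable w → Integrable g →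
      N δ w ≤ N δ g + C * ∫ x, |w x - g x|)
    (hN : ∀ g ∈ smoothTest d, Tendsto (fun δ => N δ g) l (𝓝 0)) {w : Eu d → ℝ}
    (hw : Integrable w) : Tendsto (fun δ => N δ w) l (𝓝 0) := by
  rw [Metric.tendsto_nhds]
  intro η hη
  obtain ⟨g, hg, hle⟩ := exists_smooth_integral_sub_le hw
    (η := η / (2 * (C + 1))) (by positivity)
  have hgi : Integrable g := hg.1.continuous.integrable_of_hasCompactSupport hg.2
  filter_upwards [hsub, (Metric.tendsto_nhds.1 (hN g hg)) (η / 2) (by positivity)] with δ h1 h2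
  have h3 := h1 w g hw hgi
  rw [Real.dist_eq, sub_zero, abs_of_nonneg (hN0 _ _)] at h2 ⊢
  have h4 : C * ∫ x, |w x - g x| ≤ η / 2 := by
    calc C * ∫ x, |w x - g x| ≤ (C + 1) * (η / (2 * (C + 1))) := by
          refine mul_le_mul (by linarith) hle (integral_nonneg fun x => abs_nonneg _) (by linarith)
      _ = η / 2 := by field_simp
  linarith

theorem integrable_mollifier {δ : ℝ} (hδ : 0 < δ) : Integrable (mollifier d δ) :=
  (contDiff_mollifier δ).continuous.integrable_of_hasCompactSupport
    (hasCompactSupport_mollifier hδ)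

theorem continuous_conv_mollifier {w : Eu d → ℝ} (hw : Integrable w) {δ : ℝ} (hδ : 0 < δ) :
    Continuous (conv w (mollifier d δ)) :=
  (contDiff_conv (n := 0) hw.locallyIntegrable (contDiff_mollifier δ |>.of_le (by simp))
    (hasCompactSupport_mollifier hδ)).continuous

theorem integral_abs_conv_mollifier_le {w : Eu d → ℝ} (hw : Integrable w) {δ : ℝ} (hδ : 0 < δ) :
    ∫ x, |conv w (mollifier d δ) x| ≤ ∫ x, |w x| := by
  have hm := integrable_mollifier (d := d) hδ
  calc ∫ x, |conv w (mollifier d δ) x|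
      ≤ ∫ x, conv (fun y => |w y|) (fun y => ‖mollifier d δ y‖) x :=
        integral_mono (integrable_conv hw hm).abs (integrable_conv hw.abs hm.norm)
          fun x => (Real.norm_eq_abs _).symm.le.trans (norm_conv_le w (mollifier d δ) x)
    _ = (∫ x, |w x|) * ∫ x, ‖mollifier d δ x‖ := integral_conv hw.abs hm.norm
    _ = ∫ x, |w x| := by
        have : ∀ x, ‖mollifier d δ x‖ = mollifier d δ x := fun x =>
          abs_of_nonneg (mollifier_nonneg hδ x)
        simp only [this, integral_mollifier hδ, mul_one]

/-- For smooth `w` this is dominated convergence. Mollification contracts `L¹`, so the difference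
from the identity has norm at most `2`, and density concludes. -/
theorem tendsto_setIntegral_conv_mollifier_sub {w : Eu d → ℝ} (hw : Integrable w) (r : ℝ) :
    Tendsto (fun δ => ∫ x in Metric.closedBall 0 r, |conv w (mollifier d δ) x - w x|)
      (𝓝[>] 0) (𝓝 0) := by
  refine tendsto_zero_of_smooth (C := 2) (N := fun δ w =>
    ∫ x in Metric.closedBall 0 r, |conv w (mollifier d δ) x - w x|) (by norm_num)
    (fun δ w => integral_nonneg fun x => abs_nonneg _) ?_ (fun g hg => ?_) hw
  · filter_upwards [self_mem_nhdsWithin] with δ hδ w g hw hg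
    have hδ : 0 < δ := hδ
    have hm := integrable_mollifier (d := d) hδ
    have e1 := integrable_conv hw hm
    have e2 := integrable_conv hg hm
    have hwg : Integrable (fun x => w x - g x) := hw.sub hg
    have e3 := integrable_conv hwg hm
    have h1 : ∀ x, |conv w (mollifier d δ) x - w x| ≤ |conv g (mollifier d δ) x - g x| +
        (|conv (fun y => w y - g y) (mollifier d δ) x| + |w x - g x|) := by
      intro x
      rw [conv_sub_left hw.locallyIntegrable hg.locallyIntegrable
        (contDiff_mollifier δ).continuous (hasCompactSupport_mollifier hδ)]
      have := abs_add_le (conv g (mollifier d δ) x - g x)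
        ((conv w (mollifier d δ) x - conv g (mollifier d δ) x) - (w x - g x))
      have h2 := abs_sub (conv w (mollifier d δ) x - conv g (mollifier d δ) x) (w x - g x)
      have e : conv g (mollifier d δ) x - g x +
        ((conv w (mollifier d δ) x - conv g (mollifier d δ) x) - (w x - g x)) =
        conv w (mollifier d δ) x - w x := by ring
      rw [e] at this
      linarith
    have i1 : Integrable (fun x => |conv w (mollifier d δ) x - w x|) := (e1.sub hw).abs
    have i2 : Integrable (fun x => |conv g (mollifier d δ) x - g x|) := (e2.sub hg).abs
    have i3 : Integrable (fun x => |conv (fun y => w y - g y) (mollifier d δ) x| + |w x - g x|) :=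
      e3.abs.add hwg.abs
    calc ∫ x in Metric.closedBall 0 r, |conv w (mollifier d δ) x - w x|
        ≤ ∫ x in Metric.closedBall 0 r, (|conv g (mollifier d δ) x - g x| +
        (|conv (fun y => w y - g y) (mollifier d δ) x| + |w x - g x|)) :=
          setIntegral_mono i1.integrableOn (i2.add i3).integrableOn h1
      _ = (∫ x in Metric.closedBall 0 r, |conv g (mollifier d δ) x - g x|) +
        ∫ x in Metric.closedBall 0 r,
          (|conv (fun y => w y - g y) (mollifier d δ) x| + |w x - g x|) :=
          integral_add i2.integrableOn i3.integrableOn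
      _ ≤ (∫ x in Metric.closedBall 0 r, |conv g (mollifier d δ) x - g x|) +
        ∫ x, (|conv (fun y => w y - g y) (mollifier d δ) x| + |w x - g x|) := by
          refine add_le_add le_rfl ?_
          exact setIntegral_le_integral i3 (Eventually.of_forall fun x => by positivity)
      _ ≤ _ := by
          rw [integral_add e3.abs hwg.abs]
          have := integral_abs_conv_mollifier_le hwg hδ
          linarith
  · obtain ⟨M, hM⟩ := hg.1.continuous.bounded_above_of_compact_support hg.2
    have hlim : ∀ x, Tendsto (fun δ => |conv g (mollifier d δ) x - g x|) (𝓝[>] 0) (𝓝 0) := by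
      intro x
      have := ((tendsto_conv_mollifier hg.1.continuous x).sub_const (g x)).abs
      simpa [conv_comm g] using this
    have key := tendsto_integral_filter_of_dominated_convergence
      (μ := volume.restrict (Metric.closedBall (0 : Eu d) r))
      (F := fun δ x => |conv g (mollifier d δ) x - g x|) (f := fun _ => (0 : ℝ)) (l := 𝓝[>] 0)
      (fun _ => M + M) ?_ ?_ ?_ (Eventually.of_forall hlim)
    · simpa using key
    · filter_upwards [self_mem_nhdsWithin] with δ hδ
      have hgi : Integrable g := hg.1.continuous.integrable_of_hasCompactSupport hg.2
      exact (((continuous_conv_mollifier hgi hδ).sub hg.1.continuous).abs).aestronglyMeasurable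
    · filter_upwards [self_mem_nhdsWithin] with δ hδ
      refine Eventually.of_forall fun x => ?_
      rw [conv_comm, Real.norm_eq_abs, abs_abs]
      exact (abs_sub _ _).trans (add_le_add (norm_conv_mollifier_le hM hδ x) (hM x))
    · exact integrableOn_const (isCompact_closedBall (0 : Eu d) r).measure_ne_top

/-- The commutator of mollification and transport by the vector field `c`. -/
noncomputable def mollCommutator (c : Eu d → Eu d) (w : Eu d → ℝ) (δ : ℝ) (x : Eu d) : ℝ :=
  conv w (mollifier d δ) x * divergence c x +
    ∫ y, w y * ⟪c x - c y, ∇ (mollifier d δ) (x - y)⟫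

theorem integrable_inner_gradient_mollifier {c : Eu d → Eu d} (hc : Continuous c) {w : Eu d → ℝ}
    (hw : LocallyIntegrable w volume) {δ : ℝ} (hδ : 0 < δ) (x : Eu d) :
    Integrable fun y => w y * ⟪c y, ∇ (mollifier d δ) (x - y)⟫ := by
  have hg : Continuous (∇ (mollifier d δ)) :=
    ContDiff.continuous_gradient ((contDiff_mollifier δ).of_le (by simp))
  have h1 : Continuous fun y => ⟪c y, ∇ (mollifier d δ) (x - y)⟫ :=
    hc.inner (hg.comp (continuous_const.sub continuous_id))
  have h2 : HasCompactSupport fun y => ⟪c y, ∇ (mollifier d δ) (x - y)⟫ := by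
    have h3 : HasCompactSupport fun y => ∇ (mollifier d δ) (x - y) :=
      (hasCompactSupport_mollifier hδ).gradient.comp_homeomorph (Homeomorph.subLeft x)
    exact h3.mono fun y hy => by
      contrapose! hy
      simp only [Function.mem_support, not_not] at hy ⊢
      rw [hy, inner_zero_right]
  have := hw.integrable_smul_left_of_hasCompactSupport h1 h2
  simpa [mul_comm] using this

theorem continuous_integral_inner_gradient {c : Eu d → Eu d} (hc : Continuous c) {w : Eu d → ℝ}
    (hw : LocallyIntegrable w volume) {δ : ℝ} (hδ : 0 < δ) :
    Continuous fun x => ∫ y, w y * ⟪c y, ∇ (mollifier d δ) (x - y)⟫ := by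
  have hg : Continuous (∇ (mollifier d δ)) :=
    ContDiff.continuous_gradient ((contDiff_mollifier δ).of_le (by simp))
  have h1 : LocallyIntegrable (fun y => w y • c y) volume := by
    rw [← locallyIntegrableOn_univ] at hw ⊢
    exact hw.smul_continuousOn isOpen_univ.isLocallyClosed hc.continuousOn
  have := (hasCompactSupport_mollifier hδ).gradient.continuous_convolution_right
    (innerSL ℝ : Eu d →L[ℝ] Eu d →L[ℝ] ℝ) h1 hg
  refine this.congr fun x => ?_
  refine integral_congr_ae (Eventually.of_forall fun y => ?_)
  change ⟪w y • c y, ∇ (mollifier d δ) (x - y)⟫ = _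
  rw [real_inner_smul_left]

/-- Mollified transport and transport of the mollification differ by this quantity. The definition
of `mollCommutator` displays the increment `c x - c y`, which is what gets estimated; the present
form is what the equation produces. -/
theorem commutator_eq {c : Eu d → Eu d} (hc : ContDiff ℝ 1 c) {w : Eu d → ℝ}
    (hw : LocallyIntegrable w volume) {δ : ℝ} (hδ : 0 < δ) (x : Eu d) :
    mollCommutator c w δ x = divergence (fun y => conv w (mollifier d δ) y • c y) x -
      ∫ y, w y * ⟪c y, ∇ (mollifier d δ) (x - y)⟫ := by
  have hm1 : ContDiff ℝ 1 (mollifier d δ) := (contDiff_mollifier δ).of_le (by simp)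
  have hmc := hasCompactSupport_mollifier (d := d) hδ
  rw [divergence_smul ((contDiff_conv (n := 1) hw hm1 hmc).differentiable (by norm_num) x)
    (hc.differentiable (by norm_num) x), gradient_conv hw hm1 hmc, mollCommutator, add_sub_assoc]
  congr 1
  have h1 := integrable_conv_integrand hw (ContDiff.continuous_gradient hm1) hmc.gradient x
  unfold conv
  rw [← integral_inner (𝕜 := ℝ) h1, ← integral_sub _ (integrable_inner_gradient_mollifier hc.continuous hw hδ x)]
  · refine integral_congr_ae (Eventually.of_forall fun y => ?_)
    simp only [inner_sub_left, inner_smul_right]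
    ring
  · have := h1.const_inner (𝕜 := ℝ) (c x)
    exact this

theorem continuous_commutator {c : Eu d → Eu d} (hc : ContDiff ℝ 1 c) {w : Eu d → ℝ}
    (hw : LocallyIntegrable w volume) {δ : ℝ} (hδ : 0 < δ) :
    Continuous (mollCommutator c w δ) := by
  have hm1 : ContDiff ℝ 1 (mollifier d δ) := (contDiff_mollifier δ).of_le (by simp)
  rw [funext (commutator_eq hc hw hδ)]
  exact (continuous_divergence ((contDiff_conv (n := 1) hw hm1
    (hasCompactSupport_mollifier hδ)).smul hc)).sub
    (continuous_integral_inner_gradient hc.continuous hw hδ)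

theorem commutator_sub {c : Eu d → Eu d} (hc : ContDiff ℝ 1 c) {w g : Eu d → ℝ}
    (hw : LocallyIntegrable w volume) (hg : LocallyIntegrable g volume) {δ : ℝ} (hδ : 0 < δ)
    (x : Eu d) : mollCommutator c (fun y => w y - g y) δ x =
      mollCommutator c w δ x - mollCommutator c g δ x := by
  have hi : ∀ f : Eu d → ℝ, LocallyIntegrable f volume →
      Integrable fun y => f y * ⟪c x - c y, ∇ (mollifier d δ) (x - y)⟫ := fun f hf =>
    integrable_inner_gradient_mollifier (c := fun y => c x - c y)
      (continuous_const.sub hc.continuous) hf hδ x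
  unfold mollCommutator
  rw [conv_sub_left hw hg (contDiff_mollifier δ).continuous (hasCompactSupport_mollifier hδ)]
  simp only [sub_mul]
  rw [integral_sub (hi w hw) (hi g hg)]
  ring

/-- On the support of the kernel `‖c x - c y‖ ≤ L δ`, while `∇ (mollifier d δ)` has `L¹` norm
proportional to `δ⁻¹`: the powers of `δ` cancel, and the bound is uniform in `δ`. The radius `r + 1`
contains all points involved because `δ ≤ 1`. -/
theorem integral_abs_commutator_le {c : Eu d → Eu d} (hc : ContDiff ℝ 1 c) {r A L : ℝ}
    (hA : ∀ x ∈ Metric.closedBall 0 r, |divergence c x| ≤ A) (hA0 : 0 ≤ A) (hL0 : 0 ≤ L)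
    (hL : ∀ x ∈ Metric.closedBall 0 (r + 1), ∀ y ∈ Metric.closedBall 0 (r + 1),
      ‖c x - c y‖ ≤ L * ‖x - y‖) {w : Eu d → ℝ} (hw : Integrable w) {δ : ℝ} (hδ : 0 < δ)
    (hδ1 : δ ≤ 1) :
    ∫ x in Metric.closedBall 0 r, |mollCommutator c w δ x| ≤
      (A + L * ∫ x, ‖∇ (unitBump d) x‖) * ∫ x, |w x| := by
  have hm1 : ContDiff ℝ 1 (mollifier d δ) := (contDiff_mollifier δ).of_le (by simp)
  have hgn : Integrable fun x => ‖∇ (mollifier d δ) x‖ :=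
    ((ContDiff.continuous_gradient hm1).integrable_of_hasCompactSupport
      (hasCompactSupport_mollifier hδ).gradient).norm
  have hz : ∀ z, ¬ ‖z‖ ≤ δ → ∇ (mollifier d δ) z = 0 := by
    intro z hz
    have h1 : z ∉ tsupport (mollifier d δ) := fun h => hz (by
      have := closure_minimal ((support_mollifier hδ).trans Metric.ball_subset_closedBall)
        Metric.isClosed_closedBall h
      simpa using this)
    have : z ∉ tsupport (∇ (mollifier d δ)) := fun hx' => h1 (by
      rw [gradient_eq_comp] at hx'
      exact tsupport_fderiv_subset ℝ (tsupport_comp_subset (map_zero _) _ hx'))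
    exact image_eq_zero_of_notMem_tsupport this
  have h2 := integrable_conv hw.abs hgn
  have i1 : Integrable (fun x => |conv w (mollifier d δ) x|) :=
    (integrable_conv hw (integrable_mollifier hδ)).abs
  have hpt : ∀ x ∈ Metric.closedBall (0 : Eu d) r, |mollCommutator c w δ x| ≤
      A * |conv w (mollifier d δ) x| +
      L * δ * conv (fun y => |w y|) (fun y => ‖∇ (mollifier d δ) y‖) x := by
    intro x hx
    unfold mollCommutator
    refine (abs_add_le _ _).trans (add_le_add ?_ ?_)
    · rw [abs_mul, mul_comm]
      exact mul_le_mul_of_nonneg_right (hA x hx) (abs_nonneg _)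
    · unfold conv
      rw [← integral_const_mul, ← Real.norm_eq_abs]
      refine norm_integral_le_of_norm_le ?_ (Eventually.of_forall fun y => ?_)
      · have := integrable_conv_integrand (w := fun y => |w y|)
          (g := fun y => ‖∇ (mollifier d δ) y‖) hw.abs.locallyIntegrable
          (ContDiff.continuous_gradient hm1).norm (hasCompactSupport_mollifier hδ).gradient.norm x
        exact this.const_mul _
      · rw [norm_mul, Real.norm_eq_abs, smul_eq_mul]
        by_cases hxy : ‖x - y‖ ≤ δ
        · have hy : y ∈ Metric.closedBall (0 : Eu d) (r + 1) := by
            simp only [mem_closedBall_zero_iff] at hx ⊢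
            have := norm_sub_le x (x - y)
            simp only [sub_sub_cancel] at this
            linarith
          have hx' : x ∈ Metric.closedBall (0 : Eu d) (r + 1) :=
            Metric.closedBall_subset_closedBall (by linarith) hx
          have h3 := hL x hx' y hy
          have h4 : ‖⟪c x - c y, ∇ (mollifier d δ) (x - y)⟫‖ ≤
              L * δ * ‖∇ (mollifier d δ) (x - y)‖ :=
            (norm_inner_le_norm _ _).trans (mul_le_mul_of_nonneg_right
              (h3.trans (mul_le_mul_of_nonneg_left hxy hL0)) (norm_nonneg _))
          calc |w y| * ‖⟪c x - c y, ∇ (mollifier d δ) (x - y)⟫‖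
              ≤ |w y| * (L * δ * ‖∇ (mollifier d δ) (x - y)‖) :=
                mul_le_mul_of_nonneg_left h4 (abs_nonneg _)
            _ = _ := by ring
        · rw [hz _ hxy, inner_zero_right, norm_zero, mul_zero]
          positivity
  have hcb : MeasurableSet (Metric.closedBall (0 : Eu d) r) := measurableSet_closedBall
  have hnn : ∀ x, 0 ≤ conv (fun y => |w y|) (fun y => ‖∇ (mollifier d δ) y‖) x := fun x =>
    integral_nonneg fun y => mul_nonneg (abs_nonneg _) (norm_nonneg _)
  calc ∫ x in Metric.closedBall 0 r, |mollCommutator c w δ x|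
      ≤ ∫ x in Metric.closedBall 0 r, (A * |conv w (mollifier d δ) x| +
      L * δ * conv (fun y => |w y|) (fun y => ‖∇ (mollifier d δ) y‖) x) := by
        refine setIntegral_mono_on ?_ ((i1.const_mul A).add (h2.const_mul _)).integrableOn hcb hpt
        exact (continuous_commutator hc hw.locallyIntegrable hδ).abs.continuousOn.integrableOn_compact
          (isCompact_closedBall 0 r)
    _ ≤ ∫ x, (A * |conv w (mollifier d δ) x| +
      L * δ * conv (fun y => |w y|) (fun y => ‖∇ (mollifier d δ) y‖) x) :=
        setIntegral_le_integral ((i1.const_mul A).add (h2.const_mul _))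
          (Eventually.of_forall fun x => add_nonneg (mul_nonneg hA0 (abs_nonneg _))
            (mul_nonneg (mul_nonneg hL0 hδ.le) (hnn x)))
    _ = A * (∫ x, |conv w (mollifier d δ) x|) +
        L * δ * ((∫ x, |w x|) * (δ⁻¹ * ∫ x, ‖∇ (unitBump d) x‖)) := by
        rw [integral_add (i1.const_mul A) (h2.const_mul _), integral_const_mul, integral_const_mul,
          integral_conv hw.abs hgn, integral_norm_gradient_mollifier hδ]
    _ ≤ A * (∫ x, |w x|) + L * δ * ((∫ x, |w x|) * (δ⁻¹ * ∫ x, ‖∇ (unitBump d) x‖)) := by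
        exact add_le_add (mul_le_mul_of_nonneg_left (integral_abs_conv_mollifier_le hw hδ) hA0) le_rfl
    _ = _ := by field_simp

theorem exists_lipschitz_bounds {c : Eu d → Eu d} (hc : ContDiff ℝ 1 c) (r : ℝ) :
    ∃ A L : ℝ, 0 ≤ A ∧ 0 ≤ L ∧ (∀ x ∈ Metric.closedBall (0 : Eu d) r, |divergence c x| ≤ A) ∧
      ∀ x ∈ Metric.closedBall (0 : Eu d) (r + 1), ∀ y ∈ Metric.closedBall (0 : Eu d) (r + 1),
      ‖c x - c y‖ ≤ L * ‖x - y‖ := by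
  obtain ⟨A, hA⟩ := (isCompact_closedBall (0 : Eu d) r).exists_bound_of_continuousOn
    (continuous_divergence hc).continuousOn
  obtain ⟨L, hL⟩ := (isCompact_closedBall (0 : Eu d) (r + 1)).exists_bound_of_continuousOn
    (hc.continuous_fderiv (by norm_num)).continuousOn
  refine ⟨|A|, |L|, abs_nonneg _, abs_nonneg _, fun x hx => (hA x hx).trans (le_abs_self _),
    fun x hx y hy => ?_⟩
  exact (convex_closedBall (0 : Eu d) (r + 1)).norm_image_sub_le_of_norm_fderiv_le
    (fun z _ => hc.differentiable (by norm_num) z)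
    (fun z hz => (hL z hz).trans (le_abs_self _)) hy hx

/-- Integration by parts moves the derivative from the kernel onto `g c`. Only mollifications of
continuous functions remain, and their limits cancel by the product rule for the divergence. -/
theorem commutator_eq_of_smooth {c : Eu d → Eu d} (hc : ContDiff ℝ 1 c) {g : Eu d → ℝ}
    (hg : g ∈ smoothTest d) {δ : ℝ} (hδ : 0 < δ) (x : Eu d) :
    mollCommutator c g δ x = conv (mollifier d δ) g x * divergence c x +
      ⟪c x, conv (mollifier d δ) (∇ g) x⟫ -
      conv (mollifier d δ) (divergence fun y => g y • c y) x := by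
  have hg1 : ContDiff ℝ 1 g := hg.1.of_le (by simp)
  have hm1 : ContDiff ℝ 1 (mollifier d δ) := (contDiff_mollifier δ).of_le (by simp)
  have hmc := hasCompactSupport_mollifier (d := d) hδ
  have hml : LocallyIntegrable (mollifier d δ) volume := (integrable_mollifier hδ).locallyIntegrable
  have hgl : LocallyIntegrable g volume := hg1.continuous.locallyIntegrable
  rw [commutator_eq hc hgl hδ, conv_comm g]
  rw [divergence_smul ((contDiff_conv (n := 1) hml hg1 hg.2).differentiable (by norm_num) x)
    (hc.differentiable (by norm_num) x), gradient_conv hml hg1 hg.2]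
  congr 1
  have h1 : ContDiff ℝ 1 fun y => mollifier d δ (x - y) := hm1.comp (contDiff_const.sub contDiff_id)
  have h2 : ContDiff ℝ 1 fun y => g y • c y := hg1.smul hc
  have h3 : HasCompactSupport fun y => g y • c y := hg.2.smul_right
  have h4 := integral_mul_divergence h1 h2 (Or.inr h3)
  have h5 : ∀ y, ∇ (fun y => mollifier d δ (x - y)) y = -∇ (mollifier d δ) (x - y) := by
    intro y
    refine ext_inner_left ℝ fun v => ?_
    rw [inner_gradient_eq, inner_neg_right, inner_gradient_eq]
    have e1 : HasFDerivAt (fun y : Eu d => x - y) (-ContinuousLinearMap.id ℝ (Eu d)) y :=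
      (hasFDerivAt_id y).const_sub x
    have e2 := ((hm1.differentiable (by norm_num)) (x - y)).hasFDerivAt.comp y e1
    have e3 : (fun y => mollifier d δ (x - y)) = mollifier d δ ∘ fun y => x - y := rfl
    rw [e3, e2.fderiv]
    simp
  have h6 : conv (mollifier d δ) (divergence fun y => g y • c y) x =
      ∫ y, mollifier d δ (x - y) * divergence (fun y => g y • c y) y := by
    rw [conv_comm]
    unfold conv
    simp [mul_comm]
  rw [h6, h4, ← integral_neg]
  refine integral_congr_ae (Eventually.of_forall fun y => ?_)
  simp only [h5, inner_neg_right, real_inner_smul_left, neg_neg]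

/-- The DiPerna-Lions lemma for a `C¹` field: convergence for smooth functions extends to `L¹` by
the bound uniform in `δ`. -/
theorem tendsto_integral_commutator {c : Eu d → Eu d} (hc : ContDiff ℝ 1 c) {w : Eu d → ℝ}
    (hw : Integrable w) (r : ℝ) :
    Tendsto (fun δ => ∫ x in Metric.closedBall 0 r, |mollCommutator c w δ x|) (𝓝[>] 0) (𝓝 0) := by
  obtain ⟨A, L, hA0, hL0, hA, hL⟩ := exists_lipschitz_bounds hc r
  have hN0 : 0 ≤ ∫ x, ‖∇ (unitBump d) x‖ := integral_nonneg fun x => norm_nonneg _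
  have hcb : IsCompact (Metric.closedBall (0 : Eu d) r) := isCompact_closedBall 0 r
  refine tendsto_zero_of_smooth (C := A + L * ∫ x, ‖∇ (unitBump d) x‖) (N := fun δ w =>
    ∫ x in Metric.closedBall 0 r, |mollCommutator c w δ x|) (by positivity)
    (fun δ w => integral_nonneg fun x => abs_nonneg _) ?_ (fun g hg => ?_) hw
  · filter_upwards [Ioo_mem_nhdsGT (zero_lt_one (α := ℝ))] with δ hδ w g hw hg
    have hwg : Integrable (fun x => w x - g x) := hw.sub hg
    have hint : ∀ f : Eu d → ℝ, Integrable f →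
        IntegrableOn (fun x => |mollCommutator c f δ x|) (Metric.closedBall 0 r) := fun f hf =>
      (continuous_commutator hc hf.locallyIntegrable hδ.1).abs.continuousOn.integrableOn_compact hcb
    have h1 := integral_abs_commutator_le hc hA hA0 hL0 hL hwg hδ.1 hδ.2.le
    have h2 : ∫ x in Metric.closedBall 0 r, |mollCommutator c w δ x| ≤
        ∫ x in Metric.closedBall 0 r, (|mollCommutator c g δ x| +
          |mollCommutator c (fun y => w y - g y) δ x|) := by
      refine setIntegral_mono (hint w hw) ((hint g hg).add (hint _ hwg)) fun x => ?_
      rw [commutator_sub hc hw.locallyIntegrable hg.locallyIntegrable hδ.1]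
      have := abs_add_le (mollCommutator c g δ x) (mollCommutator c w δ x - mollCommutator c g δ x)
      rwa [add_sub_cancel] at this
    rw [integral_add (hint g hg) (hint _ hwg)] at h2
    linarith
  · have hg1 : ContDiff ℝ 1 g := hg.1.of_le (by simp)
    have hgc := hg1.continuous
    have hgg := ContDiff.continuous_gradient hg1
    have hdc : Continuous (divergence fun y => g y • c y) := continuous_divergence (hg1.smul hc)
    have hdcs : HasCompactSupport (divergence fun y => g y • c y) :=
      HasCompactSupport.divergence hg.2.smul_right
    obtain ⟨M1, hM1⟩ := hgc.bounded_above_of_compact_support hg.2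
    obtain ⟨M2, hM2⟩ := hgg.bounded_above_of_compact_support hg.2.gradient
    obtain ⟨M3, hM3⟩ := hdc.bounded_above_of_compact_support hdcs
    obtain ⟨B, hB⟩ := hcb.exists_bound_of_continuousOn hc.continuous.continuousOn
    have hlim : ∀ x, Tendsto (fun δ => |mollCommutator c g δ x|) (𝓝[>] 0) (𝓝 0) := by
      intro x
      have h1 := (((tendsto_conv_mollifier hgc x).mul_const (divergence c x)).add
        ((tendsto_const_nhds (x := c x)).inner (tendsto_conv_mollifier hgg x))).sub
        (tendsto_conv_mollifier hdc x)
      rw [divergence_smul (hg1.differentiable (by norm_num) x)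
        (hc.differentiable (by norm_num) x), sub_self] at h1
      have h2 := h1.abs
      rw [abs_zero] at h2
      refine h2.congr' ?_
      filter_upwards [self_mem_nhdsWithin] with δ hδ
      rw [commutator_eq_of_smooth hc hg hδ]
    have key := tendsto_integral_filter_of_dominated_convergence
      (μ := volume.restrict (Metric.closedBall (0 : Eu d) r))
      (F := fun δ x => |mollCommutator c g δ x|) (f := fun _ => (0 : ℝ)) (l := 𝓝[>] 0)
      (fun _ => |M1| * A + |B| * |M2| + |M3|) ?_ ?_ ?_ (Eventually.of_forall hlim)
    · simpa using key
    · filter_upwards [self_mem_nhdsWithin] with δ hδ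
      exact ((continuous_commutator hc hgc.locallyIntegrable hδ).abs).aestronglyMeasurable
    · filter_upwards [self_mem_nhdsWithin] with δ hδ
      filter_upwards [ae_restrict_mem measurableSet_closedBall] with x hx
      have hδ : 0 < δ := hδ
      rw [commutator_eq_of_smooth hc hg hδ, Real.norm_eq_abs, abs_abs]
      have e1 := (norm_conv_mollifier_le hM1 hδ x).trans (le_abs_self _)
      have e2 := (norm_conv_mollifier_le hM2 hδ x).trans (le_abs_self _)
      have e3 := (norm_conv_mollifier_le hM3 hδ x).trans (le_abs_self _)
      have e4 := (hB x hx).trans (le_abs_self _)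
      have e5 := norm_inner_le_norm (𝕜 := ℝ) (c x) (conv (mollifier d δ) (∇ g) x)
      have e6 : ‖c x‖ * ‖conv (mollifier d δ) (∇ g) x‖ ≤ |B| * |M2| := by gcongr
      have e7 : |conv (mollifier d δ) g x * divergence c x| ≤ |M1| * A := by
        rw [abs_mul]
        exact mul_le_mul e1 (hA x hx) (abs_nonneg _) (abs_nonneg _)
      refine (abs_sub _ _).trans (add_le_add ((abs_add_le _ _).trans (add_le_add e7 ?_)) e3)
      exact e5.trans e6
    · exact integrableOn_const hcb.measure_ne_top

end Commutator

/-! ### Convex renormalizing functions of linear growth. -/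

section Huber

/-- A smooth convex function of linear growth which increases to `r²` as `M → ∞`. -/
noncomputable def huber (M r : ℝ) : ℝ := 2 * M * (√(M ^ 2 + r ^ 2) - M)

/-- The derivative of `huber M`. -/
noncomputable def huberDeriv (M r : ℝ) : ℝ := 2 * M * r / √(M ^ 2 + r ^ 2)

variable {M : ℝ}

theorem sqrt_huber_pos (hM : 0 < M) (r : ℝ) : 0 < √(M ^ 2 + r ^ 2) :=
  Real.sqrt_pos.2 (by positivity)

theorem hasDerivAt_sqrt_huber (hM : 0 < M) (r : ℝ) :
    HasDerivAt (fun r => √(M ^ 2 + r ^ 2)) (r / √(M ^ 2 + r ^ 2)) r := by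
  have h1 : HasDerivAt (fun r : ℝ => M ^ 2 + r ^ 2) (2 * r) r := by
    simpa using (hasDerivAt_pow 2 r).const_add (M ^ 2)
  convert! h1.sqrt (by positivity) using 1
  have := (sqrt_huber_pos hM r).ne'
  field_simp

theorem hasDerivAt_huber (hM : 0 < M) (r : ℝ) : HasDerivAt (huber M) (huberDeriv M r) r := by
  convert! ((hasDerivAt_sqrt_huber hM r).sub_const M).const_mul (2 * M) using 1
  unfold huberDeriv; ring

theorem contDiff_huberDeriv (hM : 0 < M) : ContDiff ℝ 1 (huberDeriv M) := by
  unfold huberDeriv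
  have h1 : ContDiff ℝ 1 fun r : ℝ => M ^ 2 + r ^ 2 := by fun_prop
  exact ContDiff.div (by fun_prop) (h1.sqrt fun r => by positivity)
    fun r => (sqrt_huber_pos hM r).ne'

theorem continuous_huber (M : ℝ) : Continuous (huber M) := by unfold huber; fun_prop

/-- Convexity of `huber M`; it gives the diffusion term its sign. -/
theorem deriv_huberDeriv_nonneg (hM : 0 < M) (r : ℝ) : 0 ≤ deriv (huberDeriv M) r := by
  have h0 := sqrt_huber_pos hM r
  have h1 : HasDerivAt (fun r : ℝ => 2 * M * r) (2 * M) r := by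
    simpa using (hasDerivAt_id r).const_mul (2 * M)
  have h2 := h1.div (hasDerivAt_sqrt_huber hM r) h0.ne'
  have h3 : deriv (huberDeriv M) r = _ := h2.deriv
  rw [h3]
  refine div_nonneg ?_ (sq_nonneg _)
  have h4 : √(M ^ 2 + r ^ 2) ^ 2 = M ^ 2 + r ^ 2 := Real.sq_sqrt (by positivity)
  have h5 : 2 * M * √(M ^ 2 + r ^ 2) - 2 * M * r * (r / √(M ^ 2 + r ^ 2)) =
      2 * M * (√(M ^ 2 + r ^ 2) ^ 2 - r ^ 2) / √(M ^ 2 + r ^ 2) := by field_simp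
  rw [h5, h4]
  have : M ^ 2 + r ^ 2 - r ^ 2 = M ^ 2 := by ring
  rw [this]
  positivity

theorem abs_huberDeriv_le (hM : 0 < M) (r : ℝ) : |huberDeriv M r| ≤ 2 * M := by
  unfold huberDeriv
  have h0 := sqrt_huber_pos hM r
  rw [abs_div, abs_of_pos h0, div_le_iff₀ h0, abs_mul, abs_of_pos (by positivity : 0 < 2 * M)]
  refine mul_le_mul_of_nonneg_left ?_ (by positivity)
  rw [← Real.sqrt_sq_eq_abs]
  exact Real.sqrt_le_sqrt (by nlinarith)

theorem huber_nonneg (hM : 0 < M) (r : ℝ) : 0 ≤ huber M r := by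
  refine mul_nonneg (by positivity) (sub_nonneg.2 ?_)
  exact Real.le_sqrt_of_sq_le (by nlinarith [sq_nonneg r])

theorem huber_zero (hM : 0 < M) : huber M 0 = 0 := by
  simp [huber, Real.sqrt_sq hM.le]

/-- Because `huber M` is Lipschitz, `L¹` convergence of the mollified solutions on balls suffices to
pass to the limit, which would fail for the square itself. -/
theorem abs_huber_sub_le (hM : 0 < M) (a b : ℝ) : |huber M a - huber M b| ≤ 2 * M * |a - b| := by
  have := (convex_univ : Convex ℝ (univ : Set ℝ)).norm_image_sub_le_of_norm_hasDerivWithin_le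
    (f := huber M) (f' := huberDeriv M) (C := 2 * M) (x := b) (y := a)
    (fun x _ => (hasDerivAt_huber hM x).hasDerivWithinAt) (fun x _ => abs_huberDeriv_le hM x)
    (mem_univ _) (mem_univ _)
  simpa using this

theorem huber_le_abs (hM : 0 < M) (r : ℝ) : huber M r ≤ 2 * M * |r| := by
  have := abs_huber_sub_le hM r 0
  rw [huber_zero hM, sub_zero, sub_zero] at this
  exact (le_abs_self _).trans this

theorem huber_le_sq (hM : 0 < M) (r : ℝ) : huber M r ≤ r ^ 2 := by
  unfold huber
  have h4 : √(M ^ 2 + r ^ 2) ^ 2 = M ^ 2 + r ^ 2 := Real.sq_sqrt (by positivity)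
  nlinarith [sq_nonneg (√(M ^ 2 + r ^ 2) - M)]

theorem tendsto_huber (r : ℝ) : Tendsto (fun n : ℕ => huber ((n : ℝ) + 1) r) atTop (𝓝 (r ^ 2)) := by
  have h1 : ∀ n : ℕ, r ^ 2 - r ^ 4 / ((n : ℝ) + 1) ≤ huber ((n : ℝ) + 1) r := by
    intro n
    have hM : (0 : ℝ) < (n : ℝ) + 1 := by positivity
    have hM1 : (1 : ℝ) ≤ (n : ℝ) + 1 := by linarith [n.cast_nonneg (α := ℝ)]
    generalize (n : ℝ) + 1 = M at hM hM1
    -- A second-order lower bound for the square root, with a remainder larger than the Taylor one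
    -- so that it holds for all `r` once `M ≥ 1`. Multiplied by `2 M`, it shows that `huber M r`
    -- falls short of `r²` by at most `r⁴ / M`.
    have h2 : M + r ^ 2 / (2 * M) - r ^ 4 / (2 * M ^ 2) ≤ √(M ^ 2 + r ^ 2) := by
      by_cases h0 : M + r ^ 2 / (2 * M) - r ^ 4 / (2 * M ^ 2) ≤ 0
      · exact h0.trans (Real.sqrt_nonneg _)
      push Not at h0
      refine Real.le_sqrt_of_sq_le ?_
      by_cases hr : r ^ 2 / (2 * M) ≤ r ^ 4 / (2 * M ^ 2)
      · have : M + r ^ 2 / (2 * M) - r ^ 4 / (2 * M ^ 2) ≤ M := by linarith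
        nlinarith [sq_nonneg r]
      · push Not at hr
        have e1 : r ^ 2 / (2 * M) = r ^ 2 / (2 * M) := rfl
        set q := r ^ 2 / (2 * M) - r ^ 4 / (2 * M ^ 2) with hq
        have hq0 : 0 < q := by linarith
        have e2 : 2 * M * q = r ^ 2 - r ^ 4 / M := by rw [hq]; field_simp
        have e3 : q ≤ r ^ 2 / (2 * M) := by
          have : 0 ≤ r ^ 4 / (2 * M ^ 2) := by positivity
          linarith
        have e4 : q ^ 2 ≤ (r ^ 2 / (2 * M)) ^ 2 := pow_le_pow_left₀ hq0.le e3 2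
        have e5 : (r ^ 2 / (2 * M)) ^ 2 ≤ r ^ 4 / M := by
          rw [div_pow, div_le_div_iff₀ (by positivity) hM]
          have : 0 ≤ r ^ 4 := by positivity
          nlinarith [mul_nonneg this hM.le, mul_nonneg this (mul_nonneg hM.le (sub_nonneg.2 hM1))]
        have : (M + r ^ 2 / (2 * M) - r ^ 4 / (2 * M ^ 2)) = M + q := by rw [hq]; ring
        rw [this]
        nlinarith
    unfold huber
    have h3 : r ^ 2 - r ^ 4 / M =
        2 * M * (M + r ^ 2 / (2 * M) - r ^ 4 / (2 * M ^ 2) - M) := by field_simp; ring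
    rw [h3]
    exact mul_le_mul_of_nonneg_left (by linarith) (by positivity)
  refine tendsto_of_tendsto_of_tendsto_of_le_of_le ?_ tendsto_const_nhds h1
    fun n => huber_le_sq (by positivity) r
  have := (tendsto_one_div_add_atTop_nhds_zero_nat (𝕜 := ℝ)).const_mul (r ^ 4)
  have h2 := this.const_sub (r ^ 2)
  simp only [mul_zero, sub_zero] at h2
  exact h2.congr fun n => by rw [mul_one_div]

end Huber

/-! ### The renormalized inequality at a fixed time. -/

section Renormalize

variable {d : ℕ}

/-- The terms in `⟪J, G⟫` cancel, as do those in `β' h ⟪J, X⟫`; the right side exceeds the left by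
exactly `e p k B ‖G‖²`. In the application `B` is the second derivative of the renormalizing
function, `G` the gradient of the ratio, `X` that of the cutoff and `J` the flux. -/
theorem inner_renormalize_le {J G X : Eu d} {e p h k B β β' : ℝ} (he : 0 ≤ e) (hp : 0 ≤ p)
    (hk : 0 ≤ k) (hB : 0 ≤ B) :
    ⟪h • J - e • (p • G), k • (B • G) + β' • X⟫ +
      ⟪J, k • ((-(B * h)) • G) + (β - β' * h) • X⟫ ≤
    β * ⟪J, X⟫ - e * ⟪p • X, β' • G⟫ := by
  have hc : ⟪X, G⟫ = ⟪G, X⟫ := real_inner_comm G X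
  simp only [inner_add_right, inner_sub_left, real_inner_smul_left, real_inner_smul_right, hc,
    real_inner_self_eq_norm_sq]
  have key : 0 ≤ e * (p * (k * (B * ‖G‖ ^ 2))) := by positivity
  linarith [key]

/-- The renormalized transport-diffusion inequality at a fixed time. -/
theorem integral_renormalize_le {β β' : ℝ → ℝ} (hβ : ∀ r, HasDerivAt β (β' r) r)
    (hβ' : ContDiff ℝ 1 β') (hββ : ∀ r, 0 ≤ deriv β' r) {p H χ : Eu d → ℝ} {j : Eu d → Eu d}
    {e : ℝ} (he : 0 ≤ e) (hp : ContDiff ℝ 2 p) (hp0 : ∀ x, 0 ≤ p x) (hH : ContDiff ℝ 2 H)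
    (hj : ContDiff ℝ 1 j) (hχ : ContDiff ℝ 2 χ) (hχc : HasCompactSupport χ) (hχ0 : ∀ x, 0 ≤ χ x) :
    ∫ x, χ x * (β' (H x) * -divergence (fun y => H y • j y - e • (p y • ∇ H y)) x +
      (β (H x) - β' (H x) * H x) * -divergence j x) ≤
    ∫ x, β (H x) * (⟪j x, ∇ χ x⟫ + e * divergence (fun y => p y • ∇ χ y) x) := by
  have hβ1 : ContDiff ℝ 1 β := by
    refine contDiff_one_iff_deriv.2 ⟨fun r => (hβ r).differentiableAt, ?_⟩
    rw [funext fun r => (hβ r).deriv]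
    exact hβ'.continuous
  have hp1 : ContDiff ℝ 1 p := hp.of_le (by norm_num)
  have hH1 : ContDiff ℝ 1 H := hH.of_le (by norm_num)
  have hχ1 : ContDiff ℝ 1 χ := hχ.of_le (by norm_num)
  have hgH : ContDiff ℝ 1 (∇ H) := ContDiff.gradient' (m := 1) (n := 2) hH (by norm_num)
  have hgχ : ContDiff ℝ 1 (∇ χ) := ContDiff.gradient' (m := 1) (n := 2) hχ (by norm_num)
  have hdH := hH1.differentiable (by norm_num)
  have hdχ := hχ1.differentiable (by norm_num)
  have hb1 : ContDiff ℝ 1 fun x => β (H x) := hβ1.comp hH1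
  have hb2 : ContDiff ℝ 1 fun x => β' (H x) := hβ'.comp hH1
  have hf1 : ContDiff ℝ 1 fun x => χ x * β' (H x) := hχ1.mul hb2
  have hf2 : ContDiff ℝ 1 fun x => χ x * (β (H x) - β' (H x) * H x) :=
    hχ1.mul (hb1.sub (hb2.mul hH1))
  have hv : ContDiff ℝ 1 fun y => H y • j y - e • (p y • ∇ H y) :=
    (hH1.smul hj).sub ((hp1.smul hgH).const_smul e)
  have hpχ : ContDiff ℝ 1 fun y => p y • ∇ χ y := hp1.smul hgχ
  have hc1 : HasCompactSupport fun x => χ x * β' (H x) :=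
    HasCompactSupport.mul_right (f := χ) (f' := fun x => β' (H x)) hχc
  have hc2 : HasCompactSupport fun x => χ x * (β (H x) - β' (H x) * H x) :=
    HasCompactSupport.mul_right (f := χ) (f' := fun x => β (H x) - β' (H x) * H x) hχc
  have hc3 : HasCompactSupport fun y => p y • ∇ χ y :=
    HasCompactSupport.smul_left (f := p) (f' := ∇ χ) hχc.gradient
  have hin : ∀ {u v : Eu d → Eu d}, Continuous u → Continuous v → HasCompactSupport v →
      Integrable fun x => ⟪u x, v x⟫ := fun {u v} hu hv hvc =>
    (hu.inner hv).integrable_of_hasCompactSupport (hvc.mono fun x hx => by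
        contrapose! hx
        simp only [Function.mem_support, not_not] at hx ⊢
        rw [hx, inner_zero_right])
  have I1 := integral_mul_divergence hf1 hv (Or.inl hc1)
  have I2 := integral_mul_divergence hf2 hj (Or.inl hc2)
  have I3 := integral_mul_divergence hb1 hpχ (Or.inr hc3)
  have i1 : Integrable fun x => ⟪H x • j x - e • (p x • ∇ H x), ∇ (fun x => χ x * β' (H x)) x⟫ :=
    hin hv.continuous (ContDiff.continuous_gradient hf1) hc1.gradient
  have i2 : Integrable fun x => ⟪j x, ∇ (fun x => χ x * (β (H x) - β' (H x) * H x)) x⟫ :=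
    hin hj.continuous (ContDiff.continuous_gradient hf2) hc2.gradient
  have i3 : Integrable fun x => ⟪j x, ∇ χ x⟫ := hin hj.continuous hgχ.continuous hχc.gradient
  have i3' : Integrable fun x => β (H x) * ⟪j x, ∇ χ x⟫ := by
    have : Integrable fun x => ⟪β (H x) • j x, ∇ χ x⟫ :=
      hin (hb1.continuous.smul hj.continuous) hgχ.continuous hχc.gradient
    simpa only [real_inner_smul_left] using this
  have i4 : Integrable fun x => ⟪p x • ∇ χ x, ∇ (fun x => β (H x)) x⟫ := by
    have := hin (ContDiff.continuous_gradient hb1) hpχ.continuous hc3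
    simpa only [real_inner_comm] using this
  have k1 : Integrable fun x => χ x * β' (H x) *
      divergence (fun y => H y • j y - e • (p y • ∇ H y)) x :=
    (hf1.continuous.mul (continuous_divergence hv)).integrable_of_hasCompactSupport hc1.mul_right
  have k2 : Integrable fun x => χ x * (β (H x) - β' (H x) * H x) * divergence j x :=
    (hf2.continuous.mul (continuous_divergence hj)).integrable_of_hasCompactSupport hc2.mul_right
  have k3 : Integrable fun x => β (H x) * divergence (fun y => p y • ∇ χ y) x :=
    (hb1.continuous.mul (continuous_divergence hpχ)).integrable_of_hasCompactSupport
      (HasCompactSupport.divergence hc3).mul_left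
  -- Integrating all divergences by parts reduces the claim to a pointwise inequality between
  -- first-order expressions.
  have L : ∫ x, χ x * (β' (H x) * -divergence (fun y => H y • j y - e • (p y • ∇ H y)) x +
      (β (H x) - β' (H x) * H x) * -divergence j x) =
      ∫ x, (⟪H x • j x - e • (p x • ∇ H x), ∇ (fun x => χ x * β' (H x)) x⟫ +
        ⟪j x, ∇ (fun x => χ x * (β (H x) - β' (H x) * H x)) x⟫) := by
    rw [integral_add i1 i2]
    have e1 : ∫ x, χ x * (β' (H x) * -divergence (fun y => H y • j y - e • (p y • ∇ H y)) x +
      (β (H x) - β' (H x) * H x) * -divergence j x) =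
      ∫ x, (-(χ x * β' (H x) * divergence (fun y => H y • j y - e • (p y • ∇ H y)) x) -
      χ x * (β (H x) - β' (H x) * H x) * divergence j x) :=
      integral_congr_ae (Eventually.of_forall fun x => by simp only; ring)
    have k1n : Integrable fun x => -(χ x * β' (H x) *
        divergence (fun y => H y • j y - e • (p y • ∇ H y)) x) := k1.neg
    rw [e1, integral_sub k1n k2, integral_neg, I1, I2]
    ring
  have R : ∫ x, β (H x) * (⟪j x, ∇ χ x⟫ + e * divergence (fun y => p y • ∇ χ y) x) =
      ∫ x, (β (H x) * ⟪j x, ∇ χ x⟫ - e * ⟪p x • ∇ χ x, ∇ (fun x => β (H x)) x⟫) := by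
    rw [integral_sub i3' (i4.const_mul e), integral_const_mul]
    have e1 : ∫ x, β (H x) * (⟪j x, ∇ χ x⟫ + e * divergence (fun y => p y • ∇ χ y) x) =
      ∫ x, (β (H x) * ⟪j x, ∇ χ x⟫ + e * (β (H x) * divergence (fun y => p y • ∇ χ y) x)) :=
      integral_congr_ae (Eventually.of_forall fun x => by simp only; ring)
    rw [e1, integral_add i3' (k3.const_mul e), integral_const_mul, I3]
    ring
  rw [L, R]
  refine integral_mono (i1.add i2) (i3'.sub (i4.const_mul e)) fun x => ?_
  have hβ2 : HasDerivAt β' (deriv β' (H x)) (H x) :=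
    (hβ'.differentiable (by norm_num) (H x)).hasDerivAt
  have g1 : ∇ (fun x => β (H x)) x = β' (H x) • ∇ H x := gradient_comp_real (hβ _) (hdH x)
  have g2 : ∇ (fun x => β' (H x)) x = deriv β' (H x) • ∇ H x := gradient_comp_real hβ2 (hdH x)
  have g3 : ∇ (fun x => χ x * β' (H x)) x =
      χ x • (deriv β' (H x) • ∇ H x) + β' (H x) • ∇ χ x := by
    rw [gradient_mul (hdχ x) (hb2.differentiable (by norm_num) x), g2]
  have hq : HasDerivAt (fun r => β r - β' r * r) (-(deriv β' (H x) * H x)) (H x) := by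
    have := (hβ (H x)).sub (hβ2.mul (hasDerivAt_id (H x)))
    convert! this using 1
    simp
  have g4 : ∇ (fun x => β (H x) - β' (H x) * H x) x = (-(deriv β' (H x) * H x)) • ∇ H x :=
    gradient_comp_real (β := fun r => β r - β' r * r) hq (hdH x)
  have g5 : ∇ (fun x => χ x * (β (H x) - β' (H x) * H x)) x =
      χ x • ((-(deriv β' (H x) * H x)) • ∇ H x) + (β (H x) - β' (H x) * H x) • ∇ χ x := by
    rw [gradient_mul (hdχ x) ((hb1.sub (hb2.mul hH1)).differentiable (by norm_num) x), ← g4]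
  rw [g1, g3, g5]
  exact inner_renormalize_le he (hp0 x) (hχ0 x) (hββ _)

theorem gradient_comp_sub_left {g : Eu d → ℝ} (hg : Differentiable ℝ g) (x y : Eu d) :
    ∇ (fun y => g (x - y)) y = -∇ g (x - y) := by
  refine ext_inner_left ℝ fun v => ?_
  rw [inner_gradient_eq, inner_neg_right, inner_gradient_eq]
  have e1 : HasFDerivAt (fun y : Eu d => x - y) (-ContinuousLinearMap.id ℝ (Eu d)) y :=
    (hasFDerivAt_id y).const_sub x
  have e2 := (hg (x - y)).hasFDerivAt.comp y e1
  have e3 : (fun y => g (x - y)) = g ∘ fun y => x - y := rfl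
  rw [e3, e2.fderiv]
  simp

theorem laplacian_comp_sub_left {g : Eu d → ℝ} (hg : ContDiff ℝ 2 g) (x y : Eu d) :
    Δ (fun y => g (x - y)) y = Δ g (x - y) := by
  have h1 : ContDiff ℝ 2 fun y => g (x - y) := hg.comp (contDiff_const.sub contDiff_id)
  rw [laplacian_eq_divergence h1, laplacian_eq_divergence hg,
    funext (gradient_comp_sub_left (hg.differentiable (by norm_num)) x)]
  have hG : ContDiff ℝ 1 (∇ g) := ContDiff.gradient' (m := 1) (n := 2) hg (by norm_num)
  have e1 : HasFDerivAt (fun y : Eu d => x - y) (-ContinuousLinearMap.id ℝ (Eu d)) y :=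
    (hasFDerivAt_id y).const_sub x
  have e2 := ((hG.differentiable (by norm_num) (x - y)).hasFDerivAt.comp y e1).neg
  unfold divergence
  have e3 : fderiv ℝ (fun y => -∇ g (x - y)) y = _ := e2.fderiv
  rw [e3]
  simp

end Renormalize

/-- A weak solution in the open time interval whose energy relative to `ρ` is at most `E`. -/
structure IsWeakSolution {d : ℕ} (ρ : ℝ → Eu d → ℝ) (c : ℝ → Eu d → Eu d) (κ : ℝ → ℝ) (E : ℝ)
    (w : ℝ → Eu d → ℝ) : Prop where
  meas : ∀ t ∈ Ioo (0 : ℝ) 1, AEStronglyMeasurable (w t) volume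
  energy_int : ∀ t ∈ Ioo (0 : ℝ) 1, Integrable (fun x => w t x ^ 2 / ρ t x)
  energy_le : ∀ t ∈ Ioo (0 : ℝ) 1, ∫ x, w t x ^ 2 / ρ t x ≤ E
  weak : ∀ φ : Eu d → ℝ, ContDiff ℝ (⊤ : ℕ∞) φ → HasCompactSupport φ → ∀ t ∈ Ioo (0 : ℝ) 1,
    HasDerivAt (fun τ => ∫ x, φ x * w τ x)
      (∫ x, (⟪c t x, ∇ φ x⟫ + κ t * Δ φ x) * w t x) t

section

variable {d : ℕ}

theorem gradient_mollifier_eq_zero {δ : ℝ} (hδ : 0 < δ) {z : Eu d} (hz : δ < ‖z‖) :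
    ∇ (mollifier d δ) z = 0 := by
  have h1 : z ∉ tsupport (mollifier d δ) := fun h => not_le.2 hz (by
    have := closure_minimal ((support_mollifier hδ).trans Metric.ball_subset_closedBall)
      Metric.isClosed_closedBall h
    simpa using this)
  have : z ∉ tsupport (∇ (mollifier d δ)) := fun hx' => h1 (by
    rw [gradient_eq_comp] at hx'
    exact tsupport_fderiv_subset ℝ (tsupport_comp_subset (map_zero _) _ hx'))
  exact image_eq_zero_of_notMem_tsupport this

theorem continuous_laplacian {f : Eu d → ℝ} (hf : ContDiff ℝ 2 f) : Continuous (Δ f) := by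
  rw [funext (laplacian_eq_divergence hf)]
  exact continuous_divergence (ContDiff.gradient' (m := 1) (n := 2) hf (by norm_num))

theorem HasCompactSupport.laplacian {f : Eu d → ℝ} (hf : ContDiff ℝ 2 f)
    (hfc : HasCompactSupport f) : HasCompactSupport (Δ f) := by
  rw [funext (laplacian_eq_divergence hf)]
  exact hfc.gradient.divergence

end

/-! ### The mollified equation and its renormalization. -/

namespace FlowPair

variable {d : ℕ} {ρ : ℝ → Eu d → ℝ} {b : ℝ → Eu d → Eu d} {ε : ℝ → ℝ} {E : ℝ} {w : ℝ → Eu d → ℝ}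

theorem integrable_weak (h : FlowPair ρ b)
    (hw : IsWeakSolution ρ (driftF ρ b ε) ε E w) {t : ℝ} (ht : t ∈ Ioo (0 : ℝ) 1) :
    Integrable (w t) :=
  integrable_of_energy (h.pos t (Ioo_sub ht)) (hw.meas t ht) (h.integrable t (Ioo_sub ht))
    (hw.energy_int t ht)

theorem abs_le_energy_add {p u : ℝ} (hp : 0 < p) : |u| ≤ u ^ 2 / p + p := by
  have h2 : u ^ 2 / p + p - |u| = ((|u| - p / 2) ^ 2 + 3 / 4 * p ^ 2) / p := by
    rw [← sq_abs u]; field_simp; ring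
  have : 0 ≤ u ^ 2 / p + p - |u| := by rw [h2]; positivity
  linarith

theorem integral_abs_weak_le (h : FlowPair ρ b)
    (hw : IsWeakSolution ρ (driftF ρ b ε) ε E w) {t : ℝ} (ht : t ∈ Ioo (0 : ℝ) 1) :
    ∫ x, |w t x| ≤ E + 1 := by
  have hi := h.integrable t (Ioo_sub ht)
  calc ∫ x, |w t x| ≤ ∫ x, (w t x ^ 2 / ρ t x + ρ t x) :=
        integral_mono (h.integrable_weak hw ht).abs ((hw.energy_int t ht).add hi)
          fun x => abs_le_energy_add (h.pos t (Ioo_sub ht) x)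
    _ = (∫ x, w t x ^ 2 / ρ t x) + ∫ x, ρ t x := integral_add (hw.energy_int t ht) hi
    _ ≤ E + 1 := add_le_add (hw.energy_le t ht) (h.integral_eq t (Ioo_sub ht)).le

/-- The time derivative of the mollified solution. -/
noncomputable def mollDeriv (ρ : ℝ → Eu d → ℝ) (b : ℝ → Eu d → Eu d) (ε : ℝ → ℝ)
    (w : ℝ → Eu d → ℝ) (δ t : ℝ) (x : Eu d) : ℝ :=
  -divergence (fun y => conv (w t) (mollifier d δ) y • driftF ρ b ε t y) x +
    mollCommutator (driftF ρ b ε t) (w t) δ x + ε t * Δ (conv (w t) (mollifier d δ)) x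

/-- With all derivatives placed on the kernel, `mollDeriv` is the weak equation tested against `y ↦
mollifier d δ (x - y)`. The same form bounds it locally uniformly by the `L¹` norm of the solution.
-/
theorem mollDeriv_eq (h : FlowPair ρ b) (hw : IsWeakSolution ρ (driftF ρ b ε) ε E w) {δ : ℝ}
    (hδ : 0 < δ) {t : ℝ} (ht : t ∈ Ioo (0 : ℝ) 1) (x : Eu d) :
    mollDeriv ρ b ε w δ t x =
      ∫ y, w t y * (-⟪driftF ρ b ε t y, ∇ (mollifier d δ) (x - y)⟫ +
        ε t * Δ (mollifier d δ) (x - y)) := by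
  have hwl := (h.integrable_weak hw ht).locallyIntegrable
  have hm2 : ContDiff ℝ 2 (mollifier d δ) := (contDiff_mollifier δ).of_le ENat.LEInfty.out
  have hmc := hasCompactSupport_mollifier (d := d) hδ
  have hc := h.contDiff_driftF ε ht
  rw [mollDeriv, commutator_eq hc hwl hδ, laplacian_conv hwl hm2 hmc]
  have i1 := integrable_inner_gradient_mollifier hc.continuous hwl hδ x
  have i2 : Integrable fun y => w t y * Δ (mollifier d δ) (x - y) :=
    integrable_conv_integrand hwl (continuous_laplacian hm2) (HasCompactSupport.laplacian hm2 hmc) x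
  have e1 : ∫ y, w t y * (-⟪driftF ρ b ε t y, ∇ (mollifier d δ) (x - y)⟫ +
      ε t * Δ (mollifier d δ) (x - y)) =
      ∫ y, (ε t * (w t y * Δ (mollifier d δ) (x - y)) -
        w t y * ⟪driftF ρ b ε t y, ∇ (mollifier d δ) (x - y)⟫) :=
    integral_congr_ae (Eventually.of_forall fun y => by simp only; ring)
  rw [e1, integral_sub (i2.const_mul _) i1, integral_const_mul]
  simp only [conv, smul_eq_mul]
  ring

theorem hasDerivAt_conv (h : FlowPair ρ b) (hw : IsWeakSolution ρ (driftF ρ b ε) ε E w) {δ : ℝ}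
    (hδ : 0 < δ) {t : ℝ} (ht : t ∈ Ioo (0 : ℝ) 1) (x : Eu d) :
    HasDerivAt (fun τ => conv (w τ) (mollifier d δ) x) (mollDeriv ρ b ε w δ t x) t := by
  have hm2 : ContDiff ℝ 2 (mollifier d δ) := (contDiff_mollifier δ).of_le ENat.LEInfty.out
  have h1 : ContDiff ℝ (⊤ : ℕ∞) fun y => mollifier d δ (x - y) :=
    (contDiff_mollifier δ).comp (contDiff_const.sub contDiff_id)
  have h2 : HasCompactSupport fun y => mollifier d δ (x - y) :=
    (hasCompactSupport_mollifier hδ).comp_homeomorph (Homeomorph.subLeft x)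
  have h3 := hw.weak _ h1 h2 t ht
  rw [h.mollDeriv_eq hw hδ ht]
  convert! h3 using 1
  · funext τ
    simp [conv, mul_comm]
  · refine integral_congr_ae (Eventually.of_forall fun y => ?_)
    simp only
    rw [gradient_comp_sub_left (hm2.differentiable (by norm_num)), laplacian_comp_sub_left hm2,
      inner_neg_right, mul_comm]

theorem continuous_mollDeriv (h : FlowPair ρ b) (hw : IsWeakSolution ρ (driftF ρ b ε) ε E w) {δ : ℝ}
    (hδ : 0 < δ) {t : ℝ} (ht : t ∈ Ioo (0 : ℝ) 1) : Continuous (mollDeriv ρ b ε w δ t) := by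
  have hwl := (h.integrable_weak hw ht).locallyIntegrable
  have hmc := hasCompactSupport_mollifier (d := d) hδ
  have hc := h.contDiff_driftF ε ht
  have h2 : ContDiff ℝ 2 (conv (w t) (mollifier d δ)) :=
    contDiff_conv (n := 2) hwl ((contDiff_mollifier δ).of_le ENat.LEInfty.out) hmc
  exact ((continuous_divergence ((h2.of_le (by norm_num)).smul hc)).neg.add
    (continuous_commutator hc hwl hδ)).add (continuous_const.mul (continuous_laplacian h2))

theorem exists_mollDeriv_bound (h : FlowPair ρ b) (hε : ContinuousOn ε (Icc 0 1))
    (hw : IsWeakSolution ρ (driftF ρ b ε) ε E w) {δ : ℝ}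
    (hδ : 0 < δ) {t : ℝ} (ht : t ∈ Ioo (0 : ℝ) 1) (r : ℝ) :
    ∃ r₁ > 0, Metric.ball t r₁ ⊆ Ioo 0 1 ∧ ∃ C, ∀ s ∈ Metric.ball t r₁,
      ∀ x ∈ Metric.closedBall 0 r, |mollDeriv ρ b ε w δ s x| ≤ C := by
  have hm2 : ContDiff ℝ 2 (mollifier d δ) := (contDiff_mollifier δ).of_le ENat.LEInfty.out
  have hmc := hasCompactSupport_mollifier (d := d) hδ
  have hE : 0 ≤ E + 1 := (integral_nonneg fun x => abs_nonneg _).trans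
    (h.integral_abs_weak_le hw ht)
  obtain ⟨r₁, hr₁, hsub, C, hC⟩ := exists_Icc_bound (h.cont_driftF hε).norm ht
    (isCompact_closedBall (0 : Eu d) (r + δ))
  obtain ⟨e, he⟩ := isCompact_Icc.exists_bound_of_continuousOn hε
  obtain ⟨G, hG⟩ := (ContDiff.continuous_gradient
    (hm2.of_le (by norm_num))).bounded_above_of_compact_support hmc.gradient
  obtain ⟨L, hL⟩ := (continuous_laplacian hm2).bounded_above_of_compact_support
    (HasCompactSupport.laplacian hm2 hmc)
  have hG0 : 0 ≤ G := (norm_nonneg _).trans (hG 0)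
  have hL0 : 0 ≤ L := (norm_nonneg _).trans (hL 0)
  refine ⟨r₁, hr₁, hsub, (|C| * G + |e| * L) * (E + 1), fun s hs x hx => ?_⟩
  rw [h.mollDeriv_eq hw hδ (hsub hs)]
  have hwi := h.integrable_weak hw (hsub hs)
  calc |∫ y, w s y * (-⟪driftF ρ b ε s y, ∇ (mollifier d δ) (x - y)⟫ +
        ε s * Δ (mollifier d δ) (x - y))| ≤ ∫ y, (|C| * G + |e| * L) * |w s y| := by
        rw [← Real.norm_eq_abs]
        refine norm_integral_le_of_norm_le (hwi.abs.const_mul _) (Eventually.of_forall fun y => ?_)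
        rw [norm_mul, Real.norm_eq_abs, mul_comm]
        refine mul_le_mul_of_nonneg_right ((abs_add_le _ _).trans (add_le_add ?_ ?_)) (abs_nonneg _)
        · rw [abs_neg]
          rcases le_or_gt ‖x - y‖ δ with hxy | hxy
          · have hy : y ∈ Metric.closedBall (0 : Eu d) (r + δ) := by
              simp only [mem_closedBall_zero_iff] at hx ⊢
              have := norm_sub_le x (x - y)
              simp only [sub_sub_cancel] at this
              linarith
            have h1 := hC s hs y hy
            rw [abs_norm] at h1
            exact (abs_real_inner_le_norm _ _).trans
              (mul_le_mul (h1.trans (le_abs_self _)) (hG _) (norm_nonneg _) (abs_nonneg _))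
          · rw [gradient_mollifier_eq_zero hδ hxy, inner_zero_right, abs_zero]
            positivity
        · rw [abs_mul]
          exact mul_le_mul ((he s (Ioo_sub (hsub hs))).trans (le_abs_self _)) (hL _) (abs_nonneg _)
            (abs_nonneg _)
    _ = (|C| * G + |e| * L) * ∫ y, |w s y| := integral_const_mul _ _
    _ ≤ (|C| * G + |e| * L) * (E + 1) :=
        mul_le_mul_of_nonneg_left (h.integral_abs_weak_le hw (hsub hs)) (by positivity)

/-- The derivative of `β(W / ρ) ρ` in time is `β'(H) W' + (β(H) - β'(H) H) ρ'` with `H = W / ρ`, and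
`ρ'` is given by the continuity equation. The work lies in the uniform bounds on the support of `χ`
that justify differentiating under the integral. -/
theorem hasDerivAt_integral_huber (h : FlowPair ρ b) (hε : ContinuousOn ε (Icc 0 1))
    (hw : IsWeakSolution ρ (driftF ρ b ε) ε E w) {M : ℝ} (hM : 0 < M) {χ : Eu d → ℝ}
    (hχ : χ ∈ smoothTest d) {δ : ℝ} (hδ : 0 < δ) {t : ℝ} (ht : t ∈ Ioo (0 : ℝ) 1) :
    HasDerivAt (fun τ => ∫ x, χ x * (huber M (conv (w τ) (mollifier d δ) x / ρ τ x) * ρ τ x))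
      (∫ x, χ x * (huberDeriv M (conv (w t) (mollifier d δ) x / ρ t x) * mollDeriv ρ b ε w δ t x +
        (huber M (conv (w t) (mollifier d δ) x / ρ t x) -
          huberDeriv M (conv (w t) (mollifier d δ) x / ρ t x) *
          (conv (w t) (mollifier d δ) x / ρ t x)) *
          -divergence (fun y => ρ t y • b t y) x)) t := by
  obtain ⟨r, hr⟩ := hχ.2.isCompact.isBounded.subset_closedBall (0 : Eu d)
  have hK := isCompact_closedBall (0 : Eu d) r
  obtain ⟨r₁, hr₁, hs₁, D, hD⟩ := h.exists_mollDeriv_bound hε hw hδ ht r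
  obtain ⟨r₂, hr₂, hs₂, J, hJ⟩ := exists_Icc_bound h.cont_divergence ht hK
  obtain ⟨r₃, hr₃, hs₃, P, hP⟩ := exists_Icc_bound (h.cont_rho.inv₀ fun q hq =>
    (h.pos _ (Ioo_sub hq.1) _).ne') ht hK
  obtain ⟨X, hX⟩ := hχ.1.continuous.bounded_above_of_compact_support hχ.2
  obtain ⟨m, hm⟩ := (contDiff_mollifier (d := d) δ).continuous.bounded_above_of_compact_support
    (hasCompactSupport_mollifier hδ)
  have hm0 : 0 ≤ m := (norm_nonneg _).trans (hm 0)
  have hX0 : 0 ≤ X := (norm_nonneg _).trans (hX 0)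
  have hE : 0 ≤ E + 1 := (integral_nonneg fun x => abs_nonneg _).trans
    (h.integral_abs_weak_le hw ht)
  have hWc : ∀ s ∈ Ioo (0 : ℝ) 1, Continuous (conv (w s) (mollifier d δ)) := fun s hs =>
    continuous_conv_mollifier (h.integrable_weak hw hs) hδ
  have hWb : ∀ s ∈ Ioo (0 : ℝ) 1, ∀ x, |conv (w s) (mollifier d δ) x| ≤ m * (E + 1) := by
    intro s hs x
    have hwi := h.integrable_weak hw hs
    calc |conv (w s) (mollifier d δ) x| ≤ ∫ y, m * |w s y| := by
          rw [← Real.norm_eq_abs]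
          refine norm_integral_le_of_norm_le (hwi.abs.const_mul _)
            (Eventually.of_forall fun y => ?_)
          rw [norm_smul, mul_comm]
          exact mul_le_mul_of_nonneg_right (hm _) (abs_nonneg _)
      _ = m * ∫ y, |w s y| := integral_const_mul _ _
      _ ≤ _ := mul_le_mul_of_nonneg_left (h.integral_abs_weak_le hw hs) hm0
  have hHc : ∀ s ∈ Ioo (0 : ℝ) 1, Continuous fun x => conv (w s) (mollifier d δ) x / ρ s x :=
    fun s hs => (hWc s hs).div (h.cont s (Ioo_sub hs)) fun x => (h.pos s (Ioo_sub hs) x).ne'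
  have hFc : ∀ s ∈ Ioo (0 : ℝ) 1, Continuous fun x => χ x *
      (huber M (conv (w s) (mollifier d δ) x / ρ s x) * ρ s x) := fun s hs =>
    hχ.1.continuous.mul (((continuous_huber M).comp (hHc s hs)).mul (h.cont s (Ioo_sub hs)))
  set R := min r₁ (min r₂ r₃)
  have hR : 0 < R := lt_min hr₁ (lt_min hr₂ hr₃)
  have hb1 : Metric.ball t R ⊆ Metric.ball t r₁ := Metric.ball_subset_ball (min_le_left _ _)
  have hb2 : Metric.ball t R ⊆ Metric.ball t r₂ :=
    Metric.ball_subset_ball ((min_le_right _ _).trans (min_le_left _ _))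
  have hb3 : Metric.ball t R ⊆ Metric.ball t r₃ :=
    Metric.ball_subset_ball ((min_le_right _ _).trans (min_le_right _ _))
  refine hasDerivAt_integral_of_compact
    (F' := fun s x => χ x * (huberDeriv M (conv (w s) (mollifier d δ) x / ρ s x) *
      mollDeriv ρ b ε w δ s x + (huber M (conv (w s) (mollifier d δ) x / ρ s x) -
          huberDeriv M (conv (w s) (mollifier d δ) x / ρ s x) *
          (conv (w s) (mollifier d δ) x / ρ s x)) * -divergence (fun y => ρ s y • b s y) x))
    (C := X * (2 * M * |D| + (2 * M * (m * (E + 1) * |P|) + 2 * M * (m * (E + 1) * |P|)) * |J|))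
    hR hK
    (fun s hs => (hFc s (hs₁ (hb1 hs))).aestronglyMeasurable)
    ((hFc t ht).integrable_of_hasCompactSupport hχ.2.mul_right) ?_ ?_ ?_ ?_
  · have h1 := (contDiff_huberDeriv hM).continuous.comp (hHc t ht)
    have h2 := (continuous_huber M).comp (hHc t ht)
    exact (hχ.1.continuous.mul ((h1.mul (h.continuous_mollDeriv hw hδ ht)).add
      ((h2.sub (h1.mul (hHc t ht))).mul
        (continuous_divergence (h.contDiff_flux ht)).neg))).aestronglyMeasurable
  · intro s hs x hx
    have hs' := hs₁ (hb1 hs)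
    have e1 := (hD s (hb1 hs) x hx).trans (le_abs_self _)
    have e2 := (hJ s (hb2 hs) x hx).trans (le_abs_self _)
    have e3 := (hP s (hb3 hs) x hx).trans (le_abs_self _)
    have e4 : |conv (w s) (mollifier d δ) x / ρ s x| ≤ m * (E + 1) * |P| := by
      rw [div_eq_mul_inv, abs_mul]
      exact mul_le_mul (hWb s hs' x) e3 (abs_nonneg _) (by positivity)
    have e5 : |huber M (conv (w s) (mollifier d δ) x / ρ s x)| ≤ 2 * M * (m * (E + 1) * |P|) := by
      rw [abs_of_nonneg (huber_nonneg hM _)]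
      exact (huber_le_abs hM _).trans (mul_le_mul_of_nonneg_left e4 (by positivity))
    have e6 := abs_huberDeriv_le hM (conv (w s) (mollifier d δ) x / ρ s x)
    rw [abs_mul]
    refine mul_le_mul (hX x) ((abs_add_le _ _).trans (add_le_add ?_ ?_)) (abs_nonneg _) hX0
    · rw [abs_mul]
      exact mul_le_mul e6 e1 (abs_nonneg _) (by positivity)
    · rw [abs_mul, abs_neg]
      refine mul_le_mul ((abs_sub _ _).trans (add_le_add e5 ?_)) e2 (abs_nonneg _) (by positivity)
      rw [abs_mul]
      exact mul_le_mul e6 e4 (abs_nonneg _) (by positivity)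
  · intro s _ x hx
    have : x ∉ tsupport χ := fun h' => hx (hr h')
    simp [image_eq_zero_of_notMem_tsupport this]
  · intro s hs x
    have hs' := hs₁ (hb1 hs)
    have hpos := (h.pos s (Ioo_sub hs') x).ne'
    have d1 := h.hasDerivAt_conv hw hδ hs' x
    have d2 := h.deriv s hs' x
    have d3 := (hasDerivAt_huber hM _).comp s (d1.div d2 hpos)
    have d4 := (d3.mul d2).const_mul (χ x)
    refine d4.congr_deriv ?_
    simp only [Function.comp, Pi.div_apply]
    field_simp
    ring

end FlowPair

/-! ### The mollified ratio, the cutoff error and the limit of vanishing mollification. -/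

namespace FlowPair

variable {d : ℕ} {ρ : ℝ → Eu d → ℝ} {b : ℝ → Eu d → Eu d} {ε : ℝ → ℝ} {E : ℝ} {w : ℝ → Eu d → ℝ}

theorem fderiv_eq_innerSL (f : Eu d → ℝ) (x : Eu d) : fderiv ℝ f x = innerSL ℝ (∇ f x) := by
  ext v
  rw [innerSL_apply_apply, real_inner_comm, inner_gradient_eq]

theorem fderiv_driftF (h : FlowPair ρ b) {t : ℝ} (ht : t ∈ Ioo (0 : ℝ) 1) (x : Eu d) :
    fderiv ℝ (driftF ρ b ε t) x = fderiv ℝ (b t) x + ε t • ((ρ t x)⁻¹ • fderiv ℝ (∇ (ρ t)) x +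
      ContinuousLinearMap.smulRightL ℝ (Eu d) (Eu d)
        ((-((ρ t x) ^ 2)⁻¹) • innerSL ℝ (∇ (ρ t) x)) (∇ (ρ t) x)) := by
  have e1 : driftF ρ b ε t = fun x => b t x + ε t • ((ρ t x)⁻¹ • ∇ (ρ t) x) := by
    funext x; rw [driftF, h.score_eq ht]
  have d1 : DifferentiableAt ℝ (b t) x := (h.contDiff_b _ ht).differentiable (by norm_num) _
  have d2 : DifferentiableAt ℝ (ρ t) x := (h.contDiff _ ht).differentiable (by norm_num) _
  have d3 : DifferentiableAt ℝ (∇ (ρ t)) x :=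
    (ContDiff.gradient' (m := 1) (n := 2) (h.contDiff _ ht) (by norm_num)).differentiable
      (by norm_num) _
  have d4 : HasFDerivAt (fun x => (ρ t x)⁻¹) ((-((ρ t x) ^ 2)⁻¹) • innerSL ℝ (∇ (ρ t) x)) x := by
    rw [← fderiv_eq_innerSL]
    exact (hasDerivAt_inv (h.pos t (Ioo_sub ht) x).ne').comp_hasFDerivAt x d2.hasFDerivAt
  have d5 := (d4.smul d3.hasFDerivAt).const_smul (ε t)
  have d6 := d1.hasFDerivAt.add d5
  rw [e1]
  exact d6.fderiv

/-- Joint continuity gives Lipschitz constants of the drift that are uniform over compact time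
intervals, hence a bound on the commutator that dominates in time. -/
theorem cont_fderiv_driftF (h : FlowPair ρ b) (hε : ContinuousOn ε (Icc 0 1)) :
    ContinuousOn (fun q : ℝ × Eu d => fderiv ℝ (driftF ρ b ε q.1) q.2) (Ioo 0 1 ×ˢ univ) := by
  have h1 : ContinuousOn (fun q : ℝ × Eu d => ε q.1) (Ioo 0 1 ×ˢ univ) :=
    hε.comp continuousOn_fst fun q hq => Ioo_sub hq.1
  have hne : ∀ q ∈ Ioo (0 : ℝ) 1 ×ˢ (univ : Set (Eu d)), ρ q.1 q.2 ≠ 0 := fun q hq =>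
    (h.pos _ (Ioo_sub hq.1) _).ne'
  have hi := h.cont_rho.inv₀ hne
  have hi2 := (h.cont_rho.pow 2).inv₀ fun q hq => pow_ne_zero 2 (hne q hq)
  have hs : ContinuousOn (fun q : ℝ × Eu d => innerSL ℝ (∇ (ρ q.1) q.2)) (Ioo 0 1 ×ˢ univ) :=
    (innerSL ℝ : Eu d →L[ℝ] Eu d →L[ℝ] ℝ).continuous.comp_continuousOn h.cont_grad
  have hs1 := hi2.neg.smul hs
  have hs2 := ((ContinuousLinearMap.smulRightL ℝ (Eu d) (Eu d)).continuous.comp_continuousOn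
    hs1).clm_apply h.cont_grad
  have hs3 := h.cont_fderiv_b.add (h1.smul ((hi.smul h.cont_hess).add hs2))
  exact hs3.congr fun q hq => h.fderiv_driftF hq.1 q.2

/-- The error term of the cut-off function `χ` in the renormalized equation. -/
noncomputable def cutoffFlux (ρ : ℝ → Eu d → ℝ) (b : ℝ → Eu d → Eu d) (ε : ℝ → ℝ) (χ : Eu d → ℝ)
    (t : ℝ) (x : Eu d) : ℝ :=
  ⟪ρ t x • b t x, ∇ χ x⟫ + ε t * divergence (fun y => ρ t y • ∇ χ y) x

theorem cutoffFlux_eq (h : FlowPair ρ b) {χ : Eu d → ℝ} (hχ : χ ∈ smoothTest d) {t : ℝ}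
    (ht : t ∈ Ioo (0 : ℝ) 1) (x : Eu d) : cutoffFlux ρ b ε χ t x =
      ρ t x * ⟪b t x, ∇ χ x⟫ + ε t * (ρ t x * Δ χ x + ⟪∇ χ x, ∇ (ρ t) x⟫) := by
  have hχ2 : ContDiff ℝ 2 χ := hχ.1.of_le ENat.LEInfty.out
  have hgχ : ContDiff ℝ 1 (∇ χ) := ContDiff.gradient' (m := 1) (n := 2) hχ2 (by norm_num)
  rw [cutoffFlux, divergence_smul ((h.contDiff t ht).differentiable (by norm_num) x)
    (hgχ.differentiable (by norm_num) x), laplacian_eq_divergence hχ2, real_inner_smul_left]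

theorem cont_cutoffFlux (h : FlowPair ρ b) (hε : ContinuousOn ε (Icc 0 1)) {χ : Eu d → ℝ}
    (hχ : χ ∈ smoothTest d) :
    ContinuousOn (fun q : ℝ × Eu d => cutoffFlux ρ b ε χ q.1 q.2) (Ioo 0 1 ×ˢ univ) := by
  have h1 : ContinuousOn (fun q : ℝ × Eu d => ε q.1) (Ioo 0 1 ×ˢ univ) :=
    hε.comp continuousOn_fst fun q hq => Ioo_sub hq.1
  have hχ2 : ContDiff ℝ 2 χ := hχ.1.of_le ENat.LEInfty.out
  have hg : ContinuousOn (fun q : ℝ × Eu d => ∇ χ q.2) (Ioo 0 1 ×ˢ univ) :=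
    ((ContDiff.continuous_gradient (hχ2.of_le (by norm_num))).comp continuous_snd).continuousOn
  have hl : ContinuousOn (fun q : ℝ × Eu d => Δ χ q.2) (Ioo 0 1 ×ˢ univ) :=
    ((continuous_laplacian hχ2).comp continuous_snd).continuousOn
  exact ((h.cont_rho.mul (h.cont_b.inner hg)).add (h1.mul ((h.cont_rho.mul hl).add
    (hg.inner h.cont_grad)))).congr fun q hq => h.cutoffFlux_eq hχ hq.1 _

theorem cutoffFlux_eq_zero (h : FlowPair ρ b) {χ : Eu d → ℝ} (hχ : χ ∈ smoothTest d) {t : ℝ}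
    (ht : t ∈ Ioo (0 : ℝ) 1) {x : Eu d} (hx : x ∉ tsupport χ) : cutoffFlux ρ b ε χ t x = 0 := by
  have hχ2 : ContDiff ℝ 2 χ := hχ.1.of_le ENat.LEInfty.out
  have e0 : ∇ χ =ᶠ[𝓝 x] 0 := by
    have h1 := (notMem_tsupport_iff_eventuallyEq.1 hx)
    filter_upwards [h1.eventuallyEq_nhds] with y hy
    rw [gradient_eq_comp, Function.comp_apply, hy.fderiv_eq]
    simp
  have e1 : ∇ χ x = 0 := e0.eq_of_nhds
  have e2 : Δ χ x = 0 := by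
    rw [laplacian_eq_divergence hχ2, divergence, e0.fderiv_eq]
    simp
  rw [h.cutoffFlux_eq hχ ht, e1, e2]
  simp

/-- The identity `W b_F - ε ∇W = H ρ b - ε ρ ∇H` for `H = W / ρ`: the score drift turns the
diffusion of `W` into a diffusion of the ratio, which is the structure `integral_renormalize_le`
requires. The commutator is the only error. -/
theorem mollDeriv_eq_add (h : FlowPair ρ b) (hw : IsWeakSolution ρ (driftF ρ b ε) ε E w) {δ : ℝ}
    (hδ : 0 < δ) {t : ℝ} (ht : t ∈ Ioo (0 : ℝ) 1) (x : Eu d) :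
    mollDeriv ρ b ε w δ t x = -divergence (fun y =>
      (conv (w t) (mollifier d δ) y / ρ t y) • (ρ t y • b t y) -
        ε t • (ρ t y • ∇ (fun z => conv (w t) (mollifier d δ) z / ρ t z) y)) x +
      mollCommutator (driftF ρ b ε t) (w t) δ x := by
  have hwl := (h.integrable_weak hw ht).locallyIntegrable
  have hmc := hasCompactSupport_mollifier (d := d) hδ
  have hc := h.contDiff_driftF ε ht
  have h2 : ContDiff ℝ 2 (conv (w t) (mollifier d δ)) :=
    contDiff_conv (n := 2) hwl ((contDiff_mollifier δ).of_le ENat.LEInfty.out) hmc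
  have hpos : ∀ y, ρ t y ≠ 0 := fun y => (h.pos t (Ioo_sub ht) y).ne'
  have hH : ContDiff ℝ 2 fun z => conv (w t) (mollifier d δ) z / ρ t z :=
    h2.div (h.contDiff t ht) hpos
  have e1 : (fun y => (conv (w t) (mollifier d δ) y / ρ t y) • (ρ t y • b t y) -
        ε t • (ρ t y • ∇ (fun z => conv (w t) (mollifier d δ) z / ρ t z) y)) =
      fun y => conv (w t) (mollifier d δ) y • driftF ρ b ε t y +
        (-ε t) • ∇ (conv (w t) (mollifier d δ)) y := by
    funext y
    have e2 : conv (w t) (mollifier d δ) =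
        fun z => (conv (w t) (mollifier d δ) z / ρ t z) * ρ t z := by
      funext z; rw [div_mul_cancel₀ _ (hpos z)]
    have e3 := gradient_mul (hH.differentiable (by norm_num) y)
      ((h.contDiff t ht).differentiable (by norm_num) y)
    rw [← e2] at e3
    have e4 : conv (w t) (mollifier d δ) y * (ε t * (ρ t y)⁻¹) =
      ε t * (conv (w t) (mollifier d δ) y / ρ t y) := by rw [div_eq_mul_inv]; ring
    rw [e3, driftF, h.score_eq ht]
    simp only [smul_add, smul_smul, neg_smul, div_mul_cancel₀ _ (hpos y), neg_mul]
    rw [e4]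
    abel
  have h3 : ContDiff ℝ 1 (∇ (conv (w t) (mollifier d δ))) :=
    ContDiff.gradient' (m := 1) (n := 2) h2 (by norm_num)
  have d1 : DifferentiableAt ℝ (fun y => conv (w t) (mollifier d δ) y • driftF ρ b ε t y) x :=
    (((h2.of_le (by norm_num : (1 : WithTop ℕ∞) ≤ 2)).smul hc).differentiable (by norm_num)) x
  have d2 := h3.differentiable (by norm_num) x
  have d3 : DifferentiableAt ℝ (fun y => (-ε t) • ∇ (conv (w t) (mollifier d δ)) y) x :=
    d2.fun_const_smul _
  rw [e1, divergence_add d1 d3, divergence_const_smul _ d2, mollDeriv,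
    laplacian_eq_divergence h2]
  ring

theorem integral_huber_deriv_le (h : FlowPair ρ b)
    (hw : IsWeakSolution ρ (driftF ρ b ε) ε E w) {M : ℝ} (hM : 0 < M) {χ : Eu d → ℝ}
    (hχ : χ ∈ smoothTest d) (hχ0 : ∀ x, 0 ≤ χ x) {X r : ℝ} (hX : ∀ x, χ x ≤ X)
    (hr : tsupport χ ⊆ Metric.closedBall 0 r) {δ : ℝ} (hδ : 0 < δ) {t : ℝ}
    (ht : t ∈ Ioo (0 : ℝ) 1) (hε0 : 0 ≤ ε t) :
    ∫ x, χ x * (huberDeriv M (conv (w t) (mollifier d δ) x / ρ t x) * mollDeriv ρ b ε w δ t x +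
        (huber M (conv (w t) (mollifier d δ) x / ρ t x) -
          huberDeriv M (conv (w t) (mollifier d δ) x / ρ t x) *
          (conv (w t) (mollifier d δ) x / ρ t x)) * -divergence (fun y => ρ t y • b t y) x) ≤
      (∫ x, cutoffFlux ρ b ε χ t x * huber M (conv (w t) (mollifier d δ) x / ρ t x)) +
      2 * M * X * ∫ x in Metric.closedBall 0 r, |mollCommutator (driftF ρ b ε t) (w t) δ x| := by
  have hwl := (h.integrable_weak hw ht).locallyIntegrable
  have hmc := hasCompactSupport_mollifier (d := d) hδ
  have hc := h.contDiff_driftF ε ht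
  have h2 : ContDiff ℝ 2 (conv (w t) (mollifier d δ)) :=
    contDiff_conv (n := 2) hwl ((contDiff_mollifier δ).of_le ENat.LEInfty.out) hmc
  have hpos : ∀ y, ρ t y ≠ 0 := fun y => (h.pos t (Ioo_sub ht) y).ne'
  set H : Eu d → ℝ := fun z => conv (w t) (mollifier d δ) z / ρ t z with hHdef
  have hH : ContDiff ℝ 2 H := h2.div (h.contDiff t ht) hpos
  set v : Eu d → Eu d := fun y => H y • (ρ t y • b t y) - ε t • (ρ t y • ∇ H y) with hv
  have hX0 : 0 ≤ X := (hχ0 0).trans (hX 0)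
  have key := integral_renormalize_le (hasDerivAt_huber hM) (contDiff_huberDeriv hM)
    (deriv_huberDeriv_nonneg hM) hε0 (h.contDiff t ht) (fun x => (h.pos t (Ioo_sub ht) x).le) hH
    (h.contDiff_flux ht) (hχ.1.of_le ENat.LEInfty.out) hχ.2 hχ0
  have c1 : Continuous fun x => huberDeriv M (H x) :=
    (contDiff_huberDeriv hM).continuous.comp hH.continuous
  have c2 : Continuous fun x => huber M (H x) := (continuous_huber M).comp hH.continuous
  have hvc : Continuous fun x => divergence v x := continuous_divergence
    ((((hH.of_le (by norm_num)).smul (h.contDiff_flux ht))).sub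
      (ContDiff.const_smul (ε t) (((h.contDiff t ht).of_le (by norm_num)).smul
        (ContDiff.gradient' (m := 1) (n := 2) hH (by norm_num)))))
  have hjc : Continuous fun x => divergence (fun y => ρ t y • b t y) x :=
    continuous_divergence (h.contDiff_flux ht)
  have hcc := continuous_commutator hc hwl hδ
  have i1 : Integrable fun x => χ x * (huberDeriv M (H x) * -divergence v x +
      (huber M (H x) - huberDeriv M (H x) * H x) * -divergence (fun y => ρ t y • b t y) x) :=
    (hχ.1.continuous.mul ((c1.mul hvc.neg).add ((c2.sub (c1.mul hH.continuous)).mul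
      hjc.neg))).integrable_of_hasCompactSupport hχ.2.mul_right
  have i2 : Integrable fun x => χ x * (huberDeriv M (H x) *
      mollCommutator (driftF ρ b ε t) (w t) δ x) :=
    (hχ.1.continuous.mul (c1.mul hcc)).integrable_of_hasCompactSupport hχ.2.mul_right
  have e1 : ∫ x, χ x * (huberDeriv M (H x) * mollDeriv ρ b ε w δ t x +
        (huber M (H x) - huberDeriv M (H x) * H x) * -divergence (fun y => ρ t y • b t y) x) =
      (∫ x, χ x * (huberDeriv M (H x) * -divergence v x +
      (huber M (H x) - huberDeriv M (H x) * H x) * -divergence (fun y => ρ t y • b t y) x)) +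
      ∫ x, χ x * (huberDeriv M (H x) * mollCommutator (driftF ρ b ε t) (w t) δ x) := by
    rw [← integral_add i1 i2]
    refine integral_congr_ae (Eventually.of_forall fun x => ?_)
    simp only
    rw [h.mollDeriv_eq_add hw hδ ht]
    ring
  have e2 : ∫ x, huber M (H x) * (⟪ρ t x • b t x, ∇ χ x⟫ +
      ε t * divergence (fun y => ρ t y • ∇ χ y) x) =
      ∫ x, cutoffFlux ρ b ε χ t x * huber M (H x) :=
    integral_congr_ae (Eventually.of_forall fun x => mul_comm _ _)
  have e3 : ∫ x, χ x * (huberDeriv M (H x) * mollCommutator (driftF ρ b ε t) (w t) δ x) ≤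
      ∫ x in Metric.closedBall 0 r, 2 * M * X * |mollCommutator (driftF ρ b ε t) (w t) δ x| := by
    have hz : ∀ x ∉ Metric.closedBall (0 : Eu d) r, χ x * (huberDeriv M (H x) *
        mollCommutator (driftF ρ b ε t) (w t) δ x) = 0 := fun x hx => by
      rw [image_eq_zero_of_notMem_tsupport fun h' => hx (hr h'), zero_mul]
    rw [← setIntegral_eq_integral_of_forall_compl_eq_zero hz]
    refine setIntegral_mono i2.integrableOn ?_ fun x => ?_
    · exact ((continuous_const.mul hcc.abs).continuousOn).integrableOn_compact
        (isCompact_closedBall 0 r)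
    · have := abs_huberDeriv_le hM (H x)
      refine (le_abs_self _).trans ?_
      simp only
      rw [abs_mul, abs_mul, abs_of_nonneg (hχ0 x), ← mul_assoc, mul_comm (2 * M) X]
      exact mul_le_mul_of_nonneg_right (mul_le_mul (hX x) this (abs_nonneg _) hX0) (abs_nonneg _)
  rw [integral_const_mul] at e3
  rw [e1, ← e2]
  exact add_le_add key e3

/-- The factor `1 / p` created by the linear growth of `huber M` is cancelled by `|Φ| ≤ C p`. -/
theorem integrable_mul_huber {p u Φ : Eu d → ℝ} (hpc : Continuous p) (hp : ∀ x, 0 < p x)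
    (hu : Integrable u) {M : ℝ} (hM : 0 < M) (hΦ : AEStronglyMeasurable Φ volume) {C : ℝ}
    (hC : ∀ x, |Φ x| ≤ C * p x) : Integrable fun x => Φ x * huber M (u x / p x) := by
  refine (hu.abs.const_mul (C * (2 * M))).mono' ?_ (Eventually.of_forall fun x => ?_)
  · exact hΦ.mul ((continuous_huber M).comp_aestronglyMeasurable
      (hu.1.div₀ hpc.aestronglyMeasurable))
  · have h1 : |huber M (u x / p x)| ≤ 2 * M * (|u x| / p x) := by
      have h2 := huber_le_abs hM (u x / p x)
      rwa [abs_div, abs_of_pos (hp x), ← abs_of_nonneg (huber_nonneg hM _)] at h2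
    rw [Real.norm_eq_abs, abs_mul]
    calc |Φ x| * |huber M (u x / p x)| ≤ (C * p x) * (2 * M * (|u x| / p x)) :=
          mul_le_mul (hC x) h1 (abs_nonneg _) ((abs_nonneg _).trans (hC x))
      _ = _ := by have := (hp x).ne'; field_simp

theorem abs_integral_mul_huber_le {p u Φ : Eu d → ℝ} (hp : ∀ x, 0 < p x)
    (hu : Integrable u) {M : ℝ} (hM : 0 < M) {C : ℝ} (hC : ∀ x, |Φ x| ≤ C * p x) :
    |∫ x, Φ x * huber M (u x / p x)| ≤ C * (2 * M) * ∫ x, |u x| := by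
  rw [← integral_const_mul, ← Real.norm_eq_abs]
  refine norm_integral_le_of_norm_le (hu.abs.const_mul _) (Eventually.of_forall fun x => ?_)
  have h1 : |huber M (u x / p x)| ≤ 2 * M * (|u x| / p x) := by
    have h2 := huber_le_abs hM (u x / p x)
    rwa [abs_div, abs_of_pos (hp x), ← abs_of_nonneg (huber_nonneg hM _)] at h2
  rw [Real.norm_eq_abs, abs_mul]
  calc |Φ x| * |huber M (u x / p x)| ≤ (C * p x) * (2 * M * (|u x| / p x)) :=
        mul_le_mul (hC x) h1 (abs_nonneg _) ((abs_nonneg _).trans (hC x))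
    _ = _ := by have := (hp x).ne'; field_simp

theorem tendsto_integral_huber {p u Φ : Eu d → ℝ} (hpc : Continuous p) (hp : ∀ x, 0 < p x)
    (hu : Integrable u) {M : ℝ} (hM : 0 < M) (hΦ : Continuous Φ) {C : ℝ}
    (hC : ∀ x, |Φ x| ≤ C * p x) {r : ℝ} (hr : ∀ x ∉ Metric.closedBall (0 : Eu d) r, Φ x = 0) :
    Tendsto (fun δ => ∫ x, Φ x * huber M (conv u (mollifier d δ) x / p x)) (𝓝[>] 0)
      (𝓝 (∫ x, Φ x * huber M (u x / p x))) := by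
  rw [tendsto_iff_dist_tendsto_zero]
  have h0 := (tendsto_setIntegral_conv_mollifier_sub hu r).const_mul (C * (2 * M))
  rw [mul_zero] at h0
  refine squeeze_zero' (Eventually.of_forall fun _ => dist_nonneg) ?_ h0
  filter_upwards [self_mem_nhdsWithin] with δ hδ
  have hci := integrable_conv hu (integrable_mollifier (d := d) hδ)
  have i1 := integrable_mul_huber hpc hp hci hM hΦ.aestronglyMeasurable hC
  have i2 := integrable_mul_huber hpc hp hu hM hΦ.aestronglyMeasurable hC
  rw [Real.dist_eq, ← integral_sub i1 i2, ← integral_const_mul]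
  have hz : ∀ x ∉ Metric.closedBall (0 : Eu d) r,
      Φ x * huber M (conv u (mollifier d δ) x / p x) - Φ x * huber M (u x / p x) = 0 :=
    fun x hx => by rw [hr x hx]; ring
  rw [← setIntegral_eq_integral_of_forall_compl_eq_zero hz, ← Real.norm_eq_abs]
  have hds : Integrable fun x => |conv u (mollifier d δ) x - u x| := (hci.sub hu).abs
  refine norm_integral_le_of_norm_le (hds.const_mul _).integrableOn
    (Eventually.of_forall fun x => ?_)
  have h1 : |huber M (conv u (mollifier d δ) x / p x) - huber M (u x / p x)| ≤
      2 * M * (|conv u (mollifier d δ) x - u x| / p x) := by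
    have := abs_huber_sub_le hM (conv u (mollifier d δ) x / p x) (u x / p x)
    rwa [← sub_div, abs_div, abs_of_pos (hp x)] at this
  rw [Real.norm_eq_abs, ← mul_sub, abs_mul]
  calc |Φ x| * |huber M (conv u (mollifier d δ) x / p x) - huber M (u x / p x)|
      ≤ (C * p x) * (2 * M * (|conv u (mollifier d δ) x - u x| / p x)) :=
        mul_le_mul (hC x) h1 (abs_nonneg _) ((abs_nonneg _).trans (hC x))
    _ = _ := by have := (hp x).ne'; field_simp

theorem mul_abs_le_energy_add {p u a : ℝ} (hp : 0 < p) : |u| * a ≤ u ^ 2 / p + a ^ 2 * p := by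
  have h2 : u ^ 2 / p + a ^ 2 * p - |u| * a =
      ((|u| - a * p / 2) ^ 2 + 3 / 4 * (a * p) ^ 2) / p := by
    rw [← sq_abs u]; field_simp; ring
  have : 0 ≤ u ^ 2 / p + a ^ 2 * p - |u| * a := by rw [h2]; positivity
  linarith

/-- Linear growth of `huber M` leaves the products of `|w|` with `‖b‖`, with `1` and with `‖∇ρ‖ /
ρ`; each is split by completing the square into the energy of `w` and a second moment with respect
to `ρ`. The factor `m` tends to zero when the cutoff is spread out. -/
theorem integral_cutoffFlux_le (h : FlowPair ρ b)
    (hw : IsWeakSolution ρ (driftF ρ b ε) ε E w) {M : ℝ} (hM : 0 < M) {χ : Eu d → ℝ}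
    (hχ : χ ∈ smoothTest d) {t : ℝ} (ht : t ∈ Ioo (0 : ℝ) 1) (hε0 : 0 ≤ ε t) {m B S : ℝ}
    (hm : ∀ x, ‖∇ χ x‖ ≤ m) (hm' : ∀ x, |Δ χ x| ≤ m)
    (hB : Integrable (fun x => ‖b t x‖ ^ 2 * ρ t x) ∧ ∫ x, ‖b t x‖ ^ 2 * ρ t x ≤ B)
    (hS : Integrable (fun x => ‖∇ (ρ t) x‖ ^ 2 / ρ t x) ∧ ∫ x, ‖∇ (ρ t) x‖ ^ 2 / ρ t x ≤ S) :
    ∫ x, cutoffFlux ρ b ε χ t x * huber M (w t x / ρ t x) ≤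
      2 * M * m * ((E + B) + ε t * (E + 1 + (E + S))) := by
  have hm0 : 0 ≤ m := (norm_nonneg _).trans (hm 0)
  have he := hw.energy_int t ht
  have heE := hw.energy_le t ht
  have hri := h.integrable t (Ioo_sub ht)
  have hr1 := h.integral_eq t (Ioo_sub ht)
  have i1 : Integrable fun x => w t x ^ 2 / ρ t x + ‖b t x‖ ^ 2 * ρ t x := he.add hB.1
  have i2 : Integrable fun x => w t x ^ 2 / ρ t x + ρ t x := he.add hri
  have i3 : Integrable fun x => w t x ^ 2 / ρ t x + ‖∇ (ρ t) x‖ ^ 2 / ρ t x := he.add hS.1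
  have i23 : Integrable fun x => ε t * ((w t x ^ 2 / ρ t x + ρ t x) +
    (w t x ^ 2 / ρ t x + ‖∇ (ρ t) x‖ ^ 2 / ρ t x)) := (i2.add i3).const_mul _
  have hpt : ∀ x, ‖cutoffFlux ρ b ε χ t x * huber M (w t x / ρ t x)‖ ≤ 2 * M * m *
      ((w t x ^ 2 / ρ t x + ‖b t x‖ ^ 2 * ρ t x) + ε t * ((w t x ^ 2 / ρ t x + ρ t x) +
    (w t x ^ 2 / ρ t x + ‖∇ (ρ t) x‖ ^ 2 / ρ t x))) := by
    intro x
    have hp := h.pos t (Ioo_sub ht) x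
    have h1 : |huber M (w t x / ρ t x)| ≤ 2 * M * (|w t x| / ρ t x) := by
      have h2 := huber_le_abs hM (w t x / ρ t x)
      rwa [abs_div, abs_of_pos hp, ← abs_of_nonneg (huber_nonneg hM _)] at h2
    have h2 : |cutoffFlux ρ b ε χ t x| ≤
        m * ρ t x * (‖b t x‖ + ε t * (1 + ‖∇ (ρ t) x‖ / ρ t x)) := by
      rw [h.cutoffFlux_eq hχ ht]
      have a1 : |⟪b t x, ∇ χ x⟫| ≤ ‖b t x‖ * m :=
        (abs_real_inner_le_norm _ _).trans (mul_le_mul_of_nonneg_left (hm x) (norm_nonneg _))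
      have a2 : |⟪∇ χ x, ∇ (ρ t) x⟫| ≤ m * ‖∇ (ρ t) x‖ :=
        (abs_real_inner_le_norm _ _).trans (mul_le_mul_of_nonneg_right (hm x) (norm_nonneg _))
      have a3 := hm' x
      have a4 : m * ρ t x * (‖b t x‖ + ε t * (1 + ‖∇ (ρ t) x‖ / ρ t x)) =
        ρ t x * (‖b t x‖ * m) + ε t * (ρ t x * m + m * ‖∇ (ρ t) x‖) := by
        have := hp.ne'
        field_simp
      rw [a4]
      refine (abs_add_le _ _).trans (add_le_add ?_ ?_)
      · rw [abs_mul, abs_of_pos hp]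
        exact mul_le_mul_of_nonneg_left a1 hp.le
      · rw [abs_mul, abs_of_nonneg hε0]
        refine mul_le_mul_of_nonneg_left ((abs_add_le _ _).trans (add_le_add ?_ a2)) hε0
        rw [abs_mul, abs_of_pos hp]
        exact mul_le_mul_of_nonneg_left a3 hp.le
    have b1 := mul_abs_le_energy_add (u := w t x) (a := ‖b t x‖) hp
    have b2 := abs_le_energy_add (u := w t x) hp
    have b3 := mul_abs_le_energy_add (u := w t x) (a := ‖∇ (ρ t) x‖ / ρ t x) hp
    have b4 : (‖∇ (ρ t) x‖ / ρ t x) ^ 2 * ρ t x = ‖∇ (ρ t) x‖ ^ 2 / ρ t x := by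
      have := hp.ne'
      field_simp
    rw [b4] at b3
    rw [Real.norm_eq_abs, abs_mul]
    calc |cutoffFlux ρ b ε χ t x| * |huber M (w t x / ρ t x)|
        ≤ (m * ρ t x * (‖b t x‖ + ε t * (1 + ‖∇ (ρ t) x‖ / ρ t x))) *
          (2 * M * (|w t x| / ρ t x)) := by
          refine mul_le_mul h2 h1 (abs_nonneg _) ((abs_nonneg _).trans h2)
      _ = 2 * M * m * (|w t x| * ‖b t x‖ + ε t * (|w t x| + |w t x| * (‖∇ (ρ t) x‖ / ρ t x))) := by
          have := hp.ne'
          field_simp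
      _ ≤ _ := by gcongr
  refine (le_abs_self _).trans ?_
  rw [← Real.norm_eq_abs]
  refine (norm_integral_le_of_norm_le ((i1.add i23).const_mul _)
    (Eventually.of_forall hpt)).trans ?_
  have e1 : ∫ x, 2 * M * m *
      ((w t x ^ 2 / ρ t x + ‖b t x‖ ^ 2 * ρ t x) + ε t * ((w t x ^ 2 / ρ t x + ρ t x) +
    (w t x ^ 2 / ρ t x + ‖∇ (ρ t) x‖ ^ 2 / ρ t x))) =
    2 * M * m * (((∫ x, w t x ^ 2 / ρ t x) + ∫ x, ‖b t x‖ ^ 2 * ρ t x) + ε t *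
      (((∫ x, w t x ^ 2 / ρ t x) + ∫ x, ρ t x) + ((∫ x, w t x ^ 2 / ρ t x) +
        ∫ x, ‖∇ (ρ t) x‖ ^ 2 / ρ t x))) := by
    rw [integral_const_mul, integral_add i1 i23, integral_const_mul, integral_add i2 i3,
      integral_add he hB.1, integral_add he hri, integral_add he hS.1]
  refine (le_of_eq e1).trans ?_
  have := hB.2
  have := hS.2
  rw [hr1]
  gcongr

end FlowPair

/-! ### Integration of the renormalized inequality in time. -/

namespace FlowPair

variable {d : ℕ} {ρ : ℝ → Eu d → ℝ} {b : ℝ → Eu d → Eu d} {ε : ℝ → ℝ} {E : ℝ} {w : ℝ → Eu d → ℝ}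

theorem exists_uniform_bound {G : Type*} [SeminormedAddCommGroup G] {F : ℝ × Eu d → G}
    (hF : ContinuousOn F (Ioo 0 1 ×ˢ univ)) {s T : ℝ} (hs : 0 < s) (hT : T < 1) (r : ℝ) :
    ∃ C : ℝ, 0 ≤ C ∧ ∀ t ∈ Icc s T, ∀ x ∈ Metric.closedBall (0 : Eu d) r, ‖F (t, x)‖ ≤ C := by
  obtain ⟨C, hC⟩ := (isCompact_Icc.prod
    (isCompact_closedBall (0 : Eu d) r)).exists_bound_of_continuousOn (s := Icc s T ×ˢ _)
    (hF.mono (prod_mono (fun t ht => ⟨hs.trans_le ht.1, ht.2.trans_lt hT⟩) (subset_univ _)))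
  exact ⟨|C|, abs_nonneg _, fun t ht x hx => (hC (t, x) ⟨ht, hx⟩).trans (le_abs_self _)⟩

/-- The localized renormalized inequality between two interior times. -/
theorem integral_huber_sub_le (h : FlowPair ρ b) (hε : ContinuousOn ε (Icc 0 1))
    (hε0 : ∀ t ∈ Icc (0 : ℝ) 1, 0 ≤ ε t)
    (hw : IsWeakSolution ρ (driftF ρ b ε) ε E w) {M : ℝ} (hM : 0 < M) {χ : Eu d → ℝ}
    (hχ : χ ∈ smoothTest d) (hχ0 : ∀ x, 0 ≤ χ x) {s T a : ℝ} (hs : 0 < s) (hsT : s ≤ T) (hT : T < 1)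
    (ha : ∀ t ∈ Icc s T, ∫ x, cutoffFlux ρ b ε χ t x * huber M (w t x / ρ t x) ≤ a) :
    (∫ x, χ x * (huber M (w T x / ρ T x) * ρ T x)) -
      ∫ x, χ x * (huber M (w s x / ρ s x) * ρ s x) ≤ a * (T - s) := by
  have hsub : ∀ t ∈ Icc s T, t ∈ Ioo (0 : ℝ) 1 := fun t ht =>
    ⟨hs.trans_le ht.1, ht.2.trans_lt hT⟩
  obtain ⟨r, hr⟩ := hχ.2.isCompact.isBounded.subset_closedBall (0 : Eu d)
  obtain ⟨X, hX⟩ := hχ.1.continuous.bounded_above_of_compact_support hχ.2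
  have hX' : ∀ x, χ x ≤ X := fun x => (le_abs_self _).trans (hX x)
  have hX0 : 0 ≤ X := (hχ0 0).trans (hX' 0)
  have hE : 0 ≤ E + 1 := (integral_nonneg fun x => abs_nonneg _).trans
    (h.integral_abs_weak_le hw (hsub s ⟨le_rfl, hsT⟩))
  set G : ℝ → ℝ → ℝ := fun δ τ =>
    ∫ x, χ x * (huber M (conv (w τ) (mollifier d δ) x / ρ τ x) * ρ τ x) with hG
  set cm : ℝ → ℝ → ℝ := fun δ t =>
    ∫ x in Metric.closedBall 0 r, |mollCommutator (driftF ρ b ε t) (w t) δ x| with hcm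
  set A : ℝ → ℝ → ℝ := fun δ t =>
    ∫ x, cutoffFlux ρ b ε χ t x * huber M (conv (w t) (mollifier d δ) x / ρ t x) with hA
  obtain ⟨C, hC0, hC⟩ := exists_uniform_bound (F := fun q =>
    (ρ q.1 q.2)⁻¹ * cutoffFlux ρ b ε χ q.1 q.2)
    ((h.cont_rho.inv₀ fun q hq => (h.pos _ (Ioo_sub hq.1) _).ne').mul
      (h.cont_cutoffFlux hε hχ)) hs hT r
  obtain ⟨D, hD0, hD⟩ := exists_uniform_bound (F := fun q => divergence (driftF ρ b ε q.1) q.2)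
    (by
      have h1 : Continuous fun L : Eu d →L[ℝ] Eu d =>
          ∑ i : Fin d, (L (EuclideanSpace.single i 1)) i := by fun_prop
      exact h1.comp_continuousOn (h.cont_fderiv_driftF hε)) hs hT r
  obtain ⟨L, hL0, hL⟩ := exists_uniform_bound (h.cont_fderiv_driftF hε) hs hT (r + 1)
  have hCρ : ∀ t ∈ Icc s T, ∀ x, |cutoffFlux ρ b ε χ t x| ≤ C * ρ t x := by
    intro t ht x
    have hp := h.pos t (Ioo_sub (hsub t ht)) x
    by_cases hx : x ∈ Metric.closedBall (0 : Eu d) r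
    · have h1 := hC t ht x hx
      rw [Real.norm_eq_abs, abs_mul, abs_of_pos (inv_pos.2 hp)] at h1
      rwa [inv_mul_le_iff₀ hp, mul_comm] at h1
    · rw [h.cutoffFlux_eq_zero hχ (hsub t ht) fun h' => hx (hr h'), abs_zero]
      positivity
  set N := ∫ x, ‖∇ (unitBump d) x‖ with hN
  have hN0 : 0 ≤ N := integral_nonneg fun x => norm_nonneg _
  have hcmb : ∀ t ∈ Icc s T, ∀ δ, 0 < δ → δ ≤ 1 → cm δ t ≤ (D + L * N) * (E + 1) := by
    intro t ht δ hδ hδ1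
    have hc := h.contDiff_driftF ε (hsub t ht)
    refine (integral_abs_commutator_le hc (hD t ht) hD0 hL0 ?_ (h.integrable_weak hw (hsub t ht))
      hδ hδ1).trans (mul_le_mul_of_nonneg_left (h.integral_abs_weak_le hw (hsub t ht))
        (by positivity))
    intro x hx y hy
    exact (convex_closedBall (0 : Eu d) (r + 1)).norm_image_sub_le_of_norm_fderiv_le
      (fun z _ => hc.differentiable (by norm_num) z) (fun z hz => hL t ht z hz) hy hx
  have hAb : ∀ t ∈ Icc s T, ∀ δ, 0 < δ → A δ t ≤ C * (2 * M) * (E + 1) := by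
    intro t ht δ hδ
    have hwi := h.integrable_weak hw (hsub t ht)
    refine (le_abs_self _).trans ((abs_integral_mul_huber_le
      (h.pos t (Ioo_sub (hsub t ht))) (integrable_conv hwi (integrable_mollifier hδ)) hM
      (hCρ t ht)).trans ?_)
    exact mul_le_mul_of_nonneg_left ((integral_abs_conv_mollifier_le hwi hδ).trans
      (h.integral_abs_weak_le hw (hsub t ht))) (by positivity)
  have hGd : ∀ δ, 0 < δ → ∀ t ∈ Icc s T, HasDerivAt (G δ) (_root_.deriv (G δ) t) t ∧
      _root_.deriv (G δ) t ≤ A δ t + 2 * M * X * cm δ t := by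
    intro δ hδ t ht
    have h1 := h.hasDerivAt_integral_huber hε hw hM hχ hδ (hsub t ht)
    refine ⟨h1.differentiableAt.hasDerivAt, ?_⟩
    have h2 : _root_.deriv (G δ) t = _ := h1.deriv
    rw [h2]
    exact h.integral_huber_deriv_le hw hM hχ hχ0 hX' hr hδ (hsub t ht)
      (hε0 t (Ioo_sub (hsub t ht)))
  -- The derivative of `G δ` is bounded only from above, so it need not be integrable. Its maximum
  -- with `a` is bounded on both sides, still majorizes the derivative, and tends to `a` because the
  -- limiting upper bound is at most `a`.
  set φ : ℝ → ℝ → ℝ := fun δ t => max (_root_.deriv (G δ) t) a with hφ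
  set Bd := max (C * (2 * M) * (E + 1) + 2 * M * X * ((D + L * N) * (E + 1))) a with hBd
  have hφb : ∀ t ∈ Icc s T, ∀ δ, 0 < δ → δ ≤ 1 → ‖φ δ t‖ ≤ |a| + |Bd| := by
    intro t ht δ hδ hδ1
    have h1 : a ≤ φ δ t := le_max_right _ _
    have h2 : φ δ t ≤ Bd := by
      refine max_le_max ((hGd δ hδ t ht).2.trans ?_) le_rfl
      exact add_le_add (hAb t ht δ hδ)
        (mul_le_mul_of_nonneg_left (hcmb t ht δ hδ hδ1) (by positivity))
    rw [Real.norm_eq_abs, abs_le]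
    constructor
    · linarith [neg_abs_le a, abs_nonneg Bd]
    · linarith [le_abs_self Bd, abs_nonneg a]
  have hφm : ∀ δ, Measurable (φ δ) := fun δ => (measurable_deriv (G δ)).max measurable_const
  have hφi : ∀ δ, 0 < δ → δ ≤ 1 → IntegrableOn (φ δ) (Icc s T) := fun δ hδ hδ1 =>
    Measure.integrableOn_of_bounded (M := |a| + |Bd|) (by simp) (hφm δ).aestronglyMeasurable
      ((ae_restrict_mem measurableSet_Icc).mono fun t ht => hφb t ht δ hδ hδ1)
  have hFTC : ∀ δ, 0 < δ → δ ≤ 1 → G δ T - G δ s ≤ ∫ t in s..T, φ δ t := fun δ hδ hδ1 =>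
    intervalIntegral.sub_le_integral_of_hasDeriv_right_of_le hsT
      (fun t ht => (hGd δ hδ t ht).1.continuousAt.continuousWithinAt)
      (fun t ht => (hGd δ hδ t (Ioo_subset_Icc_self ht)).1.hasDerivWithinAt) (hφi δ hδ hδ1)
      fun t _ => le_max_left _ _
  have hlimG : ∀ t ∈ Icc s T, Tendsto (fun δ => G δ t) (𝓝[>] 0)
      (𝓝 (∫ x, χ x * (huber M (w t x / ρ t x) * ρ t x))) := by
    intro t ht
    have hpc := h.cont t (Ioo_sub (hsub t ht))
    have hp := h.pos t (Ioo_sub (hsub t ht))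
    have := tendsto_integral_huber hpc hp (h.integrable_weak hw (hsub t ht)) hM
      (Φ := fun x => χ x * ρ t x) (C := X) (r := r) (hχ.1.continuous.mul hpc)
      (fun x => by
        rw [abs_mul, abs_of_pos (hp x), abs_of_nonneg (hχ0 x)]
        exact mul_le_mul_of_nonneg_right (hX' x) (hp x).le)
      (fun x hx => by rw [image_eq_zero_of_notMem_tsupport fun h' => hx (hr h'), zero_mul])
    have e : ∀ f : Eu d → ℝ, ∫ x, χ x * ρ t x * huber M (f x / ρ t x) =
        ∫ x, χ x * (huber M (f x / ρ t x) * ρ t x) := fun f =>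
      integral_congr_ae (Eventually.of_forall fun x => by simp only; ring)
    simpa only [e] using this
  have hlimφ : ∀ t ∈ Icc s T, Tendsto (fun δ => φ δ t) (𝓝[>] 0) (𝓝 a) := by
    intro t ht
    have hpc := h.cont t (Ioo_sub (hsub t ht))
    have hp := h.pos t (Ioo_sub (hsub t ht))
    have hwi := h.integrable_weak hw (hsub t ht)
    have hΦc : Continuous (cutoffFlux ρ b ε χ t) := by
      have := (h.cont_cutoffFlux hε hχ).comp_continuous
        (f := fun x : Eu d => (t, x)) (by fun_prop) fun x => ⟨hsub t ht, mem_univ _⟩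
      exact this
    have l1 := tendsto_integral_huber hpc hp hwi hM hΦc (hCρ t ht) (r := r)
      (fun x hx => h.cutoffFlux_eq_zero hχ (hsub t ht) fun h' => hx (hr h'))
    have l2 := (tendsto_integral_commutator (h.contDiff_driftF ε (hsub t ht)) hwi r).const_mul
      (2 * M * X)
    have l3 := (l1.add l2).max (tendsto_const_nhds (x := a))
    rw [mul_zero, add_zero, max_eq_right (ha t ht)] at l3
    refine tendsto_of_tendsto_of_tendsto_of_le_of_le' tendsto_const_nhds l3
      (Eventually.of_forall fun δ => le_max_right _ _) ?_
    filter_upwards [self_mem_nhdsWithin] with δ hδ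
    exact max_le_max (hGd δ hδ t ht).2 le_rfl
  have hlimI : Tendsto (fun δ => ∫ t in s..T, φ δ t) (𝓝[>] 0) (𝓝 (∫ t in s..T, a)) := by
    refine intervalIntegral.tendsto_integral_filter_of_dominated_convergence
      (fun _ => |a| + |Bd|) (Eventually.of_forall fun δ => (hφm δ).aestronglyMeasurable) ?_
      intervalIntegrable_const ?_
    · filter_upwards [Ioc_mem_nhdsGT (zero_lt_one (α := ℝ))] with δ hδ
      refine Eventually.of_forall fun t ht => ?_
      rw [uIoc_of_le hsT] at ht
      exact hφb t ⟨ht.1.le, ht.2⟩ δ hδ.1 hδ.2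
    · refine Eventually.of_forall fun t ht => ?_
      rw [uIoc_of_le hsT] at ht
      exact hlimφ t ⟨ht.1.le, ht.2⟩
  rw [intervalIntegral.integral_const, smul_eq_mul, mul_comm] at hlimI
  refine le_of_tendsto_of_tendsto ((hlimG T ⟨hsT, le_rfl⟩).sub (hlimG s ⟨le_rfl, hsT⟩)) hlimI ?_
  filter_upwards [Ioc_mem_nhdsGT (zero_lt_one (α := ℝ))] with δ hδ
  exact hFTC δ hδ.1 hδ.2

end FlowPair

/-! ### Cutoff functions with small derivatives. -/

section Cutoff

variable {d : ℕ}

theorem gradient_comp_smul {f : Eu d → ℝ} (hf : Differentiable ℝ f) (a : ℝ) (x : Eu d) :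
    ∇ (fun y => f (a • y)) x = a • ∇ f (a • x) := by
  refine ext_inner_left ℝ fun v => ?_
  rw [inner_gradient_eq, inner_smul_right, inner_gradient_eq]
  have h1 : HasFDerivAt (fun y : Eu d => a • y) (a • ContinuousLinearMap.id ℝ (Eu d)) x :=
    (a • ContinuousLinearMap.id ℝ (Eu d)).hasFDerivAt
  have h2 := (hf (a • x)).hasFDerivAt.comp x h1
  have h3 : (fun y => f (a • y)) = f ∘ fun y => a • y := rfl
  rw [h3, h2.fderiv]
  simp

theorem laplacian_comp_smul {f : Eu d → ℝ} (hf : ContDiff ℝ 2 f) (a : ℝ) (x : Eu d) :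
    Δ (fun y => f (a • y)) x = a ^ 2 * Δ f (a • x) := by
  have h0 : ContDiff ℝ 2 fun y => f (a • y) := hf.comp (contDiff_const_smul a)
  have hg : ContDiff ℝ 1 (∇ f) := ContDiff.gradient' (m := 1) (n := 2) hf (by norm_num)
  rw [laplacian_eq_divergence h0, laplacian_eq_divergence hf,
    funext (gradient_comp_smul (hf.differentiable (by norm_num)) a)]
  have h1 : HasFDerivAt (fun y : Eu d => a • y) (a • ContinuousLinearMap.id ℝ (Eu d)) x :=
    (a • ContinuousLinearMap.id ℝ (Eu d)).hasFDerivAt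
  have h2 := (hg.differentiable (by norm_num) (a • x)).hasFDerivAt.comp x h1
  have h4 : DifferentiableAt ℝ (fun y => ∇ f (a • y)) x := h2.differentiableAt
  have h3 : fderiv ℝ (fun y => ∇ f (a • y)) x = _ := h2.fderiv
  rw [divergence_const_smul a h4]
  unfold divergence
  rw [h3]
  simp only [ContinuousLinearMap.comp_apply, smul_apply,
    ContinuousLinearMap.id_apply, map_smul, PiLp.smul_apply, smul_eq_mul, ← Finset.mul_sum]
  ring

/-- A fixed bump function dilated by `n + 1`. Its Laplacian even decays like `(n + 1)⁻²`; the weaker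
rate is stated so that a single constant serves both derivatives. -/
theorem exists_cutoff (d : ℕ) : ∃ (C : ℝ) (χ : ℕ → Eu d → ℝ), ∀ n, χ n ∈ smoothTest d ∧
    (∀ x, 0 ≤ χ n x) ∧ (∀ x, χ n x ≤ 1) ∧ (∀ x, ‖∇ (χ n) x‖ ≤ C / ((n : ℝ) + 1)) ∧
    (∀ x, |Δ (χ n) x| ≤ C / ((n : ℝ) + 1)) ∧ ∀ x, ‖x‖ ≤ n → χ n x = 1 := by
  let f : ContDiffBump (0 : Eu d) := ⟨1, 2, by norm_num, by norm_num⟩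
  have hf : ContDiff ℝ (⊤ : ℕ∞) f := f.contDiff
  have hf2 : ContDiff ℝ 2 f := hf.of_le ENat.LEInfty.out
  obtain ⟨G, hG⟩ := (ContDiff.continuous_gradient
    (hf2.of_le (by norm_num))).bounded_above_of_compact_support f.hasCompactSupport.gradient
  obtain ⟨L, hL⟩ := (continuous_laplacian hf2).bounded_above_of_compact_support
    (HasCompactSupport.laplacian hf2 f.hasCompactSupport)
  have hG0 : 0 ≤ G := (norm_nonneg _).trans (hG 0)
  have hL0 : 0 ≤ L := (norm_nonneg _).trans (hL 0)
  refine ⟨G + L, fun n x => f (((n : ℝ) + 1)⁻¹ • x), fun n => ?_⟩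
  have hn : (0 : ℝ) < (n : ℝ) + 1 := by positivity
  have hn1 : ((n : ℝ) + 1)⁻¹ ≤ 1 := inv_le_one_of_one_le₀ (by linarith [n.cast_nonneg (α := ℝ)])
  refine ⟨⟨hf.comp (contDiff_const_smul _), ?_⟩, fun x => f.nonneg, fun x => f.le_one, fun x => ?_,
    fun x => ?_, fun x hx => ?_⟩
  · exact f.hasCompactSupport.comp_homeomorph (Homeomorph.smulOfNeZero _ (inv_pos.2 hn).ne')
  · rw [gradient_comp_smul (hf2.differentiable (by norm_num)), norm_smul, norm_inv,
      Real.norm_eq_abs, abs_of_pos hn, div_eq_inv_mul]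
    exact mul_le_mul_of_nonneg_left ((hG _).trans (by linarith)) (by positivity)
  · rw [laplacian_comp_smul hf2, abs_mul, abs_of_nonneg (by positivity), div_eq_inv_mul, sq,
      mul_assoc]
    refine mul_le_mul_of_nonneg_left ?_ (by positivity)
    calc ((n : ℝ) + 1)⁻¹ * |Δ (f : Eu d → ℝ) (((n : ℝ) + 1)⁻¹ • x)| ≤ 1 * L :=
          mul_le_mul hn1 (hL _) (abs_nonneg _) zero_le_one
      _ ≤ G + L := by linarith
  · refine f.one_of_mem_closedBall ?_
    simp only [mem_closedBall_zero_iff, norm_smul, norm_inv, Real.norm_eq_abs, abs_of_pos hn]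
    change ((n : ℝ) + 1)⁻¹ * ‖x‖ ≤ 1
    rw [inv_mul_le_iff₀ hn]
    linarith

end Cutoff

/-! ### Decay and lower semicontinuity of the energy. -/

namespace FlowPair

variable {d : ℕ} {ρ : ℝ → Eu d → ℝ} {b : ℝ → Eu d → Eu d} {ε : ℝ → ℝ} {E : ℝ} {w : ℝ → Eu d → ℝ}

/-- The energy of weak solutions is nonincreasing in the open time interval. -/
theorem integral_sq_antitone (h : FlowPair ρ b) (hε : ContinuousOn ε (Icc 0 1))
    (hε0 : ∀ t ∈ Icc (0 : ℝ) 1, 0 ≤ ε t)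
    (hw : IsWeakSolution ρ (driftF ρ b ε) ε E w) {s T : ℝ} (hs : 0 < s) (hsT : s ≤ T)
    (hT : T < 1) : ∫ x, w T x ^ 2 / ρ T x ≤ ∫ x, w s x ^ 2 / ρ s x := by
  have hsub : ∀ t ∈ Icc s T, t ∈ Ioo (0 : ℝ) 1 := fun t ht =>
    ⟨hs.trans_le ht.1, ht.2.trans_lt hT⟩
  obtain ⟨Cχ, χ, hχ⟩ := exists_cutoff d
  obtain ⟨B, hB⟩ := h.b_sq
  obtain ⟨K, hK, hK'⟩ := h.score_sq
  have hcont : ContinuousOn (fun t => (E + (B / t + B / (1 - t))) + ε t * (E + 1 + (E + K t)))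
      (Icc s T) := by
    have h1 : ContinuousOn (fun t : ℝ => B / t + B / (1 - t)) (Icc s T) := by
      refine (continuousOn_const.div continuousOn_id fun t ht => (hsub t ht).1.ne').add
        (continuousOn_const.div (by fun_prop) fun t ht => ?_)
      linarith [(hsub t ht).2]
    have h2 : ContinuousOn ε (Icc s T) := hε.mono fun t ht => Ioo_sub (hsub t ht)
    have h3 : ContinuousOn K (Icc s T) := hK.mono hsub
    exact (continuousOn_const.add h1).add (h2.mul (continuousOn_const.add
      (continuousOn_const.add h3)))
  obtain ⟨Q, hQ⟩ := isCompact_Icc.exists_bound_of_continuousOn hcont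
  have hmem1 : T ∈ Icc s T := ⟨hsT, le_rfl⟩
  have hmem2 : s ∈ Icc s T := ⟨le_rfl, hsT⟩
  -- For fixed `M` the cutoff is removed first: its error is of order `M / (n + 1)`, because `Q`
  -- bounds all moments on the compact interval `[s, T]` inside `(0, 1)`. Only afterwards does `M`
  -- tend to infinity.
  have step : ∀ M : ℝ, 0 < M → ∫ x, huber M (w T x / ρ T x) * ρ T x ≤ ∫ x, w s x ^ 2 / ρ s x := by
    intro M hM
    have hlim : ∀ t ∈ Icc s T, Tendsto (fun n => ∫ x, χ n x * (huber M (w t x / ρ t x) * ρ t x))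
        atTop (𝓝 (∫ x, huber M (w t x / ρ t x) * ρ t x)) := by
      intro t ht
      have hpc := h.cont t (Ioo_sub (hsub t ht))
      have hp := h.pos t (Ioo_sub (hsub t ht))
      have hwi := h.integrable_weak hw (hsub t ht)
      have hm : AEStronglyMeasurable (fun x => huber M (w t x / ρ t x) * ρ t x) volume :=
        ((continuous_huber M).comp_aestronglyMeasurable
          (hwi.1.div₀ hpc.aestronglyMeasurable)).mul hpc.aestronglyMeasurable
      refine tendsto_integral_of_dominated_convergence (fun x => 2 * M * |w t x|)
        (fun n => (hχ n).1.1.continuous.aestronglyMeasurable.mul hm) (hwi.abs.const_mul _)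
        (fun n => Eventually.of_forall fun x => ?_) (Eventually.of_forall fun x => ?_)
      · have h1 := huber_le_abs hM (w t x / ρ t x)
        rw [abs_div, abs_of_pos (hp x)] at h1
        have h0 := huber_nonneg hM (w t x / ρ t x)
        rw [Real.norm_eq_abs, abs_of_nonneg (mul_nonneg ((hχ n).2.1 x) (mul_nonneg h0 (hp x).le))]
        calc χ n x * (huber M (w t x / ρ t x) * ρ t x)
            ≤ 1 * ((2 * M * (|w t x| / ρ t x)) * ρ t x) :=
              mul_le_mul ((hχ n).2.2.1 x) (mul_le_mul_of_nonneg_right h1 (hp x).le)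
                (mul_nonneg h0 (hp x).le) zero_le_one
          _ = _ := by have := (hp x).ne'; field_simp
      · refine tendsto_const_nhds.congr' ?_
        filter_upwards [eventually_ge_atTop ⌈‖x‖⌉₊] with n hn
        rw [(hχ n).2.2.2.2.2 x ((Nat.le_ceil _).trans (by exact_mod_cast hn)), one_mul]
    have hineq : ∀ n, (∫ x, χ n x * (huber M (w T x / ρ T x) * ρ T x)) -
        ∫ x, χ n x * (huber M (w s x / ρ s x) * ρ s x) ≤
        2 * M * (Cχ / ((n : ℝ) + 1)) * Q * (T - s) := by
      intro n
      refine h.integral_huber_sub_le hε hε0 hw hM (hχ n).1 (hχ n).2.1 hs hsT hT fun t ht => ?_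
      refine (h.integral_cutoffFlux_le hw hM (hχ n).1 (hsub t ht) (hε0 t (Ioo_sub (hsub t ht)))
        (hχ n).2.2.2.1 (hχ n).2.2.2.2.1 (hB t (hsub t ht)) (hK' t (hsub t ht))).trans ?_
      refine mul_le_mul_of_nonneg_left ((le_abs_self _).trans (hQ t ht)) ?_
      have : 0 ≤ Cχ / ((n : ℝ) + 1) := (norm_nonneg _).trans ((hχ n).2.2.2.1 0)
      positivity
    have hz : Tendsto (fun n : ℕ => 2 * M * (Cχ / ((n : ℝ) + 1)) * Q * (T - s)) atTop (𝓝 0) := by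
      have := (tendsto_one_div_add_atTop_nhds_zero_nat (𝕜 := ℝ)).const_mul
        (2 * M * Cχ * Q * (T - s))
      rw [mul_zero] at this
      exact this.congr fun n => by ring
    have hle := le_of_tendsto_of_tendsto' ((hlim T hmem1).sub (hlim s hmem2)) hz hineq
    have hps := h.pos s (Ioo_sub (hsub s hmem2))
    have hle2 : ∫ x, huber M (w s x / ρ s x) * ρ s x ≤ ∫ x, w s x ^ 2 / ρ s x := by
      refine integral_mono_of_nonneg (Eventually.of_forall fun x =>
        mul_nonneg (huber_nonneg hM _) (hps x).le) (hw.energy_int s (hsub s hmem2))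
        (Eventually.of_forall fun x => ?_)
      have := hps x
      calc huber M (w s x / ρ s x) * ρ s x ≤ (w s x / ρ s x) ^ 2 * ρ s x :=
            mul_le_mul_of_nonneg_right (huber_le_sq hM _) this.le
        _ = _ := by field_simp
    linarith
  have hp := h.pos T (Ioo_sub (hsub T hmem1))
  have hpc := h.cont T (Ioo_sub (hsub T hmem1))
  have hwi := h.integrable_weak hw (hsub T hmem1)
  have hfin : Tendsto (fun n : ℕ => ∫ x, huber ((n : ℝ) + 1) (w T x / ρ T x) * ρ T x) atTop
      (𝓝 (∫ x, w T x ^ 2 / ρ T x)) := by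
    have e : ∀ x, w T x ^ 2 / ρ T x = (w T x / ρ T x) ^ 2 * ρ T x := fun x => by
      have := (hp x).ne'; field_simp
    refine tendsto_integral_of_dominated_convergence (fun x => w T x ^ 2 / ρ T x)
      (fun n => ((continuous_huber _).comp_aestronglyMeasurable
          (hwi.1.div₀ hpc.aestronglyMeasurable)).mul hpc.aestronglyMeasurable)
      (hw.energy_int T (hsub T hmem1))
      (fun n => Eventually.of_forall fun x => ?_) (Eventually.of_forall fun x => ?_)
    · have hn : (0 : ℝ) < (n : ℝ) + 1 := by positivity
      rw [Real.norm_eq_abs, abs_of_nonneg (mul_nonneg (huber_nonneg hn _) (hp x).le), e x]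
      exact mul_le_mul_of_nonneg_right (huber_le_sq hn _) (hp x).le
    · rw [e x]
      exact (tendsto_huber _).mul_const _
  exact le_of_tendsto' hfin fun n => step _ (by positivity)

/-- Lower semicontinuity of the energy along the weak convergence of the solutions. -/
theorem energy_le_of_eventually (h : FlowPair ρ b) {f : ℝ → Eu d → ℝ} {t C : ℝ}
    (ht : t ∈ Icc (0 : ℝ) 1) (hft : LocallyIntegrable (f t) volume) (hC : 0 ≤ C)
    (hm : ∀ s ∈ Ioo (0 : ℝ) 1, AEStronglyMeasurable (f s) volume)
    (hf : ∀ φ : Eu d → ℝ, ContDiff ℝ (⊤ : ℕ∞) φ → HasCompactSupport φ →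
      ContinuousOn (fun t => ∫ x, φ x * f t x) (Icc 0 1))
    (he : ∀ᶠ s in 𝓝[Ioo 0 1] t, Integrable (fun x => f s x ^ 2 / ρ s x) ∧
      ∫ x, f s x ^ 2 / ρ s x ≤ C) :
    Integrable (fun x => f t x ^ 2 / ρ t x) ∧ ∫ x, f t x ^ 2 / ρ t x ≤ C := by
  have hne : (𝓝[Ioo (0 : ℝ) 1] t).NeBot := by
    rw [← mem_closure_iff_nhdsWithin_neBot, closure_Ioo zero_ne_one]
    exact ht
  -- The energy is a supremum over test functions of `(∫ φ f)² / ∫ φ² ρ`, and numerator and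
  -- denominator are both continuous in time, so bounds on the energy pass to the limit.
  refine integral_energy_le_of_test (h.cont t ht) (h.pos t ht) (h.integrable t ht) hft hC
    fun φ hφ => ?_
  have hle : 𝓝[Ioo (0 : ℝ) 1] t ≤ 𝓝[Icc 0 1] t := nhdsWithin_mono t Ioo_subset_Icc_self
  have hφ2 : HasCompactSupport fun x => φ x ^ 2 := hφ.2.comp_left (g := fun r : ℝ => r ^ 2) (by simp)
  have l1 := ((hf φ hφ.1 hφ.2 t ht).mono_left hle).pow 2
  have l2 := (((h.weakCont (fun x => φ x ^ 2) (hφ.1.continuous.pow 2) hφ2) t ht).mono_left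
    hle).const_mul C
  refine le_of_tendsto_of_tendsto l1 l2 ?_
  filter_upwards [he, self_mem_nhdsWithin] with s hs hsI
  have hp := h.pos s (Ioo_sub hsI)
  have h1 := sq_integral_mul_le_energy hp (hm s hsI) hs.1
    hφ.1.continuous.aestronglyMeasurable (((hφ.1.continuous.pow 2).mul
      (h.cont s (Ioo_sub hsI))).integrable_of_hasCompactSupport hφ2.mul_right)
  refine h1.trans (mul_le_mul_of_nonneg_right hs.2 (integral_nonneg fun x => ?_))
  exact mul_nonneg (sq_nonneg _) (hp x).le

end FlowPair

section

variable {d : ℕ}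

theorem integrable_sq_add_smul {p u v : Eu d → ℝ} (hpc : Continuous p) (hp : ∀ x, 0 < p x)
    (hum : AEStronglyMeasurable u volume) (hvm : AEStronglyMeasurable v volume)
    (hu : Integrable fun x => u x ^ 2 / p x) (hv : Integrable fun x => v x ^ 2 / p x) (a : ℝ) :
    Integrable fun x => (u x + a * v x) ^ 2 / p x := by
  refine ((hu.const_mul 2).add (hv.const_mul (2 * a ^ 2))).mono' ?_
    (Eventually.of_forall fun x => ?_)
  · have h1 : AEStronglyMeasurable (fun x => u x + a * v x) volume := hum.add (hvm.const_mul a)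
    exact (h1.pow 2).div₀ hpc.aestronglyMeasurable
  · have h1 := hp x
    have h2 : 0 ≤ (u x + a * v x) ^ 2 / p x := by positivity
    rw [Real.norm_eq_abs, abs_of_nonneg h2]
    simp only [Pi.add_apply]
    have h3 : 2 * (u x ^ 2 / p x) + 2 * a ^ 2 * (v x ^ 2 / p x) - (u x + a * v x) ^ 2 / p x =
      (u x - a * v x) ^ 2 / p x := by ring
    have : 0 ≤ (u x - a * v x) ^ 2 / p x := by positivity
    linarith

theorem integral_sq_parallelogram {p u v : Eu d → ℝ} (hpc : Continuous p) (hp : ∀ x, 0 < p x)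
    (hum : AEStronglyMeasurable u volume) (hvm : AEStronglyMeasurable v volume)
    (hu : Integrable fun x => u x ^ 2 / p x) (hv : Integrable fun x => v x ^ 2 / p x) :
    (∫ x, (u x + -1 * v x) ^ 2 / p x) + ∫ x, (u x + 1 * v x) ^ 2 / p x =
      2 * (∫ x, u x ^ 2 / p x) + 2 * ∫ x, v x ^ 2 / p x := by
  rw [← integral_add (integrable_sq_add_smul hpc hp hum hvm hu hv (-1))
    (integrable_sq_add_smul hpc hp hum hvm hu hv 1), ← integral_const_mul, ← integral_const_mul,
    ← integral_add (hu.const_mul 2) (hv.const_mul 2)]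
  exact integral_congr_ae (Eventually.of_forall fun x => by simp only; ring)

end

/-! ### Contraction for differences, and well-posedness forward in time. -/

namespace FlowPair

variable {d : ℕ} {ρ : ℝ → Eu d → ℝ} {b : ℝ → Eu d → Eu d} {ε : ℝ → ℝ} {c : ℝ → Eu d → Eu d}
  {κ : ℝ → ℝ} {u v : ℝ → Eu d → ℝ} {t₀ : ℝ}

theorem integrable_energySolution (h : FlowPair ρ b) (hu : IsEnergySolution t₀ ρ c κ u)
    {t : ℝ} (ht : t ∈ Icc (0 : ℝ) 1) : Integrable fun x => u t x ^ 2 / ρ t x :=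
  integrable_of_energy_lt_top (h.cont t ht) (h.pos t ht) (hu.meas t ht)
    ((hu.energy_le t ht).trans_lt hu.finite)

theorem integrable_energySolution' (h : FlowPair ρ b) (hu : IsEnergySolution t₀ ρ c κ u)
    {t : ℝ} (ht : t ∈ Icc (0 : ℝ) 1) : Integrable (u t) :=
  integrable_of_energy (h.pos t ht) (hu.meas t ht) (h.integrable t ht)
    (h.integrable_energySolution hu ht)

theorem integral_energySolution_le (h : FlowPair ρ b) (ht₀ : t₀ ∈ Icc (0 : ℝ) 1)
    (hu : IsEnergySolution t₀ ρ c κ u) {t : ℝ} (ht : t ∈ Icc (0 : ℝ) 1) :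
    ∫ x, u t x ^ 2 / ρ t x ≤ ∫ x, u t₀ x ^ 2 / ρ t₀ x := by
  have h1 := hu.energy_le t ht
  rw [energy_eq_ofReal (h.pos t ht) (h.integrable_energySolution hu ht),
    energy_eq_ofReal (h.pos t₀ ht₀) (h.integrable_energySolution hu ht₀)] at h1
  exact (ENNReal.ofReal_le_ofReal_iff (integral_nonneg fun x =>
    div_nonneg (sq_nonneg _) (h.pos t₀ ht₀ x).le)).1 h1

theorem cont_add_smul (h : FlowPair ρ b) (hu : IsEnergySolution t₀ ρ c κ u)
    (hv : IsEnergySolution t₀ ρ c κ v) (a : ℝ) (φ : Eu d → ℝ) (hφ : ContDiff ℝ (⊤ : ℕ∞) φ)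
    (hφc : HasCompactSupport φ) :
    ContinuousOn (fun t => ∫ x, φ x * (u t x + a * v t x)) (Icc 0 1) := by
  refine ((hu.cont φ hφ hφc).add ((hv.cont φ hφ hφc).const_smul a)).congr fun t ht => ?_
  have i1 : Integrable fun x => φ x * u t x := by
    have := (h.integrable_energySolution' hu
      ht).locallyIntegrable.integrable_smul_left_of_hasCompactSupport hφ.continuous hφc
    simpa using this
  have i2 : Integrable fun x => φ x * v t x := by
    have := (h.integrable_energySolution' hv
      ht).locallyIntegrable.integrable_smul_left_of_hasCompactSupport hφ.continuous hφc
    simpa using this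
  simp only [Pi.add_apply, Pi.smul_apply, smul_eq_mul]
  rw [← integral_const_mul, ← integral_add i1 (i2.const_mul a)]
  exact integral_congr_ae (Eventually.of_forall fun x => by simp only; ring)

theorem isWeakSolution_add_smul (h : FlowPair ρ b)
    (hu : IsEnergySolution t₀ ρ (driftF ρ b ε) ε u)
    (hv : IsEnergySolution t₀ ρ (driftF ρ b ε) ε v) {a E : ℝ}
    (hE : ∀ t ∈ Ioo (0 : ℝ) 1, ∫ x, (u t x + a * v t x) ^ 2 / ρ t x ≤ E) :
    IsWeakSolution ρ (driftF ρ b ε) ε E fun t x => u t x + a * v t x := by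
  refine ⟨fun t ht => ?_, fun t ht => ?_, hE, fun φ hφ hφc t ht => ?_⟩
  · exact (hu.meas t (Ioo_sub ht)).add ((hv.meas t (Ioo_sub ht)).const_mul a)
  · have ht' := Ioo_sub ht
    exact integrable_sq_add_smul (h.cont t ht') (h.pos t ht') (hu.meas t ht') (hv.meas t ht')
      (h.integrable_energySolution hu ht') (h.integrable_energySolution hv ht') a
  · have hint : ∀ {f : ℝ → Eu d → ℝ}, IsEnergySolution t₀ ρ (driftF ρ b ε) ε f →
        ∀ s ∈ Icc (0 : ℝ) 1, ∀ ψ : Eu d → ℝ, Continuous ψ → HasCompactSupport ψ →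
        Integrable fun x => ψ x * f s x := fun {f} hf s hs ψ h1 h2 => by
      have := (h.integrable_energySolution' hf
        hs).locallyIntegrable.integrable_smul_left_of_hasCompactSupport h1 h2
      simpa using this
    have hA := h.adjoint_mem ε (φ := φ) ⟨hφ, hφc⟩ ht
    have d1 := (hu.weak φ hφ hφc t ht).add ((hv.weak φ hφ hφc t ht).const_mul a)
    have e1 : ∫ x, (⟪driftF ρ b ε t x, ∇ φ x⟫ + ε t * Δ φ x) * (u t x + a * v t x) =
        (∫ x, (⟪driftF ρ b ε t x, ∇ φ x⟫ + ε t * Δ φ x) * u t x) +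
        a * ∫ x, (⟪driftF ρ b ε t x, ∇ φ x⟫ + ε t * Δ φ x) * v t x := by
      have i1 : Integrable fun x => (⟪driftF ρ b ε t x, ∇ φ x⟫ + ε t * Δ φ x) * u t x :=
        hint hu t (Ioo_sub ht) _ hA.1.continuous hA.2
      have i2 : Integrable fun x => (⟪driftF ρ b ε t x, ∇ φ x⟫ + ε t * Δ φ x) * v t x :=
        hint hv t (Ioo_sub ht) _ hA.1.continuous hA.2
      rw [← integral_const_mul, ← integral_add i1 (i2.const_mul a)]
      exact integral_congr_ae (Eventually.of_forall fun x => by simp only; ring)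
    rw [e1]
    refine d1.congr_of_eventuallyEq ?_
    filter_upwards [isOpen_Ioo.mem_nhds ht] with s hs
    simp only [Pi.add_apply]
    rw [← integral_const_mul, ← integral_add (hint hu s (Ioo_sub hs) φ hφ.continuous hφc)
      ((hint hv s (Ioo_sub hs) φ hφ.continuous hφc).const_mul a)]
    exact integral_congr_ae (Eventually.of_forall fun x => by simp only; ring)

/-- Contraction of the energy of the difference of two energy solutions. -/
theorem integral_sq_sub_le (h : FlowPair ρ b) (hε : ContinuousOn ε (Icc 0 1))
    (hε0 : ∀ t ∈ Icc (0 : ℝ) 1, 0 ≤ ε t)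
    (hu : IsEnergySolution 0 ρ (driftF ρ b ε) ε u)
    (hv : IsEnergySolution 0 ρ (driftF ρ b ε) ε v) {t : ℝ} (ht : t ∈ Icc (0 : ℝ) 1) :
    ∫ x, (u t x + -1 * v t x) ^ 2 / ρ t x ≤ ∫ x, (u 0 x + -1 * v 0 x) ^ 2 / ρ 0 x := by
  have h0 : (0 : ℝ) ∈ Icc (0 : ℝ) 1 := ⟨le_rfl, zero_le_one⟩
  set eu := ∫ x, u 0 x ^ 2 / ρ 0 x
  set ev := ∫ x, v 0 x ^ 2 / ρ 0 x
  have hnn : ∀ s ∈ Icc (0 : ℝ) 1, ∀ a : ℝ, 0 ≤ ∫ x, (u s x + a * v s x) ^ 2 / ρ s x :=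
    fun s hs a => integral_nonneg fun x => div_nonneg (sq_nonneg _) (h.pos s hs x).le
  have hint : ∀ s ∈ Icc (0 : ℝ) 1, ∀ a : ℝ, Integrable fun x => (u s x + a * v s x) ^ 2 / ρ s x :=
    fun s hs a => integrable_sq_add_smul (h.cont s hs) (h.pos s hs) (hu.meas s hs) (hv.meas s hs)
      (h.integrable_energySolution hu hs) (h.integrable_energySolution hv hs) a
  have hpar : ∀ s ∈ Icc (0 : ℝ) 1, (∫ x, (u s x + -1 * v s x) ^ 2 / ρ s x) +
      ∫ x, (u s x + 1 * v s x) ^ 2 / ρ s x =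
      2 * (∫ x, u s x ^ 2 / ρ s x) + 2 * ∫ x, v s x ^ 2 / ρ s x := fun s hs =>
    integral_sq_parallelogram (h.cont s hs) (h.pos s hs) (hu.meas s hs) (hv.meas s hs)
      (h.integrable_energySolution hu hs) (h.integrable_energySolution hv hs)
  have hpar' : ∀ s ∈ Icc (0 : ℝ) 1, (∫ x, (u s x + -1 * v s x) ^ 2 / ρ s x) +
      ∫ x, (u s x + 1 * v s x) ^ 2 / ρ s x ≤ 2 * eu + 2 * ev := by
    intro s hs
    rw [hpar s hs]
    have := h.integral_energySolution_le h0 hu hs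
    have := h.integral_energySolution_le h0 hv hs
    linarith
  have hloc : ∀ s ∈ Icc (0 : ℝ) 1, ∀ a : ℝ, LocallyIntegrable (fun x => u s x + a * v s x) volume :=
    fun s hs a => ((h.integrable_energySolution' hu hs).add
      ((h.integrable_energySolution' hv hs).const_mul a)).locallyIntegrable
  have hmeas : ∀ s ∈ Ioo (0 : ℝ) 1, ∀ a : ℝ,
      AEStronglyMeasurable (fun x => u s x + a * v s x) volume := fun s hs a =>
    (hu.meas s (Ioo_sub hs)).add ((hv.meas s (Ioo_sub hs)).const_mul a)
  have hw := h.isWeakSolution_add_smul hu hv (a := -1) (E := 2 * eu + 2 * ev) fun s hs => by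
    have := hpar' s (Ioo_sub hs)
    have := hnn s (Ioo_sub hs) 1
    linarith
  have hinner : ∀ t ∈ Ioo (0 : ℝ) 1,
      ∫ x, (u t x + -1 * v t x) ^ 2 / ρ t x ≤ ∫ x, (u 0 x + -1 * v 0 x) ^ 2 / ρ 0 x := by
    intro t ht
    -- A lower bound on the energy of `u - v` at early times, which follows from its decay, becomes
    -- by the parallelogram identity an upper bound on the energy of `u + v`. Upper bounds do pass
    -- to the weak limit at time `0`, where the identity is used once more.
    have hsm : ∀ s ∈ Ioo (0 : ℝ) 1, s ≤ t → ∫ x, (u s x + 1 * v s x) ^ 2 / ρ s x ≤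
        2 * eu + 2 * ev - ∫ x, (u t x + -1 * v t x) ^ 2 / ρ t x := by
      intro s hs hst
      have h1 := h.integral_sq_antitone hε hε0 hw hs.1 hst ht.2
      have h2 := hpar' s (Ioo_sub hs)
      linarith
    have hlsc := h.energy_le_of_eventually (f := fun s x => u s x + 1 * v s x) (t := 0)
      (C := 2 * eu + 2 * ev - ∫ x, (u t x + -1 * v t x) ^ 2 / ρ t x) h0 (hloc 0 h0 1)
      ((hnn t (Ioo_sub ht) 1).trans (hsm t ht le_rfl)) (fun s hs => hmeas s hs 1)
      (h.cont_add_smul hu hv 1) (by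
        filter_upwards [self_mem_nhdsWithin, mem_nhdsWithin_of_mem_nhds (Iio_mem_nhds ht.1)]
          with s hs hst
        exact ⟨hint s (Ioo_sub hs) 1, hsm s hs (le_of_lt hst)⟩)
    have h3 := hpar 0 h0
    have h4 := hlsc.2
    linarith
  rcases eq_or_lt_of_le ht.1 with rfl | ht0
  · exact le_rfl
  -- At the final time lower semicontinuity transports the bound from the interior.
  rcases eq_or_lt_of_le ht.2 with rfl | ht1
  · refine (h.energy_le_of_eventually (f := fun s x => u s x + -1 * v s x) ht (hloc _ ht (-1))
      (hnn 0 h0 (-1)) (fun s hs => hmeas s hs (-1)) (h.cont_add_smul hu hv (-1)) ?_).2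
    filter_upwards [self_mem_nhdsWithin] with s hs
    exact ⟨hint s (Ioo_sub hs) (-1), hinner s hs⟩
  · exact hinner t ⟨ht0, ht1⟩

theorem isWellPosedFrom_zero (h : FlowPair ρ b) (hε : ContinuousOn ε (Icc 0 1))
    (hε0 : ∀ t ∈ Icc (0 : ℝ) 1, 0 ≤ ε t) : IsWellPosedFrom 0 ρ (driftF ρ b ε) ε := by
  have h0 : (0 : ℝ) ∈ Icc (0 : ℝ) 1 := ⟨le_rfl, zero_le_one⟩
  have hsub : ∀ (u v : ℝ → Eu d → ℝ) (t : ℝ), (fun x => u t x + -1 * v t x) = u t - v t :=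
    fun u v t => by funext x; simp [sub_eq_add_neg]
  refine ⟨fun f hf hfe => h.exists_energySolution hε hε0 hf hfe, fun u v hu hv h1 t ht => ?_,
    fun u v hu hv t ht => ?_⟩
  · have h2 := h.integral_sq_sub_le hε hε0 hu hv ht
    have h3 : ∫ x, (u 0 x + -1 * v 0 x) ^ 2 / ρ 0 x = 0 := by
      refine integral_eq_zero_of_ae ?_
      filter_upwards [h1] with x hx
      simp [hx]
    rw [h3] at h2
    have hnn : ∀ x, 0 ≤ (u t x + -1 * v t x) ^ 2 / ρ t x := fun x =>
      div_nonneg (sq_nonneg _) (h.pos t ht x).le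
    have h4 := (integral_eq_zero_iff_of_nonneg hnn (integrable_sq_add_smul (h.cont t ht)
      (h.pos t ht) (hu.meas t ht) (hv.meas t ht) (h.integrable_energySolution hu ht)
      (h.integrable_energySolution hv ht) (-1))).1 (le_antisymm h2 (integral_nonneg hnn))
    filter_upwards [h4] with x hx
    have h5 : (u t x + -1 * v t x) ^ 2 / ρ t x = 0 := hx
    rw [div_eq_zero_iff, or_iff_left (h.pos t ht x).ne', pow_eq_zero_iff two_ne_zero] at h5
    linarith
  · have hi : ∀ s ∈ Icc (0 : ℝ) 1, Integrable fun x => (u s - v s) x ^ 2 / ρ s x := by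
      intro s hs
      rw [← hsub u v s]
      exact integrable_sq_add_smul (h.cont s hs)
        (h.pos s hs) (hu.meas s hs) (hv.meas s hs) (h.integrable_energySolution hu hs)
        (h.integrable_energySolution hv hs) (-1)
    rw [energy_eq_ofReal (h.pos t ht) (hi t ht), energy_eq_ofReal (h.pos 0 h0) (hi 0 h0)]
    refine ENNReal.ofReal_le_ofReal ?_
    rw [← hsub u v t, ← hsub u v 0]
    exact h.integral_sq_sub_le hε hε0 hu hv ht

end FlowPair

/-! ### Time reversal of energy solutions and of well-posedness. -/

section Reverse

variable {d : ℕ} {ρ ρ' : ℝ → Eu d → ℝ} {c c' : ℝ → Eu d → Eu d} {κ κ' : ℝ → ℝ}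
  {u : ℝ → Eu d → ℝ} {t₀ t₁ : ℝ}

/-- The chain rule changes the sign of the time derivative, hence of the drift and of the diffusion
coefficient. The reversed data enter through equations, so that the same statement can be applied in
both directions. -/
theorem IsEnergySolution.reverse (hu : IsEnergySolution t₀ ρ c κ u) (ht : t₀ = 1 - t₁)
    (hρ : ∀ t, ρ' t = ρ (1 - t)) (hc : ∀ t x, c' t x = -c (1 - t) x)
    (hκ : ∀ t, κ' t = -κ (1 - t)) : IsEnergySolution t₁ ρ' c' κ' fun t => u (1 - t) := by
  have hI : ∀ t ∈ Icc (0 : ℝ) 1, 1 - t ∈ Icc (0 : ℝ) 1 := fun t ht =>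
    ⟨by linarith [ht.2], by linarith [ht.1]⟩
  have ho : ∀ t ∈ Ioo (0 : ℝ) 1, 1 - t ∈ Ioo (0 : ℝ) 1 := fun t ht =>
    ⟨by linarith [ht.2], by linarith [ht.1]⟩
  refine ⟨fun t h => hu.meas _ (hI t h), ?_, fun t h => ?_, fun φ h1 h2 => ?_,
    fun φ h1 h2 t h => ?_⟩
  · rw [hρ, ← ht]; exact hu.finite
  · rw [hρ, hρ, ← ht]; exact hu.energy_le _ (hI t h)
  · exact (hu.cont φ h1 h2).comp (by fun_prop) hI
  · have d1 := (hu.weak φ h1 h2 _ (ho t h)).scomp t ((hasDerivAt_id t).const_sub 1)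
    refine d1.congr_deriv ?_
    rw [neg_smul, one_smul, ← integral_neg]
    refine integral_congr_ae (Eventually.of_forall fun x => ?_)
    simp only [hc, hκ, inner_neg_left]
    ring

theorem IsWellPosedFrom.reverse (hw : IsWellPosedFrom t₀ ρ c κ) (ht : t₀ = 1 - t₁)
    (hρ : ∀ t, ρ' t = ρ (1 - t)) (hc : ∀ t x, c' t x = -c (1 - t) x)
    (hκ : ∀ t, κ' t = -κ (1 - t)) : IsWellPosedFrom t₁ ρ' c' κ' := by
  have hI : ∀ t ∈ Icc (0 : ℝ) 1, 1 - t ∈ Icc (0 : ℝ) 1 := fun t ht =>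
    ⟨by linarith [ht.2], by linarith [ht.1]⟩
  have hback : ∀ {v}, IsEnergySolution t₁ ρ' c' κ' v →
      IsEnergySolution t₀ ρ c κ fun t => v (1 - t) := fun {v} hv =>
    hv.reverse (by rw [ht]; ring) (fun t => by rw [hρ, sub_sub_cancel])
      (fun t x => by rw [hc, sub_sub_cancel, neg_neg]) fun t => by rw [hκ, sub_sub_cancel, neg_neg]
  have ht' : 1 - t₀ = t₁ := by rw [ht]; ring
  refine ⟨fun f hf hfe => ?_, fun u v hu hv h t h1 => ?_, fun u v hu hv t h1 => ?_⟩
  · rw [hρ, ← ht] at hfe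
    obtain ⟨u, hu, h0⟩ := hw.exist f hf hfe
    exact ⟨fun t => u (1 - t), hu.reverse ht hρ hc hκ, by simpa only [← ht] using h0⟩
  · have := hw.unique _ _ (hback hu) (hback hv) (by rw [ht']; exact h) _ (hI t h1)
    simpa only [sub_sub_cancel] using this
  · have := hw.stable _ _ (hback hu) (hback hv) _ (hI t h1)
    rw [hρ t, hρ t₁, ← ht]
    simpa only [sub_sub_cancel, ht'] using this

end Reverse

/-! ### The density as a solution, and the backward equation. -/

namespace FlowPair

variable {d : ℕ} {ρ : ℝ → Eu d → ℝ} {b : ℝ → Eu d → Eu d} {ε : ℝ → ℝ}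

theorem smul_driftF (h : FlowPair ρ b) {t : ℝ} (ht : t ∈ Ioo (0 : ℝ) 1) (x : Eu d) :
    ρ t x • driftF ρ b ε t x = ρ t x • b t x + ε t • ∇ (ρ t) x := by
  have := (h.pos t (Ioo_sub ht) x).ne'
  rw [driftF, h.score_eq ht, smul_add, smul_smul, smul_smul]
  congr 2
  field_simp

/-- Since `ρ b_F = ρ b + ε ∇ρ`, the score contributes `ε Δρ` to the divergence of the flux and
cancels the diffusion; the continuity equation remains. The cancellation is algebraic in `ε`, so it
also covers the backward equation with `-ε`. -/
theorem isClassicalFPE (h : FlowPair ρ b) (ε : ℝ → ℝ) : IsClassicalFPE (driftF ρ b ε) ε ρ := by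
  refine ⟨fun x => ?_, h.contDiff, fun t ht => h.contDiff_driftF ε ht, fun t ht x => ?_⟩
  · have h1 : ContinuousOn (fun t => -divergence (fun y => ρ t y • b t y) x) (Ioo 0 1) :=
      (h.cont_divergence.comp (f := fun t : ℝ => (t, x)) (by fun_prop)
        fun t ht => ⟨ht, mem_univ _⟩).neg
    have h2 : (1 : WithTop ℕ∞) = 0 + 1 := by norm_num
    rw [h2, contDiffOn_succ_iff_deriv_of_isOpen isOpen_Ioo]
    refine ⟨fun t ht => (h.deriv t ht x).differentiableAt.differentiableWithinAt, by simp, ?_⟩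
    rw [contDiffOn_zero]
    exact h1.congr fun t ht => (h.deriv t ht x).deriv
  · have e1 : (fun y => ρ t y • driftF ρ b ε t y) =
        fun y => ρ t y • b t y + ε t • ∇ (ρ t) y := funext fun y => h.smul_driftF ht y
    have hg : ContDiff ℝ 1 (∇ (ρ t)) :=
      ContDiff.gradient' (m := 1) (n := 2) (h.contDiff t ht) (by norm_num)
    have d1 := (h.contDiff_flux ht).differentiable (by norm_num) x
    have d2 := hg.differentiable (by norm_num) x
    have d3 : DifferentiableAt ℝ (fun y => ε t • ∇ (ρ t) y) x := d2.fun_const_smul _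
    rw [(h.deriv t ht x).deriv, e1, divergence_add d1 d3, divergence_const_smul _ d2,
      laplacian_eq_divergence (h.contDiff t ht)]
    ring

/-- The energy of `ρ` relative to itself is its mass, constantly `1`. The weak equation is the
continuity equation after `ε ∫ (∇φ · ∇ρ + ρ Δφ) = 0` has been used. -/
theorem isEnergySolution_self (h : FlowPair ρ b) (ε : ℝ → ℝ) {t₀ : ℝ} (ht₀ : t₀ ∈ Icc (0 : ℝ) 1) :
    IsEnergySolution t₀ ρ (driftF ρ b ε) ε ρ := by
  have he : ∀ t ∈ Icc (0 : ℝ) 1, energy (ρ t) (ρ t) = 1 := by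
    intro t ht
    have e : ∀ x, ρ t x ^ 2 / ρ t x = ρ t x := fun x => by
      have := (h.pos t ht x).ne'; field_simp
    rw [energy_eq_ofReal (h.pos t ht) (by simpa only [e] using h.integrable t ht)]
    simp only [e, h.integral_eq t ht, ENNReal.ofReal_one]
  refine ⟨fun t ht => (h.cont t ht).aestronglyMeasurable, by rw [he t₀ ht₀]; exact ENNReal.one_lt_top,
    fun t ht => by rw [he t ht, he t₀ ht₀], fun φ h1 h2 => h.weakCont φ h1.continuous h2,
    fun φ h1 h2 t ht => ?_⟩
  have hφ2 : ContDiff ℝ 2 φ := h1.of_le ENat.LEInfty.out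
  have hφ1 : ContDiff ℝ 1 φ := h1.of_le (by simp)
  have hgφ : ContDiff ℝ 1 (∇ φ) := ContDiff.gradient' (m := 1) (n := 2) hφ2 (by norm_num)
  have d1 := h.hasDerivAt_integral (φ := φ) ⟨hφ1, h2⟩ ht
  refine d1.congr_deriv ?_
  have hρ1 : ContDiff ℝ 1 (ρ t) := (h.contDiff t ht).of_le (by norm_num)
  have I1 := integral_mul_divergence hρ1 hgφ (Or.inr h2.gradient)
  have hin : ∀ {v : Eu d → Eu d}, Continuous v → Integrable fun x => ⟪v x, ∇ φ x⟫ := fun {v} hv =>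
    (hv.inner hgφ.continuous).integrable_of_hasCompactSupport (h2.gradient.mono fun x hx => by
        contrapose! hx
        simp only [Function.mem_support, not_not] at hx ⊢
        rw [hx, inner_zero_right])
  have i1 : Integrable fun x => ⟪b t x, ∇ φ x⟫ * ρ t x := by
    have := hin (h.contDiff_flux ht).continuous
    simpa only [real_inner_smul_left, mul_comm] using this
  have i2 : Integrable fun x => ⟪∇ φ x, ∇ (ρ t) x⟫ := by
    have := hin (ContDiff.continuous_gradient hρ1)
    simpa only [real_inner_comm] using this
  have i3 : Integrable fun x => ρ t x * divergence (∇ φ) x :=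
    (hρ1.continuous.mul (continuous_divergence hgφ)).integrable_of_hasCompactSupport
      (HasCompactSupport.divergence h2.gradient).mul_left
  have e1 : ∫ x, (⟪driftF ρ b ε t x, ∇ φ x⟫ + ε t * Δ φ x) * ρ t x =
      ∫ x, (⟪b t x, ∇ φ x⟫ * ρ t x + ε t * (⟪∇ φ x, ∇ (ρ t) x⟫ + ρ t x * divergence (∇ φ) x)) := by
    refine integral_congr_ae (Eventually.of_forall fun x => ?_)
    simp only
    rw [add_mul, mul_comm ⟪driftF ρ b ε t x, ∇ φ x⟫, ← real_inner_smul_left, h.smul_driftF ht,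
      inner_add_left, real_inner_smul_left, real_inner_smul_left, laplacian_eq_divergence hφ2,
      real_inner_comm (∇ φ x) (∇ (ρ t) x)]
    ring
  have i4 : Integrable fun x => ε t * (⟪∇ φ x, ∇ (ρ t) x⟫ + ρ t x * divergence (∇ φ) x) :=
    (i2.add i3).const_mul _
  rw [e1, integral_add i1 i4, integral_const_mul, integral_add i2 i3, I1]
  ring

theorem driftB_eq (ρ : ℝ → Eu d → ℝ) (b : ℝ → Eu d → Eu d) (ε : ℝ → ℝ) :
    driftB ρ b ε = driftF ρ b fun t => -ε t := by
  funext t x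
  rw [driftB, driftF, neg_smul, sub_eq_add_neg]

/-- In reversed time the velocity is `-b(1 - t)`, the score is unchanged up to the substitution, and
the diffusion coefficient `-ε` becomes `ε(1 - t) ≥ 0`: this is the forward equation of the reversed
pair. -/
theorem isWellPosedFrom_one (h : FlowPair ρ b) (hε : ContinuousOn ε (Icc 0 1))
    (hε0 : ∀ t ∈ Icc (0 : ℝ) 1, 0 ≤ ε t) :
    IsWellPosedFrom 1 ρ (driftB ρ b ε) fun t => -ε t := by
  have hI : ∀ t ∈ Icc (0 : ℝ) 1, 1 - t ∈ Icc (0 : ℝ) 1 := fun t ht =>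
    ⟨by linarith [ht.2], by linarith [ht.1]⟩
  have h1 := h.reverse.isWellPosedFrom_zero (ε := fun t => ε (1 - t)) (hε.comp (by fun_prop) hI)
    fun t ht => hε0 _ (hI t ht)
  refine h1.reverse (by norm_num) (fun t => by simp only [sub_sub_cancel]) (fun t x => ?_)
    fun t => by simp only [sub_sub_cancel]
  have hs : score (fun τ => ρ (1 - τ)) (1 - t) x = score ρ t x := by
    unfold score; simp only [sub_sub_cancel]
  rw [driftF, hs]
  simp only [sub_sub_cancel, driftB]
  abel

end FlowPair

/-! ### The Gaussian kernel: derivatives, heat equation and uniform bounds. -/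

section HeatKernel

variable {d : ℕ}

/-- The density of the centred Gaussian law with covariance `q` times the identity. -/
noncomputable def heatKernel (q : ℝ) (y : Eu d) : ℝ :=
  (2 * Real.pi * q) ^ (-(d / 2 : ℝ)) * Real.exp (-(‖y‖ ^ 2 / (2 * q)))

/-- The spatial gradient of the heat kernel. -/
noncomputable def heatGrad (q : ℝ) (y : Eu d) : Eu d := -(heatKernel q y / q) • y

/-- The spatial Hessian of the heat kernel. -/
noncomputable def heatHess (q : ℝ) (y : Eu d) : Eu d →L[ℝ] Eu d :=
  -(heatKernel q y / q) • ContinuousLinearMap.id ℝ (Eu d) +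
    (heatKernel q y / q ^ 2) • (innerSL ℝ y).smulRight y

/-- The derivative of the heat kernel with respect to the variance. -/
noncomputable def heatVar (q : ℝ) (y : Eu d) : ℝ :=
  heatKernel q y * (‖y‖ ^ 2 / (2 * q ^ 2) - d / (2 * q))

theorem heatKernel_pos {q : ℝ} (hq : 0 < q) (y : Eu d) : 0 < heatKernel q y := by
  unfold heatKernel
  positivity

theorem hasFDerivAt_heatKernel (q : ℝ) (y : Eu d) :
    HasFDerivAt (heatKernel q) (innerSL ℝ (heatGrad q y)) y := by
  have h1 : HasFDerivAt (fun y : Eu d => ‖y‖ ^ 2) (2 • innerSL ℝ y) y :=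
    (hasStrictFDerivAt_norm_sq y).hasFDerivAt
  have h2 : HasFDerivAt (fun y : Eu d => ‖y‖ ^ 2 / (2 * q)) ((2 * q)⁻¹ • (2 • innerSL ℝ y)) y := by
    simpa only [div_eq_mul_inv] using h1.mul_const (2 * q)⁻¹
  have h3 := ((h2.fun_neg.exp).const_mul ((2 * Real.pi * q) ^ (-(d / 2 : ℝ))))
  refine h3.congr_fderiv ?_
  ext v
  -- With division by zero equal to zero, the kernel at `q = 0` is constant in space and `heatGrad`
  -- vanishes, so the formula persists.
  by_cases hq : q = 0
  · simp [heatGrad, hq]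
  · simp [heatGrad, heatKernel]
    field_simp

theorem hasFDerivAt_heatGrad (q : ℝ) (y : Eu d) : HasFDerivAt (heatGrad q) (heatHess q y) y := by
  have h0 : HasFDerivAt (fun y : Eu d => heatKernel q y / q)
      (q⁻¹ • innerSL ℝ (heatGrad q y)) y := by
    simpa only [div_eq_mul_inv] using (hasFDerivAt_heatKernel q y).mul_const q⁻¹
  have h1 := h0.fun_neg.smul (hasFDerivAt_id y)
  refine h1.congr_fderiv ?_
  ext1 v
  by_cases hq : q = 0
  · simp [heatHess, hq]
  · simp [heatHess, heatGrad, smul_smul]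
    congr 2
    field_simp

theorem hasDerivAt_heatKernel_comp {q : ℝ → ℝ} {y : ℝ → Eu d} {q' t : ℝ} {y' : Eu d}
    (hq : 0 < q t) (hq' : HasDerivAt q q' t) (hy : HasDerivAt y y' t) :
    HasDerivAt (fun τ => heatKernel (q τ) (y τ))
      (q' * heatVar (q t) (y t) + ⟪heatGrad (q t) (y t), y'⟫) t := by
  have hpos : 0 < 2 * Real.pi * q t := by positivity
  have h1 := (hq'.const_mul (2 * Real.pi)).rpow_const (p := -(d / 2 : ℝ)) (Or.inl hpos.ne')
  have h2 := ((hy.norm_sq.div (hq'.const_mul 2) (by positivity)).fun_neg).exp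
  refine (h1.mul h2).congr_deriv ?_
  rw [Real.rpow_sub_one hpos.ne']
  simp only [heatVar, heatGrad, heatKernel, real_inner_smul_left, Pi.div_apply]
  field_simp
  ring

/-- The trace of an endomorphism of Euclidean space, as a continuous linear functional. -/
noncomputable def traceL (d : ℕ) : (Eu d →L[ℝ] Eu d) →L[ℝ] ℝ :=
  ∑ i : Fin d, (EuclideanSpace.proj i).comp
    (ContinuousLinearMap.apply ℝ (Eu d) (EuclideanSpace.single i (1 : ℝ)))

theorem traceL_apply (L : Eu d →L[ℝ] Eu d) :
    traceL d L = ∑ i : Fin d, (L (EuclideanSpace.single i 1)) i := by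
  simp [traceL]

theorem divergence_eq_traceL (v : Eu d → Eu d) (x : Eu d) :
    divergence v x = traceL d (fderiv ℝ v x) := by
  rw [traceL_apply]; rfl

theorem traceL_smulRight (g v : Eu d) : traceL d ((innerSL ℝ g).smulRight v) = ⟪g, v⟫ := by
  rw [traceL_apply, PiLp.inner_apply]
  refine Finset.sum_congr rfl fun i _ => ?_
  simp [EuclideanSpace.inner_single_right, mul_comm]

/-- The heat equation: the derivative of the kernel in its variance is half its Laplacian. -/
theorem traceL_heatHess {q : ℝ} (hq : 0 < q) (y : Eu d) :
    traceL d (heatHess q y) = 2 * heatVar q y := by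
  have h1 : traceL d (ContinuousLinearMap.id ℝ (Eu d)) = d := by simp [traceL_apply]
  rw [heatHess, map_add, map_smul, map_smul, traceL_smulRight, h1, heatVar,
    real_inner_self_eq_norm_sq]
  simp only [smul_eq_mul]
  field_simp
  ring

/-- A bound for `(1 + ‖y‖²) heatKernel q y`. -/
noncomputable def heatBound (d : ℕ) (q : ℝ) : ℝ :=
  (2 * Real.pi * q) ^ (-(d / 2 : ℝ)) * (1 + 2 * q)

/-- With `r = ‖y‖² / (2q)` it reduces to `e^(-r) ≤ 1` and `r e^(-r) ≤ 1`. The weight `1 + ‖y‖²`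
controls the kernel, its gradient and its Hessian uniformly in `y`. -/
theorem heatKernel_mul_le {q : ℝ} (hq : 0 < q) (y : Eu d) :
    heatKernel q y * (1 + ‖y‖ ^ 2) ≤ heatBound d q := by
  unfold heatKernel heatBound
  rw [mul_assoc]
  refine mul_le_mul_of_nonneg_left ?_ (by positivity)
  set r := ‖y‖ ^ 2 / (2 * q) with hr
  have h1 : ‖y‖ ^ 2 = 2 * q * r := by rw [hr]; field_simp
  have h0 : 0 ≤ r := by positivity
  have h2 : Real.exp (-r) ≤ 1 := Real.exp_le_one_iff.2 (by linarith)
  have h3 : r * Real.exp (-r) ≤ 1 := by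
    rw [Real.exp_neg, ← div_eq_mul_inv, div_le_one (Real.exp_pos _)]
    linarith [Real.add_one_le_exp r]
  rw [h1]
  nlinarith

theorem continuousOn_heatBound : ContinuousOn (heatBound d) (Ioi 0) := by
  intro q hq
  have hpos : 2 * Real.pi * q ≠ 0 := by have : 0 < q := hq; positivity
  refine ContinuousAt.continuousWithinAt ?_
  exact ((continuousAt_const.mul continuousAt_id).rpow_const (Or.inl hpos)).mul (by fun_prop)

theorem norm_heatKernel_le {q : ℝ} (hq : 0 < q) (y : Eu d) : ‖heatKernel q y‖ ≤ heatBound d q := by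
  rw [Real.norm_of_nonneg (heatKernel_pos hq y).le]
  refine le_trans ?_ (heatKernel_mul_le hq y)
  have := heatKernel_pos hq y
  nlinarith [sq_nonneg ‖y‖]

theorem norm_heatGrad_le {q : ℝ} (hq : 0 < q) (y : Eu d) :
    ‖heatGrad q y‖ ≤ heatBound d q / q := by
  have h0 := heatKernel_pos hq y
  rw [heatGrad, norm_smul, norm_neg, Real.norm_of_nonneg (by positivity), div_mul_eq_mul_div]
  gcongr
  refine le_trans ?_ (heatKernel_mul_le hq y)
  gcongr
  nlinarith [sq_nonneg (‖y‖ - 1), norm_nonneg y]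

theorem norm_heatHess_le {q : ℝ} (hq : 0 < q) (y : Eu d) :
    ‖heatHess q y‖ ≤ heatBound d q / q + heatBound d q / q ^ 2 := by
  have h0 := heatKernel_pos hq y
  have h1 := heatKernel_mul_le hq y
  refine (norm_add_le _ _).trans (add_le_add ?_ ?_)
  · rw [norm_smul, norm_neg, Real.norm_of_nonneg (by positivity)]
    refine (mul_le_of_le_one_right (by positivity) ContinuousLinearMap.norm_id_le).trans ?_
    gcongr
    nlinarith [sq_nonneg ‖y‖]
  · rw [norm_smul, Real.norm_of_nonneg (by positivity), ContinuousLinearMap.norm_smulRight_apply,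
      innerSL_apply_norm, div_mul_eq_mul_div]
    gcongr
    nlinarith [sq_nonneg ‖y‖]

theorem continuousOn_heatKernel :
    ContinuousOn (fun r : ℝ × Eu d => heatKernel r.1 r.2) (Ioi 0 ×ˢ univ) := by
  intro r hr
  have h0 : 0 < r.1 := hr.1
  refine ContinuousAt.continuousWithinAt ?_
  have h1 : ContinuousAt (fun r : ℝ × Eu d => 2 * Real.pi * r.1) r := by fun_prop
  refine (h1.rpow_const (Or.inl (by positivity))).mul ?_
  refine (ContinuousAt.neg (ContinuousAt.div (by fun_prop) (by fun_prop) ?_)).rexp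
  positivity

theorem continuousOn_heatGrad :
    ContinuousOn (fun r : ℝ × Eu d => heatGrad r.1 r.2) (Ioi 0 ×ˢ univ) :=
  (continuousOn_heatKernel.div continuousOn_fst fun r hr => (ne_of_gt hr.1)).neg.smul
    continuousOn_snd

theorem continuousOn_heatHess :
    ContinuousOn (fun r : ℝ × Eu d => heatHess r.1 r.2) (Ioi 0 ×ˢ univ) := by
  refine ContinuousOn.add ?_ ?_
  · exact (continuousOn_heatKernel.div continuousOn_fst
      fun r hr => (ne_of_gt hr.1)).neg.smul continuousOn_const
  · refine (continuousOn_heatKernel.div (continuousOn_fst.pow 2)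
      fun r hr => pow_ne_zero 2 (ne_of_gt hr.1)).smul ?_
    have h1 : Continuous fun r : ℝ × Eu d => innerSL ℝ r.2 := by fun_prop
    have h2 : Continuous fun r : ℝ × Eu d =>
        ContinuousLinearMap.smulRightL ℝ (Eu d) (Eu d) (innerSL ℝ r.2) r.2 :=
      ((ContinuousLinearMap.smulRightL ℝ (Eu d) (Eu d)).continuous.comp h1).clm_apply
        continuous_snd
    exact h2.continuousOn

end HeatKernel

/-! ### Regularity of integrals depending on time and space. -/

section Dominated

variable {d : ℕ} {𝒳 F G : Type*} [MeasurableSpace 𝒳] {μ : Measure 𝒳} {B : 𝒳 → ℝ}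
  [NormedAddCommGroup F] [NormedSpace ℝ F] [NormedAddCommGroup G] [NormedSpace ℝ G]

/-- An integrand depending continuously on `(t, x)`, which is bounded by `B` up to a factor that is
locally bounded in `t`. -/
structure IsDominated (μ : Measure 𝒳) (B : 𝒳 → ℝ) (Ψ : ℝ × Eu d → 𝒳 → F) : Prop where
  meas : ∀ r ∈ Ioo (0 : ℝ) 1 ×ˢ univ, AEStronglyMeasurable (Ψ r) μ
  cont : ∀ p, ContinuousOn (fun r => Ψ r p) (Ioo 0 1 ×ˢ univ)
  bound : ∃ β : ℝ → ℝ, ContinuousOn β (Ioo 0 1) ∧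
    ∀ r ∈ Ioo (0 : ℝ) 1 ×ˢ univ, ∀ p, ‖Ψ r p‖ ≤ β r.1 * B p

namespace IsDominated

variable {Ψ Φ : ℝ × Eu d → 𝒳 → F}

theorem add (h : IsDominated μ B Ψ) (h' : IsDominated μ B Φ) :
    IsDominated μ B (fun r p => Ψ r p + Φ r p) := by
  obtain ⟨β, hβ, hb⟩ := h.bound
  obtain ⟨β', hβ', hb'⟩ := h'.bound
  refine ⟨fun r hr => (h.meas r hr).add (h'.meas r hr), fun p => (h.cont p).add (h'.cont p),
    fun t => β t + β' t, hβ.add hβ', fun r hr p => ?_⟩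
  rw [add_mul]
  exact (norm_add_le _ _).trans (add_le_add (hb r hr p) (hb' r hr p))

theorem smul (h : IsDominated μ B Ψ) {c : ℝ → ℝ} (hc : ContinuousOn c (Ioo 0 1)) :
    IsDominated μ B (fun r p => c r.1 • Ψ r p) := by
  obtain ⟨β, hβ, hb⟩ := h.bound
  refine ⟨fun r hr => (h.meas r hr).const_smul _, fun p =>
    (hc.comp continuousOn_fst fun r hr => hr.1).smul (h.cont p),
    fun t => ‖c t‖ * β t, hc.norm.mul hβ, fun r hr p => ?_⟩
  rw [norm_smul, mul_assoc]
  exact mul_le_mul_of_nonneg_left (hb r hr p) (norm_nonneg _)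

theorem clm (h : IsDominated μ B Ψ) (L : F →L[ℝ] G) : IsDominated μ B (fun r p => L (Ψ r p)) := by
  obtain ⟨β, hβ, hb⟩ := h.bound
  refine ⟨fun r hr => L.continuous.comp_aestronglyMeasurable (h.meas r hr), fun p =>
    L.continuous.comp_continuousOn (h.cont p),
    fun t => ‖L‖ * β t, continuousOn_const.mul hβ, fun r hr p => ?_⟩
  rw [mul_assoc]
  exact (L.le_opNorm _).trans (mul_le_mul_of_nonneg_left (hb r hr p) (norm_nonneg _))

theorem integrable (h : IsDominated μ B Ψ) (hB : Integrable B μ) {t : ℝ} (ht : t ∈ Ioo (0 : ℝ) 1)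
    (x : Eu d) : Integrable (Ψ (t, x)) μ := by
  obtain ⟨β, -, hb⟩ := h.bound
  exact (hB.const_mul (β t)).mono' (h.meas _ ⟨ht, mem_univ _⟩)
    (.of_forall fun p => hb (t, x) ⟨ht, mem_univ _⟩ p)

theorem exists_nhds (h : IsDominated μ B Ψ) (hB0 : ∀ p, 0 ≤ B p) {t : ℝ}
    (ht : t ∈ Ioo (0 : ℝ) 1) :
    ∃ C, ∀ᶠ τ in 𝓝 t, τ ∈ Ioo (0 : ℝ) 1 ∧ ∀ x p, ‖Ψ (τ, x) p‖ ≤ C * B p := by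
  obtain ⟨β, hβ, hb⟩ := h.bound
  have h1 := Ioo_mem_nhds ht.1 ht.2
  refine ⟨β t + 1, ?_⟩
  filter_upwards [h1, (hβ.continuousAt h1).eventually (Iio_mem_nhds (lt_add_one (β t)))] with
    τ hτ hτ'
  exact ⟨hτ, fun x p => (hb (τ, x) ⟨hτ, mem_univ _⟩ p).trans
    (mul_le_mul_of_nonneg_right (le_of_lt hτ') (hB0 p))⟩

theorem continuousOn_integral (h : IsDominated μ B Ψ) (hB : Integrable B μ) (hB0 : ∀ p, 0 ≤ B p) :
    ContinuousOn (fun r => ∫ p, Ψ r p ∂μ) (Ioo 0 1 ×ˢ univ) := by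
  intro r hr
  obtain ⟨C, hC⟩ := h.exists_nhds hB0 hr.1
  have ho : Ioo (0 : ℝ) 1 ×ˢ (univ : Set (Eu d)) ∈ 𝓝 r :=
    (isOpen_Ioo.prod isOpen_univ).mem_nhds hr
  refine (continuousAt_of_dominated (bound := fun p => C * B p) ?_ ?_ (hB.const_mul C)
    (.of_forall fun p => (h.cont p).continuousAt ho)).continuousWithinAt
  · filter_upwards [ho] with s hs using h.meas s hs
  · filter_upwards [continuousAt_fst.eventually hC] with s hs
    exact .of_forall fun p => hs.2 s.2 p

theorem hasFDerivAt_integral {Ψ' : ℝ × Eu d → 𝒳 → Eu d →L[ℝ] F} (h : IsDominated μ B Ψ)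
    (h' : IsDominated μ B Ψ') (hB : Integrable B μ)
    {t : ℝ} (ht : t ∈ Ioo (0 : ℝ) 1)
    (hd : ∀ x p, HasFDerivAt (fun y => Ψ (t, y) p) (Ψ' (t, x) p) x) (x : Eu d) :
    HasFDerivAt (fun y => ∫ p, Ψ (t, y) p ∂μ) (∫ p, Ψ' (t, x) p ∂μ) x := by
  obtain ⟨β, -, hb⟩ := h'.bound
  exact hasFDerivAt_integral_of_dominated_of_fderiv_le (bound := fun p => β t * B p) univ_mem
    (.of_forall fun y => h.meas _ ⟨ht, mem_univ _⟩) (h.integrable hB ht x)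
    (h'.meas _ ⟨ht, mem_univ _⟩)
    (.of_forall fun p y _ => hb (t, y) ⟨ht, mem_univ _⟩ p) (hB.const_mul _)
    (.of_forall fun p y _ => hd y p)

theorem hasDerivAt_integral (h : IsDominated μ B Ψ) (h' : IsDominated μ B Φ) (hB : Integrable B μ)
    (hB0 : ∀ p, 0 ≤ B p) {t : ℝ} (ht : t ∈ Ioo (0 : ℝ) 1) (x : Eu d)
    (hd : ∀ τ ∈ Ioo (0 : ℝ) 1, ∀ p, HasDerivAt (fun τ => Ψ (τ, x) p) (Φ (τ, x) p) τ) :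
    HasDerivAt (fun τ => ∫ p, Ψ (τ, x) p ∂μ) (∫ p, Φ (t, x) p ∂μ) t := by
  obtain ⟨C, hC⟩ := h'.exists_nhds hB0 ht
  exact (hasDerivAt_integral_of_dominated_loc_of_deriv_le (bound := fun p => C * B p) hC
    (by filter_upwards [Ioo_mem_nhds ht.1 ht.2] with τ hτ using h.meas _ ⟨hτ, mem_univ _⟩)
    (h.integrable hB ht x) (h'.meas _ ⟨ht, mem_univ _⟩)
    (.of_forall fun p τ hτ => hτ.2 x p) (hB.const_mul _)
    (.of_forall fun p τ hτ => hd τ hτ.1 p)).2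

end IsDominated

end Dominated

/-- A family of paths `Y · p` with velocities `D · p`, integrated against a measure `μ`, and a
variance schedule `q` with derivative `q'`. -/
structure IsPathFamily {d : ℕ} {𝒳 : Type*} [MeasurableSpace 𝒳] (μ : Measure 𝒳)
    (Y D : ℝ → 𝒳 → Eu d) (q q' : ℝ → ℝ) (B : 𝒳 → ℝ) : Prop where
  q_pos : ∀ t ∈ Ioo (0 : ℝ) 1, 0 < q t
  deriv_q : ∀ t ∈ Ioo (0 : ℝ) 1, HasDerivAt q (q' t) t
  cont_q' : ContinuousOn q' (Ioo 0 1)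
  meas_Y : ∀ t ∈ Ioo (0 : ℝ) 1, Measurable (Y t)
  meas_D : ∀ t ∈ Ioo (0 : ℝ) 1, Measurable (D t)
  deriv_Y : ∀ t ∈ Ioo (0 : ℝ) 1, ∀ p, HasDerivAt (fun τ => Y τ p) (D t p) t
  cont_D : ∀ p, ContinuousOn (fun t => D t p) (Ioo 0 1)
  bound : ∀ t ∈ Ioo (0 : ℝ) 1, ∀ p, ‖D t p‖ ≤ B p
  one_le : ∀ p, 1 ≤ B p
  integrable : Integrable B μ

/-! ### Densities and fluxes of Gaussian mixtures along moving centres. -/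

section Kernel

variable {d : ℕ} {𝒳 F G : Type*} [MeasurableSpace 𝒳]

/-- The density of `Y t p + √(q t) z`, where `p` has law `μ` and `z` is a standard Gaussian. -/
noncomputable def mixDensity (μ : Measure 𝒳) (Y : ℝ → 𝒳 → Eu d) (q : ℝ → ℝ) (t : ℝ) (x : Eu d) :
    ℝ := ∫ p, heatKernel (q t) (x - Y t p) ∂μ

/-- The gradient of `mixDensity`. -/
noncomputable def mixGrad (μ : Measure 𝒳) (Y : ℝ → 𝒳 → Eu d) (q : ℝ → ℝ) (t : ℝ) (x : Eu d) :
    Eu d := ∫ p, heatGrad (q t) (x - Y t p) ∂μ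

/-- The Hessian of `mixDensity`. -/
noncomputable def mixHess (μ : Measure 𝒳) (Y : ℝ → 𝒳 → Eu d) (q : ℝ → ℝ) (t : ℝ) (x : Eu d) :
    Eu d →L[ℝ] Eu d := ∫ p, heatHess (q t) (x - Y t p) ∂μ

/-- The momentum transported by the velocities `D`. -/
noncomputable def mixMomentum (μ : Measure 𝒳) (Y D : ℝ → 𝒳 → Eu d) (q : ℝ → ℝ) (t : ℝ)
    (x : Eu d) : Eu d := ∫ p, heatKernel (q t) (x - Y t p) • D t p ∂μ

/-- The derivative of `mixMomentum`. -/
noncomputable def mixMomentumDeriv (μ : Measure 𝒳) (Y D : ℝ → 𝒳 → Eu d) (q : ℝ → ℝ) (t : ℝ)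
    (x : Eu d) : Eu d →L[ℝ] Eu d :=
  ∫ p, (innerSL ℝ (heatGrad (q t) (x - Y t p))).smulRight (D t p) ∂μ

/-- The probability flux of the mixture. -/
noncomputable def mixFlux (μ : Measure 𝒳) (Y D : ℝ → 𝒳 → Eu d) (q q' : ℝ → ℝ) (t : ℝ)
    (x : Eu d) : Eu d := mixMomentum μ Y D q t x - (q' t / 2) • mixGrad μ Y q t x

/-- The velocity field of the mixture. -/
noncomputable def mixVelocity (μ : Measure 𝒳) (Y D : ℝ → 𝒳 → Eu d) (q q' : ℝ → ℝ) (t : ℝ)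
    (x : Eu d) : Eu d := (mixDensity μ Y q t x)⁻¹ • mixFlux μ Y D q q' t x

namespace IsPathFamily

variable [NormedAddCommGroup F] [NormedSpace ℝ F] [NormedAddCommGroup G] [NormedSpace ℝ G]
  {μ : Measure 𝒳} {Y D : ℝ → 𝒳 → Eu d} {q q' : ℝ → ℝ} {B : 𝒳 → ℝ}

theorem nonneg (h : IsPathFamily μ Y D q q' B) (p : 𝒳) : 0 ≤ B p := zero_le_one.trans (h.one_le p)

theorem cont_q (h : IsPathFamily μ Y D q q' B) : ContinuousOn q (Ioo 0 1) := fun t ht =>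
  (h.deriv_q t ht).continuousAt.continuousWithinAt

/-- The condition `1 ≤ B` lets the envelope of the velocities also dominate integrands without a
velocity factor. -/
theorem isDominated_kernel (h : IsPathFamily μ Y D q q' B) {k : ℝ → Eu d → F}
    (hk : ContinuousOn (fun r : ℝ × Eu d => k r.1 r.2) (Ioi 0 ×ˢ univ)) {β : ℝ → ℝ}
    (hβ : ContinuousOn β (Ioi 0)) (hb : ∀ s, 0 < s → ∀ y, ‖k s y‖ ≤ β s) :
    IsDominated μ B (fun r : ℝ × Eu d => fun p => k (q r.1) (r.2 - Y r.1 p)) := by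
  have hk' : ∀ s, 0 < s → Continuous (k s) := fun s hs => by
    have := hk.comp_continuous (f := fun y : Eu d => (s, y)) (by fun_prop) fun y =>
      ⟨hs, mem_univ _⟩
    exact this
  refine ⟨fun r hr => (hk' _ (h.q_pos _ hr.1)).comp_aestronglyMeasurable
    ((h.meas_Y _ hr.1).const_sub _).aestronglyMeasurable, fun p => ?_, fun t => β (q t),
    hβ.comp h.cont_q fun t ht => h.q_pos t ht, fun r hr p => ?_⟩
  · have hY : ContinuousOn (fun t => Y t p) (Ioo 0 1) := fun t ht =>
      (h.deriv_Y t ht p).continuousAt.continuousWithinAt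
    have h1 : ContinuousOn (fun r : ℝ × Eu d => (q r.1, r.2 - Y r.1 p)) (Ioo 0 1 ×ˢ univ) :=
      (h.cont_q.comp continuousOn_fst fun r hr => hr.1).prodMk
        (continuousOn_snd.sub (hY.comp continuousOn_fst fun r hr => hr.1))
    exact hk.comp h1 fun r hr => ⟨h.q_pos _ hr.1, mem_univ _⟩
  · have h1 := hb _ (h.q_pos _ hr.1) (r.2 - Y r.1 p)
    exact h1.trans (le_mul_of_one_le_right ((norm_nonneg _).trans h1) (h.one_le p))

theorem isDominated_bilin (h : IsPathFamily μ Y D q q' B) {k : ℝ → Eu d → F}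
    (hk : ContinuousOn (fun r : ℝ × Eu d => k r.1 r.2) (Ioi 0 ×ˢ univ)) {β : ℝ → ℝ}
    (hβ : ContinuousOn β (Ioi 0)) (hb : ∀ s, 0 < s → ∀ y, ‖k s y‖ ≤ β s)
    {L : F → Eu d → G} (hL : Continuous fun a : F × Eu d => L a.1 a.2)
    (hL' : ∀ a v, ‖L a v‖ ≤ ‖a‖ * ‖v‖) :
    IsDominated μ B (fun r : ℝ × Eu d => fun p => L (k (q r.1) (r.2 - Y r.1 p)) (D r.1 p)) := by
  have h0 := h.isDominated_kernel hk hβ hb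
  refine ⟨fun r hr => hL.comp_aestronglyMeasurable
    ((h0.meas r hr).prodMk (h.meas_D _ hr.1).aestronglyMeasurable), fun p => ?_, fun t => β (q t),
    hβ.comp h.cont_q fun t ht => h.q_pos t ht, fun r hr p => ?_⟩
  · exact hL.comp_continuousOn ((h0.cont p).prodMk
      ((h.cont_D p).comp continuousOn_fst fun r hr => hr.1))
  · have h1 := hb _ (h.q_pos _ hr.1) (r.2 - Y r.1 p)
    exact (hL' _ _).trans (mul_le_mul h1 (h.bound _ hr.1 p) (norm_nonneg _)
      ((norm_nonneg _).trans h1))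

theorem isDominated_heatKernel (h : IsPathFamily μ Y D q q' B) :
    IsDominated μ B (fun r : ℝ × Eu d => fun p => heatKernel (q r.1) (r.2 - Y r.1 p)) :=
  h.isDominated_kernel continuousOn_heatKernel continuousOn_heatBound
    fun _ hs y => norm_heatKernel_le hs y

theorem continuousOn_heatBound_div :
    ContinuousOn (fun s => heatBound d s / s) (Ioi 0) :=
  continuousOn_heatBound.div continuousOn_id fun _ hs => ne_of_gt hs

theorem isDominated_heatGrad (h : IsPathFamily μ Y D q q' B) :
    IsDominated μ B (fun r : ℝ × Eu d => fun p => heatGrad (q r.1) (r.2 - Y r.1 p)) :=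
  h.isDominated_kernel continuousOn_heatGrad continuousOn_heatBound_div
    fun _ hs y => norm_heatGrad_le hs y

theorem isDominated_heatHess (h : IsPathFamily μ Y D q q' B) :
    IsDominated μ B (fun r : ℝ × Eu d => fun p => heatHess (q r.1) (r.2 - Y r.1 p)) :=
  h.isDominated_kernel continuousOn_heatHess (continuousOn_heatBound_div.add
    (continuousOn_heatBound.div (continuousOn_id.pow 2) fun _ hs => pow_ne_zero 2 (ne_of_gt hs)))
    fun _ hs y => norm_heatHess_le hs y

theorem isDominated_momentum (h : IsPathFamily μ Y D q q' B) :
    IsDominated μ B (fun r : ℝ × Eu d => fun p =>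
      heatKernel (q r.1) (r.2 - Y r.1 p) • D r.1 p) :=
  h.isDominated_bilin continuousOn_heatKernel continuousOn_heatBound
    (fun _ hs y => norm_heatKernel_le hs y) (L := fun (a : ℝ) (v : Eu d) => a • v) (by fun_prop)
    fun a v => (norm_smul a v).le

theorem isDominated_momentumDeriv (h : IsPathFamily μ Y D q q' B) :
    IsDominated μ B (fun r : ℝ × Eu d => fun p =>
      (innerSL ℝ (heatGrad (q r.1) (r.2 - Y r.1 p))).smulRight (D r.1 p)) := by
  refine h.isDominated_bilin continuousOn_heatGrad continuousOn_heatBound_div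
    (fun _ hs y => norm_heatGrad_le hs y)
    (L := fun (a v : Eu d) => (innerSL ℝ a).smulRight v) ?_ fun a v => ?_
  · have h1 : Continuous fun r : Eu d × Eu d => innerSL ℝ r.1 := by fun_prop
    exact ((ContinuousLinearMap.smulRightL ℝ (Eu d) (Eu d)).continuous.comp h1).clm_apply
      continuous_snd
  · rw [ContinuousLinearMap.norm_smulRight_apply, innerSL_apply_norm]

theorem hasFDerivAt_mixDensity (h : IsPathFamily μ Y D q q' B) {t : ℝ} (ht : t ∈ Ioo (0 : ℝ) 1)
    (x : Eu d) : HasFDerivAt (mixDensity μ Y q t) (innerSL ℝ (mixGrad μ Y q t x)) x := by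
  have h2 : IsDominated μ B (fun r : ℝ × Eu d => fun p =>
      InnerProductSpace.toDual ℝ (Eu d) (heatGrad (q r.1) (r.2 - Y r.1 p))) := by
    obtain ⟨h1, h2, β, h3, h4⟩ := h.isDominated_heatGrad
    refine ⟨fun r hr => (LinearIsometryEquiv.continuous _).comp_aestronglyMeasurable (h1 r hr),
      fun p => (LinearIsometryEquiv.continuous _).comp_continuousOn (h2 p), β, h3, fun r hr p => ?_⟩
    rw [LinearIsometryEquiv.norm_map]
    exact h4 r hr p
  have h3 := h.isDominated_heatKernel.hasFDerivAt_integral h2 h.integrable ht (fun x p =>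
    ((hasFDerivAt_comp_sub _).2 (hasFDerivAt_heatKernel (q t) (x - Y t p))).congr_fderiv
      (by ext v; simp)) x
  refine h3.congr_fderiv ?_
  ext v
  rw [ContinuousLinearMap.integral_apply (h2.integrable h.integrable ht x)]
  simp only [InnerProductSpace.toDual_apply_apply, innerSL_apply_apply, mixGrad]
  simp_rw [real_inner_comm v]
  exact integral_inner (𝕜 := ℝ) (h.isDominated_heatGrad.integrable h.integrable ht x) v

theorem hasFDerivAt_mixGrad (h : IsPathFamily μ Y D q q' B) {t : ℝ} (ht : t ∈ Ioo (0 : ℝ) 1)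
    (x : Eu d) : HasFDerivAt (mixGrad μ Y q t) (mixHess μ Y q t x) x :=
  h.isDominated_heatGrad.hasFDerivAt_integral h.isDominated_heatHess h.integrable ht (fun x p =>
    (hasFDerivAt_comp_sub _).2 (hasFDerivAt_heatGrad (q t) (x - Y t p))) x

theorem hasFDerivAt_mixMomentum (h : IsPathFamily μ Y D q q' B) {t : ℝ}
    (ht : t ∈ Ioo (0 : ℝ) 1) (x : Eu d) :
    HasFDerivAt (mixMomentum μ Y D q t) (mixMomentumDeriv μ Y D q t x) x :=
  h.isDominated_momentum.hasFDerivAt_integral h.isDominated_momentumDeriv h.integrable ht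
    (fun x p => ((hasFDerivAt_comp_sub _).2
      (hasFDerivAt_heatKernel (q t) (x - Y t p))).smul_const (D t p)) x

theorem continuousOn_mixDensity (h : IsPathFamily μ Y D q q' B) :
    ContinuousOn (fun r : ℝ × Eu d => mixDensity μ Y q r.1 r.2) (Ioo 0 1 ×ˢ univ) :=
  h.isDominated_heatKernel.continuousOn_integral h.integrable h.nonneg

theorem continuousOn_mixGrad (h : IsPathFamily μ Y D q q' B) :
    ContinuousOn (fun r : ℝ × Eu d => mixGrad μ Y q r.1 r.2) (Ioo 0 1 ×ˢ univ) :=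
  h.isDominated_heatGrad.continuousOn_integral h.integrable h.nonneg

theorem continuousOn_mixHess (h : IsPathFamily μ Y D q q' B) :
    ContinuousOn (fun r : ℝ × Eu d => mixHess μ Y q r.1 r.2) (Ioo 0 1 ×ˢ univ) :=
  h.isDominated_heatHess.continuousOn_integral h.integrable h.nonneg

theorem continuousOn_mixMomentum (h : IsPathFamily μ Y D q q' B) :
    ContinuousOn (fun r : ℝ × Eu d => mixMomentum μ Y D q r.1 r.2) (Ioo 0 1 ×ˢ univ) :=
  h.isDominated_momentum.continuousOn_integral h.integrable h.nonneg

theorem continuousOn_mixMomentumDeriv (h : IsPathFamily μ Y D q q' B) :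
    ContinuousOn (fun r : ℝ × Eu d => mixMomentumDeriv μ Y D q r.1 r.2) (Ioo 0 1 ×ˢ univ) :=
  h.isDominated_momentumDeriv.continuousOn_integral h.integrable h.nonneg

theorem continuous_slice {f : ℝ → Eu d → F}
    (hf : ContinuousOn (fun r : ℝ × Eu d => f r.1 r.2) (Ioo 0 1 ×ˢ univ)) {t : ℝ}
    (ht : t ∈ Ioo (0 : ℝ) 1) : Continuous (f t) :=
  hf.comp_continuous (f := fun y : Eu d => (t, y)) (by fun_prop) fun _ => ⟨ht, mem_univ _⟩

theorem gradient_mixDensity (h : IsPathFamily μ Y D q q' B) {t : ℝ} (ht : t ∈ Ioo (0 : ℝ) 1) :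
    ∇ (mixDensity μ Y q t) = mixGrad μ Y q t := by
  funext x
  refine HasGradientAt.gradient ?_
  rw [hasGradientAt_iff_hasFDerivAt]
  exact h.hasFDerivAt_mixDensity ht x

theorem contDiff_mixGrad (h : IsPathFamily μ Y D q q' B) {t : ℝ} (ht : t ∈ Ioo (0 : ℝ) 1) :
    ContDiff ℝ 1 (mixGrad μ Y q t) :=
  contDiff_one_iff_hasFDerivAt.2 ⟨_, continuous_slice h.continuousOn_mixHess ht,
    h.hasFDerivAt_mixGrad ht⟩

theorem contDiff_mixMomentum (h : IsPathFamily μ Y D q q' B) {t : ℝ} (ht : t ∈ Ioo (0 : ℝ) 1) :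
    ContDiff ℝ 1 (mixMomentum μ Y D q t) :=
  contDiff_one_iff_hasFDerivAt.2 ⟨_, continuous_slice h.continuousOn_mixMomentumDeriv ht,
    h.hasFDerivAt_mixMomentum ht⟩

theorem contDiff_mixDensity (h : IsPathFamily μ Y D q q' B) {t : ℝ} (ht : t ∈ Ioo (0 : ℝ) 1) :
    ContDiff ℝ 2 (mixDensity μ Y q t) := by
  have h1 : ContDiff ℝ 1 fun x => InnerProductSpace.toDual ℝ (Eu d) (mixGrad μ Y q t x) :=
    (InnerProductSpace.toDual ℝ (Eu d)).contDiff.comp (h.contDiff_mixGrad ht)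
  exact (contDiff_succ_iff_hasFDerivAt (n := 1)).2 ⟨_, h1, h.hasFDerivAt_mixDensity ht⟩

theorem mixDensity_pos [NeZero μ] (h : IsPathFamily μ Y D q q' B) {t : ℝ} (ht : t ∈ Ioo (0 : ℝ) 1)
    (x : Eu d) : 0 < mixDensity μ Y q t x := by
  have h1 : ∀ p, 0 < heatKernel (q t) (x - Y t p) := fun p => heatKernel_pos (h.q_pos t ht) _
  refine (integral_pos_iff_support_of_nonneg (fun p => (h1 p).le)
    (h.isDominated_heatKernel.integrable h.integrable ht x)).2 ?_
  have : Function.support (fun p => heatKernel (q t) (x - Y t p)) = univ :=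
    eq_univ_of_forall fun p => (h1 p).ne'
  rw [this]
  exact Measure.measure_univ_pos.2 (NeZero.ne μ)

theorem hasFDerivAt_mixFlux (h : IsPathFamily μ Y D q q' B) {t : ℝ} (ht : t ∈ Ioo (0 : ℝ) 1)
    (x : Eu d) : HasFDerivAt (mixFlux μ Y D q q' t)
      (mixMomentumDeriv μ Y D q t x - (q' t / 2) • mixHess μ Y q t x) x :=
  (h.hasFDerivAt_mixMomentum ht x).sub ((h.hasFDerivAt_mixGrad ht x).fun_const_smul _)

theorem contDiff_mixFlux (h : IsPathFamily μ Y D q q' B) {t : ℝ} (ht : t ∈ Ioo (0 : ℝ) 1) :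
    ContDiff ℝ 1 (mixFlux μ Y D q q' t) :=
  (h.contDiff_mixMomentum ht).sub ((contDiff_const_smul _).comp (h.contDiff_mixGrad ht))

/-- The heat equation writes the effect of the changing variance as `(q'/2)` times the trace of the
Hessian, and the motion of the centres contributes minus the trace of the derivative of the
momentum. Together they form the divergence of the single flux `mixFlux`. -/
theorem hasDerivAt_mixDensity (h : IsPathFamily μ Y D q q' B) {t : ℝ} (ht : t ∈ Ioo (0 : ℝ) 1)
    (x : Eu d) :
    HasDerivAt (fun τ => mixDensity μ Y q τ x) (-divergence (mixFlux μ Y D q q' t) x) t := by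
  have hc : ContinuousOn (fun t => q' t / 2) (Ioo 0 1) := h.cont_q'.div_const 2
  have hA := h.isDominated_heatHess.smul hc
  have hN := h.isDominated_momentumDeriv.smul (c := fun _ => -1) continuousOn_const
  have hW := hA.add hN
  have h1 := h.isDominated_heatKernel.hasDerivAt_integral (hW.clm (traceL d)) h.integrable
    h.nonneg ht x fun τ hτ p => by
      refine (hasDerivAt_heatKernel_comp (h.q_pos τ hτ) (h.deriv_q τ hτ)
        ((h.deriv_Y τ hτ p).const_sub x)).congr_deriv ?_
      simp only [map_add, map_smul, traceL_heatHess (h.q_pos τ hτ), traceL_smulRight,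
        inner_neg_right, smul_eq_mul]
      ring
  refine h1.congr_deriv ?_
  rw [(traceL d).integral_comp_comm (hW.integrable h.integrable ht x),
    integral_add (hA.integrable h.integrable ht x) (hN.integrable h.integrable ht x),
    integral_smul, integral_smul, divergence_eq_traceL, (h.hasFDerivAt_mixFlux ht x).fderiv,
    ← map_neg]
  simp only [mixHess, mixMomentumDeriv]
  congr 1
  module

end IsPathFamily

end Kernel

/-! ### The law of a scaled Gaussian and of its independent translates. -/

section GaussianLaw

variable {d : ℕ}

theorem continuous_heatKernel (q : ℝ) : Continuous (heatKernel (d := d) q) := by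
  unfold heatKernel
  fun_prop

theorem ofReal_heatKernel {q : ℝ} (hq : 0 < q) (y : Eu d) :
    ((heatKernel q y : ℝ) : ℂ) = ((2 * Real.pi * q : ℝ) : ℂ) ^ (-(d / 2 : ℂ)) *
      Complex.exp (-((1 / (2 * q) : ℝ) : ℂ) * ‖y‖ ^ 2) := by
  have h1 : (0 : ℝ) ≤ 2 * Real.pi * q := by positivity
  rw [heatKernel, Complex.ofReal_mul, Complex.ofReal_cpow h1]
  push_cast
  congr 2
  ring

theorem integrable_heatKernel {q : ℝ} (hq : 0 < q) :
    Integrable (heatKernel (d := d) q) := by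
  have h1 := GaussianFourier.integrable_cexp_neg_mul_sq_norm_add (V := Eu d)
    (b := ((1 / (2 * q) : ℝ) : ℂ)) (by rw [Complex.ofReal_re]; positivity) 0 0
  have h2 := ((h1.const_mul (((2 * Real.pi * q : ℝ) : ℂ) ^ (-(d / 2 : ℂ)))).norm)
  refine h2.congr (.of_forall fun y => ?_)
  have h3 := ofReal_heatKernel hq y
  simp only [zero_mul, add_zero]
  rw [← h3, Complex.norm_real, Real.norm_of_nonneg (heatKernel_pos hq y).le]

/-- Both measures are finite and have the same characteristic function, by the Gaussian Fourier
integral. -/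
theorem map_smul_stdGaussian {g : ℝ} (hg : 0 < g) :
    (stdGaussian (Eu d)).map (g • ·) =
      volume.withDensity (fun y => ENNReal.ofReal (heatKernel (g ^ 2) y)) := by
  have hq : 0 < g ^ 2 := by positivity
  have hfin : IsFiniteMeasure
      ((volume : Measure (Eu d)).withDensity (fun y => ENNReal.ofReal (heatKernel (g ^ 2) y))) :=
    isFiniteMeasure_withDensity_ofReal (integrable_heatKernel hq).2
  refine Measure.ext_of_charFun (funext fun t => ?_)
  rw [charFun_map_smul, charFun_stdGaussian, charFun_apply,
    integral_withDensity_eq_integral_toReal_smul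
      (continuous_heatKernel _).measurable.ennreal_ofReal (by simp)]
  have hb : 0 < (((1 / (2 * g ^ 2) : ℝ) : ℂ)).re := by rw [Complex.ofReal_re]; positivity
  have h1 : ∀ x : Eu d, (ENNReal.ofReal (heatKernel (g ^ 2) x)).toReal •
      Complex.exp (⟪x, t⟫ * Complex.I) = ((2 * Real.pi * g ^ 2 : ℝ) : ℂ) ^ (-(d / 2 : ℂ)) *
        Complex.exp (-((1 / (2 * g ^ 2) : ℝ) : ℂ) * ‖x‖ ^ 2 + Complex.I * ⟪t, x⟫) := fun x => by
    rw [ENNReal.toReal_ofReal (heatKernel_pos hq x).le, Complex.real_smul, ofReal_heatKernel hq,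
      Complex.exp_add, mul_assoc, mul_comm Complex.I, real_inner_comm]
  simp_rw [h1]
  rw [integral_const_mul, GaussianFourier.integral_cexp_neg_mul_sq_norm_add hb, ← mul_assoc]
  have h2 : (Real.pi : ℂ) / ((1 / (2 * g ^ 2) : ℝ) : ℂ) = ((2 * Real.pi * g ^ 2 : ℝ) : ℂ) := by
    have : (g : ℂ) ≠ 0 := by exact_mod_cast hg.ne'
    push_cast
    field_simp
  have h3 : ((2 * Real.pi * g ^ 2 : ℝ) : ℂ) ≠ 0 := by
    have : (2 * Real.pi * g ^ 2 : ℝ) ≠ 0 := by positivity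
    exact_mod_cast this
  rw [h2, finrank_euclideanSpace_fin, ← Complex.cpow_add _ _ h3, neg_add_cancel, Complex.cpow_zero,
    one_mul, norm_smul, Real.norm_of_nonneg hg.le, Complex.I_sq]
  congr 1
  have : (g : ℂ) ≠ 0 := by exact_mod_cast hg.ne'
  push_cast
  field_simp
  ring

variable {Ω 𝒳 : Type*} [MeasurableSpace Ω] [MeasurableSpace 𝒳] {P : Measure Ω}
  [IsProbabilityMeasure P]

/-- The joint law of `ξ` and `Y ξ + g z` for a standard Gaussian `z` independent of `ξ`. -/
theorem map_prodMk_add_smul {ξ : Ω → 𝒳} {z : Ω → Eu d} {Y : 𝒳 → Eu d} {g : ℝ}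
    (hξ : Measurable ξ) (hz : Measurable z) (hind : IndepFun ξ z P)
    (hlaw : P.map z = stdGaussian (Eu d)) (hY : Measurable Y) (hg : 0 < g) :
    P.map (fun ω => (ξ ω, Y (ξ ω) + g • z ω)) = ((P.map ξ).prod volume).withDensity
      (fun r => ENNReal.ofReal (heatKernel (g ^ 2) (r.2 - Y r.1))) := by
  have hp : IsProbabilityMeasure (P.map ξ) := Measure.isProbabilityMeasure_map hξ.aemeasurable
  have hk : Measurable fun r : 𝒳 × Eu d => ENNReal.ofReal (heatKernel (g ^ 2) (r.2 - Y r.1)) :=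
    ((continuous_heatKernel _).measurable.comp
      (measurable_snd.sub (hY.comp measurable_fst))).ennreal_ofReal
  refine Measure.ext_of_lintegral _ fun f hf => ?_
  have hT : Measurable fun r : 𝒳 × Eu d => (r.1, Y r.1 + g • r.2) :=
    measurable_fst.prodMk ((hY.comp measurable_fst).add (measurable_snd.const_smul g))
  have h1 : P.map (fun ω => (ξ ω, Y (ξ ω) + g • z ω)) =
      ((P.map ξ).prod (stdGaussian (Eu d))).map (fun r => (r.1, Y r.1 + g • r.2)) := by
    rw [← hlaw, ← (indepFun_iff_map_prod_eq_prod_map_map hξ.aemeasurable hz.aemeasurable).1 hind,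
      Measure.map_map hT (hξ.prodMk hz)]
    rfl
  have hfT : Measurable fun r : 𝒳 × Eu d => f (r.1, Y r.1 + g • r.2) := hf.comp hT
  rw [h1, lintegral_map hf hT, lintegral_withDensity_eq_lintegral_mul _ hk hf,
    lintegral_prod _ hfT.aemeasurable, lintegral_prod _ (hk.mul hf).aemeasurable]
  refine lintegral_congr fun p => ?_
  have hf' : Measurable fun v => f (p, Y p + v) :=
    hf.comp (measurable_const.prodMk (measurable_const.add measurable_id))
  have h2 : ∫⁻ w, f (p, Y p + g • w) ∂stdGaussian (Eu d) =
      ∫⁻ v, f (p, Y p + v) ∂(stdGaussian (Eu d)).map (g • ·) :=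
    (lintegral_map hf' (measurable_const_smul g)).symm
  rw [h2, map_smul_stdGaussian hg, lintegral_withDensity_eq_lintegral_mul _
    (continuous_heatKernel _).measurable.ennreal_ofReal hf',
    ← lintegral_sub_right_eq_self _ (Y p)]
  refine lintegral_congr fun x => ?_
  simp

end GaussianLaw

/-! ### Marginals and conditional expectations computed from a joint density. -/

section JointDensity

variable {Ω 𝒳 E V : Type*} [MeasurableSpace Ω] [MeasurableSpace 𝒳] [MeasurableSpace E]
  {P : Measure Ω} [IsProbabilityMeasure P] {μ : Measure 𝒳} [SFinite μ] {ν : Measure E} [SFinite ν]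
  {ξ : Ω → 𝒳} {X : Ω → E} {k : 𝒳 × E → ℝ} {r : E → ℝ}

/-- The marginal of a joint density. -/
theorem map_snd_of_joint (hξ : Measurable ξ) (hX : Measurable X) (hk : Measurable k)
    (hk0 : ∀ a, 0 ≤ k a)
    (hlaw : P.map (fun ω => (ξ ω, X ω)) = (μ.prod ν).withDensity fun a => ENNReal.ofReal (k a))
    (hki : ∀ x, Integrable (fun p => k (p, x)) μ) (hr : ∀ x, r x = ∫ p, k (p, x) ∂μ) :
    P.map X = ν.withDensity fun x => ENNReal.ofReal (r x) := by
  ext A hA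
  have h1 : P.map X A = P.map (fun ω => (ξ ω, X ω)) (univ ×ˢ A) := by
    rw [Measure.map_apply hX hA, Measure.map_apply (hξ.prodMk hX) (MeasurableSet.univ.prod hA)]
    congr 1
    ext ω
    simp
  rw [h1, hlaw, withDensity_apply _ (MeasurableSet.univ.prod hA), withDensity_apply _ hA,
    ← Measure.prod_restrict, lintegral_prod_symm _ hk.ennreal_ofReal.aemeasurable,
    Measure.restrict_univ]
  refine lintegral_congr fun x => ?_
  rw [hr, ofReal_integral_eq_lintegral_ofReal (hki x) (.of_forall fun p => hk0 _)]

variable [NormedAddCommGroup V] [NormedSpace ℝ V] [CompleteSpace V] [MeasurableSpace V]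
  [BorelSpace V] [SecondCountableTopology V] {F : 𝒳 × E → V} {β : E → V}

/-- The conditional expectation given the second variable, in terms of a joint density. -/
theorem condExp_of_joint (hξ : Measurable ξ) (hX : Measurable X) (hk : Measurable k)
    (hk0 : ∀ a, 0 ≤ k a)
    (hlaw : P.map (fun ω => (ξ ω, X ω)) = (μ.prod ν).withDensity fun a => ENNReal.ofReal (k a))
    (hki : ∀ x, Integrable (fun p => k (p, x)) μ) (hr : ∀ x, r x = ∫ p, k (p, x) ∂μ)
    (hrm : Measurable r) (hr0 : ∀ x, 0 ≤ r x) (hF : Measurable F) (hβ : Measurable β)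
    (hFβ : ∀ x, r x • β x = ∫ p, k (p, x) • F (p, x) ∂μ)
    (hFi : Integrable (fun ω => F (ξ ω, X ω)) P) :
    (fun ω => β (X ω)) =ᵐ[P] P[fun ω => F (ξ ω, X ω) | MeasurableSpace.comap X inferInstance] := by
  have hξX : Measurable fun ω => (ξ ω, X ω) := hξ.prodMk hX
  have hmX := map_snd_of_joint hξ hX hk hk0 hlaw hki hr
  have hF1 : Integrable F (P.map (fun ω => (ξ ω, X ω))) :=
    (integrable_map_measure hF.aestronglyMeasurable hξX.aemeasurable).2 hFi
  have hF2 : Integrable (fun a => k a • F a) (μ.prod ν) := by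
    rw [hlaw, integrable_withDensity_iff_integrable_smul' hk.ennreal_ofReal (by simp)] at hF1
    simpa only [ENNReal.toReal_ofReal (hk0 _)] using hF1
  have hβ1 : Integrable β (P.map X) := by
    rw [hmX, integrable_withDensity_iff_integrable_smul' hrm.ennreal_ofReal (by simp)]
    simp only [ENNReal.toReal_ofReal (hr0 _), hFβ]
    exact hF2.integral_prod_right
  have hβ2 : Integrable (fun ω => β (X ω)) P :=
    (integrable_map_measure hβ.aestronglyMeasurable hX.aemeasurable).1 hβ1
  refine ae_eq_condExp_of_forall_setIntegral_eq hX.comap_le hFi (fun s _ _ => hβ2.integrableOn)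
    ?_ (hβ.comp (comap_measurable X)).aestronglyMeasurable
  rintro s ⟨A, hA, rfl⟩ -
  have e1 : ∫ ω in X ⁻¹' A, β (X ω) ∂P = ∫ x in A, r x • β x ∂ν := by
    rw [← setIntegral_map hA hβ.aestronglyMeasurable hX.aemeasurable, hmX,
      setIntegral_withDensity_eq_setIntegral_toReal_smul hrm.ennreal_ofReal (by simp) _ hA]
    simp only [ENNReal.toReal_ofReal (hr0 _)]
  have hpre : X ⁻¹' A = (fun ω => (ξ ω, X ω)) ⁻¹' (univ ×ˢ A) := by ext ω; simp
  have e2 : ∫ ω in X ⁻¹' A, F (ξ ω, X ω) ∂P = ∫ x in A, ∫ p, k (p, x) • F (p, x) ∂μ ∂ν := by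
    rw [hpre, ← setIntegral_map (MeasurableSet.univ.prod hA) hF.aestronglyMeasurable
      hξX.aemeasurable, hlaw, setIntegral_withDensity_eq_setIntegral_toReal_smul
      hk.ennreal_ofReal (by simp) _ (MeasurableSet.univ.prod hA)]
    simp only [ENNReal.toReal_ofReal (hk0 _)]
    rw [← Measure.prod_restrict, integral_prod_symm, Measure.restrict_univ]
    rw [Measure.prod_restrict]
    exact hF2.integrableOn
  rw [e1, e2]
  simp only [hFβ]

/-- Conditional expectations contract the second moment, in terms of a joint density. -/
theorem integral_sq_le_of_joint (hξ : Measurable ξ) (hX : Measurable X) (hk : Measurable k)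
    (hk0 : ∀ a, 0 ≤ k a)
    (hlaw : P.map (fun ω => (ξ ω, X ω)) = (μ.prod ν).withDensity fun a => ENNReal.ofReal (k a))
    (hki : ∀ x, Integrable (fun p => k (p, x)) μ) (hr : ∀ x, r x = ∫ p, k (p, x) ∂μ)
    (hrm : Measurable r) (hr0 : ∀ x, 0 ≤ r x) (hF : Measurable F) (hβ : Measurable β)
    (hFβ : ∀ x, r x • β x = ∫ p, k (p, x) • F (p, x) ∂μ)
    (hF2 : MemLp (fun ω => F (ξ ω, X ω)) 2 P) :
    Integrable (fun x => ‖β x‖ ^ 2 * r x) ν ∧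
      ∫ x, ‖β x‖ ^ 2 * r x ∂ν ≤ ∫ ω, ‖F (ξ ω, X ω)‖ ^ 2 ∂P := by
  have hmX := map_snd_of_joint hξ hX hk hk0 hlaw hki hr
  have hc := condExp_of_joint hξ hX hk hk0 hlaw hki hr hrm hr0 hF hβ hFβ
    (hF2.integrable (by norm_num))
  have hle : eLpNorm (fun ω => β (X ω)) 2 P ≤ eLpNorm (fun ω => F (ξ ω, X ω)) 2 P := by
    rw [eLpNorm_congr_ae hc]
    exact eLpNorm_condExp_le_eLpNorm _ (by norm_num)
  have hβ2 : MemLp (fun ω => β (X ω)) 2 P :=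
    ⟨(hβ.comp hX).aestronglyMeasurable, hle.trans_lt hF2.2⟩
  have hi : Integrable (fun x => ‖β x‖ ^ 2) (P.map X) :=
    (integrable_map_measure (hβ.norm.pow_const 2).aestronglyMeasurable hX.aemeasurable).2
      ((memLp_two_iff_integrable_sq_norm hβ2.1).1 hβ2)
  have hsm : ∀ x, (ENNReal.ofReal (r x)).toReal • ‖β x‖ ^ 2 = ‖β x‖ ^ 2 * r x := fun x => by
    rw [ENNReal.toReal_ofReal (hr0 x), smul_eq_mul, mul_comm]
  have e1 : ∫ x, ‖β x‖ ^ 2 * r x ∂ν = ∫ ω, ‖β (X ω)‖ ^ 2 ∂P := by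
    rw [← integral_map (f := fun x => ‖β x‖ ^ 2) hX.aemeasurable
      (hβ.norm.pow_const 2).aestronglyMeasurable, hmX,
      integral_withDensity_eq_integral_toReal_smul hrm.ennreal_ofReal (by simp)]
    simp only [hsm]
  refine ⟨?_, ?_⟩
  · rw [hmX, integrable_withDensity_iff_integrable_smul' hrm.ennreal_ofReal (by simp)] at hi
    simpa only [hsm] using hi
  · rw [e1]
    have key : ∀ {f : Ω → V}, MemLp f 2 P →
        ∫ ω, ‖f ω‖ ^ 2 ∂P = (eLpNorm f 2 P).toReal ^ 2 := fun {f} hf => by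
      rw [hf.eLpNorm_eq_integral_rpow_norm (by norm_num) (by norm_num),
        ENNReal.toReal_ofReal (by positivity), ← Real.rpow_natCast, ← Real.rpow_mul (by positivity)]
      norm_num
    rw [key hβ2, key hF2]
    have := ENNReal.toReal_mono hF2.2.ne hle
    gcongr

end JointDensity

/-! ### Nonnegative `C²` functions on the unit interval. -/

section UnitInterval

variable {F : Type*} [NormedAddCommGroup F] [NormedSpace ℝ F] {f : ℝ → F}

theorem ContDiffOn.hasDerivAt_unitInterval (hf : ContDiffOn ℝ 2 f (Icc 0 1)) {t : ℝ}
    (ht : t ∈ Ioo (0 : ℝ) 1) : HasDerivAt f (derivWithin f (Icc 0 1) t) t :=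
  ((hf.differentiableOn (by norm_num)) t ⟨ht.1.le, ht.2.le⟩).hasDerivWithinAt.hasDerivAt
    (Icc_mem_nhds ht.1 ht.2)

theorem ContDiffOn.continuousOn_derivWithin_unitInterval (hf : ContDiffOn ℝ 2 f (Icc 0 1)) :
    ContinuousOn (derivWithin f (Icc 0 1)) (Icc 0 1) :=
  hf.continuousOn_derivWithin (uniqueDiffOn_Icc zero_lt_one) (by norm_num)

/-- The derivative of a nonnegative `C²` function is controlled by the square root of the function,
with a weight that degenerates at the end points. -/
theorem exists_sq_derivWithin_le {q : ℝ → ℝ} (hq : ContDiffOn ℝ 2 q (Icc 0 1))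
    (hq0 : ∀ t ∈ Icc (0 : ℝ) 1, 0 ≤ q t) :
    ∃ A : ℝ, 0 ≤ A ∧ ∀ t ∈ Ioo (0 : ℝ) 1,
      derivWithin q (Icc 0 1) t ^ 2 ≤ q t * (A / t + A / (1 - t)) := by
  have h1 : ContDiffOn ℝ 1 (derivWithin q (Icc 0 1)) (Icc 0 1) :=
    hq.derivWithin (uniqueDiffOn_Icc zero_lt_one) (by norm_num)
  obtain ⟨K, hK⟩ := h1.exists_lipschitzOnWith one_ne_zero (convex_Icc 0 1) isCompact_Icc
  obtain ⟨M, hM⟩ := isCompact_Icc.exists_bound_of_continuousOn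
    hq.continuousOn_derivWithin_unitInterval
  have hM0 : 0 ≤ M := (norm_nonneg _).trans (hM 0 (by simp))
  -- For nonnegative `q`, evaluation at `t + h` gives `0 ≤ q + a h + K h²`. The step `h = -a m / C`
  -- goes downhill; `C ≥ M` keeps it within the distance `m` to the boundary, and `C ≥ 2K` makes the
  -- quadratic error at most half of the gain. Hence `a² ≤ 2 C q / m`.
  set C : ℝ := 2 * K + M + 1 with hC
  have hC0 : 0 < C := by positivity
  refine ⟨2 * C, by positivity, fun t ht => ?_⟩
  have htI : t ∈ Icc (0 : ℝ) 1 := ⟨ht.1.le, ht.2.le⟩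
  set m := min t (1 - t) with hm
  have hm0 : 0 < m := lt_min ht.1 (by linarith [ht.2])
  have hm1 : m ≤ t := min_le_left _ _
  have hm2 : m ≤ 1 - t := min_le_right _ _
  set a := derivWithin q (Icc 0 1) t with ha
  have haM : |a| ≤ M := hM t htI
  set h := -(a * m / C) with hh
  have hhm : |h| ≤ m := by
    rw [hh, abs_neg, abs_div, abs_mul, abs_of_pos hm0, abs_of_pos hC0, div_le_iff₀ hC0]
    have : |a| ≤ C := by rw [hC]; linarith [K.coe_nonneg]
    nlinarith
  have hth : t + h ∈ Icc (0 : ℝ) 1 := by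
    have := abs_le.1 hhm
    constructor <;> linarith
  have hsub : uIcc t (t + h) ⊆ Icc 0 1 := (convex_Icc (0 : ℝ) 1).ordConnected.uIcc_subset htI hth
  have hmv := (convex_uIcc t (t + h)).norm_image_sub_le_of_norm_hasDerivWithin_le
    (f := fun s => q s - a * s) (f' := fun s => derivWithin q (Icc 0 1) s - a) (C := K * |h|)
    (fun s hs => by
      have h2 := ((hq.differentiableOn (by norm_num)) s (hsub hs)).hasDerivWithinAt.mono hsub
      simpa using h2.fun_sub ((hasDerivWithinAt_id s _).const_mul a))
    (fun s hs => by
      have h2 := hK.dist_le_mul s (hsub hs) t htI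
      rw [dist_eq_norm] at h2
      refine h2.trans (mul_le_mul_of_nonneg_left ?_ K.coe_nonneg)
      have h3 := abs_sub_left_of_mem_uIcc hs
      simpa [Real.dist_eq] using h3)
    left_mem_uIcc right_mem_uIcc
  have h4 := hq0 _ hth
  have h5 : q (t + h) ≤ q t + a * h + K * h ^ 2 := by
    have := le_of_abs_le hmv
    simp only [add_sub_cancel_left, Real.norm_eq_abs] at this
    rw [← sq_abs h]
    linarith
  have h6 : a ^ 2 * m / (2 * C) ≤ q t := by
    have e1 : a * h = -(a ^ 2 * m / C) := by rw [hh]; ring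
    have e2 : K * h ^ 2 ≤ a ^ 2 * m / (2 * C) := by
      have : K * h ^ 2 = a ^ 2 * m / (2 * C) * (2 * K * m / C) := by
        rw [hh]; field_simp
      rw [this]
      refine mul_le_of_le_one_right (by positivity) ?_
      rw [div_le_one hC0, hC]
      nlinarith [K.coe_nonneg, ht.2]
    have e3 : a ^ 2 * m / C = 2 * (a ^ 2 * m / (2 * C)) := by field_simp
    linarith
  have h7 : a ^ 2 ≤ q t * (2 * C / m) := by
    rw [div_le_iff₀ (by positivity)] at h6
    rw [mul_div_assoc', le_div_iff₀ hm0]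
    linarith
  refine h7.trans (mul_le_mul_of_nonneg_left ?_ (hq0 t htI))
  have h8 : 0 < 1 - t := by linarith [ht.2]
  have h9 : 0 < t := ht.1
  have a1 : 0 ≤ 2 * C / t := by positivity
  have a2 : 0 ≤ 2 * C / (1 - t) := by positivity
  rcases min_choice t (1 - t) with h' | h' <;> rw [hm, h'] <;> linarith

end UnitInterval

/-! ### Measurability and integrability of the paths of an interpolant. -/

section Interpolant

variable {d : ℕ} {Ω : Type*} [MeasurableSpace Ω] {P : Measure Ω} [IsProbabilityMeasure P]
  {ρ₀ ρ₁ : Eu d → ℝ} {I : ℝ → Eu d → Eu d → Eu d} {γ : ℝ → ℝ} {x₀ x₁ z : Ω → Eu d}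

namespace IsStochasticInterpolant

theorem γ_nonneg (h : IsStochasticInterpolant P ρ₀ ρ₁ I γ x₀ x₁ z) {t : ℝ}
    (ht : t ∈ Icc (0 : ℝ) 1) : 0 ≤ γ t := by
  rcases ht.1.eq_or_lt with h0 | h0
  · rw [← h0, h.γ_zero]
  rcases ht.2.eq_or_lt with h1 | h1
  · rw [h1, h.γ_one]
  exact (h.γ_pos t ⟨h0, h1⟩).le

theorem continuousOn_γ (h : IsStochasticInterpolant P ρ₀ ρ₁ I γ x₀ x₁ z) :
    ContinuousOn γ (Icc 0 1) :=
  h.γ_sq.continuousOn.sqrt.congr fun t ht => (Real.sqrt_sq (h.γ_nonneg ht)).symm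

theorem deriv_γ (h : IsStochasticInterpolant P ρ₀ ρ₁ I γ x₀ x₁ z) {t : ℝ}
    (ht : t ∈ Ioo (0 : ℝ) 1) :
    deriv γ t = derivWithin (fun t => γ t ^ 2) (Icc 0 1) t / (2 * γ t) := by
  have h1 := (h.γ_sq.hasDerivAt_unitInterval ht).sqrt (pow_pos (h.γ_pos t ht) 2).ne'
  rw [Real.sqrt_sq (h.γ_pos t ht).le] at h1
  refine (h1.congr_of_eventuallyEq ?_).deriv
  filter_upwards [Icc_mem_nhds ht.1 ht.2] with s hs
  exact (Real.sqrt_sq (h.γ_nonneg hs)).symm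

theorem measurable_pair (h : IsStochasticInterpolant P ρ₀ ρ₁ I γ x₀ x₁ z) :
    Measurable fun ω => (x₀ ω, x₁ ω) := h.meas_x₀.prodMk h.meas_x₁

theorem measurable_I (h : IsStochasticInterpolant P ρ₀ ρ₁ I γ x₀ x₁ z) {t : ℝ}
    (ht : t ∈ Icc (0 : ℝ) 1) : Measurable fun p : Eu d × Eu d => I t p.1 p.2 :=
  (h.contDiff_space t ht).continuous.measurable

/-- The interpolant is regular in `t` and in `(x₀, x₁)` only separately. At interior times its time
derivative is a limit of difference quotients that are continuous in the end points; at `0` and `1`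
it is a limit of interior derivatives. -/
theorem measurable_dtI (h : IsStochasticInterpolant P ρ₀ ρ₁ I γ x₀ x₁ z) {t : ℝ}
    (ht : t ∈ Icc (0 : ℝ) 1) : Measurable fun p : Eu d × Eu d => dtI I t p.1 p.2 := by
  have hint : ∀ s ∈ Ioo (0 : ℝ) 1, Measurable fun p : Eu d × Eu d => dtI I s p.1 p.2 := by
    intro s hs
    have h1 : ∀ τ : ℝ, Measurable fun p : Eu d × Eu d =>
        τ⁻¹ • (I (projIcc (0 : ℝ) 1 zero_le_one (s + τ)) p.1 p.2 - I s p.1 p.2) := fun τ => by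
      have e1 := h.measurable_I (projIcc (0 : ℝ) 1 zero_le_one (s + τ)).2
      have e2 := h.measurable_I (t := s) ⟨hs.1.le, hs.2.le⟩
      fun_prop
    refine measurable_of_tendsto_metrizable' (𝓝[≠] (0 : ℝ)) h1 (tendsto_pi_nhds.2 fun p => ?_)
    have h2 := hasDerivAt_iff_tendsto_slope_zero.1
      ((h.contDiff_time p.1 p.2).hasDerivAt_unitInterval hs)
    refine h2.congr' (eventually_nhdsWithin_of_eventually_nhds ?_)
    have h3 : Tendsto (fun τ : ℝ => s + τ) (𝓝 0) (𝓝 s) := by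
      simpa using (show Continuous fun τ : ℝ => s + τ by fun_prop).tendsto 0
    filter_upwards [h3.eventually (Icc_mem_nhds hs.1 hs.2)] with τ hτ
    rw [projIcc_of_mem _ hτ]
  have hcl : t ∈ closure (Ioo (0 : ℝ) 1) := by rwa [closure_Ioo zero_ne_one]
  obtain ⟨s, hs, hst⟩ := mem_closure_iff_seq_limit.1 hcl
  refine measurable_of_tendsto_metrizable (fun n => hint (s n) (hs n))
    (tendsto_pi_nhds.2 fun p => ?_)
  refine ((h.contDiff_time p.1 p.2).continuousOn_derivWithin_unitInterval t ht).tendsto.comp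
    (tendsto_nhdsWithin_iff.2 ⟨hst, .of_forall fun n => ⟨(hs n).1.le, (hs n).2.le⟩⟩)

/-- No moment of `ρ₀` or `ρ₁` is assumed, but `x₁ - x₀` is the time integral of `∂ₜI`, whose fourth
moment is bounded. This makes the envelope `1 + |C| ‖x₀ - x₁‖` of the velocities integrable. -/
theorem lintegral_sub_lt_top (h : IsStochasticInterpolant P ρ₀ ρ₁ I γ x₀ x₁ z)
    (hA : InterpolantAssumption P ρ₀ ρ₁ I x₀ x₁) : ∫⁻ ω, ‖x₁ ω - x₀ ω‖ₑ ∂P < ⊤ := by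
  obtain ⟨M, hM⟩ := hA.moment_dt
  -- Extending the velocity constantly beyond `[0, 1]` makes it continuous in time on the whole
  -- line, so it is jointly measurable as a Carathéodory function and Tonelli applies.
  set c : ℝ → ℝ := fun t => projIcc (0 : ℝ) 1 zero_le_one t with hc
  have hcI : ∀ t, c t ∈ Icc (0 : ℝ) 1 := fun t => (projIcc _ _ _ t).2
  have hcc : Continuous c := continuous_subtype_val.comp continuous_projIcc
  have hD : ∀ a b, ContinuousOn (fun t => dtI I t a b) (Icc 0 1) := fun a b =>
    (h.contDiff_time a b).continuousOn_derivWithin_unitInterval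
  have hmeas : Measurable (Function.uncurry fun (t : ℝ) (ω : Ω) => dtI I (c t) (x₀ ω) (x₁ ω)) :=
    measurable_uncurry_of_continuous_of_measurable
      (fun ω => (hD (x₀ ω) (x₁ ω)).comp_continuous hcc hcI)
      fun t => (h.measurable_dtI (hcI t)).comp h.measurable_pair
  have hle : ∀ ω, ‖x₁ ω - x₀ ω‖ₑ ≤ ∫⁻ t in Ioc (0 : ℝ) 1, ‖dtI I (c t) (x₀ ω) (x₁ ω)‖ₑ := by
    intro ω
    have h1 := intervalIntegral.integral_eq_sub_of_hasDerivAt_of_le zero_le_one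
      (h.contDiff_time (x₀ ω) (x₁ ω)).continuousOn
      (fun t ht => (h.contDiff_time (x₀ ω) (x₁ ω)).hasDerivAt_unitInterval ht)
      ((hD (x₀ ω) (x₁ ω)).intervalIntegrable_of_Icc zero_le_one)
    rw [h.I_one, h.I_zero, intervalIntegral.integral_of_le zero_le_one] at h1
    rw [← h1]
    refine (enorm_integral_le_lintegral_enorm _).trans
      (setLIntegral_mono' measurableSet_Ioc fun t ht => ?_)
    rw [hc]
    simp only
    rw [projIcc_of_mem _ (Ioc_subset_Icc_self ht)]
    rfl
  calc ∫⁻ ω, ‖x₁ ω - x₀ ω‖ₑ ∂P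
      ≤ ∫⁻ ω, (∫⁻ t in Ioc (0 : ℝ) 1, ‖dtI I (c t) (x₀ ω) (x₁ ω)‖ₑ) ∂P := lintegral_mono hle
    _ = ∫⁻ t in Ioc (0 : ℝ) 1, (∫⁻ ω, ‖dtI I (c t) (x₀ ω) (x₁ ω)‖ₑ ∂P) :=
        (lintegral_lintegral_swap hmeas.enorm.aemeasurable).symm
    _ ≤ ∫⁻ _ in Ioc (0 : ℝ) 1, (1 + (M : ℝ≥0∞)) := by
        refine lintegral_mono fun t => ?_
        calc ∫⁻ ω, ‖dtI I (c t) (x₀ ω) (x₁ ω)‖ₑ ∂P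
            ≤ ∫⁻ ω, (1 + ‖dtI I (c t) (x₀ ω) (x₁ ω)‖ₑ ^ 4) ∂P := by
              refine lintegral_mono fun ω => ?_
              rcases le_total ‖dtI I (c t) (x₀ ω) (x₁ ω)‖ₑ 1 with h1 | h1
              · exact h1.trans le_self_add
              · exact (le_self_pow₀ h1 (by norm_num)).trans le_add_self
          _ ≤ 1 + M := by
              rw [lintegral_add_left measurable_const, lintegral_const, measure_univ, mul_one]
              gcongr
              exact hM _ (hcI t)
    _ < ⊤ := by
        rw [lintegral_const]
        simp

/-- The paths of a stochastic interpolant form a path family. -/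
theorem exists_isPathFamily (h : IsStochasticInterpolant P ρ₀ ρ₁ I γ x₀ x₁ z)
    (hA : InterpolantAssumption P ρ₀ ρ₁ I x₀ x₁) :
    ∃ B, IsPathFamily (P.map fun ω => (x₀ ω, x₁ ω)) (fun t p => I t p.1 p.2)
      (fun t p => dtI I t p.1 p.2) (fun t => γ t ^ 2)
      (derivWithin (fun t => γ t ^ 2) (Icc 0 1)) B := by
  obtain ⟨C, hC⟩ := h.dtI_bound
  have hsub : Ioo (0 : ℝ) 1 ⊆ Icc 0 1 := Ioo_subset_Icc_self
  have hp : IsProbabilityMeasure (P.map fun ω => (x₀ ω, x₁ ω)) :=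
    Measure.isProbabilityMeasure_map h.measurable_pair.aemeasurable
  have hint : Integrable (fun ω => x₁ ω - x₀ ω) P :=
    ⟨(h.meas_x₁.sub h.meas_x₀).aestronglyMeasurable, h.lintegral_sub_lt_top hA⟩
  have hint' : Integrable (fun p : Eu d × Eu d => ‖p.1 - p.2‖)
      (P.map fun ω => (x₀ ω, x₁ ω)) := by
    rw [integrable_map_measure (by fun_prop) h.measurable_pair.aemeasurable]
    exact hint.norm.congr (.of_forall fun ω => norm_sub_rev _ _)
  refine ⟨fun p => 1 + |C| * ‖p.1 - p.2‖, fun t ht => pow_pos (h.γ_pos t ht) 2,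
    fun t ht => h.γ_sq.hasDerivAt_unitInterval ht,
    h.γ_sq.continuousOn_derivWithin_unitInterval.mono hsub,
    fun t ht => h.measurable_I (hsub ht), fun t ht => h.measurable_dtI (hsub ht),
    fun t ht p => (h.contDiff_time p.1 p.2).hasDerivAt_unitInterval ht,
    fun p => (h.contDiff_time p.1 p.2).continuousOn_derivWithin_unitInterval.mono hsub,
    fun t ht p => ?_, fun p => le_add_of_nonneg_right (by positivity),
    (integrable_const 1).add (hint'.const_mul |C|)⟩
  have h1 := hC t (hsub ht) p.1 p.2
  have h2 : C * ‖p.1 - p.2‖ ≤ |C| * ‖p.1 - p.2‖ := by gcongr; exact le_abs_self C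
  linarith

end IsStochasticInterpolant

end Interpolant

/-! ### Continuous densities are determined by the law. -/

section DensityOf

variable {d : ℕ} {Ω : Type*} [MeasurableSpace Ω] {P : Measure Ω} [IsProbabilityMeasure P]

theorem eq_of_withDensity_ofReal_eq {f g : Eu d → ℝ} (hf : Continuous f) (hg : Continuous g)
    (hf0 : ∀ x, 0 ≤ f x) (hg0 : ∀ x, 0 ≤ g x)
    (hfin : IsFiniteMeasure ((volume : Measure (Eu d)).withDensity fun x => ENNReal.ofReal (f x)))
    (h : (volume : Measure (Eu d)).withDensity (fun x => ENNReal.ofReal (f x)) =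
      volume.withDensity fun x => ENNReal.ofReal (g x)) : f = g := by
  have h1 : ∫⁻ x, ENNReal.ofReal (f x) ≠ ⊤ := by
    have := measure_ne_top ((volume : Measure (Eu d)).withDensity
      fun x => ENNReal.ofReal (f x)) univ
    rwa [withDensity_apply _ MeasurableSet.univ, Measure.restrict_univ] at this
  have h2 := (withDensity_eq_iff hf.measurable.ennreal_ofReal.aemeasurable
    hg.measurable.ennreal_ofReal.aemeasurable h1).1 h
  refine (Continuous.ae_eq_iff_eq volume hf hg).1 ?_
  filter_upwards [h2] with x hx
  exact (ENNReal.ofReal_eq_ofReal_iff (hf0 x) (hg0 x)).1 hx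

namespace IsDensityOf

variable {X : ℝ → Ω → Eu d} {ρ : ℝ → Eu d → ℝ}

theorem integral_mul (h : IsDensityOf P X ρ) {t : ℝ} (ht : t ∈ Icc (0 : ℝ) 1)
    (hX : Measurable (X t)) {g : Eu d → ℝ} (hg : Continuous g) :
    ∫ x, g x * ρ t x = ∫ ω, g (X t ω) ∂P := by
  rw [← integral_map hX.aemeasurable hg.aestronglyMeasurable, h.law t ht,
    integral_withDensity_eq_integral_toReal_smul (h.cont t ht).measurable.ennreal_ofReal (by simp)]
  simp only [ENNReal.toReal_ofReal (h.nonneg t ht _), smul_eq_mul, mul_comm]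

theorem integrable (h : IsDensityOf P X ρ) {t : ℝ} (ht : t ∈ Icc (0 : ℝ) 1)
    (hX : Measurable (X t)) : Integrable (ρ t) := by
  have hp : IsProbabilityMeasure (P.map (X t)) := Measure.isProbabilityMeasure_map hX.aemeasurable
  have h1 : Integrable (fun _ => (1 : ℝ)) (P.map (X t)) := integrable_const 1
  rw [h.law t ht, integrable_withDensity_iff_integrable_smul'
    (h.cont t ht).measurable.ennreal_ofReal (by simp)] at h1
  simpa only [ENNReal.toReal_ofReal (h.nonneg t ht _), smul_eq_mul, mul_one] using h1

/-- A continuous density is determined by the law. -/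
theorem eq_of_law (h : IsDensityOf P X ρ) {t : ℝ} (ht : t ∈ Icc (0 : ℝ) 1) (hX : Measurable (X t))
    {f : Eu d → ℝ} (hf : Continuous f) (hf0 : ∀ x, 0 ≤ f x)
    (hlaw : P.map (X t) = volume.withDensity fun x => ENNReal.ofReal (f x)) : ρ t = f := by
  have hp : IsProbabilityMeasure (P.map (X t)) := Measure.isProbabilityMeasure_map hX.aemeasurable
  refine eq_of_withDensity_ofReal_eq (h.cont t ht) hf (h.nonneg t ht) hf0 ?_ ?_
  · rw [← h.law t ht]
    infer_instance
  · rw [← h.law t ht, hlaw]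

end IsDensityOf

end DensityOf

/-! ### Density, flux and velocity of the interpolant at interior times. -/

section Interpolant

variable {d : ℕ} {Ω : Type*} [MeasurableSpace Ω] {P : Measure Ω}
  {ρ₀ ρ₁ : Eu d → ℝ} {I : ℝ → Eu d → Eu d → Eu d} {γ : ℝ → ℝ} {x₀ x₁ z : Ω → Eu d}

/-- The density of a stochastic interpolant at interior times. -/
noncomputable abbrev interpDensity (P : Measure Ω) (I : ℝ → Eu d → Eu d → Eu d) (γ : ℝ → ℝ)
    (x₀ x₁ : Ω → Eu d) : ℝ → Eu d → ℝ :=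
  mixDensity (P.map fun ω => (x₀ ω, x₁ ω)) (fun t p => I t p.1 p.2) (fun t => γ t ^ 2)

/-- The gradient of the density of a stochastic interpolant at interior times. -/
noncomputable abbrev interpGrad (P : Measure Ω) (I : ℝ → Eu d → Eu d → Eu d) (γ : ℝ → ℝ)
    (x₀ x₁ : Ω → Eu d) : ℝ → Eu d → Eu d :=
  mixGrad (P.map fun ω => (x₀ ω, x₁ ω)) (fun t p => I t p.1 p.2) (fun t => γ t ^ 2)

/-- The probability flux of a stochastic interpolant at interior times. -/
noncomputable abbrev interpFlux (P : Measure Ω) (I : ℝ → Eu d → Eu d → Eu d) (γ : ℝ → ℝ)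
    (x₀ x₁ : Ω → Eu d) : ℝ → Eu d → Eu d :=
  mixFlux (P.map fun ω => (x₀ ω, x₁ ω)) (fun t p => I t p.1 p.2) (fun t p => dtI I t p.1 p.2)
    (fun t => γ t ^ 2) (derivWithin (fun t => γ t ^ 2) (Icc 0 1))

/-- The velocity of a stochastic interpolant at interior times. -/
noncomputable abbrev interpVelocity (P : Measure Ω) (I : ℝ → Eu d → Eu d → Eu d) (γ : ℝ → ℝ)
    (x₀ x₁ : Ω → Eu d) : ℝ → Eu d → Eu d :=
  mixVelocity (P.map fun ω => (x₀ ω, x₁ ω)) (fun t p => I t p.1 p.2) (fun t p => dtI I t p.1 p.2)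
    (fun t => γ t ^ 2) (derivWithin (fun t => γ t ^ 2) (Icc 0 1))

namespace IsStochasticInterpolant

variable [IsProbabilityMeasure P]

theorem measurable_interpolant (h : IsStochasticInterpolant P ρ₀ ρ₁ I γ x₀ x₁ z) {t : ℝ}
    (ht : t ∈ Icc (0 : ℝ) 1) : Measurable (interpolant I γ x₀ x₁ z t) :=
  ((h.measurable_I ht).comp h.measurable_pair).add (h.meas_z.const_smul (γ t))

theorem interpolant_zero (h : IsStochasticInterpolant P ρ₀ ρ₁ I γ x₀ x₁ z) :
    interpolant I γ x₀ x₁ z 0 = x₀ := by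
  funext ω
  simp [interpolant, h.I_zero, h.γ_zero]

theorem interpolant_one (h : IsStochasticInterpolant P ρ₀ ρ₁ I γ x₀ x₁ z) :
    interpolant I γ x₀ x₁ z 1 = x₁ := by
  funext ω
  simp [interpolant, h.I_one, h.γ_one]

theorem isProbabilityMeasure_map_pair (h : IsStochasticInterpolant P ρ₀ ρ₁ I γ x₀ x₁ z) :
    IsProbabilityMeasure (P.map fun ω => (x₀ ω, x₁ ω)) :=
  Measure.isProbabilityMeasure_map h.measurable_pair.aemeasurable

theorem interpDensity_pos (h : IsStochasticInterpolant P ρ₀ ρ₁ I γ x₀ x₁ z)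
    (hA : InterpolantAssumption P ρ₀ ρ₁ I x₀ x₁) {t : ℝ} (ht : t ∈ Ioo (0 : ℝ) 1) (x : Eu d) :
    0 < interpDensity P I γ x₀ x₁ t x := by
  obtain ⟨B, hB⟩ := h.exists_isPathFamily hA
  have := h.isProbabilityMeasure_map_pair
  exact hB.mixDensity_pos ht x

theorem continuous_interpDensity (h : IsStochasticInterpolant P ρ₀ ρ₁ I γ x₀ x₁ z)
    (hA : InterpolantAssumption P ρ₀ ρ₁ I x₀ x₁) {t : ℝ} (ht : t ∈ Ioo (0 : ℝ) 1) :
    Continuous (interpDensity P I γ x₀ x₁ t) := by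
  obtain ⟨B, hB⟩ := h.exists_isPathFamily hA
  exact (hB.contDiff_mixDensity ht).continuous

theorem continuous_interpVelocity (h : IsStochasticInterpolant P ρ₀ ρ₁ I γ x₀ x₁ z)
    (hA : InterpolantAssumption P ρ₀ ρ₁ I x₀ x₁) {t : ℝ} (ht : t ∈ Ioo (0 : ℝ) 1) :
    Continuous (interpVelocity P I γ x₀ x₁ t) := by
  obtain ⟨B, hB⟩ := h.exists_isPathFamily hA
  exact ((h.continuous_interpDensity hA ht).inv₀ fun x => (h.interpDensity_pos hA ht x).ne').smul
    (hB.contDiff_mixFlux ht).continuous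

theorem map_pair_interpolant (h : IsStochasticInterpolant P ρ₀ ρ₁ I γ x₀ x₁ z) {t : ℝ}
    (ht : t ∈ Ioo (0 : ℝ) 1) :
    P.map (fun ω => ((x₀ ω, x₁ ω), interpolant I γ x₀ x₁ z t ω)) =
      ((P.map fun ω => (x₀ ω, x₁ ω)).prod volume).withDensity
        (fun r => ENNReal.ofReal (heatKernel (γ t ^ 2) (r.2 - I t r.1.1 r.1.2))) :=
  map_prodMk_add_smul h.measurable_pair h.meas_z h.indep h.law_z
    (h.measurable_I ⟨ht.1.le, ht.2.le⟩) (h.γ_pos t ht)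

theorem measurable_kernel (h : IsStochasticInterpolant P ρ₀ ρ₁ I γ x₀ x₁ z) {t : ℝ}
    (ht : t ∈ Ioo (0 : ℝ) 1) : Measurable fun r : (Eu d × Eu d) × Eu d =>
      heatKernel (γ t ^ 2) (r.2 - I t r.1.1 r.1.2) :=
  (continuous_heatKernel _).measurable.comp
    (measurable_snd.sub ((h.measurable_I ⟨ht.1.le, ht.2.le⟩).comp measurable_fst))

theorem map_interpolant (h : IsStochasticInterpolant P ρ₀ ρ₁ I γ x₀ x₁ z)
    (hA : InterpolantAssumption P ρ₀ ρ₁ I x₀ x₁) {t : ℝ} (ht : t ∈ Ioo (0 : ℝ) 1) :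
    P.map (interpolant I γ x₀ x₁ z t) =
      volume.withDensity fun x => ENNReal.ofReal (interpDensity P I γ x₀ x₁ t x) := by
  obtain ⟨B, hB⟩ := h.exists_isPathFamily hA
  have := h.isProbabilityMeasure_map_pair
  exact map_snd_of_joint h.measurable_pair (h.measurable_interpolant ⟨ht.1.le, ht.2.le⟩)
    (h.measurable_kernel ht) (fun a => (heatKernel_pos (hB.q_pos t ht) _).le)
    (h.map_pair_interpolant ht)
    (fun x => hB.isDominated_heatKernel.integrable hB.integrable ht x) fun x => rfl

theorem memLp_z (h : IsStochasticInterpolant P ρ₀ ρ₁ I γ x₀ x₁ z) : MemLp z 2 P := by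
  have h1 : MemLp id 2 (P.map z) := by
    rw [h.law_z]
    exact IsGaussian.memLp_two_id
  exact (memLp_map_measure_iff h1.1 h.meas_z.aemeasurable).1 h1

theorem memLp_dtI (h : IsStochasticInterpolant P ρ₀ ρ₁ I γ x₀ x₁ z)
    (hA : InterpolantAssumption P ρ₀ ρ₁ I x₀ x₁) : ∃ C : ℝ, 0 ≤ C ∧ ∀ t ∈ Icc (0 : ℝ) 1,
      MemLp (fun ω => dtI I t (x₀ ω) (x₁ ω)) 2 P ∧ ∫ ω, ‖dtI I t (x₀ ω) (x₁ ω)‖ ^ 2 ∂P ≤ C := by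
  obtain ⟨M, hM⟩ := hA.moment_dt
  refine ⟨(1 + M : ℝ≥0), NNReal.coe_nonneg _, fun t ht => ?_⟩
  have hm : Measurable fun ω => dtI I t (x₀ ω) (x₁ ω) :=
    (h.measurable_dtI ht).comp h.measurable_pair
  have h1 : ∫⁻ ω, ENNReal.ofReal (‖dtI I t (x₀ ω) (x₁ ω)‖ ^ 2) ∂P ≤ ((1 + M : ℝ≥0) : ℝ≥0∞) := by
    calc ∫⁻ ω, ENNReal.ofReal (‖dtI I t (x₀ ω) (x₁ ω)‖ ^ 2) ∂P
        ≤ ∫⁻ ω, (1 + ‖dtI I t (x₀ ω) (x₁ ω)‖ₑ ^ 4) ∂P := by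
          refine lintegral_mono fun ω => ?_
          rw [ENNReal.ofReal_pow (norm_nonneg _), ofReal_norm]
          rcases le_total ‖dtI I t (x₀ ω) (x₁ ω)‖ₑ 1 with h1 | h1
          · exact (pow_le_one₀ zero_le h1).trans le_self_add
          · exact (pow_le_pow_right₀ h1 (by norm_num)).trans le_add_self
      _ ≤ _ := by
          rw [lintegral_add_left measurable_const, lintegral_const, measure_univ, mul_one]
          push_cast
          gcongr
          exact hM _ ht
  have h2 : Integrable (fun ω => ‖dtI I t (x₀ ω) (x₁ ω)‖ ^ 2) P :=
    (lintegral_ofReal_ne_top_iff_integrable (hm.norm.pow_const 2).aestronglyMeasurable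
      (.of_forall fun ω => by positivity)).1 (h1.trans_lt ENNReal.coe_lt_top).ne
  refine ⟨(memLp_two_iff_integrable_sq_norm hm.aestronglyMeasurable).2 h2, ?_⟩
  rw [← ENNReal.ofReal_le_ofReal_iff (NNReal.coe_nonneg _), ENNReal.ofReal_coe_nnreal,
    ofReal_integral_eq_lintegral_ofReal h2 (.of_forall fun ω => by positivity)]
  exact h1

/-- The velocity of the interpolant as a function of the end points and of the position. -/
theorem interpolantDot_eq (h : IsStochasticInterpolant P ρ₀ ρ₁ I γ x₀ x₁ z) {t : ℝ}
    (ht : t ∈ Ioo (0 : ℝ) 1) (ω : Ω) :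
    interpolantDot I γ x₀ x₁ z t ω = dtI I t (x₀ ω) (x₁ ω) +
      (derivWithin (fun t => γ t ^ 2) (Icc 0 1) t / (2 * γ t ^ 2)) •
        (interpolant I γ x₀ x₁ z t ω - I t (x₀ ω) (x₁ ω)) := by
  have hg := (h.γ_pos t ht).ne'
  rw [interpolantDot, interpolant, h.deriv_γ ht, add_sub_cancel_left, smul_smul]
  congr 2
  field_simp

theorem measurable_velocityKernel (h : IsStochasticInterpolant P ρ₀ ρ₁ I γ x₀ x₁ z) {t c : ℝ}
    (ht : t ∈ Ioo (0 : ℝ) 1) : Measurable fun r : (Eu d × Eu d) × Eu d =>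
      dtI I t r.1.1 r.1.2 + c • (r.2 - I t r.1.1 r.1.2) := by
  have e1 : Measurable fun r : (Eu d × Eu d) × Eu d => I t r.1.1 r.1.2 :=
    (h.measurable_I ⟨ht.1.le, ht.2.le⟩).comp measurable_fst
  have e2 : Measurable fun r : (Eu d × Eu d) × Eu d => dtI I t r.1.1 r.1.2 :=
    (h.measurable_dtI ⟨ht.1.le, ht.2.le⟩).comp measurable_fst
  exact e2.add ((measurable_snd.sub e1).const_smul c)

theorem smul_interpVelocity (h : IsStochasticInterpolant P ρ₀ ρ₁ I γ x₀ x₁ z)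
    (hA : InterpolantAssumption P ρ₀ ρ₁ I x₀ x₁) {t : ℝ} (ht : t ∈ Ioo (0 : ℝ) 1) (x : Eu d) :
    interpDensity P I γ x₀ x₁ t x • interpVelocity P I γ x₀ x₁ t x =
      interpFlux P I γ x₀ x₁ t x :=
  smul_inv_smul₀ (h.interpDensity_pos hA ht x).ne' _

/-- Given the position `x` and the end points, `γ' z` equals `(γ²)' / (2 γ²) (x - I)`; weighted by
the Gaussian kernel this is `-(γ²)' / 2` times the kernel's gradient. The flux of the mixture is
thus the average of the velocity of the interpolant. -/
theorem interpFlux_eq_integral (h : IsStochasticInterpolant P ρ₀ ρ₁ I γ x₀ x₁ z)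
    (hA : InterpolantAssumption P ρ₀ ρ₁ I x₀ x₁) {t : ℝ} (ht : t ∈ Ioo (0 : ℝ) 1) (x : Eu d) :
    interpFlux P I γ x₀ x₁ t x = ∫ p, heatKernel (γ t ^ 2) (x - I t p.1 p.2) •
      (dtI I t p.1 p.2 + (derivWithin (fun t => γ t ^ 2) (Icc 0 1) t / (2 * γ t ^ 2)) •
        (x - I t p.1 p.2)) ∂(P.map fun ω => (x₀ ω, x₁ ω)) := by
  obtain ⟨B, hB⟩ := h.exists_isPathFamily hA
  have i1 := hB.isDominated_momentum.integrable hB.integrable ht x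
  have i2 := (hB.isDominated_heatGrad.integrable hB.integrable ht x).smul
    (derivWithin (fun t => γ t ^ 2) (Icc 0 1) t / 2)
  rw [interpFlux, mixFlux, mixMomentum, mixGrad, ← integral_smul]
  refine (integral_sub i1 i2).symm.trans (integral_congr_ae (.of_forall fun p => ?_))
  have hg := (h.γ_pos t ht).ne'
  simp only [Pi.smul_apply, heatGrad, smul_add, smul_smul, smul_neg, neg_smul, sub_neg_eq_add]
  congr 2
  field_simp

theorem memLp_interpolantDot (h : IsStochasticInterpolant P ρ₀ ρ₁ I γ x₀ x₁ z)
    (hA : InterpolantAssumption P ρ₀ ρ₁ I x₀ x₁) {t : ℝ} (ht : t ∈ Ioo (0 : ℝ) 1) :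
    MemLp (interpolantDot I γ x₀ x₁ z t) 2 P := by
  obtain ⟨C, -, hC⟩ := h.memLp_dtI hA
  exact (hC t ⟨ht.1.le, ht.2.le⟩).1.add (h.memLp_z.const_smul (deriv γ t))

theorem condExp_interpolantDot (h : IsStochasticInterpolant P ρ₀ ρ₁ I γ x₀ x₁ z)
    (hA : InterpolantAssumption P ρ₀ ρ₁ I x₀ x₁) {t : ℝ} (ht : t ∈ Ioo (0 : ℝ) 1) :
    (fun ω => interpVelocity P I γ x₀ x₁ t (interpolant I γ x₀ x₁ z t ω)) =ᵐ[P]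
      P[interpolantDot I γ x₀ x₁ z t |
        MeasurableSpace.comap (interpolant I γ x₀ x₁ z t) inferInstance] := by
  obtain ⟨B, hB⟩ := h.exists_isPathFamily hA
  have := h.isProbabilityMeasure_map_pair
  have hF := funext (h.interpolantDot_eq ht)
  have hL := h.memLp_interpolantDot hA ht
  rw [hF] at hL ⊢
  exact condExp_of_joint (r := interpDensity P I γ x₀ x₁ t)
    h.measurable_pair (h.measurable_interpolant ⟨ht.1.le, ht.2.le⟩)
    (h.measurable_kernel ht) (fun a => (heatKernel_pos (hB.q_pos t ht) _).le)
    (h.map_pair_interpolant ht)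
    (fun x => hB.isDominated_heatKernel.integrable hB.integrable ht x) (fun x => rfl)
    (h.continuous_interpDensity hA ht).measurable (fun x => (h.interpDensity_pos hA ht x).le)
    (h.measurable_velocityKernel ht) (h.continuous_interpVelocity hA ht).measurable
    (fun x => (h.smul_interpVelocity hA ht x).trans (h.interpFlux_eq_integral hA ht x))
    (hL.integrable (by norm_num))

theorem integral_velocity_sq_le (h : IsStochasticInterpolant P ρ₀ ρ₁ I γ x₀ x₁ z)
    (hA : InterpolantAssumption P ρ₀ ρ₁ I x₀ x₁) {t : ℝ} (ht : t ∈ Ioo (0 : ℝ) 1) :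
    Integrable (fun x => ‖interpVelocity P I γ x₀ x₁ t x‖ ^ 2 * interpDensity P I γ x₀ x₁ t x) ∧
      ∫ x, ‖interpVelocity P I γ x₀ x₁ t x‖ ^ 2 * interpDensity P I γ x₀ x₁ t x ≤
        ∫ ω, ‖interpolantDot I γ x₀ x₁ z t ω‖ ^ 2 ∂P := by
  obtain ⟨B, hB⟩ := h.exists_isPathFamily hA
  have := h.isProbabilityMeasure_map_pair
  have hF := funext (h.interpolantDot_eq ht)
  have hL := h.memLp_interpolantDot hA ht
  rw [hF] at hL
  have key := integral_sq_le_of_joint (r := interpDensity P I γ x₀ x₁ t)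
    (F := fun r : (Eu d × Eu d) × Eu d =>
      dtI I t r.1.1 r.1.2 + (derivWithin (fun t => γ t ^ 2) (Icc 0 1) t / (2 * γ t ^ 2)) •
        (r.2 - I t r.1.1 r.1.2))
    (β := interpVelocity P I γ x₀ x₁ t) 
    h.measurable_pair
    (h.measurable_interpolant ⟨ht.1.le, ht.2.le⟩) (h.measurable_kernel ht) (fun a => (heatKernel_pos (hB.q_pos t ht) _).le)
    (h.map_pair_interpolant ht)
    (fun x => hB.isDominated_heatKernel.integrable hB.integrable ht x) (fun x => rfl)
    (h.continuous_interpDensity hA ht).measurable (fun x => (h.interpDensity_pos hA ht x).le)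
    (h.measurable_velocityKernel ht) (h.continuous_interpVelocity hA ht).measurable
    (fun x => (h.smul_interpVelocity hA ht x).trans (h.interpFlux_eq_integral hA ht x)) hL
  simp only [h.interpolantDot_eq ht]
  exact key

/-- The score is the conditional expectation of `-z / γ` given the position, so Jensen's inequality
bounds its second moment. The bound may degenerate at the end points, which is harmless because it
is used only between interior times. -/
theorem integral_score_sq_le (h : IsStochasticInterpolant P ρ₀ ρ₁ I γ x₀ x₁ z)
    (hA : InterpolantAssumption P ρ₀ ρ₁ I x₀ x₁) {t : ℝ} (ht : t ∈ Ioo (0 : ℝ) 1) :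
    Integrable (fun x => ‖interpGrad P I γ x₀ x₁ t x‖ ^ 2 / interpDensity P I γ x₀ x₁ t x) ∧
      ∫ x, ‖interpGrad P I γ x₀ x₁ t x‖ ^ 2 / interpDensity P I γ x₀ x₁ t x ≤
        (∫ ω, ‖z ω‖ ^ 2 ∂P) / γ t ^ 2 := by
  obtain ⟨B, hB⟩ := h.exists_isPathFamily hA
  have := h.isProbabilityMeasure_map_pair
  have hg := h.γ_pos t ht
  have hpos := h.interpDensity_pos hA ht
  have hF : ∀ ω, (-(γ t ^ 2)⁻¹) • (interpolant I γ x₀ x₁ z t ω - I t (x₀ ω) (x₁ ω)) =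
      (-(γ t)⁻¹) • z ω := fun ω => by
    rw [interpolant, add_sub_cancel_left, smul_smul]
    congr 1
    field_simp
  have hL : MemLp (fun ω => (-(γ t ^ 2)⁻¹) •
      (interpolant I γ x₀ x₁ z t ω - I t (x₀ ω) (x₁ ω))) 2 P := by
    simp only [hF]
    exact h.memLp_z.const_smul (-(γ t)⁻¹)
  have hm : Measurable fun r : (Eu d × Eu d) × Eu d =>
      (-(γ t ^ 2)⁻¹) • (r.2 - I t r.1.1 r.1.2) := by
    have e1 : Measurable fun r : (Eu d × Eu d) × Eu d => I t r.1.1 r.1.2 :=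
      (h.measurable_I ⟨ht.1.le, ht.2.le⟩).comp measurable_fst
    exact (measurable_snd.sub e1).const_smul (-(γ t ^ 2)⁻¹)
  have key := integral_sq_le_of_joint (r := interpDensity P I γ x₀ x₁ t)
    h.measurable_pair
    (h.measurable_interpolant ⟨ht.1.le, ht.2.le⟩)
    (h.measurable_kernel ht) (fun a => (heatKernel_pos (hB.q_pos t ht) _).le)
    (h.map_pair_interpolant ht)
    (fun x => hB.isDominated_heatKernel.integrable hB.integrable ht x) (fun x => rfl)
    (h.continuous_interpDensity hA ht).measurable (fun x => (hpos x).le) hm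
    (β := fun x => (interpDensity P I γ x₀ x₁ t x)⁻¹ • interpGrad P I γ x₀ x₁ t x)
    (((h.continuous_interpDensity hA ht).inv₀ fun x => (hpos x).ne').smul
      (hB.contDiff_mixGrad ht).continuous).measurable
    (fun x => by
      refine (smul_inv_smul₀ (hpos x).ne' _).trans
        (integral_congr_ae (.of_forall fun p => ?_))
      simp only [heatGrad, smul_smul, neg_smul, smul_neg, div_eq_mul_inv]) hL
  have e1 : ∀ x, ‖(interpDensity P I γ x₀ x₁ t x)⁻¹ • interpGrad P I γ x₀ x₁ t x‖ ^ 2 *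
      interpDensity P I γ x₀ x₁ t x =
        ‖interpGrad P I γ x₀ x₁ t x‖ ^ 2 / interpDensity P I γ x₀ x₁ t x := fun x => by
    have := hpos x
    rw [norm_smul, norm_inv, Real.norm_of_nonneg this.le]
    field_simp
  simp only [e1, hF] at key
  refine ⟨key.1, key.2.trans (le_of_eq ?_)⟩
  rw [← integral_div]
  refine integral_congr_ae (.of_forall fun ω => ?_)
  simp only [norm_smul, norm_neg, norm_inv, Real.norm_of_nonneg hg.le]
  field_simp

end IsStochasticInterpolant

end Interpolant

/-! ### Joint regularity of the velocity of a mixture. -/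

namespace IsPathFamily

variable {d : ℕ} {𝒳 : Type*} [MeasurableSpace 𝒳] {μ : Measure 𝒳} {Y D : ℝ → 𝒳 → Eu d}
  {q q' : ℝ → ℝ} {B : 𝒳 → ℝ}

theorem contDiff_mixVelocity [NeZero μ] (h : IsPathFamily μ Y D q q' B) {t : ℝ}
    (ht : t ∈ Ioo (0 : ℝ) 1) : ContDiff ℝ 1 (mixVelocity μ Y D q q' t) :=
  (((h.contDiff_mixDensity ht).of_le (by norm_num)).inv
    fun x => (h.mixDensity_pos ht x).ne').smul (h.contDiff_mixFlux ht)

theorem continuousOn_mixFlux (h : IsPathFamily μ Y D q q' B) :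
    ContinuousOn (fun r : ℝ × Eu d => mixFlux μ Y D q q' r.1 r.2) (Ioo 0 1 ×ˢ univ) :=
  h.continuousOn_mixMomentum.sub (((h.cont_q'.div_const 2).comp continuousOn_fst
    fun _ hr => hr.1).smul h.continuousOn_mixGrad)

theorem continuousOn_inv_mixDensity [NeZero μ] (h : IsPathFamily μ Y D q q' B) :
    ContinuousOn (fun r : ℝ × Eu d => (mixDensity μ Y q r.1 r.2)⁻¹) (Ioo 0 1 ×ˢ univ) :=
  h.continuousOn_mixDensity.inv₀ fun r hr => (h.mixDensity_pos hr.1 r.2).ne'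

theorem continuousOn_mixVelocity [NeZero μ] (h : IsPathFamily μ Y D q q' B) :
    ContinuousOn (fun r : ℝ × Eu d => mixVelocity μ Y D q q' r.1 r.2) (Ioo 0 1 ×ˢ univ) :=
  h.continuousOn_inv_mixDensity.smul h.continuousOn_mixFlux

theorem fderiv_mixVelocity [NeZero μ] (h : IsPathFamily μ Y D q q' B) {t : ℝ}
    (ht : t ∈ Ioo (0 : ℝ) 1) (x : Eu d) : fderiv ℝ (mixVelocity μ Y D q q' t) x =
      (mixDensity μ Y q t x)⁻¹ •
        (mixMomentumDeriv μ Y D q t x - (q' t / 2) • mixHess μ Y q t x) -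
      ((mixDensity μ Y q t x)⁻¹ ^ 2) •
        (innerSL ℝ (mixGrad μ Y q t x)).smulRight (mixFlux μ Y D q q' t x) := by
  have hp := (h.mixDensity_pos ht x).ne'
  have h1 := (hasDerivAt_inv hp).comp_hasFDerivAt x (h.hasFDerivAt_mixDensity ht x)
  have h2 := h1.smul (h.hasFDerivAt_mixFlux ht x)
  have h3 : fderiv ℝ (mixVelocity μ Y D q q' t) x = _ := h2.fderiv
  rw [h3]
  ext1 v
  simp [smul_smul, sub_eq_add_neg]

theorem continuousOn_fderiv_mixVelocity [NeZero μ] (h : IsPathFamily μ Y D q q' B) :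
    ContinuousOn (fun r : ℝ × Eu d => fderiv ℝ (mixVelocity μ Y D q q' r.1) r.2)
      (Ioo 0 1 ×ˢ univ) := by
  have h1 : ContinuousOn (fun r : ℝ × Eu d => innerSL ℝ (mixGrad μ Y q r.1 r.2))
      (Ioo 0 1 ×ˢ univ) := (innerSL ℝ).continuous.comp_continuousOn h.continuousOn_mixGrad
  have h2 : ContinuousOn (fun r : ℝ × Eu d =>
      (innerSL ℝ (mixGrad μ Y q r.1 r.2)).smulRight (mixFlux μ Y D q q' r.1 r.2))
      (Ioo 0 1 ×ˢ univ) :=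
    ((ContinuousLinearMap.smulRightL ℝ (Eu d) (Eu d)).continuous.comp_continuousOn h1).clm_apply
      h.continuousOn_mixFlux
  refine ((h.continuousOn_inv_mixDensity.smul (h.continuousOn_mixMomentumDeriv.sub
    (((h.cont_q'.div_const 2).comp continuousOn_fst fun _ hr => hr.1).smul
      h.continuousOn_mixHess))).sub ((h.continuousOn_inv_mixDensity.pow 2).smul h2)).congr
        fun r hr => ?_
  exact h.fderiv_mixVelocity hr.1 r.2

end IsPathFamily

/-! ### The interpolant as a flow pair. -/

section Interpolant

variable {d : ℕ} {Ω : Type*} [MeasurableSpace Ω] {P : Measure Ω} [IsProbabilityMeasure P]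
  {ρ₀ ρ₁ : Eu d → ℝ} {I : ℝ → Eu d → Eu d → Eu d} {γ : ℝ → ℝ} {x₀ x₁ z : Ω → Eu d}
  {ρ : ℝ → Eu d → ℝ} {b : ℝ → Eu d → Eu d}

namespace IsStochasticInterpolant

/-- The law of a stochastic interpolant has a continuous density, and its velocity has a continuous
version. -/
theorem exists_isDensityOf_isVelocityOf (h : IsStochasticInterpolant P ρ₀ ρ₁ I γ x₀ x₁ z)
    (hA : InterpolantAssumption P ρ₀ ρ₁ I x₀ x₁) :
    ∃ (ρ : ℝ → Eu d → ℝ) (b : ℝ → Eu d → Eu d),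
      IsDensityOf P (interpolant I γ x₀ x₁ z) ρ ∧
      IsVelocityOf P (interpolant I γ x₀ x₁ z) (interpolantDot I γ x₀ x₁ z) b := by
  -- At the end points the variance vanishes and the mixture formula is meaningless; the given
  -- densities are used instead.
  set ρ : ℝ → Eu d → ℝ := fun t =>
    if t = 0 then ρ₀ else if t = 1 then ρ₁ else interpDensity P I γ x₀ x₁ t with hρ
  have e0 : ρ 0 = ρ₀ := by simp [hρ]
  have e1 : ρ 1 = ρ₁ := by simp [hρ]
  have e : ∀ t ∈ Ioo (0 : ℝ) 1, ρ t = interpDensity P I γ x₀ x₁ t := fun t ht => by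
    simp [hρ, ht.1.ne', ht.2.ne]
  have hcases : ∀ t ∈ Icc (0 : ℝ) 1, t = 0 ∨ t = 1 ∨ t ∈ Ioo (0 : ℝ) 1 := fun t ht => by
    rcases ht.1.eq_or_lt with h0 | h0
    · exact Or.inl h0.symm
    rcases ht.2.eq_or_lt with h1 | h1
    · exact Or.inr (Or.inl h1)
    exact Or.inr (Or.inr ⟨h0, h1⟩)
  refine ⟨ρ, interpVelocity P I γ x₀ x₁, ⟨fun t ht x => ?_, fun t ht => ?_, fun t ht => ?_⟩,
    fun t ht => h.continuous_interpVelocity hA ht, fun t ht => h.condExp_interpolantDot hA ht⟩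
  · rcases hcases t ht with rfl | rfl | ht'
    · rw [e0]; exact (hA.reg₀.pos x).le
    · rw [e1]; exact (hA.reg₁.pos x).le
    · rw [e t ht']; exact (h.interpDensity_pos hA ht' x).le
  · rcases hcases t ht with rfl | rfl | ht'
    · rw [e0]; exact hA.reg₀.contDiff.continuous
    · rw [e1]; exact hA.reg₁.contDiff.continuous
    · rw [e t ht']; exact h.continuous_interpDensity hA ht'
  · rcases hcases t ht with rfl | rfl | ht'
    · rw [e0, h.interpolant_zero]; exact h.law_x₀
    · rw [e1, h.interpolant_one]; exact h.law_x₁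
    · rw [e t ht']; exact h.map_interpolant hA ht'

theorem density_zero (h : IsStochasticInterpolant P ρ₀ ρ₁ I γ x₀ x₁ z)
    (hA : InterpolantAssumption P ρ₀ ρ₁ I x₀ x₁)
    (hρ : IsDensityOf P (interpolant I γ x₀ x₁ z) ρ) : ρ 0 = ρ₀ :=
  hρ.eq_of_law ⟨le_rfl, zero_le_one⟩ (h.measurable_interpolant ⟨le_rfl, zero_le_one⟩)
    hA.reg₀.contDiff.continuous (fun x => (hA.reg₀.pos x).le)
    (by rw [h.interpolant_zero]; exact h.law_x₀)

theorem density_one (h : IsStochasticInterpolant P ρ₀ ρ₁ I γ x₀ x₁ z)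
    (hA : InterpolantAssumption P ρ₀ ρ₁ I x₀ x₁)
    (hρ : IsDensityOf P (interpolant I γ x₀ x₁ z) ρ) : ρ 1 = ρ₁ :=
  hρ.eq_of_law ⟨zero_le_one, le_rfl⟩ (h.measurable_interpolant ⟨zero_le_one, le_rfl⟩)
    hA.reg₁.contDiff.continuous (fun x => (hA.reg₁.pos x).le)
    (by rw [h.interpolant_one]; exact h.law_x₁)

theorem density_eq (h : IsStochasticInterpolant P ρ₀ ρ₁ I γ x₀ x₁ z)
    (hA : InterpolantAssumption P ρ₀ ρ₁ I x₀ x₁)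
    (hρ : IsDensityOf P (interpolant I γ x₀ x₁ z) ρ) {t : ℝ} (ht : t ∈ Ioo (0 : ℝ) 1) :
    ρ t = interpDensity P I γ x₀ x₁ t :=
  hρ.eq_of_law ⟨ht.1.le, ht.2.le⟩ (h.measurable_interpolant ⟨ht.1.le, ht.2.le⟩)
    (h.continuous_interpDensity hA ht) (fun x => (h.interpDensity_pos hA ht x).le)
    (h.map_interpolant hA ht)

/-- A conditional expectation is determined only almost everywhere for the law of the position. That
law has a positive density, so the equality holds Lebesgue almost everywhere, and by continuity
everywhere. -/
theorem velocity_eq (h : IsStochasticInterpolant P ρ₀ ρ₁ I γ x₀ x₁ z)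
    (hA : InterpolantAssumption P ρ₀ ρ₁ I x₀ x₁)
    (hb : IsVelocityOf P (interpolant I γ x₀ x₁ z) (interpolantDot I γ x₀ x₁ z) b) {t : ℝ}
    (ht : t ∈ Ioo (0 : ℝ) 1) : b t = interpVelocity P I γ x₀ x₁ t := by
  have hc := h.continuous_interpVelocity hA ht
  have h1 := (hb.condExp t ht).trans (h.condExp_interpolantDot hA ht).symm
  have h2 : ∀ᵐ x ∂(P.map (interpolant I γ x₀ x₁ z t)),
      b t x = interpVelocity P I γ x₀ x₁ t x :=
    (ae_map_iff (h.measurable_interpolant ⟨ht.1.le, ht.2.le⟩).aemeasurable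
      (isClosed_eq (hb.cont t ht) hc).measurableSet).2 h1
  rw [h.map_interpolant hA ht, ae_withDensity_iff
    (h.continuous_interpDensity hA ht).measurable.ennreal_ofReal] at h2
  refine (Continuous.ae_eq_iff_eq volume (hb.cont t ht) hc).1 ?_
  filter_upwards [h2] with x hx
  exact hx (ENNReal.ofReal_pos.2 (h.interpDensity_pos hA ht x)).ne'

/-- The paths are continuous on the closed interval, so dominated convergence applies to the
expectation, including at the end points. -/
theorem continuousOn_integral_mul_density (h : IsStochasticInterpolant P ρ₀ ρ₁ I γ x₀ x₁ z)
    (hρ : IsDensityOf P (interpolant I γ x₀ x₁ z) ρ) {φ : Eu d → ℝ} (hφ : Continuous φ)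
    (hφc : HasCompactSupport φ) : ContinuousOn (fun t => ∫ x, φ x * ρ t x) (Icc 0 1) := by
  obtain ⟨C, hC⟩ := hφc.exists_bound_of_continuous hφ
  refine ContinuousOn.congr (f := fun t => ∫ ω, φ (interpolant I γ x₀ x₁ z t ω) ∂P) ?_
    fun t ht => hρ.integral_mul ht (h.measurable_interpolant ht) hφ
  refine continuousOn_of_dominated (bound := fun _ => C)
    (fun t ht => (hφ.measurable.comp (h.measurable_interpolant ht)).aestronglyMeasurable)
    (fun t ht => .of_forall fun ω => hC _) (integrable_const C) (.of_forall fun ω => ?_)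
  exact hφ.comp_continuousOn ((h.contDiff_time (x₀ ω) (x₁ ω)).continuousOn.add
    (h.continuousOn_γ.smul continuousOn_const))

/-- The singular part is `γ'² = ((γ²)')² / (4 γ²)`, which `exists_sq_derivWithin_le` bounds by `(A/t
+ A/(1-t)) / 4`. -/
theorem exists_integral_interpolantDot_sq_le (h : IsStochasticInterpolant P ρ₀ ρ₁ I γ x₀ x₁ z)
    (hA : InterpolantAssumption P ρ₀ ρ₁ I x₀ x₁) : ∃ C : ℝ, ∀ t ∈ Ioo (0 : ℝ) 1,
      ∫ ω, ‖interpolantDot I γ x₀ x₁ z t ω‖ ^ 2 ∂P ≤ C / t + C / (1 - t) := by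
  obtain ⟨M, hM0, hM⟩ := h.memLp_dtI hA
  obtain ⟨A, hA0, hAq⟩ := exists_sq_derivWithin_le h.γ_sq fun t _ => sq_nonneg (γ t)
  set Z := ∫ ω, ‖z ω‖ ^ 2 ∂P with hZ
  have hZ0 : 0 ≤ Z := integral_nonneg fun ω => by positivity
  -- From `‖a + b‖² ≤ 2‖a‖² + 2‖b‖²`: the term `2 M` is absorbed through `M ≤ M / t`, and `2 γ'² Z`
  -- contributes `A Z / 2`.
  refine ⟨2 * M + A * Z / 2, fun t ht => ?_⟩
  have ht' : t ∈ Icc (0 : ℝ) 1 := ⟨ht.1.le, ht.2.le⟩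
  have hz := (memLp_two_iff_integrable_sq_norm h.memLp_z.1).1 h.memLp_z
  have hd := (memLp_two_iff_integrable_sq_norm (hM t ht').1.1).1 (hM t ht').1
  have hL := h.memLp_interpolantDot hA ht
  have hX := (memLp_two_iff_integrable_sq_norm hL.1).1 hL
  have h1 : ∫ ω, ‖interpolantDot I γ x₀ x₁ z t ω‖ ^ 2 ∂P ≤
      2 * (∫ ω, ‖dtI I t (x₀ ω) (x₁ ω)‖ ^ 2 ∂P) + 2 * deriv γ t ^ 2 * Z := by
    rw [hZ, ← integral_const_mul, ← integral_const_mul,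
      ← integral_add (hd.const_mul 2) (hz.const_mul _)]
    refine integral_mono hX ((hd.const_mul 2).add (hz.const_mul _)) fun ω => ?_
    have e1 := norm_add_le (dtI I t (x₀ ω) (x₁ ω)) (deriv γ t • z ω)
    have e2 : ‖deriv γ t • z ω‖ ^ 2 = deriv γ t ^ 2 * ‖z ω‖ ^ 2 := by
      rw [norm_smul, mul_pow, Real.norm_eq_abs, sq_abs]
    simp only [interpolantDot]
    have e3 : ‖dtI I t (x₀ ω) (x₁ ω) + deriv γ t • z ω‖ ^ 2 ≤
        (‖dtI I t (x₀ ω) (x₁ ω)‖ + ‖deriv γ t • z ω‖) ^ 2 := by gcongr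
    nlinarith [sq_nonneg (‖dtI I t (x₀ ω) (x₁ ω)‖ - ‖deriv γ t • z ω‖)]
  have h2 : deriv γ t ^ 2 ≤ (A / t + A / (1 - t)) / 4 := by
    have hg := h.γ_pos t ht
    rw [h.deriv_γ ht, div_pow, div_le_iff₀ (by positivity)]
    have := hAq t ht
    calc _ ≤ _ := this
      _ = _ := by ring
  have t0 : 0 < t := ht.1
  have t1 : 0 < 1 - t := by linarith [ht.2]
  have h3 : M ≤ M / t := by
    rw [le_div_iff₀ t0]
    nlinarith [ht.2]
  have h4 : 0 ≤ M / (1 - t) := by positivity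
  have h5 : deriv γ t ^ 2 * Z ≤ (A / t + A / (1 - t)) / 4 * Z := by gcongr
  have h6 : (2 * M + A * Z / 2) / t + (2 * M + A * Z / 2) / (1 - t) =
      2 * (M / t) + 2 * (M / (1 - t)) + 2 * ((A / t + A / (1 - t)) / 4 * Z) := by
    field_simp
    ring
  rw [h6]
  linarith [(hM t ht').2]

/-- The density and the velocity of a stochastic interpolant form a flow pair. -/
theorem flowPair (h : IsStochasticInterpolant P ρ₀ ρ₁ I γ x₀ x₁ z)
    (hA : InterpolantAssumption P ρ₀ ρ₁ I x₀ x₁)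
    (hρ : IsDensityOf P (interpolant I γ x₀ x₁ z) ρ)
    (hb : IsVelocityOf P (interpolant I γ x₀ x₁ z) (interpolantDot I γ x₀ x₁ z) b) :
    FlowPair ρ b := by
  obtain ⟨B, hB⟩ := h.exists_isPathFamily hA
  have := h.isProbabilityMeasure_map_pair
  have er : ∀ t ∈ Ioo (0 : ℝ) 1, ρ t = interpDensity P I γ x₀ x₁ t := fun t ht =>
    h.density_eq hA hρ ht
  have eb : ∀ t ∈ Ioo (0 : ℝ) 1, b t = interpVelocity P I γ x₀ x₁ t := fun t ht =>
    h.velocity_eq hA hb ht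
  have eg : ∀ t ∈ Ioo (0 : ℝ) 1, ∇ (ρ t) = interpGrad P I γ x₀ x₁ t := fun t ht => by
    rw [er t ht]
    exact hB.gradient_mixDensity ht
  refine ⟨fun t ht x => ?_, hρ.cont, fun t ht => hρ.integrable ht (h.measurable_interpolant ht),
    fun t ht => ?_, fun φ h1 h2 => h.continuousOn_integral_mul_density hρ h1 h2, fun t ht => ?_,
    fun t ht => ?_, ?_, ?_, ?_, ?_, ?_, fun t ht x => ?_, ?_, ?_⟩
  · rcases ht.1.eq_or_lt with h0 | h0
    · rw [← h0, h.density_zero hA hρ]; exact hA.reg₀.pos x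
    rcases ht.2.eq_or_lt with h1 | h1
    · rw [h1, h.density_one hA hρ]; exact hA.reg₁.pos x
    rw [er t ⟨h0, h1⟩]
    exact h.interpDensity_pos hA ⟨h0, h1⟩ x
  · simpa using hρ.integral_mul ht (h.measurable_interpolant ht) (g := fun _ => 1)
      continuous_const
  · rw [er t ht]; exact hB.contDiff_mixDensity ht
  · rw [eb t ht]; exact hB.contDiff_mixVelocity ht
  · exact hB.continuousOn_mixDensity.congr fun r hr => by rw [er _ hr.1]
  · exact hB.continuousOn_mixGrad.congr fun r hr => by rw [eg _ hr.1]
  · refine hB.continuousOn_mixHess.congr fun r hr => ?_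
    rw [eg _ hr.1]
    exact (hB.hasFDerivAt_mixGrad hr.1 r.2).fderiv
  · exact hB.continuousOn_mixVelocity.congr fun r hr => by rw [eb _ hr.1]
  · exact hB.continuousOn_fderiv_mixVelocity.congr fun r hr => by rw [eb _ hr.1]
  · have e1 : (fun y => ρ t y • b t y) = interpFlux P I γ x₀ x₁ t := by
      funext y
      rw [er t ht, eb t ht]
      exact h.smul_interpVelocity hA ht y
    rw [e1]
    refine (hB.hasDerivAt_mixDensity ht x).congr_of_eventuallyEq ?_
    filter_upwards [Ioo_mem_nhds ht.1 ht.2] with s hs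
    rw [er s hs]
  · obtain ⟨C, hC⟩ := h.exists_integral_interpolantDot_sq_le hA
    refine ⟨C, fun t ht => ?_⟩
    have h1 := h.integral_velocity_sq_le hA ht
    rw [er t ht, eb t ht]
    exact ⟨h1.1, h1.2.trans (hC t ht)⟩
  · refine ⟨fun t => (∫ ω, ‖z ω‖ ^ 2 ∂P) / γ t ^ 2, continuousOn_const.div
      (h.γ_sq.continuousOn.mono Ioo_subset_Icc_self)
      fun t ht => (pow_pos (h.γ_pos t ht) 2).ne', fun t ht => ?_⟩
    rw [eg t ht, er t ht]
    exact h.integral_score_sq_le hA ht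

end IsStochasticInterpolant

end Interpolant

end

theorem mainTheorem4 {d : ℕ} {Ω : Type*} [MeasurableSpace Ω] (P : Measure Ω)
    [IsProbabilityMeasure P] (ρ₀ ρ₁ : Eu d → ℝ) (I : ℝ → Eu d → Eu d → Eu d) (γ : ℝ → ℝ)
    (x₀ x₁ z : Ω → Eu d)
    (hX : IsStochasticInterpolant P ρ₀ ρ₁ I γ x₀ x₁ z)
    (hA : InterpolantAssumption P ρ₀ ρ₁ I x₀ x₁) :
    (∃ (ρ : ℝ → Eu d → ℝ) (b : ℝ → Eu d → Eu d),
      IsDensityOf P (interpolant I γ x₀ x₁ z) ρ ∧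
      IsVelocityOf P (interpolant I γ x₀ x₁ z) (interpolantDot I γ x₀ x₁ z) b) ∧
    ∀ (ρ : ℝ → Eu d → ℝ) (b : ℝ → Eu d → Eu d),
      IsDensityOf P (interpolant I γ x₀ x₁ z) ρ →
      IsVelocityOf P (interpolant I γ x₀ x₁ z) (interpolantDot I γ x₀ x₁ z) b →
      ∀ ε : ℝ → ℝ, ContinuousOn ε (Icc 0 1) → (∀ t ∈ Icc (0 : ℝ) 1, 0 ≤ ε t) →
        (IsClassicalFPE (driftF ρ b ε) ε ρ ∧ ρ 0 = ρ₀ ∧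
          IsEnergySolution 0 ρ (driftF ρ b ε) ε ρ ∧
          IsWellPosedFrom 0 ρ (driftF ρ b ε) ε ∧
          ∀ u, IsEnergySolution 0 ρ (driftF ρ b ε) ε u → u 0 =ᵐ[volume] ρ₀ →
            u 1 =ᵐ[volume] ρ₁) ∧
        (IsClassicalFPE (driftB ρ b ε) (fun t => -ε t) ρ ∧ ρ 1 = ρ₁ ∧
          IsEnergySolution 1 ρ (driftB ρ b ε) (fun t => -ε t) ρ ∧
          IsWellPosedFrom 1 ρ (driftB ρ b ε) (fun t => -ε t) ∧
          ∀ u, IsEnergySolution 1 ρ (driftB ρ b ε) (fun t => -ε t) u → u 1 =ᵐ[volume] ρ₁ →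
            u 0 =ᵐ[volume] ρ₀) := by
  refine ⟨hX.exists_isDensityOf_isVelocityOf hA, fun ρ b hρ hb ε hε hε0 => ?_⟩
  have hf := hX.flowPair hA hρ hb
  have e0 := hX.density_zero hA hρ
  have e1 := hX.density_one hA hρ
  have m0 : (0 : ℝ) ∈ Icc (0 : ℝ) 1 := ⟨le_rfl, zero_le_one⟩
  have m1 : (1 : ℝ) ∈ Icc (0 : ℝ) 1 := ⟨zero_le_one, le_rfl⟩
  have hF := hf.isEnergySolution_self ε m0
  have hW := hf.isWellPosedFrom_zero hε hε0
  have hB : IsEnergySolution 1 ρ (driftB ρ b ε) (fun t => -ε t) ρ := by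
    rw [FlowPair.driftB_eq]
    exact hf.isEnergySolution_self _ m1
  have hV := hf.isWellPosedFrom_one hε hε0
  refine ⟨⟨hf.isClassicalFPE ε, e0, hF, hW, fun u hu hu0 => ?_⟩,
    ?_, e1, hB, hV, fun u hu hu1 => ?_⟩
  -- The solution is compared with `ρ`, itself an energy solution with the same initial datum.
  · rw [← e1]
    exact hW.unique u ρ hu hF (by rwa [e0]) 1 m1
  · rw [FlowPair.driftB_eq]
    exact hf.isClassicalFPE _
  · rw [← e0]
    exact hV.unique u ρ hu hB (by rwa [e1]) 0 m0
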